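/- Conventions. A noetherian formal scheme is a quasi-compact locally (topologically) ringed space that is locally the formal spectrum of a noetherian adic ring; noetherian schemes are included. A morphism $f\colon X\to S$ of noetherian formal schemes is of finite type if it is locally of the form $\operatorname{Spf}B\to\operatorname{Spf}A$ with $B/J$ a finitely generated $A$-algebra, where $J$ is the largest ideal of definition of $B$ (for schemes this is the usual notion). $\Omega^1_{X/S}$ is the sheaf of (continuous) differentials, and $T_{X/S}$ is the sheaf of (continuous) $S$-derivations of $\mathcal O_X$. For $x\in X$ put $s=f(x)$. Let $f\colon X\to S$ be of finite type such that the residue field extension $k(x)/k(f(x))$ is separable algebraic for every closed point $x$ of $X$. A *smooth foliation* on $f$ is a coherent $\mathcal O_X$-submodule $\mathcal F\subseteq T_{X/S}$ that is closed under commutators and, if $S$ is over $\mathbb F_p$, under $p$-th powers, such that for every closed point $x\in X$ the map $\mathcal F\otimes k(x)\to\operatorname{Hom}_{k(x)}(\mathfrak m_x/(\mathfrak m_s\mathcal O_{X,x}+\mathfrak m_x^2),k(x))$ is injective. It is *transverse* to a closed subscheme $Z\subseteq X$ with ideal $I_Z$ if for every closed point $x$ of $X$ lying on $Z$ the composite $\mathcal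 F\otimes k(x)\to\operatorname{Hom}_{k(x)}(I_Z/\mathfrak m_xI_Z,k(x))$ is injective. An $S$-morphism $q\colon X\to Y$ is a *quotient* of $\mathcal F$ if $\mathcal F=T_{X/Y}$ and $\mathcal O_Y\to q_*\mathcal O_X$ is injective with image the sections annihilated by all local sections of $\mathcal F$. Theorem. Let $f\colon X\to S$ be as above and let $\mathcal F$ be a smooth foliation on $f$ that is transverse to the closed subscheme $Z$ of $X$. (1) Locally on $X$ there are functions $x_1,\dots,x_n$ and a decomposition $\Omega^1_{X/S}=\mathcal G'\oplus\mathcal G''$ such that $\mathcal G'$ is free with basis $dx_1,\dots,dx_n$, $\mathcal F$ is identified with $(\mathcal G')^*$, and $\mathcal F$ is the annihilator of $\mathcal G''$ in $T_{X/S}$. In particular $\mathcal F$ is locally free, and locally $T_{X/S}=\mathcal F\oplus(\mathcal G'')^*$. Near a point of $Z$ the $x_i$ can be chosen in $I_Z$. (2) Suppose that $S$ is over $\operatorname{Spec}\mathbb Q$. Let $\widehat X$ be the formal completion of $X$ along $Z$ and $\widehat S$ that of $S$ along the closure of the image of $Z$. Then the restriction of $\mathcal F$ to $\widehat X$ (the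 $\mathcal O_{\widehat X}$-submodule of $T_{\widehat X/S}$ generated by the extensions of the local sections of $\mathcal F$) has a quotient $q\colon\widehat X\to Y$, with $Y$ a noetherian formal scheme, such that $q$ is formally smooth and the composite $Z\to\widehat X\to Y$ is a closed embedding. If moreover $\mathcal F=T_{X/S}$ and tangent vectors lift, that is, $T_{X/S,x}\to\operatorname{Hom}_{k(x)}(\mathfrak m_x/(\mathfrak m_s\mathcal O_{X,x}+\mathfrak m_x^2),k(x))$ is surjective for every closed point $x$ of $X$, then the structure map $Y\to\widehat S$ is an immersion in the sense of differential geometry, i.e. it is of finite type and unramified ($\Omega^1_{Y/\widehat S}=0$); it is an immersion in the sense of algebraic geometry (a closed embedding into an open formal subscheme) whenever $Z\to S$ is one. (3) Suppose that $S$ is over $\operatorname{Spec}\mathbb F_p$, $p$ prime. Then $\mathcal F$ has a quotient $q\colon X\to Y$, with $Y$ a noetherian formal scheme, such that $q$ is flat and the composite $Z\to X\to Y$ is a closed embedding. Locally on $Y$ there are $n\ge 0$, functions $t_1,\dots,t_n$ on $X$ vanishing on $Z$ and functions $f_1,\dots,f_n$ on $Y$ such that $\mathcal O_Y[t_1,\dots,t_n]/(t_1^p-f_1,\dots,t_n^p-f_n)\cong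 q_*\mathcal O_X$. -/

import Mathlib

open AlgebraicGeometry CategoryTheory TopologicalSpace Opposite

universe u

noncomputable section

namespace FormalGeometry

/-! ### Sections of locally ringed spaces -/

/-- The ring of sections of the structure sheaf of `X` over the open set `U`. -/
abbrev Sec (X : LocallyRingedSpace.{u}) (U : Opens X) : Type u :=
  X.presheaf.obj (op U)

/-- Restriction of sections from `U` to a smaller open set `W`. -/
def res {X : LocallyRingedSpace.{u}} {U W : Opens X} (h : W ≤ U) : Sec X U →+* Sec X W :=
  (X.presheaf.map (homOfLE h).op).hom

/-- The preimage of an open set under a morphism. -/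
abbrev preim {X Y : LocallyRingedSpace.{u}} (f : X ⟶ Y) (V : Opens Y) : Opens X :=
  (Opens.map f.base).obj V

/-- Pull-back of a section over `V` along `f`, restricted to an open set `W` with `f(W) ⊆ V`. -/
def pull {X Y : LocallyRingedSpace.{u}} (f : X ⟶ Y) {V : Opens Y} {W : Opens X}
    (h : W ≤ preim f V) : Sec Y V →+* Sec X W :=
  (res h).comp (f.c.app (op V)).hom

/-- The section `s` vanishes at the point `x`, i.e. its value in the residue field is zero. -/
def VanishesAt {X : LocallyRingedSpace.{u}} {U : Opens X} (s : Sec X U) (x : X) (hx : x ∈ U) :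
    Prop :=
  X.evaluation ⟨x, hx⟩ s = 0

/-- The ideal of the sections over `U` that vanish at all points of `U ∩ T`. -/
def vanishingIdeal (X : LocallyRingedSpace.{u}) (T : Set X) (U : Opens X) : Ideal (Sec X U) :=
  ⨅ (x : U) (_ : x.1 ∈ T), RingHom.ker (X.evaluation x).hom

/-! ### Locally noetherian formal schemes

On a locally noetherian formal scheme the topology of the structure sheaf is determined by the
underlying locally ringed space: on a formal affine open set `U` it is the `J`-adic topology, where
`J` is the largest ideal of definition, which consists of the sections that vanish at every point
of `U`. Every morphism of locally ringed spaces is continuous for these topologies. So locally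
noetherian formal schemes form a full subcategory of locally ringed spaces, in which locally
noetherian schemes are the case where all these ideals `J` are nilpotent. -/

/-- The largest ideal of definition: the ideal of all sections over `U` that vanish at every point
of `U`. -/
abbrev definingIdeal (X : LocallyRingedSpace.{u}) (U : Opens X) : Ideal (Sec X U) :=
  vanishingIdeal X Set.univ U

/-- The point of `Spec Γ(U)` that consists of the sections vanishing at `x`. -/
def pointPrime (X : LocallyRingedSpace.{u}) (U : Opens X) (x : U) : PrimeSpectrum (Sec X U) :=
  ⟨RingHom.ker (X.evaluation x).hom, RingHom.ker_isPrime _⟩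

/-- The open set `U` is, with its structure sheaf, the formal spectrum `Spf B` of the noetherian
adic ring `B = Γ(U)` with ideal of definition `J = definingIdeal X U`: the ring `B` is noetherian
and `J`-adically complete, the space `U` is the closed subset `V(J)` of `Spec B`, and for
every `s ∈ B` the ring `Γ(D(s))` is the `J`-adic completion of `B[1/s]`. -/
structure IsFormalAffine (X : LocallyRingedSpace.{u}) (U : Opens X) : Prop where
  noetherian : IsNoetherianRing (Sec X U)
  complete : IsAdicComplete (definingIdeal X U) (Sec X U)
  isEmbedding : Topology.IsEmbedding (pointPrime X U)
  range_eq : Set.range (pointPrime X U) = PrimeSpectrum.zeroLocus (definingIdeal X U)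
  complete_basicOpen : ∀ s : Sec X U,
    IsAdicComplete ((definingIdeal X U).map (res (X.toRingedSpace.basicOpen_le s)))
      (Sec X (X.toRingedSpace.basicOpen s))
  localization_basicOpen : ∀ (s : Sec X U) (n : ℕ),
    letI : Algebra (Sec X U ⧸ definingIdeal X U ^ n)
        (Sec X (X.toRingedSpace.basicOpen s) ⧸
          (definingIdeal X U ^ n).map (res (X.toRingedSpace.basicOpen_le s))) :=
      (Ideal.quotientMap _ (res (X.toRingedSpace.basicOpen_le s)) Ideal.le_comap_map).toAlgebra
    IsLocalization.Away (Ideal.Quotient.mk (definingIdeal X U ^ n) s)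
      (Sec X (X.toRingedSpace.basicOpen s) ⧸
          (definingIdeal X U ^ n).map (res (X.toRingedSpace.basicOpen_le s)))

/-- A noetherian formal scheme: a quasi-compact locally ringed space that is covered by formal
spectra of noetherian adic rings. Noetherian schemes are a special case. -/
structure IsNoetherianFormalScheme (X : LocallyRingedSpace.{u}) : Prop where
  compact : CompactSpace X
  exists_affine : ∀ x : X, ∃ U : Opens X, x ∈ U ∧ IsFormalAffine X U

/-! ### Morphisms -/

/-- Morphisms of finite type of noetherian formal schemes: locally of the form `Spf B → Spf A` where
`B / J` is an `A`-algebra of finite type for the largest ideal of definition `J` of `B`. For schemes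
this is the usual notion; adic morphisms that are topologically of finite type are included, and
so is for instance `Spf A[[t]] → Spf A`. -/
def IsOfFiniteType {X S : LocallyRingedSpace.{u}} (f : X ⟶ S) : Prop :=
  ∀ x : X, ∃ (V : Opens S) (U : Opens X) (h : U ≤ preim f V), x ∈ U ∧ IsFormalAffine S V ∧
    IsFormalAffine X U ∧
      ((Ideal.Quotient.mk (definingIdeal X U)).comp (pull f h)).FiniteType

/-- Over the open set `U` of `X`, the morphism `i : Z ⟶ X` is of the form `Spf (B / K) → Spf B`, where
`B / K` has the quotient topology (this is the last condition). -/
structure IsClosedImmersionOver {Z X : LocallyRingedSpace.{u}} (i : Z ⟶ X) (U : Opens X) :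
    Prop where
  affine : IsFormalAffine X U
  affine_preim : IsFormalAffine Z (preim i U)
  surjective : Function.Surjective (pull i (le_refl (preim i U)))
  adic : definingIdeal Z (preim i U) ≤
    ((definingIdeal X U).map (pull i (le_refl (preim i U)))).radical

/-- Closed immersions (closed embeddings) of formal schemes. -/
def IsFormalClosedImmersion {Z X : LocallyRingedSpace.{u}} (i : Z ⟶ X) : Prop :=
  ∀ x : X, ∃ U : Opens X, x ∈ U ∧ IsClosedImmersionOver i U

/-- Immersions (embeddings) of formal schemes: closed immersions into an open subset. -/
def IsFormalImmersion {Z X : LocallyRingedSpace.{u}} (i : Z ⟶ X) : Prop :=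
  ∀ z : Z, ∃ U : Opens X, i.base z ∈ U ∧ IsClosedImmersionOver i U

/-- The sections over `W` of the ideal sheaf of the closed subscheme `i : Z ⟶ X`. -/
def idealOf {Z X : LocallyRingedSpace.{u}} (i : Z ⟶ X) (W : Opens X) : Ideal (Sec X W) :=
  RingHom.ker (pull i (le_refl (preim i W)))

/-- `j : Xhat ⟶ X` is the formal completion of the formal scheme `X` along the closed subset `T`:
its space is `T`, and over a formal affine open set `U` of `X` it is the formal spectrum of the
`I`-adic completion of `Γ(U)`, where `I` is the ideal of the sections that vanish on `T`. -/
structure IsFormalCompletion {Xhat X : LocallyRingedSpace.{u}} (T : Set X) (j : Xhat ⟶ X) :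
    Prop where
  isClosedEmbedding : Topology.IsClosedEmbedding j.base
  range_eq : Set.range j.base = T
  affine : ∀ U : Opens X, IsFormalAffine X U → IsFormalAffine Xhat (preim j U)
  complete : ∀ U : Opens X, IsFormalAffine X U →
    IsAdicComplete ((vanishingIdeal X T U).map (pull j (le_refl (preim j U))))
      (Sec Xhat (preim j U))
  bijective : ∀ U : Opens X, IsFormalAffine X U → ∀ n : ℕ,
    Function.Bijective (Ideal.quotientMap
      ((vanishingIdeal X T U ^ n).map (pull j (le_refl (preim j U))))
      (pull j (le_refl (preim j U))) Ideal.le_comap_map)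

/-- The `J`-adically topologized ring `B` is formally smooth over `A` along `φ : A → B`, where `A`
has a topology for which `φ` is continuous: for every discrete ring `C` with an ideal `N` of square
zero, every continuous `A`-algebra homomorphism `B → C / N` lifts to an `A`-algebra
homomorphism `B → C` (which is then continuous). -/
def IsAdicallyFormallySmooth {A B : Type u} [CommRing A] [CommRing B] (φ : A →+* B)
    (J : Ideal B) : Prop :=
  ∀ (C : Type u) [CommRing C] (N : Ideal C), N ^ 2 = ⊥ →
    ∀ (α : A →+* C) (β : B →+* C ⧸ N), (∃ n : ℕ, J ^ n ≤ RingHom.ker β) →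
      β.comp φ = (Ideal.Quotient.mk N).comp α →
        ∃ γ : B →+* C, γ.comp φ = α ∧ (Ideal.Quotient.mk N).comp γ = β

/-- Formally smooth morphisms of formal schemes: locally `Spf B → Spf A` with `B` formally smooth
over `A` for the adic topologies. -/
def IsFormallySmooth {X Y : LocallyRingedSpace.{u}} (f : X ⟶ Y) : Prop :=
  ∀ x : X, ∃ (V : Opens Y) (U : Opens X) (h : U ≤ preim f V), x ∈ U ∧ IsFormalAffine Y V ∧
    IsFormalAffine X U ∧ IsAdicallyFormallySmooth (pull f h) (definingIdeal X U)

/-- Flatness: all homomorphisms of local rings are flat. -/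
def IsFlat {X Y : LocallyRingedSpace.{u}} (f : X ⟶ Y) : Prop :=
  ∀ x : X, (f.stalkMap x).hom.Flat

/-! ### Differentials of formal schemes -/

/-- The module of continuous differentials of the `J`-adic `A`-algebra `B`: the `J`-adic completion
of the module of Kähler differentials. It is the usual module when `J` is nilpotent. -/
abbrev Omega (A B : Type u) [CommRing A] [CommRing B] [Algebra A B] (J : Ideal B) : Type u :=
  AdicCompletion J (Ω[B⁄A])

/-- The universal derivation `B → Omega A B J`. -/
def diff (A : Type u) {B : Type u} [CommRing A] [CommRing B] [Algebra A B] (J : Ideal B) (b : B) :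
    Omega A B J :=
  AdicCompletion.of J (Ω[B⁄A]) (KaehlerDifferential.D A B b)

/-- The `B`-linear map `Omega A B J → B` that corresponds to a derivation `D` of the complete
ring `B`. It sends `db` to `D b`. -/
def contract {A B : Type u} [CommRing A] [CommRing B] [Algebra A B] (J : Ideal B)
    [IsAdicComplete J B] (D : Derivation A B B) : Omega A B J →ₗ[B] B :=
  (AdicCompletion.ofLinearEquiv J B).symm.toLinearMap ∘ₗ
    (AdicCompletion.map J D.liftKaehlerDifferential).restrictScalars B

theorem contract_diff {A B : Type u} [CommRing A] [CommRing B] [Algebra A B] (J : Ideal B)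
    [IsAdicComplete J B] (D : Derivation A B B) (b : B) : contract J D (diff A J b) = D b := by
  rw [contract, diff, LinearMap.comp_apply, LinearMap.restrictScalars_apply,
    AdicCompletion.map_of, Derivation.liftKaehlerDifferential_comp_D]
  exact AdicCompletion.ofLinearEquiv_symm_of (I := J) (M := B) (D b)

/-- A morphism `f` of formal schemes is unramified (an immersion in the sense of differential
geometry) if it is of finite type and its sheaf of continuous differentials vanishes. -/
def IsUnramified {X S : LocallyRingedSpace.{u}} (f : X ⟶ S) : Prop :=
  IsOfFiniteType f ∧
    ∀ x : X, ∃ (V : Opens S) (U : Opens X) (h : U ≤ preim f V), x ∈ U ∧ IsFormalAffine S V ∧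
      IsFormalAffine X U ∧
        letI : Algebra (Sec S V) (Sec X U) := (pull f h).toAlgebra
        Subsingleton (Omega (Sec S V) (Sec X U) (definingIdeal X U))

/-! ### The tangent sheaf -/

/-- A section over `U` of the tangent sheaf `T_{X/S}` of `f : X ⟶ S`: a derivation of the sheaf of
rings `O_X` restricted to `U` that kills the image of `f⁻¹ O_S`. -/
@[ext]
structure VectorField {X S : LocallyRingedSpace.{u}} (f : X ⟶ S) (U : Opens X) where
  der : ∀ W : Opens X, W ≤ U → Derivation ℤ (Sec X W) (Sec X W)
  der_res : ∀ (W W' : Opens X) (h : W ≤ U) (h' : W' ≤ W) (a : Sec X W),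
    der W' (h'.trans h) (res h' a) = res h' (der W h a)
  der_pull : ∀ (W : Opens X) (h : W ≤ U) (V : Opens S) (hV : W ≤ preim f V) (s : Sec S V),
    der W h (pull f hV s) = 0

namespace VectorField

variable {X S : LocallyRingedSpace.{u}} {f : X ⟶ S} {U : Opens X}

theorem res_res {U W W' : Opens X} (h : W ≤ U) (h' : W' ≤ W) (a : Sec X U) :
    res h' (res h a) = res (h'.trans h) a := by
  simp only [res, ← CommRingCat.comp_apply, ← Functor.map_comp]
  rfl

instance : Zero (VectorField f U) :=
  ⟨⟨fun _ _ => 0, by simp, by simp⟩⟩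

instance : Add (VectorField f U) :=
  ⟨fun D E => ⟨fun W h => D.der W h + E.der W h,
    fun W W' h h' a => by simp [D.der_res W W' h h' a, E.der_res W W' h h' a],
    fun W h V hV s => by simp [D.der_pull W h V hV s, E.der_pull W h V hV s]⟩⟩

instance : Neg (VectorField f U) :=
  ⟨fun D => ⟨fun W h => -D.der W h,
    fun W W' h h' a => by simp [D.der_res W W' h h' a],
    fun W h V hV s => by simp [D.der_pull W h V hV s]⟩⟩

instance : SMul (Sec X U) (VectorField f U) :=
  ⟨fun b D => ⟨fun W h => res h b • D.der W h,
    fun W W' h h' a => by simp [D.der_res W W' h h' a, res_res],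
    fun W h V hV s => by simp [D.der_pull W h V hV s]⟩⟩

instance : AddCommGroup (VectorField f U) where
  add_assoc D E G := by ext W h a; exact add_assoc _ _ _
  zero_add D := by ext W h a; exact zero_add _
  add_zero D := by ext W h a; exact add_zero _
  add_comm D E := by ext W h a; exact add_comm _ _
  neg_add_cancel D := by ext W h a; exact neg_add_cancel _
  nsmul := nsmulRec
  zsmul := zsmulRec

instance : Module (Sec X U) (VectorField f U) where
  one_smul D := by
    ext W h a
    change res h 1 * D.der W h a = D.der W h a
    rw [map_one, one_mul]
  mul_smul b c D := by
    ext W h a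
    change res h (b * c) * D.der W h a = res h b * (res h c * D.der W h a)
    rw [map_mul, mul_assoc]
  smul_zero b := by ext W h a; exact mul_zero _
  smul_add b D E := by ext W h a; exact mul_add _ _ _
  add_smul b c D := by
    ext W h a
    change res h (b + c) * D.der W h a = res h b * D.der W h a + res h c * D.der W h a
    rw [map_add, add_mul]
  zero_smul D := by
    ext W h a
    change res h 0 * D.der W h a = 0
    rw [map_zero, zero_mul]

/-- Restriction of a vector field to a smaller open set. -/
def restrict {W : Opens X} (h : W ≤ U) (D : VectorField f U) : VectorField f W :=
  ⟨fun W' h' => D.der W' (h'.trans h), fun W₁ W₂ h₁ h₂ a => D.der_res W₁ W₂ (h₁.trans h) h₂ a,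
    fun W₁ h₁ V hV s => D.der_pull W₁ (h₁.trans h) V hV s⟩

/-- The derivation of the ring `Γ(U)` over `Γ(V)` given by a vector field on `U`, for an open
set `V` of `S` that contains the image of `U`. -/
def toDerivation (D : VectorField f U) (V : Opens S) (hV : U ≤ preim f V) :
    letI : Algebra (Sec S V) (Sec X U) := (pull f hV).toAlgebra
    Derivation (Sec S V) (Sec X U) (Sec X U) :=
  letI : Algebra (Sec S V) (Sec X U) := (pull f hV).toAlgebra
  Derivation.mk'
    { toFun := D.der U le_rfl
      map_add' := map_add _
      map_smul' := fun s b => by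
        change D.der U le_rfl (pull f hV s * b) = pull f hV s * D.der U le_rfl b
        rw [Derivation.leibniz, D.der_pull U le_rfl V hV s, smul_zero, add_zero, smul_eq_mul] }
    (fun a b => (D.der U le_rfl).leibniz a b)

end VectorField

/-- A family of `Γ(U)`-submodules of the modules of sections `T_{X/S}(U)` of the tangent sheaf. -/
abbrev SubTangent {X S : LocallyRingedSpace.{u}} (f : X ⟶ S) : Type u :=
  ∀ U : Opens X, Submodule (Sec X U) (VectorField f U)

section Foliations

variable {X S : LocallyRingedSpace.{u}} {f : X ⟶ S}

/-- The family `F` is a subsheaf of `O_X`-modules of the tangent sheaf. -/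
structure IsSubsheaf (F : SubTangent f) : Prop where
  restrict_mem : ∀ (U W : Opens X) (h : W ≤ U), ∀ D ∈ F U, D.restrict h ∈ F W
  mem_of_local : ∀ (U : Opens X) (D : VectorField f U),
    (∀ x ∈ U, ∃ (W : Opens X) (h : W ≤ U), x ∈ W ∧ D.restrict h ∈ F W) → D ∈ F U

/-- The sheaf `F` of `O_X`-modules is of finite type. For a subsheaf of modules of the tangent sheaf
of a finite type morphism of noetherian formal schemes this says that it is coherent. -/
def IsLocallyFinitelyGenerated (F : SubTangent f) : Prop :=
  ∀ x : X, ∃ (U : Opens X) (n : ℕ) (E : Fin n → VectorField f U), x ∈ U ∧ (∀ k, E k ∈ F U) ∧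
    ∀ (W : Opens X) (h : W ≤ U), ∀ D ∈ F W, ∀ y ∈ W, ∃ (W' : Opens X) (h' : W' ≤ W), y ∈ W' ∧
      D.restrict h' ∈ Submodule.span (Sec X W') (Set.range fun k => (E k).restrict (h'.trans h))

/-- The germ at `x` of the section `D` of `F` lies in `𝔪_x F_x`, in other words `D` maps to zero
in `F ⊗ k(x)`. -/
def GermMemMaximalSmul (F : SubTangent f) {U : Opens X} (D : VectorField f U) (x : X) : Prop :=
  ∃ (W : Opens X) (h : W ≤ U) (hx : x ∈ W) (n : ℕ) (a : Fin n → Sec X W)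
    (E : Fin n → VectorField f W), (∀ k, VanishesAt (a k) x hx) ∧ (∀ k, E k ∈ F W) ∧
      D.restrict h = ∑ k, a k • E k

/-- The map `F ⊗ k(x) → Hom(𝔪_x / (𝔪_{f(x)} + 𝔪_x²), k(x))` is injective. A section `D` of `F`
goes to zero there if and only if `D g` vanishes at `x` for all local functions `g` that vanish
at `x`. -/
def InjectiveAt (F : SubTangent f) (x : X) : Prop :=
  ∀ (U : Opens X) (_ : x ∈ U), ∀ D ∈ F U,
    (∀ (W : Opens X) (h : W ≤ U) (hx : x ∈ W) (g : Sec X W),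
      VanishesAt g x hx → VanishesAt (D.der W h g) x hx) →
    GermMemMaximalSmul F D x

/-- A smooth foliation on `f : X ⟶ S`: a coherent submodule sheaf `F` of the tangent sheaf
`T_{X/S}`, such that `F ⊗ k(x) → Hom(𝔪_x / (𝔪_{f(x)} + 𝔪_x²), k(x))` is injective for every closed
point `x` of `X`, and which is closed under commutators and, if `p = 0` on `S` for a prime number
`p`, under `p`-th powers. -/
structure IsSmoothFoliation (F : SubTangent f) : Prop where
  isSubsheaf : IsSubsheaf F
  finite : IsLocallyFinitelyGenerated F
  injective : ∀ x : X, IsClosed ({x} : Set X) → InjectiveAt F x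
  commutator : ∀ (U : Opens X), ∀ D ∈ F U, ∀ D' ∈ F U, ∃ E ∈ F U,
    ∀ (W : Opens X) (h : W ≤ U), E.der W h = ⁅D.der W h, D'.der W h⁆
  pth_power : ∀ p : ℕ, p.Prime → (p : Sec S ⊤) = 0 → ∀ (U : Opens X), ∀ D ∈ F U, ∃ E ∈ F U,
    ∀ (W : Opens X) (h : W ≤ U) (a : Sec X W), E.der W h a = (D.der W h)^[p] a

/-- `F` is transverse to the closed subscheme `i : Z ⟶ X` with ideal sheaf `I`: for every closed
point `x` of `X` that lies on `Z`, the map `F ⊗ k(x) → Hom(I / 𝔪_x I, k(x))` is injective. -/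
def IsTransverse (F : SubTangent f) {Z : LocallyRingedSpace.{u}} (i : Z ⟶ X) : Prop :=
  ∀ x ∈ Set.range i.base, IsClosed ({x} : Set X) →
    ∀ (U : Opens X) (_ : x ∈ U), ∀ D ∈ F U,
      (∀ (W : Opens X) (h : W ≤ U) (hx : x ∈ W), ∀ g ∈ idealOf i W,
        VanishesAt (D.der W h g) x hx) →
      GermMemMaximalSmul F D x

/-- For every closed point `x` of `X`, the residue field extension `k(x) / k(f(x))` is separable
algebraic. -/
def HasSeparableResidueFields (f : X ⟶ S) : Prop :=
  ∀ x : X, IsClosed ({x} : Set X) →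
    letI : Algebra (S.residueField (f.base x)) (X.residueField x) :=
      (LocallyRingedSpace.residueFieldMap f x).hom.toAlgebra
    Algebra.IsSeparable (S.residueField (f.base x)) (X.residueField x)

/-- Tangent vectors lift: for every closed point `x` of `X`, the map
`T_{X/S,x} → Hom(𝔪_x / (𝔪_{f(x)} + 𝔪_x²), k(x))` is surjective. The target is the space of
all `O_{X,x}`-linear maps `𝔪_x → k(x)` that vanish on the image of `𝔪_{f(x)}`. -/
def TangentVectorsLift (f : X ⟶ S) : Prop :=
  ∀ x : X, IsClosed ({x} : Set X) →
    ∀ v : IsLocalRing.maximalIdeal (X.presheaf.stalk x) →ₗ[X.presheaf.stalk x]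
        IsLocalRing.ResidueField (X.presheaf.stalk x),
      (∀ t : IsLocalRing.maximalIdeal (X.presheaf.stalk x),
        (∃ s ∈ IsLocalRing.maximalIdeal (S.presheaf.stalk (f.base x)),
          (f.stalkMap x).hom s = t.1) → v t = 0) →
      ∃ (U : Opens X) (_ : x ∈ U) (D : VectorField f U),
        ∀ (W : Opens X) (h : W ≤ U) (hx : x ∈ W) (g : Sec X W)
          (hg : X.presheaf.germ W x hx g ∈ IsLocalRing.maximalIdeal (X.presheaf.stalk x)),
          v ⟨X.presheaf.germ W x hx g, hg⟩ =
            IsLocalRing.residue (X.presheaf.stalk x) (X.presheaf.germ W x hx (D.der W h g))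

/-- The vector field `E` on an open set `W` of `Xhat` extends the vector field `D` on the open
set `U` of `X` along `j : Xhat ⟶ X`. -/
def Extends {Xhat : LocallyRingedSpace.{u}} (j : Xhat ⟶ X) {U : Opens X} {W : Opens Xhat}
    (D : VectorField f U) (E : VectorField (j ≫ f) W) : Prop :=
  ∀ (U' : Opens X) (h : U' ≤ U) (W' : Opens Xhat) (h' : W' ≤ W) (hj : W' ≤ preim j U')
    (a : Sec X U'), E.der W' h' (pull j hj a) = pull j hj (D.der U' h a)

/-- The restriction of `F` to the formal completion `j : Xhat ⟶ X`: the subsheaf of `O`-modules of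
the tangent sheaf of `Xhat` over `S` that is generated by the extensions of the local sections
of `F`. -/
def restrictToCompletion (F : SubTangent f) {Xhat : LocallyRingedSpace.{u}} (j : Xhat ⟶ X)
    (W : Opens Xhat) : Set (VectorField (j ≫ f) W) :=
  {D | ∀ w ∈ W, ∃ (W' : Opens Xhat) (h : W' ≤ W), w ∈ W' ∧
    D.restrict h ∈ Submodule.span (Sec Xhat W')
      {E : VectorField (j ≫ f) W' | ∃ (U : Opens X), W' ≤ preim j U ∧ ∃ D' ∈ F U, Extends j D' E}}

/-- The `S`-morphism `q : X ⟶ Y` is a quotient of the subsheaf `F` of the tangent sheaf of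
`f : X ⟶ S`: `F` is the relative tangent sheaf of `q`, and `O_Y` is the sheaf of `F`-constants
in `q_* O_X`. -/
structure IsQuotient (f : X ⟶ S) (F : ∀ U : Opens X, Set (VectorField f U))
    {Y : LocallyRingedSpace.{u}} (q : X ⟶ Y) : Prop where
  overBase : ∃ g : Y ⟶ S, q ≫ g = f
  tangent : ∀ (U : Opens X) (D : VectorField f U), D ∈ F U ↔
    ∀ (W : Opens X) (h : W ≤ U) (V : Opens Y) (hV : W ≤ preim q V) (s : Sec Y V),
      D.der W h (pull q hV s) = 0
  injective : ∀ V : Opens Y, Function.Injective (pull q (le_refl (preim q V)))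
  constants : ∀ (V : Opens Y) (a : Sec X (preim q V)),
    a ∈ Set.range (pull q (le_refl (preim q V))) ↔
      ∀ (W : Opens X) (h : W ≤ preim q V), ∀ D ∈ F W, D.der W le_rfl (res h a) = 0

/-- The sheaf `F` of `O_X`-modules is locally free of finite rank. -/
def IsLocallyFree (F : SubTangent f) : Prop :=
  ∀ x : X, ∃ (U : Opens X) (n : ℕ) (E : Fin n → VectorField f U), x ∈ U ∧
    ∀ (W : Opens X) (h : W ≤ U),
      LinearIndependent (Sec X W) (fun k => (E k).restrict h) ∧
        Submodule.span (Sec X W) (Set.range fun k => (E k).restrict h) = F W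

/-- Over the formal affine open sets `U` of `X` and `V ⊇ f(U)` of `S`, the module of differentials
`Ω` of `X` over `S` is a direct sum `G' ⊕ G''`, where `dx_1, …, dx_n` is a basis of `G'`, the
pairing of vector fields with differentials identifies `F` with the dual of `G'` and with the
annihilator of `G''`, and `T = F ⊕ (G'')^*`, where the second summand is the annihilator of `G'`. -/
def SplitsOver (F : SubTangent f) {U : Opens X} (hU : IsFormalAffine X U) (V : Opens S)
    (hV : U ≤ preim f V) {n : ℕ} (x : Fin n → Sec X U) : Prop :=
  letI : Algebra (Sec S V) (Sec X U) := (pull f hV).toAlgebra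
  haveI := hU.complete
  let J := definingIdeal X U
  let pairing : VectorField f U → (Omega (Sec S V) (Sec X U) J →ₗ[Sec X U] Sec X U) :=
    fun D => contract J (D.toDerivation V hV)
  ∃ G' G'' : Submodule (Sec X U) (Omega (Sec S V) (Sec X U) J),
    IsCompl G' G'' ∧
    (∃ b : Module.Basis (Fin n) (Sec X U) G', ∀ k, (b k : Omega (Sec S V) (Sec X U) J) =
      diff (Sec S V) J (x k)) ∧
    Function.Bijective (fun D : F U => (pairing D).domRestrict G') ∧
    (∀ D : VectorField f U, D ∈ F U ↔ ∀ m ∈ G'', pairing D m = 0) ∧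
    ∃ T'' : Submodule (Sec X U) (VectorField f U),
      IsCompl (F U) T'' ∧ (∀ D : VectorField f U, D ∈ T'' ↔ ∀ m ∈ G', pairing D m = 0) ∧
      Function.Bijective (fun D : T'' => (pairing D).domRestrict G'')

end Foliations

end FormalGeometry

end

open FormalGeometry

universe v w

noncomputable section

namespace FormalGeometry

/-! ### Adically complete rings -/

section Adic

variable {A : Type u} {B : Type v} [CommRing A] [CommRing B]

/-! Frames. At a closed point `x`, transversality (on `Z`) or smoothness (elsewhere) says that `F ⊗
k(x)` injects into the dual of an ideal of functions vanishing at `x`. Dually, for a minimal system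
of local generators `E_k` there are functions `t_j` in that ideal such that the matrix `(E_k t_j)`
is invertible at `x`. Its inverse turns the generators into a frame with `E_i t_j = δ_ij`
(`exists_isFrame`). Every point specializes to a closed one, so such frames exist everywhere. Part
(1) is then linear algebra: the `E_i` and the `dt_j` are dual families, and `G''` is the common
kernel of the `E_i` (`splitsOver_of_isFrame`). A section of `F` that kills all `t_j` is zero; hence
the `E_i` commute and, in characteristic `p`, satisfy `E_i^p = 0`.

The quotient. `Y` has the same space as `X` (as the completion of `X` in characteristic zero), and
its structure sheaf is the sheaf of `F`-constants. The point is that this is a formal scheme. Let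
`B` be the ring of functions on a small formal affine open set and `R` its ring of constants. Taylor
expansion at `t = 0` in the directions `E_i` yields an `R`-linear retraction `π : B → R` with `π b ≡
b` modulo `(t)`, and there is a ring homomorphism `θ : B → R` that is a power map on `R`. These data
(`IsRetraction`) carry noetherianity, completeness, prime ideals and completed localizations from
`B` to `R` (`IsProjection.isFormalAffine`). Since the `t_j` vanish on `Z`, they also make `Z → Y` a
closed embedding.

In characteristic `p` the Taylor expansion stops before the `p`-th term, `θ` is the Frobenius, and
the monomials in `t` with exponents below `p` are a basis of `B` over `R`; this gives flatness and
the presentation. In characteristic zero the series must converge. On the completion along `Z` the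
`t_j` are topologically nilpotent, `π = θ` is a ring homomorphism, `B = R ⊕ (t)`, and the quotients
of `B` by the powers of `(t)` are truncated polynomial rings over `R`; this gives formal smoothness.
Derivations are continuous for adic topologies, so vector fields, frames and their relations pass to
completions by approximation (`IsCompletedAway`).

The base. Suppose that `F` is the whole tangent sheaf and that tangent vectors lift. Consider a
derivation over `S` into the residue field at a closed point `x` of `Z` that kills the `t_j`. On
`𝔪_x` it is induced by a vector field `∑ a_i E_i` with `a_i(x) = 0`, so it vanishes there; what
remains is a derivation of a separable algebraic field extension, which is zero
(`derivation_eq_zero_of_tangentVectorsLift`). Functions on `Y` are approximated by functions on `X`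
after setting `t = 0`, so Nakayama's lemma shows that `Y` is unramified over the completed base. If
`Z → S` is an immersion, then locally functions on the base generate those on `Y` modulo the ideal
`N` of `Z`; vanishing of derivations puts `N` into the ideal generated by the ideal of definition of
the base (`DerivationsVanish.le_map`), and completeness gives surjectivity. -/

theorem eq_zero_of_forall_mem_pow (I : Ideal B) [IsHausdorff I B] {b : B}
    (h : ∀ n, b ∈ I ^ n) : b = 0 :=
  IsHausdorff.haus (I := I) inferInstance b fun n => by
    simpa [SModEq.zero] using h n

theorem exists_limit (I : Ideal B) [IsPrecomplete I B] (c : ℕ → B)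
    (h : ∀ n, c (n + 1) - c n ∈ I ^ n) : ∃ L, ∀ n, L - c n ∈ I ^ n := by
  obtain ⟨L, hL⟩ := IsPrecomplete.prec (I := I) inferInstance (f := c) (by
    intro m n hmn
    simp only [smul_eq_mul, Ideal.mul_top, SModEq.sub_mem]
    induction n, hmn using Nat.le_induction with
    | base => simp
    | succ n hmn ih =>
      have := sub_mem ih (Ideal.pow_le_pow_right hmn (h n))
      convert this using 1
      ring)
  refine ⟨L, fun n => ?_⟩
  have := hL n
  simp only [smul_eq_mul, Ideal.mul_top, SModEq.sub_mem] at this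
  rw [← neg_sub]
  exact neg_mem this

theorem isAdicComplete_of (I : Ideal B) (h₀ : ∀ b : B, (∀ n, b ∈ I ^ n) → b = 0)
    (h : ∀ c : ℕ → B, (∀ n, c (n + 1) - c n ∈ I ^ n) → ∃ L, ∀ n, L - c n ∈ I ^ n) :
    IsAdicComplete I B where
  haus' b hb := h₀ b fun n => by simpa [SModEq.zero] using hb n
  prec' c hc := by
    obtain ⟨L, hL⟩ := h c fun n => by
      have := hc (Nat.le_succ n)
      simp only [smul_eq_mul, Ideal.mul_top, SModEq.sub_mem] at this
      rw [← neg_sub]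
      exact neg_mem this
    refine ⟨L, fun n => ?_⟩
    simp only [smul_eq_mul, Ideal.mul_top, SModEq.sub_mem]
    rw [← neg_sub]
    exact neg_mem (hL n)

theorem isUnit_of_mul_sub_one_mem (I : Ideal B) [IsAdicComplete I B] {b c : B}
    (h : b * c - 1 ∈ I) : IsUnit b := by
  have h1 : b * c - 1 ∈ Ring.jacobson B := by
    rw [Ring.jacobson_eq_sInf_isMaximal]
    have := IsAdicComplete.le_jacobson_bot I h
    simpa [Ideal.jacobson] using this
  have h2 : IsUnit (b * c) := by
    have := IsAdicComplete.le_jacobson_bot I h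
    rw [Ideal.mem_jacobson_bot] at this
    simpa using this 1
  exact isUnit_of_mul_isUnit_left h2

/-- The two topologies agree, so a `J`-Cauchy sequence has an `I`-adic limit. The prescribed rate of
convergence is recovered by comparing with the term of index `n + N * n`, because `I ^ (N * n) ≤ J ^
n`. -/
theorem isAdicComplete_of_pow_le {I J : Ideal B} [IsAdicComplete I B] (N : ℕ) (h : I ^ N ≤ J)
    (h' : J ≤ I) : IsAdicComplete J B := by
  have hle : ∀ n, I ^ (N * n) ≤ J ^ n := fun n => by
    rw [pow_mul]; exact Ideal.pow_right_mono h n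
  refine isAdicComplete_of J (fun b hb => eq_zero_of_forall_mem_pow I fun n =>
    Ideal.pow_right_mono h' n (hb n)) fun c hc => ?_
  obtain ⟨L, hL⟩ := exists_limit I c fun n => Ideal.pow_right_mono h' n (hc n)
  refine ⟨L, fun n => ?_⟩
  have h1 : ∀ m, c (n + m) - c n ∈ J ^ n := by
    intro m
    induction m with
    | zero => simp
    | succ m ih =>
      have := add_mem ih (Ideal.pow_le_pow_right (Nat.le_add_right n m) (hc (n + m)))
      convert this using 1
      rw [← add_assoc]; ring
  have h2 : L - c (n + N * n) ∈ J ^ n :=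
    hle n (Ideal.pow_le_pow_right (Nat.le_add_left _ _) (hL _))
  have := add_mem h2 (h1 (N * n))
  convert this using 1
  ring

/-- A derivation maps `I ^ (n + 1)` into `I ^ n • M`. -/
theorem derivation_mem_pow_smul {M : Type w} [AddCommGroup M] [Module B M] (D : Derivation ℤ B M)
    (I : Ideal B) (n : ℕ) {b : B} (hb : b ∈ I ^ (n + 1)) :
    D b ∈ (I ^ n • ⊤ : Submodule B M) := by
  induction n generalizing b with
  | zero => simp
  | succ n ih =>
    rw [pow_succ] at hb
    refine Submodule.mul_induction_on hb (fun x hx y hy => ?_) fun x y hx hy => ?_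
    · rw [Derivation.leibniz]
      refine add_mem (Submodule.smul_mem_smul hx Submodule.mem_top) ?_
      have := Submodule.smul_mem_smul hy (ih hx)
      rwa [← mul_smul, ← pow_succ'] at this
    · rw [map_add]; exact add_mem hx hy

theorem derivation_mem_pow (D : Derivation ℤ B B) (I : Ideal B) (n : ℕ) {b : B}
    (hb : b ∈ I ^ (n + 1)) : D b ∈ I ^ n := by
  simpa using derivation_mem_pow_smul D I n hb

/-- The homomorphism `φ : A → B` makes `B` the `J`-adic completion of `A[1/s]`. -/
structure IsCompletedAway (φ : A →+* B) (J : Ideal A) (s : A) : Prop where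
  complete : IsAdicComplete (J.map φ) B
  isUnit : IsUnit (φ s)
  exists_mul_sub_mem : ∀ (n : ℕ) (b : B), ∃ (k : ℕ) (a : A), φ s ^ k * b - φ a ∈ J.map φ ^ n
  exists_pow_mul_mem : ∀ (n : ℕ) (a : A), φ a ∈ J.map φ ^ n → ∃ k : ℕ, s ^ k * a ∈ J ^ n

namespace IsCompletedAway

variable {φ : A →+* B} {J : Ideal A} {s : A}

theorem mem_pow_of_mul_mem (h : IsCompletedAway φ J s) {I : Ideal B} {k : ℕ} {b : B}
    (hb : φ s ^ k * b ∈ I) : b ∈ I := by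
  have := h.isUnit.pow k
  rwa [Ideal.unit_mul_mem_iff_mem _ this] at hb

/-- Derivations on `B` are determined by their values on `A`. -/
theorem derivation_eq_zero (h : IsCompletedAway φ J s) {M : Type w} [AddCommGroup M] [Module B M]
    [IsHausdorff (J.map φ) M] (D : Derivation ℤ B M) (hD : ∀ a, D (φ a) = 0) : D = 0 := by
  ext b
  refine IsHausdorff.haus (I := J.map φ) inferInstance _ fun n => ?_
  rw [SModEq.zero]
  -- Order `n + 1`, because a derivation lowers the order by one; the unit `φ s ^ k` is divided out
  -- at the end.
  obtain ⟨k, a, hk⟩ := h.exists_mul_sub_mem (n + 1) b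
  have h1 := derivation_mem_pow_smul D _ n hk
  rw [map_sub, hD, sub_zero, ← map_pow, Derivation.leibniz, hD, smul_zero, add_zero, map_pow] at h1
  obtain ⟨c, hc⟩ := (h.isUnit.pow k).exists_left_inv
  have := Submodule.smul_mem _ c h1
  rwa [← mul_smul, hc, one_smul] at this

theorem derivation_ext (h : IsCompletedAway φ J s) {D₁ D₂ : Derivation ℤ B B}
    (hD : ∀ a, D₁ (φ a) = D₂ (φ a)) : D₁ = D₂ := by
  have := h.complete
  rw [← sub_eq_zero]
  exact h.derivation_eq_zero _ fun a => by simp [hD]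

/-- Derivations of `A` extend to `B`. -/
theorem exists_derivation (h : IsCompletedAway φ J s) (D : Derivation ℤ A A) :
    ∃ D' : Derivation ℤ B B, ∀ a, D' (φ a) = φ (D a) := by
  have := h.complete
  obtain ⟨u, hu⟩ := h.isUnit
  set v : B := ↑u⁻¹ with hv
  have huv : φ s * v = 1 := by rw [← hu]; exact u.mul_inv
  set I := J.map φ with hI
  let w : B := φ (D s) * v
  -- The quotient rule: `q a k` is the value that an extension of `D` must take on the fraction `a /
  -- s ^ k`. The extension is the limit of these values along fractions that approximate `b`.
  let q : A → ℕ → B := fun a k => v ^ k * (φ (D a) - k * w * φ a)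
  have q_def : ∀ a k, q a k = v ^ k * (φ (D a) - k * w * φ a) := fun _ _ => rfl
  have huv' : ∀ k, φ s ^ k * v ^ k = 1 := fun k => by rw [← mul_pow, huv, one_pow]
  have hDpow : ∀ (m : ℕ) (a : A), φ (D (s ^ m * a)) = φ s ^ m * (φ (D a) + m * w * φ a) := by
    intro m a
    induction m with
    | zero => simp
    | succ m ih =>
      have e1 : φ (D s) = φ s * w := by
        change _ = φ s * (φ (D s) * v)
        rw [mul_left_comm, huv, mul_one]
      rw [pow_succ', mul_assoc, Derivation.leibniz, smul_eq_mul, smul_eq_mul, map_add, map_mul, ih,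
        map_mul, e1]
      simp only [map_mul, map_pow]
      push_cast
      ring
  have qpow : ∀ a k m, q (s ^ m * a) (k + m) = q a k := by
    intro a k m
    rw [q_def, hDpow, map_mul, map_pow, q_def]
    push_cast
    linear_combination (v ^ k * (φ (D a) - k * w * φ a)) * huv' m
  have qsub : ∀ a a' k, q a k - q a' k = q (a - a') k := by
    intro a a' k
    simp only [q_def, map_sub]; ring
  have qmem : ∀ a k n, a ∈ J ^ (n + 1) → q a k ∈ I ^ n := by
    intro a k n ha
    refine Ideal.mul_mem_left _ _ (sub_mem ?_ (Ideal.mul_mem_left _ _ ?_))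
    · rw [hI, ← Ideal.map_pow]; exact Ideal.mem_map_of_mem _ (derivation_mem_pow D J n ha)
    · rw [hI, ← Ideal.map_pow]
      exact Ideal.mem_map_of_mem _ (Ideal.pow_le_pow_right (Nat.le_succ n) ha)
  -- Two fractions that approximate `b` to order `n + 1` have the same value modulo `I ^ n`: clear
  -- denominators and use that `D` loses one order.
  have qwd : ∀ n b a k a' k', φ s ^ k * b - φ a ∈ I ^ (n + 1) →
      φ s ^ k' * b - φ a' ∈ I ^ (n + 1) → q a k - q a' k' ∈ I ^ n := by
    intro n b a k a' k' h1 h2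
    have h3 : φ (s ^ k' * a - s ^ k * a') ∈ I ^ (n + 1) := by
      have := sub_mem (Ideal.mul_mem_left _ (φ s ^ k) h2) (Ideal.mul_mem_left _ (φ s ^ k') h1)
      convert this using 1
      simp only [map_sub, map_mul, map_pow]; ring
    obtain ⟨l, hl⟩ := h.exists_pow_mul_mem _ _ h3
    have e : q a k - q a' k' = q (s ^ l * (s ^ k' * a - s ^ k * a')) (k + k' + l) := by
      rw [qpow, ← qsub, qpow, add_comm k k', qpow]
    rw [e]
    exact qmem _ _ _ hl
  have hex : ∀ b, ∃ c, ∀ n a k, φ s ^ k * b - φ a ∈ I ^ (n + 1) → c - q a k ∈ I ^ n := by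
    intro b
    choose k a hka using fun n => h.exists_mul_sub_mem (n + 1) b
    obtain ⟨L, hL⟩ := exists_limit I (fun n => q (a n) (k n)) fun n =>
      qwd n b _ _ _ _ (Ideal.pow_le_pow_right (Nat.le_succ _) (hka (n + 1))) (hka n)
    refine ⟨L, fun n a' k' h' => ?_⟩
    have := add_mem (hL n) (qwd n b _ _ _ _ (hka n) h')
    simpa using this
  choose d hd using hex
  have hcommon : ∀ n b b', ∃ k a a', φ s ^ k * b - φ a ∈ I ^ (n + 1) ∧
      φ s ^ k * b' - φ a' ∈ I ^ (n + 1) := by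
    intro n b b'
    obtain ⟨k, a, h1⟩ := h.exists_mul_sub_mem (n + 1) b
    obtain ⟨k', a', h2⟩ := h.exists_mul_sub_mem (n + 1) b'
    refine ⟨k + k', s ^ k' * a, s ^ k * a', ?_, ?_⟩
    · have := Ideal.mul_mem_left _ (φ s ^ k') h1
      convert this using 1
      simp only [map_mul, map_pow]; ring
    · have := Ideal.mul_mem_left _ (φ s ^ k) h2
      convert this using 1
      simp only [map_mul, map_pow]; ring
  have hadd : ∀ b b', d (b + b') = d b + d b' := by
    intro b b'
    rw [← sub_eq_zero]
    refine eq_zero_of_forall_mem_pow I fun n => ?_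
    obtain ⟨k, a, a', h1, h2⟩ := hcommon n b b'
    have h3 := hd (b + b') n (a + a') k (by
      have := add_mem h1 h2
      convert this using 1
      simp only [map_add]; ring)
    have := sub_mem (sub_mem h3 (hd b n a k h1)) (hd b' n a' k h2)
    convert this using 1
    simp only [q_def, map_add]; ring
  have hmul : ∀ b b', d (b * b') = b * d b' + b' * d b := by
    intro b b'
    rw [← sub_eq_zero]
    refine eq_zero_of_forall_mem_pow I fun n => ?_
    obtain ⟨k, a, a', h1, h2⟩ := hcommon n b b'
    have h1' : b - v ^ k * φ a ∈ I ^ n := by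
      have := Ideal.pow_le_pow_right (Nat.le_succ n) (Ideal.mul_mem_left _ (v ^ k) h1)
      convert this using 1
      linear_combination (- b) * huv' k
    have h2' : b' - v ^ k * φ a' ∈ I ^ n := by
      have := Ideal.pow_le_pow_right (Nat.le_succ n) (Ideal.mul_mem_left _ (v ^ k) h2)
      convert this using 1
      linear_combination (- b') * huv' k
    have h3 := hd (b * b') n (a * a') (k + k) (by
      have := add_mem (Ideal.mul_mem_left _ (φ s ^ k * b') h1)
        (Ideal.mul_mem_left _ (φ a) h2)
      convert this using 1
      simp only [map_mul]; ring)
    have e : q (a * a') (k + k) = v ^ k * φ a * q a' k + v ^ k * φ a' * q a k := by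
      simp only [q_def, Derivation.leibniz, smul_eq_mul, map_add, map_mul]
      push_cast
      ring
    have h4 := hd b n a k h1
    have h5 := hd b' n a' k h2
    have := sub_mem (sub_mem (sub_mem (sub_mem h3 (Ideal.mul_mem_left _ b h5))
      (Ideal.mul_mem_left _ b' h4)) (Ideal.mul_mem_left _ (q a' k) h1'))
      (Ideal.mul_mem_left _ (q a k) h2')
    convert this using 1
    rw [e]
    ring
  refine ⟨Derivation.mk' (AddMonoidHom.mk' d hadd).toIntLinearMap hmul, fun a => ?_⟩
  change d (φ a) = _
  rw [← sub_eq_zero]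
  refine eq_zero_of_forall_mem_pow I fun n => ?_
  have := hd (φ a) n a 0 (by simp)
  simpa [q_def] using this

/-- Passing from the completion of `A[1/s]` to a further completed localization. -/
theorem of_comp (h : IsCompletedAway φ J s) {C : Type w} [CommRing C] {ψ : B →+* C} {t : B}
    (h' : ∀ (n l : ℕ) (a : A), n ≠ 0 → φ s ^ l * t - φ a ∈ J.map φ ^ n →
      IsCompletedAway (ψ.comp φ) J (s * a)) :
    IsCompletedAway ψ (J.map φ) t := by
  -- Up to the unit `φ s ^ l`, the element `t` is close to the image of an element `a` of `A`, so
  -- inverting `t` over `B` amounts to inverting `s * a` over `A`. A finer approximation is needed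
  -- for each order `n`.
  have key : ∀ n : ℕ, ∃ (l : ℕ) (a : A), φ s ^ l * t - φ a ∈ J.map φ ^ (n + 1) ∧
      IsCompletedAway (ψ.comp φ) J (s * a) := fun n => by
    obtain ⟨l, a, h1⟩ := h.exists_mul_sub_mem (n + 1) t
    exact ⟨l, a, h1, h' _ l a (Nat.succ_ne_zero n) h1⟩
  have hmap : (J.map φ).map ψ = J.map (ψ.comp φ) := Ideal.map_map _ _
  have key' : ∀ n : ℕ, ∃ (l : ℕ) (a : A), φ s ^ l * t - φ a ∈ J.map φ ^ (n + 1) ∧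
      ψ (φ s) ^ l * ψ t - ψ (φ a) ∈ J.map (ψ.comp φ) ^ (n + 1) ∧
      IsCompletedAway (ψ.comp φ) J (s * a) := fun n => by
    obtain ⟨l, a, h1, h2⟩ := key n
    refine ⟨l, a, h1, ?_, h2⟩
    have := Ideal.mem_map_of_mem ψ h1
    rw [Ideal.map_pow, hmap] at this
    simpa using this
  refine ⟨?_, ?_, fun n c => ?_, fun n b hb => ?_⟩
  · obtain ⟨l, a, -, h2⟩ := key 0
    rw [hmap]; exact h2.complete
  · obtain ⟨l, a, -, h1, h2⟩ := key' 0
    have := h2.complete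
    have hu := h2.isUnit
    simp only [RingHom.comp_apply, map_mul] at hu
    obtain ⟨c, hc⟩ := (isUnit_of_mul_isUnit_right hu).exists_right_inv
    refine isUnit_of_mul_sub_one_mem (J.map (ψ.comp φ)) (c := ψ (φ s) ^ l * c) ?_
    have := Ideal.mul_mem_left _ c h1
    rw [zero_add, pow_one] at this
    convert this using 1
    linear_combination hc
  · obtain ⟨l, a, -, h1, h2⟩ := key' n
    obtain ⟨k, a', h3⟩ := h2.exists_mul_sub_mem n c
    simp only [RingHom.comp_apply, map_mul] at h3
    obtain ⟨v, hv⟩ := h.isUnit.exists_right_inv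
    have hv' : ψ (φ s) * ψ v = 1 := by rw [← map_mul, hv, map_one]
    have hv'' : ψ (φ s) ^ (k + l * k) * ψ v ^ (k + l * k) = 1 := by
      rw [← mul_pow, hv', one_pow]
    refine ⟨k, v ^ (k + l * k) * φ a', ?_⟩
    rw [hmap]
    have h4 : (ψ (φ s) ^ l * ψ t) ^ k - ψ (φ a) ^ k ∈ J.map (ψ.comp φ) ^ n :=
      Ideal.mem_of_dvd _ (sub_dvd_pow_sub_pow _ _ k) (Ideal.pow_le_pow_right (Nat.le_succ n) h1)
    have := Ideal.mul_mem_left _ (ψ v ^ (k + l * k))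
      (add_mem h3 (Ideal.mul_mem_left _ (ψ (φ s) ^ k * c) h4))
    convert this using 1
    simp only [map_mul, map_pow]
    linear_combination (- ψ t ^ k * c) * hv''
  · obtain ⟨l, a, h0, h1, h2⟩ := key' n
    rw [hmap] at hb
    obtain ⟨k, a', h3⟩ := h.exists_mul_sub_mem n b
    have h4 : (ψ.comp φ) a' ∈ J.map (ψ.comp φ) ^ n := by
      have h5 := Ideal.mem_map_of_mem ψ h3
      rw [Ideal.map_pow, hmap] at h5
      have := sub_mem (Ideal.mul_mem_left _ (ψ (φ s) ^ k) hb) h5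
      convert this using 1
      simp
    obtain ⟨m, hm⟩ := h2.exists_pow_mul_mem n a' h4
    refine ⟨m, ?_⟩
    apply h.mem_pow_of_mul_mem (k := m + l * m + k)
    have h6 : (φ s ^ l * t) ^ m - φ a ^ m ∈ J.map φ ^ n :=
      Ideal.mem_of_dvd _ (sub_dvd_pow_sub_pow _ _ m) (Ideal.pow_le_pow_right (Nat.le_succ n) h0)
    have h7 : φ ((s * a) ^ m * a') ∈ J.map φ ^ n := by
      rw [← Ideal.map_pow]; exact Ideal.mem_map_of_mem _ hm
    have := add_mem (Ideal.mul_mem_left _ (φ s ^ m * φ a ^ m) h3) (add_mem h7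
      (Ideal.mul_mem_left _ (φ s ^ (m + k) * b) h6))
    convert this using 1
    simp only [map_mul, map_pow]
    ring

end IsCompletedAway

open scoped MvPowerSeries.WithPiTopology in
/-- A complete ring is noetherian if its quotient by a finitely generated ideal of definition is a
quotient of a noetherian ring that maps to it. -/
theorem isNoetherianRing_of_isAdicComplete [IsNoetherianRing A] (φ : A →+* B) (I : Ideal B)
    (hI : I.FG) [IsAdicComplete I B] (h : ∀ b, ∃ a, b - φ a ∈ I) : IsNoetherianRing B := by
  obtain ⟨n, g, hg⟩ := Submodule.fg_iff_exists_fin_generating_family.mp hI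
  let _ : WithIdeal B := ⟨I⟩
  have hcomp := (IsAdic.isAdicComplete_iff (I := I) (R := B) rfl).mp inferInstance
  have := hcomp.1
  have := hcomp.2
  let _ : UniformSpace A := ⊥
  have : DiscreteTopology A := ⟨rfl⟩
  have hg' : ∀ i, g i ∈ I := fun i => by
    rw [← hg]; exact Submodule.subset_span ⟨i, rfl⟩
  have hcont : Continuous φ := continuous_of_discreteTopology
  have heval : MvPowerSeries.HasEval g := by
    refine ⟨fun i => WithIdeal.isTopologicallyNilpotent_of_mem (hg' i), ?_⟩
    rw [Filter.cofinite_eq_bot]; exact Filter.tendsto_bot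
  -- A power series ring over `A` (with the discrete topology) maps to `B` by sending the variables
  -- to generators of `I`. It is surjective modulo `I`, hence surjective by completeness.
  let Φ : MvPowerSeries (Fin n) A →+* B := MvPowerSeries.eval₂Hom hcont heval
  have hX : ∀ i, Φ (MvPowerSeries.X i) = g i := fun i => by
    simp only [Φ, MvPowerSeries.coe_eval₂Hom]
    exact MvPowerSeries.eval₂_X φ g i
  have hC : ∀ a, Φ (MvPowerSeries.C a) = φ a := fun i => by
    simp only [Φ, MvPowerSeries.coe_eval₂Hom]
    exact MvPowerSeries.eval₂_C φ g i
  have hmap : (Ideal.span (Set.range MvPowerSeries.X) : Ideal (MvPowerSeries (Fin n) A)).map Φ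
      = I := by
    rw [Ideal.map_span, ← Set.range_comp, ← hg]
    congr 2
    ext1 i
    exact hX i
  have : IsHausdorff ((Ideal.span (Set.range MvPowerSeries.X) :
      Ideal (MvPowerSeries (Fin n) A)).map Φ) B := by
    rw [hmap]; infer_instance
  have hs : Function.Surjective Φ := by
    refine surjective_of_mk_map_comp_surjective
      (I := Ideal.span (Set.range MvPowerSeries.X)) Φ fun b => ?_
    obtain ⟨b, rfl⟩ := Ideal.Quotient.mk_surjective b
    obtain ⟨a, ha⟩ := h b
    refine ⟨MvPowerSeries.C a, ?_⟩
    rw [RingHom.comp_apply, hC, eq_comm, Ideal.Quotient.eq, hmap]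
    exact ha
  exact isNoetherianRing_of_surjective _ _ Φ hs

/-- The criterion above applies to the noetherian ring `A[X]`, with `X` sent to the inverse of `s`.
-/
theorem IsCompletedAway.isNoetherianRing [IsNoetherianRing A] {φ : A →+* B} {J : Ideal A} {s : A}
    (h : IsCompletedAway φ J s) : IsNoetherianRing B := by
  have := h.complete
  obtain ⟨v, hv⟩ := h.isUnit.exists_right_inv
  refine isNoetherianRing_of_isAdicComplete (Polynomial.eval₂RingHom φ v) (J.map φ)
    (Ideal.FG.map (IsNoetherian.noetherian J) φ) fun b => ?_
  obtain ⟨k, a, ha⟩ := h.exists_mul_sub_mem 1 b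
  refine ⟨Polynomial.C a * Polynomial.X ^ k, ?_⟩
  rw [pow_one] at ha
  have := Ideal.mul_mem_left _ (v ^ k) ha
  have e : φ s ^ k * v ^ k = 1 := by rw [← mul_pow, hv, one_pow]
  convert this using 1
  simp only [Polynomial.coe_eval₂RingHom, Polynomial.eval₂_mul, Polynomial.eval₂_C,
    Polynomial.eval₂_pow, Polynomial.eval₂_X]
  linear_combination (-b) * e

end Adic

/-! ### Sections of locally ringed spaces -/

section Sections

variable {X Y S : LocallyRingedSpace.{u}}

@[simp]
theorem res_self {U : Opens X} (h : U ≤ U) (a : Sec X U) : res h a = a := by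
  simp [res]

theorem res_res {U W W' : Opens X} (h : W ≤ U) (h' : W' ≤ W) (a : Sec X U) :
    res h' (res h a) = res (h'.trans h) a :=
  VectorField.res_res h h' a

theorem res_comp {U W W' : Opens X} (h : W ≤ U) (h' : W' ≤ W) :
    (res h').comp (res h) = res (h'.trans h) :=
  RingHom.ext fun a => res_res h h' a

theorem preim_mono (f : X ⟶ Y) {V V' : Opens Y} (h : V' ≤ V) : preim f V' ≤ preim f V :=
  fun _ hx => h hx

theorem res_pull (f : X ⟶ Y) {V : Opens Y} {W W' : Opens X} (h : W ≤ preim f V) (h' : W' ≤ W)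
    (a : Sec Y V) : res h' (pull f h a) = pull f (h'.trans h) a :=
  res_res _ _ _

theorem pull_res (f : X ⟶ Y) {V V' : Opens Y} {W : Opens X} (hV : V' ≤ V) (h : W ≤ preim f V')
    (a : Sec Y V) : pull f h (res hV a) = pull f (h.trans (preim_mono f hV)) a := by
  have := ConcreteCategory.congr_hom (f.c.naturality (homOfLE hV).op) a
  simp only [CommRingCat.comp_apply] at this
  change res h ((f.c.app (op V')).hom ((Y.presheaf.map (homOfLE hV).op).hom a)) = _
  erw [this]
  exact res_res (preim_mono f hV) h _

theorem pull_comp (f : X ⟶ Y) (g : Y ⟶ S) {V : Opens S} {V' : Opens Y} {W : Opens X}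
    (h : V' ≤ preim g V) (h' : W ≤ preim f V') (a : Sec S V) :
    pull (f ≫ g) (h'.trans (preim_mono f h)) a = pull f h' (pull g h a) := by
  rw [pull, pull, pull, RingHom.comp_apply, RingHom.comp_apply, RingHom.comp_apply]
  have := pull_res f (V := preim g V) h h' ((g.c.app (op V)).hom a)
  exact this.symm

theorem vanishesAt_iff_notMem_basicOpen {U : Opens X} (s : Sec X U) (x : X) (hx : x ∈ U) :
    VanishesAt s x hx ↔ x ∉ X.toRingedSpace.basicOpen s :=
  X.evaluation_eq_zero_iff_notMem_basicOpen ⟨x, hx⟩ s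

theorem mem_basicOpen_iff {U : Opens X} (s : Sec X U) (x : X) (hx : x ∈ U) :
    x ∈ X.toRingedSpace.basicOpen s ↔ ¬ VanishesAt s x hx := by
  rw [vanishesAt_iff_notMem_basicOpen, not_not]

theorem vanishesAt_iff_mem_ker {U : Opens X} (s : Sec X U) (x : X) (hx : x ∈ U) :
    VanishesAt s x hx ↔ s ∈ RingHom.ker (X.evaluation ⟨x, hx⟩).hom :=
  Iff.rfl

theorem vanishesAt_iff_germ {U : Opens X} (s : Sec X U) (x : X) (hx : x ∈ U) :
    VanishesAt s x hx ↔ X.presheaf.germ U x hx s ∈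
      IsLocalRing.maximalIdeal (X.presheaf.stalk x) := by
  rw [vanishesAt_iff_notMem_basicOpen, X.toRingedSpace.mem_basicOpen s x hx]
  rfl

theorem germ_res {U W : Opens X} (h : W ≤ U) (x : X) (hx : x ∈ W) (s : Sec X U) :
    X.presheaf.germ W x hx (res h s) = X.presheaf.germ U x (h hx) s :=
  X.presheaf.germ_res_apply (homOfLE h) x hx s

@[simp]
theorem vanishesAt_res {U W : Opens X} (h : W ≤ U) (s : Sec X U) (x : X) (hx : x ∈ W) :
    VanishesAt (res h s) x hx ↔ VanishesAt s x (h hx) := by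
  rw [vanishesAt_iff_germ, vanishesAt_iff_germ, germ_res]

theorem vanishesAt_mul {U : Opens X} {s t : Sec X U} {x : X} {hx : x ∈ U} :
    VanishesAt (s * t) x hx ↔ VanishesAt s x hx ∨ VanishesAt t x hx := by
  simp [VanishesAt]

theorem VanishesAt.add {U : Opens X} {s t : Sec X U} {x : X} {hx : x ∈ U}
    (h : VanishesAt s x hx) (h' : VanishesAt t x hx) : VanishesAt (s + t) x hx := by
  rw [vanishesAt_iff_mem_ker] at *
  exact add_mem h h'

theorem vanishesAt_of_sub {U : Opens X} {s t : Sec X U} {x : X} {hx : x ∈ U}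
    (h : VanishesAt (s - t) x hx) : VanishesAt s x hx ↔ VanishesAt t x hx := by
  simp only [vanishesAt_iff_mem_ker] at *
  exact ⟨fun h' => by simpa using sub_mem h' h, fun h' => by simpa using add_mem h h'⟩

theorem not_vanishesAt_of_isUnit {U : Opens X} {s : Sec X U} (h : IsUnit s) (x : X) (hx : x ∈ U) :
    ¬ VanishesAt s x hx := by
  have := h.map (X.evaluation ⟨x, hx⟩).hom
  exact this.ne_zero

@[simp]
theorem vanishesAt_pull (f : X ⟶ Y) {V : Opens Y} {W : Opens X} (h : W ≤ preim f V) (s : Sec Y V)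
    (x : X) (hx : x ∈ W) : VanishesAt (pull f h s) x hx ↔ VanishesAt s (f.base x) (h hx) := by
  have h1 := LocallyRingedSpace.evaluation_naturality_apply f (V := V) ⟨x, h hx⟩ s
  have h2 : VanishesAt (pull f h s) x hx ↔ X.evaluation (⟨x, h hx⟩ : preim f V)
      ((f.c.app (op V)).hom s) = 0 := vanishesAt_res h _ x hx
  rw [h2]
  erw [← h1]
  exact map_eq_zero _

theorem mem_vanishingIdeal {T : Set X} {U : Opens X} {s : Sec X U} :
    s ∈ vanishingIdeal X T U ↔ ∀ (x : X) (hx : x ∈ U), x ∈ T → VanishesAt s x hx := by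
  simp only [vanishingIdeal, Ideal.mem_iInf, Subtype.forall]
  rfl

theorem mem_definingIdeal {U : Opens X} {s : Sec X U} :
    s ∈ definingIdeal X U ↔ ∀ (x : X) (hx : x ∈ U), VanishesAt s x hx := by
  simp [definingIdeal, mem_vanishingIdeal]

theorem map_res_definingIdeal_le {U W : Opens X} (h : W ≤ U) :
    (definingIdeal X U).map (res h) ≤ definingIdeal X W := by
  rw [Ideal.map_le_iff_le_comap]
  intro s hs
  rw [Ideal.mem_comap, mem_definingIdeal]
  intro x hx
  rw [vanishesAt_res]
  exact mem_definingIdeal.mp hs x (h hx)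

theorem map_pull_definingIdeal_le (f : X ⟶ Y) {V : Opens Y} {W : Opens X} (h : W ≤ preim f V) :
    (definingIdeal Y V).map (pull f h) ≤ definingIdeal X W := by
  rw [Ideal.map_le_iff_le_comap]
  intro s hs
  rw [Ideal.mem_comap, mem_definingIdeal]
  intro x hx
  rw [vanishesAt_pull]
  exact mem_definingIdeal.mp hs _ (h hx)

theorem mem_pow_of_mem_pow {A B : Type*} [CommRing A] [CommRing B] {φ : A →+* B} {I : Ideal A}
    {J : Ideal B} (h : I.map φ ≤ J) {n : ℕ} {a : A} (ha : a ∈ I ^ n) : φ a ∈ J ^ n := by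
  have := Ideal.mem_map_of_mem φ ha
  rw [Ideal.map_pow] at this
  exact Ideal.pow_right_mono h n this

/-- Two sections that agree locally are equal. -/
theorem sec_ext {U : Opens X} {a b : Sec X U}
    (h : ∀ x ∈ U, ∃ (W : Opens X) (hW : W ≤ U), x ∈ W ∧ res hW a = res hW b) : a = b := by
  choose W hW hx hres using h
  refine X.sheaf.eq_of_locally_eq' (fun x : U => W x.1 x.2) U (fun x => homOfLE (hW x.1 x.2))
    (fun x hxU => ?_) a b fun x => hres x.1 x.2
  simp only [Opens.mem_iSup, Subtype.exists]
  exact ⟨x, hxU, hx x hxU⟩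

/-- Gluing of the sections that satisfy a predicate which is stable under restriction and
determines a section uniquely. -/
theorem exists_glue {U : Opens X} (P : ∀ W : Opens X, W ≤ U → Sec X W → Prop)
    (hres : ∀ (W : Opens X) (h : W ≤ U) (W' : Opens X) (h' : W' ≤ W) (c : Sec X W), P W h c →
      P W' (h'.trans h) (res h' c))
    (huniq : ∀ (W : Opens X) (h : W ≤ U) (c c' : Sec X W), P W h c → P W h c' → c = c')
    (hloc : ∀ x ∈ U, ∃ (W : Opens X) (h : W ≤ U), x ∈ W ∧ ∃ c, P W h c) :
    ∃ c : Sec X U, ∀ (W : Opens X) (h : W ≤ U) (c' : Sec X W), P W h c' → res h c = c' := by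
  choose W hW hx c hc using hloc
  have hcov : U ≤ iSup fun x : U => W x.1 x.2 := fun x hxU => by
    simp only [Opens.mem_iSup, Subtype.exists]
    exact ⟨x, hxU, hx x hxU⟩
  obtain ⟨(a : Sec X U), ha, -⟩ := X.sheaf.existsUnique_gluing' (fun x : U => W x.1 x.2) U
    (fun x => homOfLE (hW x.1 x.2)) hcov (fun x => c x.1 x.2) (fun x y => by
      refine huniq (W x.1 x.2 ⊓ W y.1 y.2) (inf_le_left.trans (hW x.1 x.2)) _ _ ?_ ?_
      · exact hres _ _ _ inf_le_left _ (hc x.1 x.2)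
      · exact hres _ _ _ inf_le_right _ (hc y.1 y.2))
  refine ⟨a, fun W' h' c' hc' => sec_ext fun x hx' => ?_⟩
  refine ⟨W' ⊓ W x (h' hx'), inf_le_left, ⟨hx', hx x (h' hx')⟩, ?_⟩
  refine huniq _ (inf_le_left.trans h') _ _ ?_ (hres _ _ _ inf_le_left _ hc')
  have h1 : res (hW x (h' hx')) a = c x (h' hx') := ha ⟨x, h' hx'⟩
  have h2 := hres _ _ (W' ⊓ W x (h' hx')) inf_le_right _ (hc x (h' hx'))
  rw [← h1, res_res] at h2
  rwa [res_res]

/-- A section on a smaller open set that is the inverse of a function which vanishes nowhere. -/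
theorem isUnit_res_basicOpen {U : Opens X} (s : Sec X U) :
    IsUnit (res (X.toRingedSpace.basicOpen_le s) s) :=
  X.toRingedSpace.isUnit_res_basicOpen s

theorem basicOpen_res {U W : Opens X} (h : W ≤ U) (s : Sec X U) :
    X.toRingedSpace.basicOpen (res h s) = W ⊓ X.toRingedSpace.basicOpen s :=
  X.toRingedSpace.basicOpen_res (homOfLE h).op s

theorem basicOpen_eq_of_sub_mem {U : Opens X} {s t : Sec X U} (h : s - t ∈ definingIdeal X U) :
    X.toRingedSpace.basicOpen s = X.toRingedSpace.basicOpen t := by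
  ext x
  have aux : ∀ r : Sec X U, x ∈ X.toRingedSpace.basicOpen r → x ∈ U :=
    fun r hr => X.toRingedSpace.basicOpen_le r hr
  constructor
  · intro hx
    have hxU := aux _ hx
    exact (mem_basicOpen_iff _ _ hxU).mpr fun h' => (mem_basicOpen_iff _ _ hxU).mp hx
      ((vanishesAt_of_sub (mem_definingIdeal.mp h x hxU)).mpr h')
  · intro hx
    have hxU := aux _ hx
    exact (mem_basicOpen_iff _ _ hxU).mpr fun h' => (mem_basicOpen_iff _ _ hxU).mp hx
      ((vanishesAt_of_sub (mem_definingIdeal.mp h x hxU)).mp h')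

theorem basicOpen_pull (f : X ⟶ Y) {V : Opens Y} {W : Opens X} (h : W ≤ preim f V) (s : Sec Y V) :
    X.toRingedSpace.basicOpen (pull f h s) = W ⊓ preim f (Y.toRingedSpace.basicOpen s) := by
  ext x
  constructor
  · intro hx
    have hxU := X.toRingedSpace.basicOpen_le _ hx
    refine ⟨hxU, ?_⟩
    have := (mem_basicOpen_iff _ _ hxU).mp hx
    rw [vanishesAt_pull] at this
    exact (mem_basicOpen_iff s _ (h hxU)).mpr this
  · rintro ⟨hxU, hx⟩
    refine (mem_basicOpen_iff _ _ hxU).mpr ?_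
    rw [vanishesAt_pull]
    exact (mem_basicOpen_iff s (f.base x) (h hxU)).mp hx

end Sections

/-! ### Formal affine open sets -/

section FormalAffine

variable {X Y S : LocallyRingedSpace.{u}}

/-- The open set where a section does not vanish. -/
abbrev basicOpen {U : Opens X} (s : Sec X U) : Opens X :=
  X.toRingedSpace.basicOpen s

theorem basicOpen_le {U : Opens X} (s : Sec X U) : basicOpen s ≤ U :=
  X.toRingedSpace.basicOpen_le s

theorem mem_pointPrime {U : Opens X} (x : U) (s : Sec X U) :
    s ∈ (pointPrime X U x).asIdeal ↔ VanishesAt s x.1 x.2 :=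
  Iff.rfl

theorem pointPrime_mem_basicOpen {U : Opens X} (x : U) (s : Sec X U) :
    pointPrime X U x ∈ PrimeSpectrum.basicOpen s ↔ x.1 ∈ basicOpen s := by
  rw [PrimeSpectrum.mem_basicOpen, mem_pointPrime, mem_basicOpen_iff s x.1 x.2]

theorem continuous_pointPrime (U : Opens X) : Continuous (pointPrime X U) := by
  rw [PrimeSpectrum.isTopologicalBasis_basic_opens.continuous_iff]
  rintro _ ⟨s, rfl⟩
  have : pointPrime X U ⁻¹' (PrimeSpectrum.basicOpen s : Set (PrimeSpectrum (Sec X U))) =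
      Subtype.val ⁻¹' (basicOpen s : Set X) := by
    ext x
    exact pointPrime_mem_basicOpen x s
  rw [this]
  exact (basicOpen s).isOpen.preimage continuous_subtype_val

theorem isEmbedding_pointPrime {U : Opens X}
    (hbasis : ∀ x ∈ U, ∀ W : Opens X, x ∈ W → ∃ s : Sec X U, x ∈ basicOpen s ∧ basicOpen s ≤ W)
    (hinj : Function.Injective (pointPrime X U)) : Topology.IsEmbedding (pointPrime X U) := by
  refine ⟨Topology.isInducing_iff_nhds.mpr fun x => le_antisymm
    (continuous_pointPrime U).continuousAt.le_comap ?_, hinj⟩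
  intro N hN
  obtain ⟨O, hO, hOo, hxO⟩ := mem_nhds_iff.mp hN
  obtain ⟨O', hO', rfl⟩ := isOpen_induced_iff.mp hOo
  obtain ⟨s, hxs, hs⟩ := hbasis x.1 x.2 ⟨O', hO'⟩ hxO
  rw [Filter.mem_comap]
  refine ⟨PrimeSpectrum.basicOpen s, (PrimeSpectrum.basicOpen s).isOpen.mem_nhds
    ((pointPrime_mem_basicOpen x s).mpr hxs), fun y hy => hO ?_⟩
  exact hs ((pointPrime_mem_basicOpen y s).mp hy)

theorem range_pointPrime_subset (U : Opens X) :
    Set.range (pointPrime X U) ⊆ PrimeSpectrum.zeroLocus (definingIdeal X U) := by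
  rintro _ ⟨x, rfl⟩ s hs
  exact mem_definingIdeal.mp hs x.1 x.2

/-- Localizations of the quotients by the powers of `J`, in terms of elements. -/
theorem isLocalization_quotient_iff {A : Type v} {B : Type w} [CommRing A] [CommRing B]
    (φ : A →+* B) (J : Ideal A) (s : A) (n : ℕ) :
    (letI : Algebra (A ⧸ J ^ n) (B ⧸ (J ^ n).map φ) :=
        (Ideal.quotientMap _ φ Ideal.le_comap_map).toAlgebra;
      IsLocalization.Away (Ideal.Quotient.mk (J ^ n) s) (B ⧸ (J ^ n).map φ)) ↔
    (∃ b, φ s * b - 1 ∈ J.map φ ^ n) ∧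
      (∀ b : B, ∃ (k : ℕ) (a : A), φ s ^ k * b - φ a ∈ J.map φ ^ n) ∧
      (∀ a : A, φ a ∈ J.map φ ^ n → ∃ k : ℕ, s ^ k * a ∈ J ^ n) := by
  let _ : Algebra (A ⧸ J ^ n) (B ⧸ (J ^ n).map φ) :=
    (Ideal.quotientMap _ φ Ideal.le_comap_map).toAlgebra
  have halg : ∀ a : A, algebraMap (A ⧸ J ^ n) (B ⧸ (J ^ n).map φ) (Ideal.Quotient.mk _ a) =
    Ideal.Quotient.mk _ (φ a) := fun a => rfl
  have hmk : ∀ b c : B, (Ideal.Quotient.mk ((J ^ n).map φ) b = Ideal.Quotient.mk _ c) ↔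
      b - c ∈ J.map φ ^ n := fun b c => by rw [Ideal.Quotient.eq, Ideal.map_pow]
  have hmk' : ∀ b c : A, (Ideal.Quotient.mk (J ^ n) b = Ideal.Quotient.mk _ c) ↔
      b - c ∈ J ^ n := fun b c => by rw [Ideal.Quotient.eq]
  constructor
  · intro h
    refine ⟨?_, fun b => ?_, fun a ha => ?_⟩
    · obtain ⟨c, hc⟩ := (IsLocalization.Away.algebraMap_isUnit
        (S := B ⧸ (J ^ n).map φ) (Ideal.Quotient.mk (J ^ n) s)).exists_right_inv
      obtain ⟨b, rfl⟩ := Ideal.Quotient.mk_surjective c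
      refine ⟨b, ?_⟩
      rw [halg, ← map_mul, ← map_one (Ideal.Quotient.mk ((J ^ n).map φ)), hmk] at hc
      exact hc
    · obtain ⟨k, a, ha⟩ := IsLocalization.Away.surj (Ideal.Quotient.mk (J ^ n) s)
        (Ideal.Quotient.mk ((J ^ n).map φ) b)
      obtain ⟨a, rfl⟩ := Ideal.Quotient.mk_surjective a
      refine ⟨k, a, ?_⟩
      rw [halg, halg, ← map_pow, ← map_mul, hmk] at ha
      rwa [mul_comm]
    · have h1 : algebraMap (A ⧸ J ^ n) (B ⧸ (J ^ n).map φ) (Ideal.Quotient.mk _ a) =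
          algebraMap (A ⧸ J ^ n) (B ⧸ (J ^ n).map φ) 0 := by
        rw [halg, map_zero, ← map_zero (Ideal.Quotient.mk ((J ^ n).map φ)), hmk]
        simpa using ha
      obtain ⟨⟨_, k, rfl⟩, hk⟩ := IsLocalization.exists_of_eq
        (M := Submonoid.powers (Ideal.Quotient.mk (J ^ n) s)) h1
      refine ⟨k, ?_⟩
      simp only [mul_zero] at hk
      rw [← map_pow, ← map_mul, ← map_zero (Ideal.Quotient.mk (J ^ n)), hmk'] at hk
      simpa using hk
  · rintro ⟨⟨c, hc⟩, h2, h3⟩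
    refine ⟨?_, ?_, ?_⟩
    · rintro ⟨_, k, rfl⟩
      simp only
      rw [map_pow, halg]
      refine IsUnit.pow _ (IsUnit.of_mul_eq_one (Ideal.Quotient.mk _ c) ?_)
      rw [← map_mul, ← map_one (Ideal.Quotient.mk ((J ^ n).map φ)), hmk]
      exact hc
    · intro z
      obtain ⟨b, rfl⟩ := Ideal.Quotient.mk_surjective z
      obtain ⟨k, a, ha⟩ := h2 b
      refine ⟨(Ideal.Quotient.mk _ a, ⟨_, k, rfl⟩), ?_⟩
      simp only
      rw [map_pow, halg, halg, ← map_pow, ← map_mul, hmk, mul_comm]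
      exact ha
    · intro x y hxy
      obtain ⟨a, rfl⟩ := Ideal.Quotient.mk_surjective x
      obtain ⟨b, rfl⟩ := Ideal.Quotient.mk_surjective y
      rw [halg, halg, hmk, ← map_sub] at hxy
      obtain ⟨k, hk⟩ := h3 _ hxy
      refine ⟨⟨_, k, rfl⟩, ?_⟩
      simp only
      rw [← map_pow, ← map_mul, ← map_mul, hmk', ← mul_sub]
      exact hk

namespace IsFormalAffine

variable {U : Opens X}

theorem isCompletedAway_basicOpen (hU : IsFormalAffine X U) (s : Sec X U) :
    IsCompletedAway (res (basicOpen_le s)) (definingIdeal X U) s where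
  complete := hU.complete_basicOpen s
  isUnit := isUnit_res_basicOpen s
  exists_mul_sub_mem n b :=
    ((isLocalization_quotient_iff _ _ s n).mp (hU.localization_basicOpen s n)).2.1 b
  exists_pow_mul_mem n a :=
    ((isLocalization_quotient_iff _ _ s n).mp (hU.localization_basicOpen s n)).2.2 a

theorem isCompletedAway (hU : IsFormalAffine X U) (s : Sec X U) {W : Opens X} (hW : W ≤ U)
    (h : W = basicOpen s) : IsCompletedAway (res hW) (definingIdeal X U) s := by
  subst h
  exact hU.isCompletedAway_basicOpen s

theorem of_isCompletedAway (h₁ : IsNoetherianRing (Sec X U))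
    (h₂ : IsAdicComplete (definingIdeal X U) (Sec X U))
    (h₃ : Topology.IsEmbedding (pointPrime X U))
    (h₄ : ∀ P : PrimeSpectrum (Sec X U), definingIdeal X U ≤ P.asIdeal →
      ∃ x : U, pointPrime X U x = P)
    (h₅ : ∀ s : Sec X U, IsCompletedAway (res (basicOpen_le s)) (definingIdeal X U) s) :
    IsFormalAffine X U where
  noetherian := h₁
  complete := h₂
  isEmbedding := h₃
  range_eq := (range_pointPrime_subset U).antisymm fun P hP => h₄ P hP
  complete_basicOpen s := (h₅ s).complete
  localization_basicOpen s n := by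
    refine (isLocalization_quotient_iff _ _ s n).mpr
      ⟨?_, (h₅ s).exists_mul_sub_mem n, (h₅ s).exists_pow_mul_mem n⟩
    obtain ⟨b, hb⟩ := (h₅ s).isUnit.exists_right_inv
    exact ⟨b, by rw [hb, sub_self]; exact zero_mem _⟩

theorem exists_point (hU : IsFormalAffine X U) (P : Ideal (Sec X U)) [hP : P.IsPrime]
    (h : definingIdeal X U ≤ P) :
    ∃ (x : X) (hx : x ∈ U), ∀ s : Sec X U, VanishesAt s x hx ↔ s ∈ P := by
  have : (⟨P, hP⟩ : PrimeSpectrum (Sec X U)) ∈ Set.range (pointPrime X U) := by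
    rw [hU.range_eq]; exact h
  obtain ⟨x, hx⟩ := this
  refine ⟨x.1, x.2, fun s => ?_⟩
  rw [← mem_pointPrime, hx]

/-- The sets where a section does not vanish are a basis of the topology. -/
theorem exists_basicOpen (hU : IsFormalAffine X U) {x : X} (hx : x ∈ U) {W : Opens X}
    (hW : x ∈ W) : ∃ s : Sec X U, x ∈ basicOpen s ∧ basicOpen s ≤ W := by
  have h1 : (Subtype.val ⁻¹' (W : Set X) : Set U) ∈ nhds (⟨x, hx⟩ : U) :=
    (W.isOpen.preimage continuous_subtype_val).mem_nhds hW
  rw [hU.isEmbedding.isInducing.nhds_eq_comap, Filter.mem_comap] at h1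
  obtain ⟨N, hN, hNW⟩ := h1
  obtain ⟨_, ⟨s, rfl⟩, hxs, hs⟩ :=
    PrimeSpectrum.isTopologicalBasis_basic_opens.mem_nhds_iff.mp hN
  refine ⟨s, (pointPrime_mem_basicOpen ⟨x, hx⟩ s).mp hxs, fun y hy => ?_⟩
  have hyU := basicOpen_le s hy
  exact hNW (hs ((pointPrime_mem_basicOpen ⟨y, hyU⟩ s).mpr hy) :
    (⟨y, hyU⟩ : U) ∈ pointPrime X U ⁻¹' N)

theorem definingIdeal_fg (hU : IsFormalAffine X U) : (definingIdeal X U).FG := by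
  have := hU.noetherian
  exact IsNoetherian.noetherian _

theorem mem_definingIdeal_of_res (s : Sec X U) {b : Sec X U}
    (h : ∀ (x : X) (hx : x ∈ U), x ∈ basicOpen s → VanishesAt b x hx) :
    s * b ∈ definingIdeal X U := by
  rw [mem_definingIdeal]
  intro x hx
  rw [vanishesAt_mul, or_iff_not_imp_left]
  intro h'
  exact h x hx ((mem_basicOpen_iff s x hx).mpr h')

/-- If `b` vanishes on `D(s)` and `s ^ k b` is close to `a` in `Γ(U)`, then `a` vanishes on `D(s)`
and `s a` vanishes on all of `U`. So `s ^ (k + 1) b` lies in the extended ideal, and `s` is a unit.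
-/
theorem definingIdeal_basicOpen (hU : IsFormalAffine X U) (s : Sec X U) :
    definingIdeal X (basicOpen s) = (definingIdeal X U).map (res (basicOpen_le s)) := by
  refine le_antisymm (fun b hb => ?_) (map_res_definingIdeal_le _)
  have hs := hU.isCompletedAway_basicOpen s
  obtain ⟨k, a, hka⟩ := hs.exists_mul_sub_mem 1 b
  rw [pow_one] at hka
  have h1 : s * a ∈ definingIdeal X U := mem_definingIdeal_of_res s fun x hx hxs => by
    have h2 := mem_definingIdeal.mp (map_res_definingIdeal_le _ hka) x hxs
    rw [← vanishesAt_res (basicOpen_le s) a x hxs, ← vanishesAt_of_sub h2]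
    exact vanishesAt_mul.mpr (Or.inr (mem_definingIdeal.mp hb x hxs))
  apply hs.mem_pow_of_mul_mem (k := k + 1)
  have h2 := Ideal.mem_map_of_mem (res (basicOpen_le s)) h1
  have := add_mem h2 (Ideal.mul_mem_left _ (res (basicOpen_le s) s) hka)
  convert this using 1
  rw [map_mul]; ring

/-- Functions on `D(s)` are, up to the unit `s`, approximated by functions on `U`, and vanishing at
a point only depends on the approximation; this identifies the points with the primes. For the
further localizations, `D(t)` inside `D(s)` is `D(s a)` inside `U` when `s ^ l t` is close to `a`,
and `IsCompletedAway.of_comp` applies. -/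
protected theorem basicOpen (hU : IsFormalAffine X U) (s : Sec X U) :
    IsFormalAffine X (basicOpen s) := by
  have hs := hU.isCompletedAway_basicOpen s
  have hJ := hU.definingIdeal_basicOpen s
  have := hU.noetherian
  refine of_isCompletedAway hs.isNoetherianRing (hJ ▸ hs.complete) ?_ ?_ fun t => ?_
  · refine isEmbedding_pointPrime (fun x hx W hW => ?_) fun x y hxy => ?_
    · obtain ⟨t, hxt, ht⟩ := hU.exists_basicOpen (basicOpen_le s hx) hW
      refine ⟨res (basicOpen_le s) t, ?_, ?_⟩
      · rw [basicOpen, basicOpen_res]; exact ⟨hx, hxt⟩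
      · rw [basicOpen, basicOpen_res]; exact inf_le_right.trans ht
    · have : pointPrime X U ⟨x.1, basicOpen_le s x.2⟩ = pointPrime X U ⟨y.1, basicOpen_le s y.2⟩ := by
        ext a
        rw [mem_pointPrime, mem_pointPrime, ← vanishesAt_res (basicOpen_le s) a x.1 x.2,
          ← vanishesAt_res (basicOpen_le s) a y.1 y.2]
        exact Iff.of_eq (congrArg (fun P : PrimeSpectrum _ => res (basicOpen_le s) a ∈ P.asIdeal)
          hxy)
      have := hU.isEmbedding.injective this
      exact Subtype.ext (Subtype.mk.inj this)
  · intro P hP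
    have hP' := P.2
    let Q := P.asIdeal.comap (res (basicOpen_le s))
    have hQ : definingIdeal X U ≤ Q := by
      rw [← Ideal.map_le_iff_le_comap, ← hJ]; exact hP
    obtain ⟨x, hx, hxQ⟩ := hU.exists_point Q hQ
    have hxs : x ∈ basicOpen s := by
      rw [mem_basicOpen_iff s x hx, hxQ]
      intro h
      exact hP'.ne_top (Ideal.eq_top_of_isUnit_mem _ h hs.isUnit)
    refine ⟨⟨x, hxs⟩, ?_⟩
    ext b
    obtain ⟨k, a, hka⟩ := hs.exists_mul_sub_mem 1 b
    rw [pow_one, ← hJ] at hka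
    have h1 := vanishesAt_of_sub (mem_definingIdeal.mp hka x hxs)
    have h2 : res (basicOpen_le s) s ^ k * b ∈ P.asIdeal ↔ a ∈ Q :=
      ⟨fun h => by simpa [Q] using sub_mem h (hP hka),
        fun h => by simpa [Q] using add_mem (hP hka) h⟩
    rw [mem_pointPrime]
    rw [vanishesAt_res, hxQ, ← h2, Ideal.unit_mul_mem_iff_mem _ (hs.isUnit.pow k),
      vanishesAt_mul] at h1
    rw [← h1, iff_or_self]
    intro h
    exact absurd h (not_vanishesAt_of_isUnit (hs.isUnit.pow k) x hxs)
  · rw [hJ]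
    refine hs.of_comp fun n l a hn hna => ?_
    rw [res_comp]
    refine hU.isCompletedAway _ _ ?_
    have h1 : res (basicOpen_le s) s ^ l * t - res (basicOpen_le s) a ∈
        definingIdeal X (basicOpen s) := by
      rw [hJ]; exact Ideal.pow_le_self hn hna
    have h2 : basicOpen (res (basicOpen_le s) s ^ l * t) = basicOpen t := by
      rw [basicOpen, X.toRingedSpace.basicOpen_mul,
        X.toRingedSpace.basicOpen_of_isUnit (hs.isUnit.pow l)]
      exact inf_eq_right.mpr (basicOpen_le t)
    rw [← h2, basicOpen, basicOpen_eq_of_sub_mem h1, basicOpen_res, ← X.toRingedSpace.basicOpen_mul]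

end IsFormalAffine

/-- A locally ringed space that is covered by formal affine open sets. -/
def IsLocallyFormalAffine (X : LocallyRingedSpace.{u}) : Prop :=
  ∀ x : X, ∃ U : Opens X, x ∈ U ∧ IsFormalAffine X U

theorem IsLocallyFormalAffine.exists_le (hX : IsLocallyFormalAffine X) {x : X} {W : Opens X}
    (hx : x ∈ W) : ∃ U : Opens X, x ∈ U ∧ U ≤ W ∧ IsFormalAffine X U := by
  obtain ⟨U, hxU, hU⟩ := hX x
  obtain ⟨s, hxs, hs⟩ := hU.exists_basicOpen hxU hx
  exact ⟨basicOpen s, hxs, hs, hU.basicOpen s⟩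

theorem IsFormalAffine.exists_le {U W : Opens X} (hU : IsFormalAffine X U) {x : X} (hxU : x ∈ U)
    (hx : x ∈ W) : ∃ U' : Opens X, x ∈ U' ∧ U' ≤ W ∧ U' ≤ U ∧ IsFormalAffine X U' := by
  obtain ⟨s, hxs, hs⟩ := hU.exists_basicOpen hxU hx
  exact ⟨basicOpen s, hxs, hs, basicOpen_le s, hU.basicOpen s⟩

theorem IsNoetherianFormalScheme.isLocallyFormalAffine (hX : IsNoetherianFormalScheme X) :
    IsLocallyFormalAffine X :=
  hX.exists_affine

/-- Morphisms of formal schemes are continuous: a section of `S` is approximated by sections over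
a formal affine open set up to functions in the powers of the ideals of definition of `X`. -/
theorem IsFormalAffine.exists_pull_sub_mem (f : X ⟶ S) {V V' : Opens S}
    (hV : IsFormalAffine S V) (hV' : V' ≤ V) {a : Sec S V} (ha : V' = basicOpen a) {W : Opens X}
    (hW : W ≤ preim f V') (n : ℕ) (c : Sec S V') :
    ∃ (k : ℕ) (b : Sec S V),
      pull f (hW.trans (preim_mono f hV')) a ^ k * pull f hW c -
        pull f (hW.trans (preim_mono f hV')) b ∈ definingIdeal X W ^ n := by
  obtain ⟨k, b, hkb⟩ := (hV.isCompletedAway a hV' ha).exists_mul_sub_mem n c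
  refine ⟨k, b, ?_⟩
  have h1 : ((definingIdeal S V).map (res hV')).map (pull f hW) ≤ definingIdeal X W :=
    (Ideal.map_mono (map_res_definingIdeal_le hV')).trans (map_pull_definingIdeal_le f hW)
  have := mem_pow_of_mem_pow h1 hkb
  simpa [pull_res] using this

end FormalAffine

/-- Maps that satisfy the Leibniz rule are determined by their values on the ring before
completion. -/
theorem IsCompletedAway.eq_zero_of_leibniz {A : Type u} {B : Type v} [CommRing A] [CommRing B]
    {φ : A →+* B} {J : Ideal A} {s : A} (h : IsCompletedAway φ J s) {C : Type w} [CommRing C]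
    (ψ : B →+* C) (K : Ideal C) [IsHausdorff K C] (hK : (J.map φ).map ψ ≤ K) (δ : B →+ C)
    (hδ : ∀ b b', δ (b * b') = ψ b * δ b' + ψ b' * δ b) (h₀ : ∀ a, δ (φ a) = 0) (b : B) :
    δ b = 0 := by
  let _ : Module B C := Module.compHom C ψ
  have hle : ∀ n, ∀ c ∈ ((J.map φ) ^ n • ⊤ : Submodule B C), c ∈ K ^ n := by
    intro n c hc
    refine Submodule.smul_induction_on hc (fun r hr m _ => ?_) fun x y hx hy => add_mem hx hy
    exact Ideal.mul_mem_right _ _ (mem_pow_of_mem_pow hK hr)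
  have : IsHausdorff (J.map φ) C := ⟨fun c hc => eq_zero_of_forall_mem_pow K fun n =>
    hle n c (by simpa [SModEq.zero] using hc n)⟩
  let D : Derivation ℤ B C := Derivation.mk' δ.toIntLinearMap hδ
  have := h.derivation_eq_zero D h₀
  exact congrArg (fun D : Derivation ℤ B C => D b) this

/-! ### Vector fields -/

section VectorFields

variable {X S : LocallyRingedSpace.{u}} {f : X ⟶ S} {U : Opens X}

namespace VectorField

@[simp] theorem add_der (D E : VectorField f U) (W : Opens X) (h : W ≤ U) (a : Sec X W) :
    (D + E).der W h a = D.der W h a + E.der W h a := rfl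

@[simp] theorem neg_der (D : VectorField f U) (W : Opens X) (h : W ≤ U) (a : Sec X W) :
    (-D).der W h a = -D.der W h a := rfl

@[simp] theorem sub_der (D E : VectorField f U) (W : Opens X) (h : W ≤ U) (a : Sec X W) :
    (D - E).der W h a = D.der W h a - E.der W h a := by
  rw [sub_eq_add_neg, add_der, neg_der, sub_eq_add_neg]

@[simp] theorem zero_der (W : Opens X) (h : W ≤ U) (a : Sec X W) :
    (0 : VectorField f U).der W h a = 0 := rfl

@[simp] theorem smul_der (b : Sec X U) (D : VectorField f U) (W : Opens X) (h : W ≤ U)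
    (a : Sec X W) : (b • D).der W h a = res h b * D.der W h a := rfl

/-- Evaluation of vector fields on a function, as a homomorphism of groups. -/
def derHom (W : Opens X) (h : W ≤ U) (a : Sec X W) : VectorField f U →+ Sec X W where
  toFun D := D.der W h a
  map_zero' := rfl
  map_add' _ _ := rfl

theorem sum_der {ι : Type*} (s : Finset ι) (D : ι → VectorField f U) (W : Opens X) (h : W ≤ U)
    (a : Sec X W) : (∑ k ∈ s, D k).der W h a = ∑ k ∈ s, (D k).der W h a :=
  map_sum (derHom W h a) D s

@[simp] theorem restrict_der {W : Opens X} (h : W ≤ U) (D : VectorField f U) (W' : Opens X)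
    (h' : W' ≤ W) (a : Sec X W') : (D.restrict h).der W' h' a = D.der W' (h'.trans h) a := rfl

@[simp] theorem restrict_restrict {W W' : Opens X} (h : W ≤ U) (h' : W' ≤ W)
    (D : VectorField f U) : (D.restrict h).restrict h' = D.restrict (h'.trans h) := rfl

@[simp] theorem restrict_self (h : U ≤ U) (D : VectorField f U) : D.restrict h = D := rfl

theorem restrict_smul {W : Opens X} (h : W ≤ U) (b : Sec X U) (D : VectorField f U) :
    (b • D).restrict h = res h b • D.restrict h := by
  ext W' h' a
  simp [FormalGeometry.res_res]

theorem restrict_sum {ι : Type*} {W : Opens X} (h : W ≤ U) (s : Finset ι)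
    (D : ι → VectorField f U) : (∑ k ∈ s, D k).restrict h = ∑ k ∈ s, (D k).restrict h := by
  ext W' h' a
  simp [sum_der]

theorem ext' {D E : VectorField f U} (h : ∀ (W : Opens X) (hW : W ≤ U) (a : Sec X W),
    D.der W hW a = E.der W hW a) : D = E := by
  ext W hW a
  exact h W hW a

/-- Vector fields that agree locally are equal. -/
theorem ext_of_local {D E : VectorField f U}
    (h : ∀ x ∈ U, ∃ (W : Opens X) (hW : W ≤ U), x ∈ W ∧ D.restrict hW = E.restrict hW) :
    D = E := by
  refine ext' fun W hW a => sec_ext fun x hx => ?_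
  obtain ⟨W', hW', hxW', h'⟩ := h x (hW hx)
  refine ⟨W ⊓ W', inf_le_left, ⟨hx, hxW'⟩, ?_⟩
  rw [← D.der_res, ← E.der_res]
  exact congrArg (fun D : VectorField f W' => D.der (W ⊓ W') inf_le_right (res inf_le_left a)) h'

/-- A vector field on a formal affine open set `U` is determined by its action on `Γ(U)`. -/
theorem ext_of_isFormalAffine (hU : IsFormalAffine X U) {D E : VectorField f U}
    (h : ∀ a, D.der U le_rfl a = E.der U le_rfl a) : D = E := by
  refine ext' fun W hW a => sec_ext fun x hx => ?_
  obtain ⟨s, hxs, hs⟩ := hU.exists_basicOpen (hW hx) hx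
  refine ⟨basicOpen s, hs, hxs, ?_⟩
  rw [← D.der_res, ← E.der_res]
  congr 1
  refine (hU.isCompletedAway_basicOpen s).derivation_ext fun a => ?_
  rw [D.der_res U (basicOpen s) le_rfl (basicOpen_le s),
    E.der_res U (basicOpen s) le_rfl (basicOpen_le s), h]

end VectorField

/-- A derivation that kills the functions on a formal affine open set of the base kills the functions
on smaller basic open sets. -/
theorem derivation_pull_eq_zero {V V' : Opens S} (hV : IsFormalAffine S V) (hV' : V' ≤ V)
    {a : Sec S V} (ha : V' = basicOpen a) {W : Opens X}
    [IsHausdorff (definingIdeal X W) (Sec X W)] (hW : W ≤ preim f V')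
    (δ : Derivation ℤ (Sec X W) (Sec X W))
    (hδ : ∀ b, δ (pull f (hW.trans (preim_mono f hV')) b) = 0) (c : Sec S V') :
    δ (pull f hW c) = 0 := by
  refine eq_zero_of_forall_mem_pow (definingIdeal X W) fun n => ?_
  obtain ⟨k, b, hkb⟩ := hV.exists_pull_sub_mem f hV' ha hW (n + 1) c
  have h1 := derivation_mem_pow δ _ n hkb
  rw [map_sub, hδ, sub_zero, ← map_pow, Derivation.leibniz, hδ, smul_zero, add_zero, map_pow,
    smul_eq_mul] at h1
  have hu : IsUnit (pull f (hW.trans (preim_mono f hV')) a) := by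
    subst ha
    rw [← pull_res f hV' hW a]
    exact (isUnit_res_basicOpen a).map _
  rwa [Ideal.unit_mul_mem_iff_mem _ (hu.pow k)] at h1

/-- Derivations of the ring of functions on a formal affine open set extend to vector fields. -/
theorem exists_vectorField (hU : IsFormalAffine X U) {V : Opens S} (hV : IsFormalAffine S V)
    (h : U ≤ preim f V) (d : Derivation ℤ (Sec X U) (Sec X U)) (hd : ∀ s, d (pull f h s) = 0) :
    ∃ D : VectorField f U, D.der U le_rfl = d := by
  have hc := hU.isCompletedAway_basicOpen
  choose ds hds using fun s : Sec X U => (hc s).exists_derivation d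
  -- The difference of the two composites satisfies the Leibniz rule along the restriction map and
  -- vanishes on `Γ(U)`, so it vanishes by continuity.
  have compat : ∀ (s t : Sec X U) (hts : basicOpen t ≤ basicOpen s) (c : Sec X (basicOpen s)),
      ds t (res hts c) = res hts (ds s c) := by
    intro s t hts c
    have := (hc t).complete
    let δ : Sec X (basicOpen s) →+ Sec X (basicOpen t) :=
      ((ds t).toLinearMap.toAddMonoidHom.comp (res hts).toAddMonoidHom) -
        ((res hts).toAddMonoidHom.comp (ds s).toLinearMap.toAddMonoidHom)
    have hδ : ∀ c, δ c = ds t (res hts c) - res hts (ds s c) := fun c => rfl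
    rw [← sub_eq_zero, ← hδ]
    refine (hc s).eq_zero_of_leibniz (res hts)
      ((definingIdeal X U).map (res (basicOpen_le t))) ?_ δ ?_ ?_ c
    · rw [Ideal.map_map, res_comp]
    · intro b b'
      simp only [hδ, map_mul, Derivation.leibniz, smul_eq_mul, map_add]
      ring
    · intro a
      rw [hδ, hds, res_res, res_res, hds, sub_self]
  -- On an arbitrary open set the value is glued from the values on the basic open subsets.
  have hex : ∀ (W : Opens X) (hW : W ≤ U) (a : Sec X W), ∃ c : Sec X W,
      ∀ (s : Sec X U) (hs : basicOpen s ≤ W), res hs c = ds s (res hs a) := by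
    intro W hW a
    obtain ⟨c, hc'⟩ := exists_glue (U := W) (fun W' h' c' => ∀ (s : Sec X U)
        (hs : basicOpen s ≤ W'), res hs c' = ds s (res (hs.trans h') a))
      (fun W₁ h₁ W₂ h₂ c' hc' s hs => by rw [res_res]; exact hc' s (hs.trans h₂))
      (fun W₁ h₁ c₁ c₂ hc₁ hc₂ => sec_ext fun x hx => by
        obtain ⟨s, hxs, hs⟩ := hU.exists_basicOpen (hW (h₁ hx)) hx
        exact ⟨basicOpen s, hs, hxs, by rw [hc₁ s hs, hc₂ s hs]⟩)
      (fun x hx => by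
        obtain ⟨s, hxs, hs⟩ := hU.exists_basicOpen (hW hx) hx
        refine ⟨basicOpen s, hs, hxs, ds s (res hs a), fun t ht => ?_⟩
        rw [← compat, res_res])
    refine ⟨c, fun s hs => ?_⟩
    rw [hc' (basicOpen s) hs (ds s (res hs a)) fun t ht => ?_]
    rw [← compat, res_res]
  choose dW hdW using hex
  have huniq : ∀ (W : Opens X) (_ : W ≤ U) (c c' : Sec X W),
      (∀ (s : Sec X U) (hs : basicOpen s ≤ W), res hs c = res hs c') → c = c' :=
    fun W hW c c' hcc => sec_ext fun x hx => by
      obtain ⟨s, hxs, hs⟩ := hU.exists_basicOpen (hW hx) hx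
      exact ⟨basicOpen s, hs, hxs, hcc s hs⟩
  let D : ∀ W : Opens X, W ≤ U → Derivation ℤ (Sec X W) (Sec X W) := fun W hW =>
    Derivation.mk' (AddMonoidHom.mk' (dW W hW) fun a b => huniq W hW _ _ fun s hs => by
      rw [hdW, map_add, map_add, map_add, hdW, hdW]).toIntLinearMap fun a b => by
        change dW W hW (a * b) = a * dW W hW b + b * dW W hW a
        refine huniq W hW _ _ fun s hs => ?_
        rw [hdW, map_mul, Derivation.leibniz, map_add, map_mul, map_mul, hdW, hdW]
        rfl
  refine ⟨⟨D, fun W W' hW hW' a => ?_, fun W hW V' hV' c => ?_⟩, ?_⟩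
  · refine huniq W' (hW'.trans hW) _ _ fun s hs => ?_
    change res hs (dW W' _ _) = res hs (res hW' (dW W hW a))
    rw [hdW, res_res, res_res, hdW]
  · refine sec_ext fun x hx => ?_
    obtain ⟨a, hxa, ha⟩ := hV.exists_basicOpen (x := f.base x) (h (hW hx)) (W := V') (hV' hx)
    obtain ⟨s, hxs, hs⟩ := hU.exists_basicOpen (hW hx) (W := W ⊓ preim f (basicOpen a)) ⟨hx, hxa⟩
    have hsW := hs.trans inf_le_left
    refine ⟨basicOpen s, hsW, hxs, ?_⟩
    change res hsW (dW W hW (pull f hV' c)) = res hsW 0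
    rw [hdW, map_zero, res_pull, ← pull_res f ha (hs.trans inf_le_right)]
    have := (hU.basicOpen s).complete
    refine derivation_pull_eq_zero hV (basicOpen_le a) rfl _ _ (fun b => ?_) _
    rw [← res_pull f h (basicOpen_le s), hds, hd, map_zero]
  · ext a
    refine huniq U le_rfl _ _ fun s hs => ?_
    change res hs (dW U le_rfl a) = res hs (d a)
    rw [hdW, hds]

end VectorFields

/-! ### Frames of foliations -/

section Frames

variable {X S : LocallyRingedSpace.{u}} {f : X ⟶ S}

/-- The vector fields `E_1, …, E_n` are a basis of `F` over `U`, and the functions `x_1, …, x_n` are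
coordinates with `E_i x_j = δ_ij`. -/
structure IsFrame (F : ∀ W : Opens X, Set (VectorField f W)) (U : Opens X) {n : ℕ}
    (E : Fin n → VectorField f U) (x : Fin n → Sec X U) : Prop where
  dual : ∀ i j, (E i).der U le_rfl (x j) = if i = j then 1 else 0
  mem_iff : ∀ (W : Opens X) (h : W ≤ U) (D : VectorField f W),
    D ∈ F W ↔ D = ∑ i, D.der W le_rfl (res h (x i)) • (E i).restrict h

namespace IsFrame

variable {F : ∀ W : Opens X, Set (VectorField f W)} {U : Opens X} {n : ℕ}
  {E : Fin n → VectorField f U} {x : Fin n → Sec X U}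

theorem der_res (hE : IsFrame F U E x) (W : Opens X) (h : W ≤ U) (i j : Fin n) :
    (E i).der W h (res h (x j)) = if i = j then 1 else 0 := by
  rw [(E i).der_res U W le_rfl h, hE.dual]
  split_ifs <;> simp

theorem restrict (hE : IsFrame F U E x) {U' : Opens X} (h : U' ≤ U) :
    IsFrame F U' (fun i => (E i).restrict h) (fun i => res h (x i)) where
  dual i j := hE.der_res U' h i j
  mem_iff W hW D := by
    rw [hE.mem_iff W (hW.trans h)]
    simp [res_res]

theorem eq_of_sum (hE : IsFrame F U E x) (W : Opens X) (h : W ≤ U) (c : Fin n → Sec X W)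
    (j : Fin n) : (∑ i, c i • (E i).restrict h).der W le_rfl (res h (x j)) = c j := by
  simp only [VectorField.sum_der, VectorField.smul_der, VectorField.restrict_der, hE.der_res W h]
  simp

theorem sum_mem (hE : IsFrame F U E x) (W : Opens X) (h : W ≤ U) (c : Fin n → Sec X W) :
    ∑ i, c i • (E i).restrict h ∈ F W := by
  rw [hE.mem_iff W h]
  refine Finset.sum_congr rfl fun j _ => ?_
  rw [hE.eq_of_sum]

theorem mem (hE : IsFrame F U E x) (W : Opens X) (h : W ≤ U) (i : Fin n) :
    (E i).restrict h ∈ F W := by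
  have := hE.sum_mem W h (Pi.single i 1)
  rwa [Finset.sum_eq_single i, Pi.single_eq_same, one_smul] at this
  · intro j _ hj
    rw [Pi.single_eq_of_ne hj, zero_smul]
  · simp

theorem eq_zero (hE : IsFrame F U E x) (W : Opens X) (h : W ≤ U) {D : VectorField f W}
    (hD : D ∈ F W) (h0 : ∀ i, D.der W le_rfl (res h (x i)) = 0) : D = 0 := by
  rw [(hE.mem_iff W h D).mp hD]
  simp [h0]

end IsFrame

/-- The vector fields `E_1, …, E_m` over `U` generate the sheaf `F`. -/
def Generates (F : SubTangent f) (U : Opens X) {m : ℕ} (E : Fin m → VectorField f U) : Prop :=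
  (∀ k, E k ∈ F U) ∧
    ∀ (W : Opens X) (h : W ≤ U), ∀ D ∈ F W, ∀ y ∈ W, ∃ (W' : Opens X) (h' : W' ≤ W), y ∈ W' ∧
      D.restrict h' ∈ Submodule.span (Sec X W') (Set.range fun k => (E k).restrict (h'.trans h))

theorem span_restrict_mem {U W : Opens X} (h : W ≤ U) {m : ℕ} {E : Fin m → VectorField f U}
    {D : VectorField f U} (hD : D ∈ Submodule.span (Sec X U) (Set.range E)) :
    D.restrict h ∈ Submodule.span (Sec X W) (Set.range fun k => (E k).restrict h) := by
  rw [Submodule.mem_span_range_iff_exists_fun] at hD ⊢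
  obtain ⟨c, rfl⟩ := hD
  exact ⟨fun k => res h (c k), by simp [VectorField.restrict_sum, VectorField.restrict_smul]⟩

theorem exists_open_of_forall_fin {m : ℕ} {x : X} {U : Opens X} (hx : x ∈ U)
    {P : Fin m → Opens X → Prop} (hP : ∀ k W W', W' ≤ W → P k W → P k W')
    (h : ∀ k, ∃ W : Opens X, x ∈ W ∧ P k W) : ∃ W : Opens X, W ≤ U ∧ x ∈ W ∧ ∀ k, P k W := by
  choose W hxW hW using h
  refine ⟨⟨U ∩ ⋂ k, (W k : Set X), U.isOpen.inter (isOpen_iInter_of_finite fun k => (W k).isOpen)⟩,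
    Set.inter_subset_left, ⟨hx, Set.mem_iInter.mpr hxW⟩, fun k => hP k (W k) _ ?_ (hW k)⟩
  exact fun y hy => Set.mem_iInter.mp hy.2 k

/-- The value of a section at a point, in the residue field. -/
def ev {U : Opens X} (x : X) (hx : x ∈ U) : Sec X U →+* X.residueField x :=
  (X.evaluation ⟨x, hx⟩).hom

theorem vanishesAt_iff_ev {U : Opens X} {x : X} {hx : x ∈ U} {a : Sec X U} :
    VanishesAt a x hx ↔ ev x hx a = 0 :=
  Iff.rfl

theorem ev_res {U W : Opens X} (h : W ≤ U) (x : X) (hx : x ∈ W) (a : Sec X U) :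
    ev x hx (res h a) = ev x (h hx) a :=
  congrArg (X.residue x) (germ_res h x hx a)

theorem exists_ev_eq {x : X} (c : X.residueField x) :
    ∃ (W : Opens X) (hx : x ∈ W) (a : Sec X W), ev x hx a = c := by
  obtain ⟨g, hg⟩ := X.residue_surjective x c
  obtain ⟨W, hxW, a, rfl⟩ := X.presheaf.exists_germ_eq g
  exact ⟨W, hxW, a, hg⟩

theorem exists_forall_ev_eq {m : ℕ} {x : X} {U : Opens X} (hx : x ∈ U)
    (c : Fin m → X.residueField x) :
    ∃ (W : Opens X) (_ : W ≤ U) (hxW : x ∈ W) (a : Fin m → Sec X W),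
      ∀ k, ev x hxW (a k) = c k := by
  obtain ⟨W, hW, hxW, h⟩ := exists_open_of_forall_fin (m := m) hx
    (P := fun k W => ∀ h : x ∈ W, ∃ a : Sec X W, ev x h a = c k)
    (fun k W W' hW' h hx' => by
      obtain ⟨a, ha⟩ := h (hW' hx')
      exact ⟨res hW' a, by rw [ev_res, ha]⟩)
    (fun k => by
      obtain ⟨W, hxW, a, ha⟩ := exists_ev_eq (c k)
      exact ⟨W, hxW, fun _ => ⟨a, ha⟩⟩)
  choose a ha using fun k => h k hxW
  exact ⟨W, hW, hxW, a, ha⟩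

/-- A generator that occurs in a relation with an invertible coefficient can be omitted. -/
theorem Generates.omit_generator {F : SubTangent f} (hF : IsSubsheaf F) {m : ℕ} {U : Opens X}
    {E : Fin (m + 1) → VectorField f U} (hE : Generates F U E) {W : Opens X} (hW : W ≤ U)
    (c : Fin (m + 1) → Sec X W) (hc : ∑ k, c k • (E k).restrict hW = 0) (j : Fin (m + 1)) :
    Generates F (basicOpen (c j))
      fun k => (E (j.succAbove k)).restrict ((basicOpen_le (c j)).trans hW) := by
  refine ⟨fun k => hF.restrict_mem _ _ _ _ (hE.1 _), fun W' hW' D hD y hy => ?_⟩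
  obtain ⟨W₄, hW₄, hy₄, hD₄⟩ := hE.2 W' (hW'.trans ((basicOpen_le (c j)).trans hW)) D hD y hy
  refine ⟨W₄, hW₄, hy₄, (Submodule.span_le.mpr ?_) hD₄⟩
  rintro _ ⟨k, rfl⟩
  by_cases hk : k = j
  · subst hk
    have hle₄ := hW₄.trans (hW'.trans (basicOpen_le (c k)))
    have hu : IsUnit (res hle₄ (c k)) := by
      have := (isUnit_res_basicOpen (c k)).map (res (hW₄.trans hW'))
      rwa [res_res] at this
    have h2 := congrArg (VectorField.restrict hle₄) hc
    rw [VectorField.restrict_sum, Fin.sum_univ_succAbove _ k] at h2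
    simp only [VectorField.restrict_smul, VectorField.restrict_restrict] at h2
    have h3 : (0 : VectorField f W).restrict hle₄ = 0 := rfl
    rw [h3, add_eq_zero_iff_eq_neg] at h2
    have h4 : res hle₄ (c k) • (E k).restrict (hle₄.trans hW) ∈
        Submodule.span (Sec X W₄) (Set.range fun l => (E (k.succAbove l)).restrict
          (hle₄.trans hW)) := by
      rw [h2]
      refine neg_mem (sum_mem fun l _ => Submodule.smul_mem _ _ (Submodule.subset_span ⟨l, rfl⟩))
    obtain ⟨v, hv⟩ := hu.exists_left_inv
    have := Submodule.smul_mem _ v h4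
    rwa [← mul_smul, hv, one_smul] at this
  · obtain ⟨l, rfl⟩ := Fin.exists_succAbove_eq hk
    exact Submodule.subset_span ⟨l, rfl⟩

/-- A combination of generators that lies in `𝔪_x F` satisfies a relation whose coefficients have
the same values at `x`. -/
theorem Generates.exists_relation {F : SubTangent f} {x : X} {m : ℕ}
    {U : Opens X} {E : Fin m → VectorField f U} (hE : Generates F U E) {W : Opens X} (hW : W ≤ U)
    (hx : x ∈ W) (a : Fin m → Sec X W)
    (h : GermMemMaximalSmul F (∑ k, a k • (E k).restrict hW) x) :
    ∃ (W₂ : Opens X) (hW₂ : W₂ ≤ U) (hx₂ : x ∈ W₂) (c : Fin m → Sec X W₂),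
      ∑ k, c k • (E k).restrict hW₂ = 0 ∧ ∀ k, ev x hx₂ (c k) = ev x hx (a k) := by
  obtain ⟨W₁, hW₁, hx₁, n, b, E', hb, hE', hsum⟩ := h
  obtain ⟨W₂, hW₂, hx₂, hspan⟩ := exists_open_of_forall_fin (m := n) hx₁
    (P := fun l W' => ∃ h' : W' ≤ W₁, (E' l).restrict h' ∈ Submodule.span (Sec X W')
      (Set.range fun k => (E k).restrict ((h'.trans hW₁).trans hW)))
    (fun l W W' hW' hl => ⟨hW'.trans hl.1, by
      have := span_restrict_mem hW' hl.2
      exact this⟩)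
    (fun l => by
      obtain ⟨W', h', hx', h''⟩ := hE.2 W₁ (hW₁.trans hW) (E' l) (hE' l) x hx₁
      exact ⟨W', hx', h', h''⟩)
  have hspan' : ∀ l, ∃ e : Fin m → Sec X W₂, ∑ k, e k • (E k).restrict
      ((hW₂.trans hW₁).trans hW) = (E' l).restrict hW₂ := fun l =>
    (Submodule.mem_span_range_iff_exists_fun _).mp (hspan l).2
  choose e he using hspan'
  refine ⟨W₂, (hW₂.trans hW₁).trans hW, hx₂,
    fun k => res (hW₂.trans hW₁) (a k) - ∑ l, res hW₂ (b l) * e l k, ?_, fun k => ?_⟩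
  · have h1 := congrArg (VectorField.restrict hW₂) hsum
    simp only [VectorField.restrict_sum, VectorField.restrict_smul,
      VectorField.restrict_restrict, res_res] at h1
    simp only [← he, Finset.smul_sum] at h1
    rw [Finset.sum_comm] at h1
    simp only [sub_smul, Finset.sum_smul, mul_smul, Finset.sum_sub_distrib]
    rw [h1, sub_self]
  · have hb' : ∀ l, ev x hx₁ (b l) = 0 := hb
    simp [ev_res, hb']

/-- If the number of generators is minimal, a combination of the generators that lies in `𝔪_x F` has
its coefficients in `𝔪_x`. -/
theorem vanishesAt_of_germMemMaximalSmul {F : SubTangent f} (hF : IsSubsheaf F) {x : X} {m : ℕ}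
    (hmin : ∀ m' < m, ∀ (U : Opens X) (E : Fin m' → VectorField f U), x ∈ U → ¬ Generates F U E)
    {U : Opens X} {E : Fin m → VectorField f U} (hE : Generates F U E) {W : Opens X} (hW : W ≤ U)
    (hx : x ∈ W) (a : Fin m → Sec X W)
    (h : GermMemMaximalSmul F (∑ k, a k • (E k).restrict hW) x) (j : Fin m) :
    VanishesAt (a j) x hx := by
  by_contra hj
  obtain ⟨W₂, hW₂, hx₂, c, hc, hca⟩ := hE.exists_relation hW hx a h
  have hcj : ¬ VanishesAt (c j) x hx₂ := by rwa [vanishesAt_iff_ev, hca]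
  match m, j with
  | m + 1, j =>
    exact hmin m (Nat.lt_succ_self m) (basicOpen (c j)) _
      ((mem_basicOpen_iff _ _ hx₂).mpr hcj) (hE.omit_generator hF hW₂ c hc j)

/-- Duality over `k(x)`. The vectors `((E_k g)(x))_k`, for `g` in the ideal, form a subspace of
`k(x)^m`; closure under scalars uses `g(x) = 0`, which kills the second term of the Leibniz rule. A
proper subspace lies in the kernel of a nonzero linear form, whose coefficients would contradict the
hypothesis. -/
theorem exists_mem_forall_ev_eq {x : X} {m : ℕ} {U : Opens X} (E : Fin m → VectorField f U)
    (G : ∀ W : Opens X, Ideal (Sec X W)) (hG : ∀ (W W' : Opens X) (h : W' ≤ W), ∀ g ∈ G W,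
      res h g ∈ G W') (hGx : ∀ (W : Opens X) (hx : x ∈ W), ∀ g ∈ G W, VanishesAt g x hx)
    (hxU : x ∈ U)
    (h : ∀ c : Fin m → X.residueField x, (∀ (W : Opens X) (hW : W ≤ U) (hx : x ∈ W), ∀ g ∈ G W,
      ∑ k, c k * ev x hx ((E k).der W hW g) = 0) → c = 0)
    (v : Fin m → X.residueField x) :
    ∃ (W : Opens X) (hW : W ≤ U) (hx : x ∈ W), ∃ g ∈ G W,
      ∀ k, ev x hx ((E k).der W hW g) = v k := by
  let N : Submodule (X.residueField x) (Fin m → X.residueField x) :=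
    { carrier := {v | ∃ (W : Opens X) (hW : W ≤ U) (hx : x ∈ W), ∃ g ∈ G W,
        ∀ k, ev x hx ((E k).der W hW g) = v k}
      zero_mem' := ⟨U, le_rfl, hxU, 0, zero_mem _, fun k => by simp⟩
      add_mem' := by
        rintro v v' ⟨W, hW, hx, g, hg, hv⟩ ⟨W', hW', hx', g', hg', hv'⟩
        refine ⟨W ⊓ W', inf_le_left.trans hW, ⟨hx, hx'⟩, res inf_le_left g + res inf_le_right g',
          add_mem (hG _ _ _ _ hg) (hG _ _ _ _ hg'), fun k => ?_⟩
        have hxx : x ∈ W ⊓ W' := ⟨hx, hx'⟩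
        change ev x hxx _ = _
        rw [map_add, (E k).der_res W _ hW inf_le_left, (E k).der_res W' _ hW' inf_le_right,
          map_add, ev_res, ev_res, hv, hv']
        rfl
      smul_mem' := by
        rintro c v ⟨W, hW, hx, g, hg, hv⟩
        obtain ⟨W', hW', hx', a, ha⟩ := exists_forall_ev_eq (m := 1) hx fun _ => c
        refine ⟨W', hW'.trans hW, hx', a 0 * res hW' g, Ideal.mul_mem_left _ _ (hG _ _ _ _ hg),
          fun k => ?_⟩
        rw [Derivation.leibniz, (E k).der_res W _ hW hW', map_add, smul_eq_mul, smul_eq_mul,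
          map_mul, map_mul, ev_res, ev_res, hv, ha]
        have : ev x (hW' hx') g = 0 := hGx W hx g hg
        rw [this, zero_mul, add_zero]
        rfl }
  suffices hN : N = ⊤ by
    have : v ∈ N := hN ▸ Submodule.mem_top
    exact this
  by_contra hN
  obtain ⟨φ, hφ, hφN⟩ := Submodule.exists_le_ker_of_lt_top N (lt_top_iff_ne_top.mpr hN)
  have hφ' : ∀ v, φ v = ∑ k, φ (Pi.single k 1) * v k := fun v => by
    conv_lhs => rw [← Finset.univ_sum_single v, map_sum]
    refine Finset.sum_congr rfl fun k _ => ?_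
    rw [mul_comm, ← smul_eq_mul, ← map_smul, ← Pi.single_smul, smul_eq_mul, mul_one]
  refine hφ (LinearMap.ext fun v => ?_)
  have := h (fun k => φ (Pi.single k 1)) fun W hW hx g hg => by
    rw [← hφ' fun k => ev x hx ((E k).der W hW g)]
    exact hφN ⟨W, hW, hx, g, hg, fun k => rfl⟩
  rw [hφ']
  simp [fun k => congrFun this k]

/-- Local frames with coordinates in a given ideal sheaf exist at a point where the reduction of `F`
injects into the dual of the ideal. -/
theorem exists_isFrame {F : SubTangent f} (hF : IsSubsheaf F) (hfin : IsLocallyFinitelyGenerated F)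
    (x : X) (G : ∀ W : Opens X, Ideal (Sec X W)) (hG : ∀ (W W' : Opens X) (h : W' ≤ W), ∀ g ∈ G W,
      res h g ∈ G W') (hGx : ∀ (W : Opens X) (hx : x ∈ W), ∀ g ∈ G W, VanishesAt g x hx)
    (hinj : ∀ (U : Opens X) (_ : x ∈ U), ∀ D ∈ F U, (∀ (W : Opens X) (h : W ≤ U) (hx : x ∈ W),
      ∀ g ∈ G W, VanishesAt (D.der W h g) x hx) → GermMemMaximalSmul F D x) :
    ∃ (U : Opens X) (n : ℕ) (E : Fin n → VectorField f U) (t : Fin n → Sec X U),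
      x ∈ U ∧ IsFrame (fun U => (F U : Set (VectorField f U))) U E t ∧ ∀ k, t k ∈ G U := by
  classical
  -- A minimal number of generators near `x` plays the role of a basis of `F ⊗ k(x)`; this replaces
  -- Nakayama's lemma on the stalk.
  have hex : ∃ m : ℕ, ∃ (U : Opens X) (E : Fin m → VectorField f U), x ∈ U ∧ Generates F U E := by
    obtain ⟨U, n, E, hx, hE⟩ := hfin x
    exact ⟨n, U, E, hx, hE⟩
  obtain ⟨U, E, hxU, hE⟩ := Nat.find_spec hex
  have hmin : ∀ m' < Nat.find hex, ∀ (U : Opens X) (E : Fin m' → VectorField f U), x ∈ U →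
      ¬ Generates F U E := fun m' hm' U E hx hE => Nat.find_min hex hm' ⟨U, E, hx, hE⟩
  generalize Nat.find hex = m at E hE hmin
  have hev := exists_mem_forall_ev_eq E G hG hGx hxU fun c hc => by
    obtain ⟨W, hW, hx, a, ha⟩ := exists_forall_ev_eq hxU c
    have h1 : GermMemMaximalSmul F (∑ k, a k • (E k).restrict hW) x := by
      refine hinj W hx _ (sum_mem fun k _ => Submodule.smul_mem _ _
        (hF.restrict_mem _ _ _ _ (hE.1 k))) fun W' hW' hx' g hg => ?_
      rw [VectorField.sum_der]
      rw [vanishesAt_iff_ev, map_sum, ← hc W' (hW'.trans hW) hx' g hg]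
      refine Finset.sum_congr rfl fun k _ => ?_
      rw [VectorField.smul_der, map_mul, ev_res, ha]
      rfl
    funext k
    rw [← ha k]
    exact vanishesAt_of_germMemMaximalSmul hF hmin hE hW hx a h1 k
  obtain ⟨W, hW, hxW, hg⟩ := exists_open_of_forall_fin (m := m) hxU
    (P := fun j W => ∃ (hW : W ≤ U), ∃ g ∈ G W, ∀ (hx : x ∈ W) (k : Fin m),
      ev x hx ((E k).der W hW g) = if k = j then 1 else 0)
    (fun j W W' hW' ⟨hW, g, hg, h⟩ => ⟨hW'.trans hW, res hW' g, hG _ _ _ _ hg, fun hx k => by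
      rw [(E k).der_res W _ hW hW', ev_res, h]⟩)
    (fun j => by
      obtain ⟨W, hW, hx, g, hg, h⟩ := hev fun k => if k = j then 1 else 0
      exact ⟨W, hx, hW, g, hg, fun _ => h⟩)
  choose hW' g hgG hg using hg
  -- This matrix is the identity at `x`, hence invertible in a neighbourhood; its inverse replaces
  -- the `E_k` by a family dual to the functions `g_j`.
  let A : Matrix (Fin m) (Fin m) (Sec X W) := fun k j => (E k).der W hW (g j)
  have hdet : ¬ VanishesAt A.det x hxW := by
    have h1 : ev x hxW A.det = 1 := by
      rw [RingHom.map_det]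
      have : (ev x hxW).mapMatrix A = 1 := by
        ext k j
        rw [RingHom.mapMatrix_apply, Matrix.map_apply, Matrix.one_apply]
        exact hg j hxW k
      rw [this, Matrix.det_one]
    intro h
    have : ev x hxW A.det = 0 := h
    rw [h1] at this
    exact one_ne_zero this
  set W₁ := basicOpen A.det with hW₁
  have hle := basicOpen_le A.det
  let B := (res hle).mapMatrix A
  have hB : IsUnit B.det := by
    have := isUnit_res_basicOpen A.det
    rwa [RingHom.map_det] at this
  have hB1 : B⁻¹ * B = 1 := Matrix.nonsing_inv_mul B hB
  have hB2 : B * B⁻¹ = 1 := Matrix.mul_nonsing_inv B hB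
  let E' : Fin m → VectorField f W₁ := fun i => ∑ k, B⁻¹ i k • (E k).restrict (hle.trans hW)
  have hEB : ∀ k j, (E k).der W₁ (hle.trans hW) (res hle (g j)) = B k j := fun k j =>
    (E k).der_res W W₁ hW hle (g j)
  have hdual : ∀ i j, (E' i).der W₁ le_rfl (res hle (g j)) = if i = j then 1 else 0 := by
    intro i j
    simp only [E', VectorField.sum_der, VectorField.smul_der, VectorField.restrict_der, hEB,
      res_self]
    have := congrFun (congrFun hB1 i) j
    rwa [Matrix.mul_apply, Matrix.one_apply] at this
  have hE' : ∀ k, (E k).restrict (hle.trans hW) = ∑ i, B k i • E' i := by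
    intro k
    simp only [E', Finset.smul_sum, ← mul_smul]
    rw [Finset.sum_comm]
    simp only [← Finset.sum_smul, ← Matrix.mul_apply, hB2, Matrix.one_apply]
    simp
  have hmem : ∀ i, E' i ∈ F W₁ := fun i => sum_mem fun k _ => Submodule.smul_mem _ _
    (hF.restrict_mem _ _ _ _ (hE.1 k))
  refine ⟨W₁, m, E', fun j => res hle (g j), (mem_basicOpen_iff _ _ hxW).mpr hdet,
    ⟨hdual, fun W' hW' D => ⟨fun hD => ?_, fun hD => ?_⟩⟩, fun k => hG _ _ _ _ (hgG k)⟩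
  · refine VectorField.ext_of_local fun y hy => ?_
    obtain ⟨W₂, hW₂, hy₂, h2⟩ := hE.2 W' (hW'.trans (hle.trans hW)) D hD y hy
    refine ⟨W₂, hW₂, hy₂, ?_⟩
    have h3 : D.restrict hW₂ ∈ Submodule.span (Sec X W₂)
        (Set.range fun i => (E' i).restrict (hW₂.trans hW')) := by
      refine Submodule.span_le.mpr ?_ h2
      rintro _ ⟨k, rfl⟩
      have := congrArg (VectorField.restrict (hW₂.trans hW')) (hE' k)
      rw [VectorField.restrict_sum, VectorField.restrict_restrict] at this
      change (E k).restrict _ ∈ _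
      rw [this]
      refine sum_mem fun i _ => ?_
      rw [VectorField.restrict_smul]
      exact Submodule.smul_mem _ _ (Submodule.subset_span ⟨i, rfl⟩)
    rw [Submodule.mem_span_range_iff_exists_fun] at h3
    obtain ⟨c, hc⟩ := h3
    rw [← hc, VectorField.restrict_sum]
    refine Finset.sum_congr rfl fun i _ => ?_
    rw [VectorField.restrict_smul, VectorField.restrict_restrict,
      ← D.der_res W' W₂ le_rfl hW₂, res_res]
    congr 1
    change c i = (D.restrict hW₂).der W₂ le_rfl _
    rw [← hc, VectorField.sum_der]
    simp only [VectorField.smul_der, VectorField.restrict_der]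
    have : ∀ k, (E' k).der W₂ (hW₂.trans hW') (res (hW₂.trans hW') (res hle (g i))) =
        if k = i then 1 else 0 := fun k => by
      rw [(E' k).der_res W₁ W₂ le_rfl, hdual]
      split_ifs <;> simp
    simp [this]
  · rw [hD]
    exact sum_mem fun i _ => Submodule.smul_mem _ _ (hF.restrict_mem _ _ _ _ (hmem i))

end Frames

/-! ### Commuting frames, reduction to closed points, splitting of the differentials -/

section FrameProperties

variable {X S : LocallyRingedSpace.{u}} {f : X ⟶ S}

/-- The commutator lies in `F`, and it kills every coordinate because each `E_i x_k` is `0` or `1`.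
A section of `F` that kills the coordinates is zero. -/
theorem IsFrame.commute {F : SubTangent f} (hF : IsSmoothFoliation F) {U : Opens X} {n : ℕ}
    {E : Fin n → VectorField f U} {x : Fin n → Sec X U}
    (hE : IsFrame (fun U => (F U : Set (VectorField f U))) U E x) (i j : Fin n) (W : Opens X)
    (h : W ≤ U) (a : Sec X W) :
    (E i).der W h ((E j).der W h a) = (E j).der W h ((E i).der W h a) := by
  have hmem : ∀ i, E i ∈ F U := fun i => hE.mem U le_rfl i
  obtain ⟨D, hD, hD'⟩ := hF.commutator U (E i) (hmem i) (E j) (hmem j)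
  have h0 : D = 0 := hE.eq_zero U le_rfl hD fun k => by
    rw [hD', Derivation.commutator_apply, res_self, hE.dual, hE.dual]
    split_ifs <;> simp
  have := hD' W h
  rw [h0] at this
  have h1 := congrArg (fun D : Derivation ℤ (Sec X W) (Sec X W) => D a) this
  simp only [VectorField.zero_der, Derivation.commutator_apply] at h1
  exact (sub_eq_zero.mp h1.symm)

/-- The `p`-th power is in `F`, and since `p ≥ 2` it already kills the coordinates, whose first
derivatives are constants. -/
theorem IsFrame.iterate_eq_zero {F : SubTangent f} (hF : IsSmoothFoliation F) {p : ℕ}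
    (hp : p.Prime) (hpS : (p : Sec S ⊤) = 0) {U : Opens X} {n : ℕ}
    {E : Fin n → VectorField f U} {x : Fin n → Sec X U}
    (hE : IsFrame (fun U => (F U : Set (VectorField f U))) U E x) (i : Fin n) (W : Opens X)
    (h : W ≤ U) (a : Sec X W) : ((E i).der W h)^[p] a = 0 := by
  obtain ⟨D, hD, hD'⟩ := hF.pth_power p hp hpS U (E i) (hE.mem U le_rfl i)
  have h0 : D = 0 := hE.eq_zero U le_rfl hD fun k => by
    rw [hD', res_self]
    obtain ⟨q, rfl⟩ : ∃ q, p = q + 2 := ⟨p - 2, by have := hp.two_le; omega⟩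
    rw [Function.iterate_add_apply, Function.iterate_succ_apply, Function.iterate_one, hE.dual]
    have : (E i).der U le_rfl (if i = k then 1 else 0) = 0 := by split_ifs <;> simp
    rw [this]
    exact iterate_map_zero _ _
  rw [← hD', h0]
  rfl

theorem IsLocallyFormalAffine.t0Space {X : LocallyRingedSpace.{u}} (hX : IsLocallyFormalAffine X) :
    T0Space X := by
  refine ⟨fun x x' hxx => ?_⟩
  obtain ⟨U, hxU, hU⟩ := hX x
  have hx'U : x' ∈ U := (hxx.mem_open_iff U.isOpen).mp hxU
  have : pointPrime X U ⟨x, hxU⟩ = pointPrime X U ⟨x', hx'U⟩ := by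
    ext s
    rw [mem_pointPrime, mem_pointPrime, vanishesAt_iff_notMem_basicOpen,
      vanishesAt_iff_notMem_basicOpen]
    exact not_congr (hxx.mem_open_iff (basicOpen s).isOpen)
  exact Subtype.mk.inj (hU.isEmbedding.injective this)

/-- The hypotheses on foliations concern closed points only. An open neighbourhood of a closed
specialization of `y` contains `y`, so local constructions at closed points reach all points. -/
theorem IsLocallyFormalAffine.exists_isClosed_singleton {X : LocallyRingedSpace.{u}}
    (hX : IsLocallyFormalAffine X) [CompactSpace X] (y : X) :
    ∃ x ∈ closure {y}, IsClosed ({x} : Set X) := by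
  have := hX.t0Space
  obtain ⟨x, hxy, hx⟩ := IsClosed.exists_closed_singleton (S := closure {y}) isClosed_closure
    ⟨y, subset_closure rfl⟩
  exact ⟨x, hxy, hx⟩

theorem mem_of_mem_closure_singleton {X : LocallyRingedSpace.{u}} {x y : X} (h : x ∈ closure {y})
    {U : Opens X} (hx : x ∈ U) : y ∈ U :=
  (specializes_iff_mem_closure.mpr h).mem_open U.isOpen hx

/-- A smooth foliation has frames locally; near a point of `Z` the coordinates can be chosen in the
ideal of `Z`. -/
theorem IsSmoothFoliation.exists_isFrame {F : SubTangent f} (hF : IsSmoothFoliation F)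
    [CompactSpace X] (hX : IsLocallyFormalAffine X) {Z : LocallyRingedSpace.{u}} (i : Z ⟶ X)
    (hi : IsClosed (Set.range i.base)) (hT : IsTransverse F i) (y : X) :
    ∃ (U : Opens X) (n : ℕ) (E : Fin n → VectorField f U) (t : Fin n → Sec X U),
      y ∈ U ∧ IsFrame (fun U => (F U : Set (VectorField f U))) U E t ∧
        (y ∈ Set.range i.base → ∀ k, t k ∈ idealOf i U) := by
  obtain ⟨x, hxy, hx⟩ := hX.exists_isClosed_singleton y
  have hspec : ∀ U : Opens X, x ∈ U → y ∈ U := fun U hxU => mem_of_mem_closure_singleton hxy hxU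
  by_cases hy : y ∈ Set.range i.base
  · have hxZ : x ∈ Set.range i.base :=
      (IsClosed.closure_subset_iff hi).mpr (Set.singleton_subset_iff.mpr hy) hxy
    obtain ⟨U, n, E, t, hxU, hE, ht⟩ := FormalGeometry.exists_isFrame hF.isSubsheaf hF.finite x
      (fun W => idealOf i W) (fun W W' h g hg => by
        rw [idealOf, RingHom.mem_ker] at hg ⊢
        rw [pull_res, ← res_pull i le_rfl (preim_mono i h), hg, map_zero])
      (fun W hxW g hg => by
        obtain ⟨z, rfl⟩ := hxZ
        rw [← vanishesAt_pull i (le_refl (preim i W)) g z hxW, RingHom.mem_ker.mp hg]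
        exact map_zero _)
      (fun U hxU D hD h => hT x hxZ hx U hxU D hD h)
    exact ⟨U, n, E, t, hspec U hxU, hE, fun _ => ht⟩
  -- Away from `Z` the ideal consists of all functions that vanish at `x`, and the injectivity is
  -- the smoothness of the foliation.
  · obtain ⟨U, n, E, t, hxU, hE, ht⟩ := FormalGeometry.exists_isFrame hF.isSubsheaf hF.finite x
      (fun W => vanishingIdeal X {x} W) (fun W W' h g hg => by
        rw [mem_vanishingIdeal] at hg ⊢
        intro z hz hzx
        rw [vanishesAt_res]
        exact hg z (h hz) hzx)
      (fun W hxW g hg => mem_vanishingIdeal.mp hg x hxW rfl)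
      (fun U hxU D hD h => hF.injective x hx U hxU D hD fun W hW hxW g hg =>
        h W hW hxW g (mem_vanishingIdeal.mpr fun z hz hzx => by
          obtain rfl : z = x := hzx
          exact hg))
    exact ⟨U, n, E, t, hspec U hxU, hE, fun h => absurd h hy⟩

theorem isLocallyFree_of_isFrame {F : SubTangent f}
    (h : ∀ y : X, ∃ (U : Opens X) (n : ℕ) (E : Fin n → VectorField f U) (t : Fin n → Sec X U),
      y ∈ U ∧ IsFrame (fun U => (F U : Set (VectorField f U))) U E t) : IsLocallyFree F := by
  intro y
  obtain ⟨U, n, E, t, hy, hE⟩ := h y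
  refine ⟨U, n, E, hy, fun W hW => ⟨?_, ?_⟩⟩
  · rw [Fintype.linearIndependent_iff]
    intro c hc j
    rw [← hE.eq_of_sum W hW c j, hc]
    rfl
  · refine le_antisymm (Submodule.span_le.mpr ?_) fun D hD => ?_
    · rintro _ ⟨k, rfl⟩
      exact hE.mem W hW k
    · rw [(hE.mem_iff W hW D).mp hD]
      exact sum_mem fun k _ => Submodule.smul_mem _ _ (Submodule.subset_span ⟨k, rfl⟩)

/-- Linear maps on the completed differentials are determined by their values on the exact
differentials. -/
theorem omega_hom_ext {A B : Type u} [CommRing A] [CommRing B] [Algebra A B] {J : Ideal B}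
    [IsAdicComplete J B] (hJ : J.FG) {φ ψ : Omega A B J →ₗ[B] B}
    (h : ∀ b, φ (diff A J b) = ψ (diff A J b)) : φ = ψ := by
  rw [← sub_eq_zero]
  set χ := φ - ψ with hχ
  have h0 : ∀ b, χ (diff A J b) = 0 := fun b => by rw [hχ, LinearMap.sub_apply, h, sub_self]
  have h1 : ∀ m : Ω[B⁄A], χ (AdicCompletion.of J _ m) = 0 := by
    intro m
    have hm : m ∈ Submodule.span B (Set.range (KaehlerDifferential.D A B)) := by
      rw [KaehlerDifferential.span_range_derivation]; trivial
    induction hm using Submodule.span_induction with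
    | mem x hx => obtain ⟨b, rfl⟩ := hx; exact h0 b
    | zero => simp
    | add x y _ _ hx hy => rw [map_add, map_add, hx, hy, add_zero]
    | smul a x _ hx => rw [map_smul, map_smul, hx, smul_zero]
  refine LinearMap.ext fun m => ?_
  refine eq_zero_of_forall_mem_pow J fun n => ?_
  obtain ⟨m₀, hm₀⟩ := Submodule.Quotient.mk_surjective _ (AdicCompletion.eval J (Ω[B⁄A]) n m)
  -- As `J` is finitely generated, the kernel of evaluation at level `n` is `J ^ n` times the
  -- module, so the uncompleted differentials are dense.
  have h2 : m - AdicCompletion.of J _ m₀ ∈ (J ^ n • ⊤ : Submodule B (Omega A B J)) := by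
    rw [AdicCompletion.pow_smul_top_eq_ker_eval hJ, LinearMap.mem_ker, map_sub,
      AdicCompletion.eval_of, ← hm₀, Submodule.mkQ_apply, sub_self]
  have h3 : χ m = χ (m - AdicCompletion.of J _ m₀) := by rw [map_sub, h1, sub_zero]
  rw [h3]
  have h4 : χ (m - AdicCompletion.of J _ m₀) ∈ (J ^ n • ⊤ : Submodule B (Omega A B J)).map χ :=
    Submodule.mem_map_of_mem h2
  rw [Submodule.map_smul''] at h4
  have h5 : (J ^ n • (⊤ : Submodule B (Omega A B J)).map χ : Submodule B B) ≤ J ^ n :=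
    Submodule.smul_le.mpr fun r hr x _ => Ideal.mul_mem_right x _ hr
  exact h5 h4

/-- The families `E_i` and `dt_j` are dual under the pairing, so `m ↦ ∑ ⟨E_k, m⟩ dt_k` projects the
differentials onto the span `G'` of the `dt_j`, with kernel `G''` the common kernel of the `E_i`. A
field that annihilates `G''` is determined by its values on the `t_k` and equals `∑ D(t_k) E_k`. The
complement of `F` consists of the fields that kill all `t_k`. -/
theorem splitsOver_of_isFrame {F : SubTangent f} {U : Opens X} (hU : IsFormalAffine X U)
    {V : Opens S} (hV : IsFormalAffine S V) (h : U ≤ preim f V) {n : ℕ}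
    {E : Fin n → VectorField f U} {t : Fin n → Sec X U}
    (hE : IsFrame (fun U => (F U : Set (VectorField f U))) U E t) : SplitsOver F hU V h t := by
  let _ : Algebra (Sec S V) (Sec X U) := (pull f h).toAlgebra
  have := hU.complete
  set J := definingIdeal X U with hJ
  have hfg : J.FG := hU.definingIdeal_fg
  let P : VectorField f U → (Omega (Sec S V) (Sec X U) J →ₗ[Sec X U] Sec X U) :=
    fun D => contract J (D.toDerivation V h)
  have hP : ∀ D b, P D (diff (Sec S V) J b) = D.der U le_rfl b := fun D b =>
    contract_diff J (D.toDerivation V h) b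
  have hPext : ∀ D (φ : Omega (Sec S V) (Sec X U) J →ₗ[Sec X U] Sec X U),
      (∀ b, D.der U le_rfl b = φ (diff (Sec S V) J b)) → P D = φ := fun D φ hφ =>
    omega_hom_ext hfg fun b => by rw [hP, hφ]
  have hPsub : ∀ D D', P (D - D') = P D - P D' := fun D D' => hPext _ _ fun b => by
    rw [LinearMap.sub_apply, hP, hP]; simp
  have hPsum : ∀ c : Fin n → Sec X U, P (∑ k, c k • E k) = ∑ k, c k • P (E k) := fun c =>
    hPext _ _ fun b => by
      simp [hP, VectorField.sum_der, res_self]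
  have hPinj : ∀ D D', (∀ b, P D (diff (Sec S V) J b) = P D' (diff (Sec S V) J b)) → D = D' :=
    fun D D' hDD => VectorField.ext_of_isFormalAffine hU fun a => by rw [← hP, ← hP, hDD]
  let dt : Fin n → Omega (Sec S V) (Sec X U) J := fun k => diff (Sec S V) J (t k)
  have hEt : ∀ i j, P (E i) (dt j) = if i = j then 1 else 0 := fun i j => by
    rw [hP, hE.dual]
  have hFmem : ∀ D : VectorField f U, D ∈ F U ↔ D = ∑ k, D.der U le_rfl (t k) • E k := fun D => by
    have := hE.mem_iff U le_rfl D
    simpa only [res_self, VectorField.restrict_self, SetLike.mem_coe] using this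
  have hli : LinearIndependent (Sec X U) dt := by
    rw [Fintype.linearIndependent_iff]
    intro c hc j
    have := congrArg (P (E j)) hc
    simpa [hEt] using this
  let G' := Submodule.span (Sec X U) (Set.range dt)
  let G'' : Submodule (Sec X U) (Omega (Sec S V) (Sec X U) J) := ⨅ k, LinearMap.ker (P (E k))
  have hG'' : ∀ m, m ∈ G'' ↔ ∀ k, P (E k) m = 0 := fun m => by
    simp [G'', Submodule.mem_iInf]
  have hdec : ∀ m, m - ∑ k, P (E k) m • dt k ∈ G'' := fun m => by
    rw [hG'']
    intro j
    simp [hEt]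
  have hsumG' : ∀ c : Fin n → Sec X U, ∑ k, c k • dt k ∈ G' := fun c =>
    sum_mem fun k _ => Submodule.smul_mem _ _ (Submodule.subset_span ⟨k, rfl⟩)
  have hcompl : IsCompl G' G'' := by
    refine ⟨Submodule.disjoint_def.mpr fun m hm hm' => ?_, codisjoint_iff.mpr ?_⟩
    · obtain ⟨c, rfl⟩ := (Submodule.mem_span_range_iff_exists_fun _).mp hm
      rw [hG''] at hm'
      have : ∀ k, c k = 0 := fun j => by simpa [hEt] using hm' j
      simp [this]
    · rw [eq_top_iff]
      intro m _
      rw [← add_sub_cancel (∑ k, P (E k) m • dt k) m]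
      exact Submodule.add_mem_sup (hsumG' _) (hdec m)
  let b : Module.Basis (Fin n) (Sec X U) G' := Module.Basis.span hli
  have hb : ∀ k, (b k : Omega (Sec S V) (Sec X U) J) = dt k := fun k =>
    congrArg Subtype.val (Module.Basis.span_apply hli k)
  let T'' : Submodule (Sec X U) (VectorField f U) :=
    { carrier := {D | ∀ k, D.der U le_rfl (t k) = 0}
      zero_mem' := fun k => rfl
      add_mem' := fun {D D'} hD hD' k => by
        rw [VectorField.add_der, hD k, hD' k, add_zero]
      smul_mem' := fun c D hD k => by rw [VectorField.smul_der, hD k, mul_zero] }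
  have hT'' : ∀ D : VectorField f U, D ∈ T'' ↔ ∀ m ∈ G', P D m = 0 := by
    intro D
    constructor
    · intro hD m hm
      obtain ⟨c, rfl⟩ := (Submodule.mem_span_range_iff_exists_fun _).mp hm
      have hD' : ∀ k, P D (dt k) = 0 := fun k => by rw [hP, hD k]
      simp [hD']
    · intro hD k
      rw [← hP]
      exact hD _ (Submodule.subset_span ⟨k, rfl⟩)
  have hF : ∀ D : VectorField f U, D ∈ F U ↔ ∀ m ∈ G'', P D m = 0 := by
    intro D
    constructor
    · intro hD m hm
      rw [(hFmem D).mp hD, hPsum, LinearMap.sum_apply]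
      refine Finset.sum_eq_zero fun k _ => ?_
      rw [LinearMap.smul_apply, (hG'' m).mp hm k, smul_zero]
    · intro hD
      rw [hFmem]
      refine hPinj _ _ fun b => ?_
      have := hD _ (hdec (diff (Sec S V) J b))
      rw [map_sub, sub_eq_zero, map_sum] at this
      rw [this, hPsum, LinearMap.sum_apply]
      refine Finset.sum_congr rfl fun k _ => ?_
      rw [map_smul, hP, hP, LinearMap.smul_apply, hP, smul_eq_mul, smul_eq_mul, mul_comm]
  refine ⟨G', G'', hcompl, ⟨b, hb⟩, ⟨?_, ?_⟩, hF, T'', ?_, hT'', ⟨?_, ?_⟩⟩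
  · intro D D' hDD
    have : ∀ k, D.1.der U le_rfl (t k) = D'.1.der U le_rfl (t k) := fun k => by
      rw [← hP, ← hP]
      exact congrArg (fun φ : G' →ₗ[Sec X U] Sec X U => φ ⟨dt k, Submodule.subset_span ⟨k, rfl⟩⟩)
        hDD
    refine Subtype.ext ?_
    rw [(hFmem D.1).mp D.2, (hFmem D'.1).mp D'.2]
    simp only [this]
  · intro ψ
    refine ⟨⟨∑ k, ψ (b k) • E k, ?_⟩, ?_⟩
    · have := hE.sum_mem U le_rfl fun k => ψ (b k)
      exact this
    · refine b.ext fun j => ?_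
      change P (∑ k, ψ (b k) • E k) (b j) = ψ (b j)
      rw [hPsum, hb]
      simp [hEt]
  · refine ⟨Submodule.disjoint_def.mpr fun D hD hD' => ?_, codisjoint_iff.mpr ?_⟩
    · rw [(hFmem D).mp hD]
      exact Finset.sum_eq_zero fun k _ => by rw [hD' k, zero_smul]
    · rw [eq_top_iff]
      intro D _
      rw [← add_sub_cancel (∑ k, D.der U le_rfl (t k) • E k) D]
      refine Submodule.add_mem_sup ?_ fun j => ?_
      · exact hE.sum_mem U le_rfl fun k => D.der U le_rfl (t k)
      · simp [VectorField.sum_der, res_self, hE.dual]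
  · intro D D' hDD
    refine Subtype.ext (sub_eq_zero.mp (hPinj _ _ fun b => ?_))
    have h0 : ∀ m ∈ G', P (D.1 - D'.1) m = 0 := (hT'' _).mp (sub_mem D.2 D'.2)
    have h0' : ∀ m ∈ G'', P (D.1 - D'.1) m = 0 := fun m hm => by
      rw [hPsub, LinearMap.sub_apply, sub_eq_zero]
      exact congrArg (fun φ : G'' →ₗ[Sec X U] Sec X U => φ ⟨m, hm⟩) hDD
    have h1 : P (D.1 - D'.1) (diff (Sec S V) J b) = 0 := by
      rw [← add_sub_cancel (∑ k, P (E k) (diff (Sec S V) J b) • dt k) (diff (Sec S V) J b),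
        map_add, h0 _ (hsumG' _), h0' _ (hdec _), add_zero]
    exact h1.trans (hP 0 b).symm
  · intro ψ
    -- A linear form on `G''` is extended by zero to `G'`, so that the vector field it defines kills
    -- the coordinates.
    let Ψ : Omega (Sec S V) (Sec X U) J →ₗ[Sec X U] Sec X U :=
      ψ ∘ₗ G''.projectionOnto G' hcompl.symm
    have hΨ : ∀ m : G'', Ψ m = ψ m := fun m => by simp [Ψ]
    have hΨ' : ∀ m ∈ G', Ψ m = 0 := fun m hm => by
      simp only [Ψ, LinearMap.comp_apply]
      rw [Submodule.projectionOnto_apply_of_mem_right _ hm, map_zero]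
    let d : Derivation (Sec S V) (Sec X U) (Sec X U) :=
      (Ψ ∘ₗ AdicCompletion.of J _).compDer (KaehlerDifferential.D (Sec S V) (Sec X U))
    have hd : ∀ b, d b = Ψ (diff (Sec S V) J b) := fun b => rfl
    obtain ⟨D, hD⟩ := exists_vectorField hU hV h (d.restrictScalars ℤ) fun s =>
      d.map_algebraMap s
    have hDb : ∀ b, D.der U le_rfl b = Ψ (diff (Sec S V) J b) := fun b => by
      rw [hD]; rfl
    refine ⟨⟨D, fun k => ?_⟩, ?_⟩
    · rw [hDb]; exact hΨ' _ (Submodule.subset_span ⟨k, rfl⟩)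
    · have := hPext D Ψ hDb
      ext m
      change P D m = ψ m
      rw [this, hΨ]

end FrameProperties

/-! ### Retractions onto rings of constants -/

section Retractions

variable {B : Type u} [CommRing B]

/-- A linear map to a subring maps extended ideals to the ideals themselves. -/
theorem exists_mem_eq_of_mem_map {R : Subring B} {π : B →+ B} (hmem : ∀ b, π b ∈ R)
    (hmul : ∀ r ∈ R, ∀ b, π (r * b) = r * π b) {I : Ideal R} {b : B} (hb : b ∈ I.map R.subtype) :
    ∃ r ∈ I, (r : B) = π b := by
  -- The claim is proved for all multiples `a * b`, which makes the scalar step of the induction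
  -- immediate.
  refine Submodule.span_induction (p := fun b _ => ∀ a, ∃ r ∈ I, (r : B) = π (a * b))
    ?_ ?_ ?_ ?_ hb 1 |>.imp fun r hr => by simpa using hr
  · rintro _ ⟨r, hr, rfl⟩ a
    refine ⟨r * ⟨π a, hmem a⟩, Ideal.mul_mem_right _ _ hr, ?_⟩
    rw [mul_comm a]
    exact (hmul _ r.2 a).symm
  · exact fun a => ⟨0, zero_mem _, by simp⟩
  · intro b c _ _ hb hc a
    obtain ⟨r, hr, hb⟩ := hb a
    obtain ⟨s, hs, hc⟩ := hc a
    exact ⟨r + s, add_mem hr hs, by rw [mul_add, map_add, ← hb, ← hc]; rfl⟩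
  · intro c b _ hb a
    rw [smul_eq_mul, ← mul_assoc]
    exact hb _

/-- An `R`-linear retraction `π` of `B` onto the subring `R` with `π b ≡ b` modulo the functions
`x_i`, continuous for the `J`-adic topology, and a homomorphism `θ` from `B` to `R` that is the
`e`-th power map up to elements of `(x) ∩ J`. -/
structure IsRetraction {n : ℕ} (R : Subring B) (x : Fin n → B) (J : Ideal B) (e : ℕ) (π : B →+ B)
    (θ : B →+* B) : Prop where
  ne_zero : e ≠ 0
  mem : ∀ b, π b ∈ R
  eq_self : ∀ r ∈ R, π r = r
  map_mul : ∀ r ∈ R, ∀ b, π (r * b) = r * π b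
  sub_mem : ∀ b, b - π b ∈ Ideal.span (Set.range x)
  theta_mem : ∀ b, θ b ∈ R
  theta_eq_pow : ∀ r ∈ R, θ r = r ^ e
  theta_sub_mem : ∀ b, θ b - b ^ e ∈ Ideal.span (Set.range x)
  theta_sub_mem' : ∀ b, θ b - b ^ e ∈ J
  map_pow : ∀ k : ℕ, ∃ m : ℕ, ∀ b ∈ J ^ m, ∃ r ∈ (J.comap R.subtype) ^ k, (r : B) = π b

namespace IsRetraction

variable {n : ℕ} {R : Subring B} {x : Fin n → B} {J : Ideal B} {e : ℕ} {π : B →+ B} {θ : B →+* B}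

theorem map_mem (h : IsRetraction R x J e π θ) {I : Ideal R} {b : B} (hb : b ∈ I.map R.subtype) :
    ∃ r ∈ I, (r : B) = π b :=
  exists_mem_eq_of_mem_map h.mem h.map_mul hb

/-- If an element of `R` lies in `I B`, applying the `R`-linear map `π`, which fixes it, shows that
it lies in `I`. -/
theorem comap_map (h : IsRetraction R x J e π θ) (I : Ideal R) :
    (I.map R.subtype).comap R.subtype = I := by
  refine le_antisymm (fun r hr => ?_) Ideal.le_comap_map
  obtain ⟨s, hs, hsr⟩ := h.map_mem hr
  have : s = r := Subtype.ext (hsr.trans (h.eq_self _ r.2))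
  exact this ▸ hs

/-- By `comap_map`, extension of ideals embeds the ordered set of ideals of `R` into that of `B`, so
the ascending chain condition descends. -/
theorem isNoetherianRing (h : IsRetraction R x J e π θ) [IsNoetherianRing B] :
    IsNoetherianRing R := by
  rw [isNoetherianRing_iff, isNoetherian_iff']
  have : WellFoundedGT (Ideal B) := inferInstance
  refine (OrderEmbedding.ofMapLEIff (fun I : Ideal R => I.map R.subtype) fun I I' => ?_).wellFoundedGT
  constructor
  · intro h'
    rw [← h.comap_map I, ← h.comap_map I']
    exact Ideal.comap_mono h'
  · exact fun h' => Ideal.map_mono h'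

/-- A Cauchy sequence in `R` has a limit `L` in `B`, and `π L` is the limit in `R`. The continuity
condition `map_pow` is what controls powers of `J ∩ R`, which may be smaller than the traces of the
powers of `J`. -/
theorem isAdicComplete (h : IsRetraction R x J e π θ) [IsAdicComplete J B] :
    IsAdicComplete (J.comap R.subtype) R := by
  have hle : ∀ (k : ℕ) (r : R), r ∈ (J.comap R.subtype) ^ k → (r : B) ∈ J ^ k := fun k r hr =>
    mem_pow_of_mem_pow (φ := R.subtype) Ideal.map_comap_le hr
  refine isAdicComplete_of _ (fun r hr => ?_) fun c hc => ?_
  · exact Subtype.ext (eq_zero_of_forall_mem_pow J fun k => hle k r (hr k))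
  · obtain ⟨L, hL⟩ := exists_limit J (fun k => (c k : B)) fun k => hle k _ (hc k)
    refine ⟨⟨π L, h.mem L⟩, fun k => ?_⟩
    obtain ⟨m, hm⟩ := h.map_pow k
    obtain ⟨r, hr, hr'⟩ := hm _ (Ideal.pow_le_pow_right (Nat.le_add_left m k) (hL (k + m)))
    rw [map_sub, h.eq_self _ (c (k + m)).2] at hr'
    have h1 : ∀ l, c (k + l) - c k ∈ (J.comap R.subtype) ^ k := by
      intro l
      induction l with
      | zero => simp
      | succ l ih =>
        have := add_mem ih (Ideal.pow_le_pow_right (Nat.le_add_right k l) (hc (k + l)))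
        convert this using 1
        rw [← add_assoc]; ring
    have := add_mem hr (h1 m)
    convert this using 1
    apply Subtype.ext
    push_cast
    rw [hr']
    ring

/-- The prime is the preimage of `P` under `θ`. It lies over `P` because `θ` is the `e`-th power map
on `R`, and it contains `J` because `θ b ≡ b ^ e` modulo `J`. -/
theorem exists_prime (h : IsRetraction R x J e π θ) (P : Ideal R) [P.IsPrime]
    (hP : J.comap R.subtype ≤ P) :
    ∃ Q : Ideal B, Q.IsPrime ∧ J ≤ Q ∧ Q.comap R.subtype = P := by
  let θ' : B →+* R := θ.codRestrict R h.theta_mem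
  refine ⟨P.comap θ', inferInstance, fun j hj => hP ?_, ?_⟩
  · change θ j ∈ J
    have := add_mem (h.theta_sub_mem' j) (Ideal.pow_le_self h.ne_zero (Ideal.pow_mem_pow hj e))
    simpa using this
  · ext r
    have : θ' (r : B) = r ^ e := Subtype.ext (h.theta_eq_pow _ r.2)
    rw [Ideal.mem_comap, Ideal.mem_comap]
    erw [this]
    exact Ideal.IsPrime.pow_mem_iff_mem inferInstance e (Nat.pos_of_ne_zero h.ne_zero)

/-- Rings of constants are compatible with completed localizations. -/
theorem isCompletedAway {B' : Type v} [CommRing B'] [IsNoetherianRing B'] {φ : B →+* B'} {s : B}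
    (hs : IsCompletedAway φ J s) (hsR : s ∈ R) {R' : Subring B'} {x' : Fin n → B'} {e' : ℕ}
    {π' : B' →+ B'} {θ' : B' →+* B'} (h : IsRetraction R x J e π θ)
    (h' : IsRetraction R' x' (J.map φ) e' π' θ') (hφ : ∀ r ∈ R, φ r ∈ R')
    (hinv : ∀ r ∈ R', ∀ b, r * b = 1 → b ∈ R') (hπ : ∀ b, π' (φ b) = φ (π b)) :
    IsCompletedAway ((φ.comp R.subtype).codRestrict R' fun r => hφ r r.2) (J.comap R.subtype)
      ⟨s, hsR⟩ := by
  set ψ := (φ.comp R.subtype).codRestrict R' fun r => hφ r r.2 with hψ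
  set σ : R := ⟨s, hsR⟩
  have hψc : ∀ r : R, ((ψ r : R') : B') = φ r := fun r => rfl
  set K := (J.map φ).comap R'.subtype with hK
  have hc := hs.complete
  have hKc : IsAdicComplete K R' := h'.isAdicComplete
  have hR' : IsNoetherianRing R' := h'.isNoetherianRing
  have hKle : ∀ (k : ℕ) (r : R'), r ∈ K ^ k → (r : B') ∈ J.map φ ^ k := fun k r hr =>
    mem_pow_of_mem_pow (φ := R'.subtype) Ideal.map_comap_le hr
  obtain ⟨v, hv⟩ := hs.isUnit.exists_right_inv
  have hvR : v ∈ R' := hinv _ (hφ s hsR) v hv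
  have hu : IsUnit (ψ σ) := IsUnit.of_mul_eq_one ⟨v, hvR⟩ (Subtype.ext hv)
  -- Approximate `r` in `B'` by a fraction of elements of `B` and apply `π'`: this is compatible
  -- with `π`, fixes constants and is continuous.
  have happrox : ∀ (k : ℕ) (r : R'), ∃ (l : ℕ) (a : R), ψ σ ^ l * r - ψ a ∈ K ^ k := by
    intro k r
    obtain ⟨m, hm⟩ := h'.map_pow k
    obtain ⟨l, b, hb⟩ := hs.exists_mul_sub_mem m r
    obtain ⟨q, hq, hq'⟩ := hm _ hb
    refine ⟨l, ⟨π b, h.mem b⟩, ?_⟩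
    convert hq using 1
    apply Subtype.ext
    rw [hq', map_sub, hπ, h'.eq_self _ (R'.mul_mem (R'.pow_mem (hφ s hsR) l) r.2)]
    rfl
  have hle : (J.comap R.subtype).map ψ ≤ K := by
    rw [Ideal.map_le_iff_le_comap]
    exact fun r hr => Ideal.mem_map_of_mem φ hr
  -- Approximation to order two shows that `K` is contained in the extended ideal plus `K ^ 2`;
  -- Nakayama's lemma removes the last term.
  have hKeq : (J.comap R.subtype).map ψ = K := by
    refine le_antisymm hle (Submodule.le_of_le_smul_of_le_jacobson_bot (I := K)
      (IsNoetherian.noetherian K) (IsAdicComplete.le_jacobson_bot K) fun r hr => ?_)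
    obtain ⟨l, a, ha⟩ := happrox 2 r
    have h1 : φ a ∈ J.map φ ^ 1 := by
      rw [pow_one]
      have h2 : ψ a ∈ K := by
        have := _root_.sub_mem (Ideal.mul_mem_left _ (ψ σ ^ l) hr) (Ideal.pow_le_self two_ne_zero ha)
        simpa using this
      exact h2
    obtain ⟨k, hk⟩ := hs.exists_pow_mul_mem 1 _ h1
    have h3 : σ ^ k * a ∈ J.comap R.subtype := by
      rw [pow_one] at hk; exact hk
    have h4 : ψ σ ^ (k + l) * r ∈ (J.comap R.subtype).map ψ ⊔ K • K := by
      have := Submodule.add_mem_sup (Ideal.mem_map_of_mem ψ h3)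
        (Ideal.mul_mem_left _ (ψ σ ^ k) (show ψ σ ^ l * r - ψ a ∈ K • K by
          rwa [smul_eq_mul, ← sq]))
      convert this using 1
      simp only [_root_.map_mul, _root_.map_pow]
      ring
    rwa [Ideal.unit_mul_mem_iff_mem _ (hu.pow _)] at h4
  refine ⟨hKeq ▸ hKc, hu, fun k r => hKeq ▸ happrox k r, fun k r hr => ?_⟩
  -- The order `m` is such that `π` maps `J ^ m` into `(J ∩ R) ^ k`. So elements of the extension of
  -- `(J ∩ R) ^ k` are approximated to order `m` by elements of `(J ∩ R) ^ k` up to powers of `s`,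
  -- and the error is treated in `B` and then projected by `π`.
  obtain ⟨m, hm⟩ := h.map_pow k
  have key : ∀ y : R', y ∈ ((J.comap R.subtype) ^ k).map ψ → ∃ (l : ℕ), ∃ j ∈ (J.comap R.subtype) ^ k,
      ψ σ ^ l * y - ψ j ∈ K ^ m := by
    intro y hy
    refine Submodule.span_induction (p := fun y _ => ∃ (l : ℕ), ∃ j ∈ (J.comap R.subtype) ^ k,
      ψ σ ^ l * y - ψ j ∈ K ^ m) ?_ ?_ ?_ ?_ hy
    · rintro _ ⟨j, hj, rfl⟩
      exact ⟨0, j, hj, by simp⟩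
    · exact ⟨0, 0, zero_mem _, by simp⟩
    · rintro y z _ _ ⟨l, j, hj, h1⟩ ⟨l', j', hj', h2⟩
      refine ⟨l + l', σ ^ l' * j + σ ^ l * j', add_mem (Ideal.mul_mem_left _ _ hj)
        (Ideal.mul_mem_left _ _ hj'), ?_⟩
      have := add_mem (Ideal.mul_mem_left _ (ψ σ ^ l') h1) (Ideal.mul_mem_left _ (ψ σ ^ l) h2)
      convert this using 1
      simp only [_root_.map_add, _root_.map_mul, _root_.map_pow]
      ring
    · rintro c y _ ⟨l, j, hj, h1⟩
      obtain ⟨l', a, ha⟩ := happrox m c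
      refine ⟨l + l', a * j, Ideal.mul_mem_left _ _ hj, ?_⟩
      have := add_mem (Ideal.mul_mem_left _ (ψ σ ^ l' * c) h1) (Ideal.mul_mem_left _ (ψ j) ha)
      convert this using 1
      simp only [_root_.map_mul, smul_eq_mul]
      ring
  rw [← Ideal.map_pow] at hr
  obtain ⟨l, j, hj, h1⟩ := key _ hr
  have h2 : φ (σ ^ l * r - j : R) ∈ J.map φ ^ m := by
    have := hKle m _ h1
    convert this using 1
    simp [hψc]
  obtain ⟨q, hq⟩ := hs.exists_pow_mul_mem m _ h2
  obtain ⟨a, ha, ha'⟩ := hm _ hq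
  have h3 : a = σ ^ q * (σ ^ l * r - j) := by
    apply Subtype.ext
    rw [ha']
    exact h.eq_self _ (σ ^ q * (σ ^ l * r - j)).2
  refine ⟨q + l, ?_⟩
  have := add_mem ha (Ideal.mul_mem_left _ (σ ^ q) hj)
  rw [h3] at this
  convert this using 1
  ring

end IsRetraction

/-- Commuting derivations `E_i` of `B` with the ring of constants `R`, and elements `x_i` with
`E_i x_j = δ_ij`. -/
structure IsDualFrame {n : ℕ} (R : Subring B) (E : Fin n → Derivation ℤ B B) (x : Fin n → B) :
    Prop where
  mem_iff : ∀ b, b ∈ R ↔ ∀ i, E i b = 0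
  dual : ∀ i j, E i (x j) = if i = j then 1 else 0
  commute : ∀ i j b, E i (E j b) = E j (E i b)

end Retractions

/-! ### Rings of constants in characteristic `p` -/

section CharP

variable {B : Type u} [CommRing B] {p : ℕ}

/-- The `p`-th power map of a ring with `p = 0`. -/
def powHom (hp : p.Prime) (hB : (p : B) = 0) : B →+* B where
  toFun b := b ^ p
  map_one' := one_pow p
  map_mul' a b := mul_pow a b p
  map_zero' := zero_pow hp.ne_zero
  map_add' a b := by
    rcases subsingleton_or_nontrivial B with h | h
    · exact Subsingleton.elim _ _
    · have := Fact.mk hp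
      have := (CharP.charP_iff_prime_eq_zero hp).2 hB
      exact add_pow_char a b p

/-- A natural number that is inverse to `k!` modulo `p`. -/
def invFactorial (p k : ℕ) : ℕ :=
  ((k.factorial : ZMod p)⁻¹).val

theorem natCast_eq_of_zmod (hB : (p : B) = 0) {a b : ℕ} (h : (a : ZMod p) = b) :
    (a : B) = b := by
  rw [ZMod.natCast_eq_natCast_iff] at h
  obtain ⟨k, hk⟩ := Nat.modEq_iff_dvd.1 h
  have : ((b - a : ℤ) : B) = 0 := by rw [hk]; push_cast; rw [hB, zero_mul]
  push_cast at this
  exact (sub_eq_zero.1 this).symm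

theorem invFactorial_mul (hp : p.Prime) (hB : (p : B) = 0) {k : ℕ} (hk : k < p) :
    (invFactorial p k : B) * k.factorial = 1 := by
  have := Fact.mk hp
  have h : ((invFactorial p k * k.factorial : ℕ) : ZMod p) = (1 : ℕ) := by
    have h0 : (k.factorial : ZMod p) ≠ 0 := by
      rw [Ne, ZMod.natCast_eq_zero_iff, hp.dvd_factorial]
      exact not_le.2 hk
    rw [Nat.cast_mul, invFactorial, ZMod.natCast_val, ZMod.cast_id', id_eq, inv_mul_cancel₀ h0,
      Nat.cast_one]
  simpa using natCast_eq_of_zmod hB h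

theorem invFactorial_succ (hp : p.Prime) (hB : (p : B) = 0) {k : ℕ} (hk : k + 1 < p) :
    (invFactorial p (k + 1) : B) * (k + 1 : ℕ) = invFactorial p k := by
  have h1 := invFactorial_mul hp hB hk
  have h2 := invFactorial_mul hp hB (Nat.lt_of_succ_lt hk)
  rw [Nat.factorial_succ, Nat.cast_mul] at h1
  calc _ = (invFactorial p (k + 1) : B) * (k + 1 : ℕ) * (invFactorial p k * k.factorial) := by
        rw [h2, mul_one]
    _ = (invFactorial p (k + 1) : B) * ((k + 1 : ℕ) * k.factorial) * invFactorial p k := by ring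
    _ = _ := by rw [h1, one_mul]

variable (p) in
/-- The truncated Taylor expansion at `x = 0` of `b`, with respect to a derivation `E`. -/
def taylor (E : Derivation ℤ B B) (x : B) : B →+ B where
  toFun b := ∑ k ∈ Finset.range p, (invFactorial p k : B) * (-x) ^ k * E^[k] b
  map_zero' := Finset.sum_eq_zero fun k _ => by rw [iterate_map_zero E k, mul_zero]
  map_add' a b := by
    rw [← Finset.sum_add_distrib]
    exact Finset.sum_congr rfl fun k _ => by rw [iterate_map_add E k, mul_add]

theorem taylor_apply (E : Derivation ℤ B B) (x b : B) :
    taylor p E x b = ∑ k ∈ Finset.range p, (invFactorial p k : B) * (-x) ^ k * E^[k] b :=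
  rfl

theorem iterate_mul_of_eq_zero (E : Derivation ℤ B B) {r : B} (hr : E r = 0) (k : ℕ) (b : B) :
    E^[k] (r * b) = r * E^[k] b := by
  induction k generalizing b with
  | zero => rfl
  | succ k ih =>
    rw [Function.iterate_succ_apply, Function.iterate_succ_apply, Derivation.leibniz, hr, smul_zero,
      add_zero, smul_eq_mul, ih]

theorem iterate_pow_mul (E : Derivation ℤ B B) {x : B} (hx : E x = 1) (k : ℕ) {r : B}
    (hr : E r = 0) : E^[k] (x ^ k * r) = k.factorial * r := by
  induction k generalizing r with
  | zero => simp
  | succ k ih =>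
    have : E (x ^ (k + 1) * r) = x ^ k * ((k + 1 : ℕ) * r) := by
      rw [Derivation.leibniz, hr, Derivation.leibniz_pow, hx]
      simp only [nsmul_eq_mul, smul_eq_mul, Nat.add_sub_cancel]
      ring
    rw [Function.iterate_succ_apply, this, ih, Nat.factorial_succ]
    · push_cast; ring
    · rw [Derivation.leibniz, hr, Derivation.map_natCast]; simp

/-- The sum telescopes: `E` of the partial sum up to `m` is `(-x) ^ m / m!` times `E ^ (m + 1) b`,
which is zero for `m = p - 1`. -/
theorem derivation_taylor (hp : p.Prime) (hB : (p : B) = 0) (E : Derivation ℤ B B) {x : B}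
    (hx : E x = 1) (hE : ∀ b, E^[p] b = 0) (b : B) : E (taylor p E x b) = 0 := by
  have h : ∀ m < p, E (∑ k ∈ Finset.range (m + 1), (invFactorial p k : B) * (-x) ^ k * E^[k] b) =
      invFactorial p m * (-x) ^ m * E^[m + 1] b := by
    intro m
    induction m with
    | zero =>
      intro _
      rw [Finset.sum_range_one, Derivation.leibniz, Derivation.leibniz, Derivation.map_natCast]
      simp
    | succ m ih =>
      intro hm
      rw [Finset.sum_range_succ, map_add, ih (Nat.lt_of_succ_lt hm), Derivation.leibniz,
        Derivation.leibniz, Derivation.map_natCast, Derivation.leibniz_pow, map_neg, hx,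
        ← invFactorial_succ hp hB hm, Function.iterate_succ_apply' E (m + 1)]
      simp only [nsmul_eq_mul, smul_eq_mul, Nat.add_sub_cancel]
      ring
  obtain ⟨m, rfl⟩ := Nat.exists_eq_succ_of_ne_zero hp.ne_zero
  rw [taylor_apply, h m (Nat.lt_succ_self m), hE, mul_zero]

theorem taylor_mul (E : Derivation ℤ B B) (x : B) {r : B} (hr : E r = 0) (b : B) :
    taylor p E x (r * b) = r * taylor p E x b := by
  rw [taylor_apply, taylor_apply, Finset.mul_sum]
  exact Finset.sum_congr rfl fun k _ => by rw [iterate_mul_of_eq_zero E hr]; ring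

theorem taylor_sub_mem (hp : p.Prime) (hB : (p : B) = 0) (E : Derivation ℤ B B) (x b : B) :
    b - taylor p E x b ∈ Ideal.span {x} := by
  obtain ⟨m, rfl⟩ := Nat.exists_eq_succ_of_ne_zero hp.ne_zero
  have h0 : (invFactorial (m + 1) 0 : B) = 1 := by
    simpa using invFactorial_mul hp hB (k := 0) hp.pos
  rw [taylor_apply, Finset.sum_range_succ', h0]
  simp only [pow_zero, mul_one, one_mul, Function.iterate_zero, id_eq]
  rw [sub_add_cancel_right, neg_mem_iff]
  refine sum_mem fun k _ => ?_
  rw [Ideal.mem_span_singleton, pow_succ]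
  exact ⟨-(invFactorial (m + 1) (k + 1) * (-x) ^ k * E^[k + 1] b), by ring⟩

theorem taylor_eq_self (hp : p.Prime) (hB : (p : B) = 0) (E : Derivation ℤ B B) (x : B) {r : B}
    (hr : E r = 0) : taylor p E x r = r := by
  obtain ⟨m, rfl⟩ := Nat.exists_eq_succ_of_ne_zero hp.ne_zero
  have h0 : (invFactorial (m + 1) 0 : B) = 1 := by
    simpa using invFactorial_mul hp hB (k := 0) hp.pos
  rw [taylor_apply, Finset.sum_range_succ', h0, Finset.sum_eq_zero]
  · simp
  · intro k _
    rw [Function.iterate_succ_apply, hr, iterate_map_zero E k, mul_zero]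

/-- This is what allows expansions in several directions to be composed: the expansion along one
`E_i` does not spoil being killed by the others. -/
theorem taylor_commute (E D : Derivation ℤ B B) {x : B} (hx : D x = 0)
    (h : ∀ b, D (E b) = E (D b)) (b : B) : D (taylor p E x b) = taylor p E x (D b) := by
  have h' : ∀ k, D (E^[k] b) = E^[k] (D b) := fun k => by
    induction k with
    | zero => rfl
    | succ k ih => rw [Function.iterate_succ_apply', Function.iterate_succ_apply', h, ih]
  rw [taylor_apply, taylor_apply, map_sum]
  refine Finset.sum_congr rfl fun k _ => ?_
  rw [Derivation.leibniz, Derivation.leibniz, Derivation.map_natCast, Derivation.leibniz_pow,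
    map_neg, hx, h']
  simp

theorem map_taylor {B' : Type v} [CommRing B'] (φ : B →+* B') (E : Derivation ℤ B B)
    (E' : Derivation ℤ B' B') (h : ∀ b, φ (E b) = E' (φ b)) (x b : B) :
    φ (taylor p E x b) = taylor p E' (φ x) (φ b) := by
  have h' : ∀ k, φ (E^[k] b) = E'^[k] (φ b) := fun k => by
    induction k with
    | zero => rfl
    | succ k ih => rw [Function.iterate_succ_apply', Function.iterate_succ_apply', h, ih]
  rw [taylor_apply, taylor_apply, map_sum]
  exact Finset.sum_congr rfl fun k _ => by
    rw [map_mul, map_mul, map_pow, map_neg, map_natCast, h']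

variable {n : ℕ}

variable (p) in
/-- The composite of the Taylor expansions with respect to the derivations in a list. -/
def taylorList (E : Fin n → Derivation ℤ B B) (x : Fin n → B) (l : List (Fin n)) : B →+ B :=
  l.foldr (fun i π => (taylor p (E i) (x i)).comp π) (AddMonoidHom.id B)

theorem taylorList_cons (E : Fin n → Derivation ℤ B B) (x : Fin n → B) (i : Fin n)
    (l : List (Fin n)) (b : B) :
    taylorList p E x (i :: l) b = taylor p (E i) (x i) (taylorList p E x l b) :=
  rfl

theorem map_taylorList {B' : Type v} [CommRing B'] (φ : B →+* B') (E : Fin n → Derivation ℤ B B)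
    (E' : Fin n → Derivation ℤ B' B') (h : ∀ i b, φ (E i b) = E' i (φ b)) (x : Fin n → B)
    (l : List (Fin n)) (b : B) :
    φ (taylorList p E x l b) = taylorList p E' (fun i => φ (x i)) l (φ b) := by
  induction l with
  | nil => rfl
  | cons i l ih => rw [taylorList_cons, taylorList_cons, map_taylor φ _ _ (h i), ih]

namespace IsDualFrame

variable {R : Subring B} {E : Fin n → Derivation ℤ B B} {x : Fin n → B}

/-- Each expansion makes its argument constant in its own direction and commutes with the other
derivations, so the composite over all directions lands in `R`. The Frobenius serves as `θ`, because
`p`-th powers are constants. For the same reason `J` lies in the radical of `(J ∩ R) B`; as `J` is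
finitely generated, some power of it lies in `(J ∩ R) B`, and linearity of the projection gives its
continuity. -/
theorem isRetraction_taylorList (h : IsDualFrame R E x) (hp : p.Prime) (hB : (p : B) = 0)
    (hE : ∀ i b, (E i)^[p] b = 0) [IsNoetherianRing B] (J : Ideal B) :
    IsRetraction R x J p (taylorList p E x (List.finRange n)) (powHom hp hB) := by
  have hkill : ∀ (l : List (Fin n)) (b : B), ∀ i ∈ l, E i (taylorList p E x l b) = 0 := by
    intro l b
    induction l with
    | nil => simp
    | cons j l ih =>
      intro i hi
      rw [taylorList_cons]
      rcases eq_or_ne i j with rfl | hij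
      · exact derivation_taylor hp hB _ (by rw [h.dual, if_pos rfl]) (hE i) _
      · rw [taylor_commute _ _ (by rw [h.dual, if_neg hij]) (h.commute i j),
          ih i (List.mem_of_ne_of_mem hij hi), map_zero]
  have hmem : ∀ b, taylorList p E x (List.finRange n) b ∈ R := fun b =>
    (h.mem_iff _).2 fun i => hkill _ b i (List.mem_finRange i)
  have hmul : ∀ r ∈ R, ∀ b, taylorList p E x (List.finRange n) (r * b) =
      r * taylorList p E x (List.finRange n) b := by
    intro r hr b
    induction List.finRange n with
    | nil => rfl
    | cons i l ih =>
      rw [taylorList_cons, taylorList_cons, ih, taylor_mul _ _ ((h.mem_iff r).1 hr i)]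
  refine ⟨hp.ne_zero, hmem, fun r hr => ?_, hmul, fun b => ?_, fun b => ?_, fun r _ => rfl,
    fun b => ?_, fun b => ?_, fun k => ?_⟩
  · induction List.finRange n with
    | nil => rfl
    | cons i l ih =>
      rw [taylorList_cons, ih, taylor_eq_self hp hB _ _ ((h.mem_iff r).1 hr i)]
  · induction List.finRange n with
    | nil => exact (sub_self b).symm ▸ zero_mem _
    | cons i l ih =>
      have := taylor_sub_mem hp hB (E i) (x i) (taylorList p E x l b)
      have := add_mem ih (Ideal.span_mono (Set.singleton_subset_iff.2 (Set.mem_range_self i)) this)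
      rwa [sub_add_sub_cancel] at this
  · refine (h.mem_iff _).2 fun i => ?_
    change E i (b ^ p) = 0
    rw [Derivation.leibniz_pow, nsmul_eq_mul, hB, zero_mul]
  · exact (sub_self (b ^ p)).symm ▸ zero_mem _
  · exact (sub_self (b ^ p)).symm ▸ zero_mem _
  · obtain ⟨N, hN⟩ := Ideal.exists_pow_le_of_le_radical_of_fg
      (show J ≤ ((J.comap R.subtype).map R.subtype).radical from fun b hb => ⟨p, by
        have h1 : b ^ p ∈ R := (h.mem_iff _).2 fun i => by
          rw [Derivation.leibniz_pow, nsmul_eq_mul, hB, zero_mul]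
        exact Ideal.mem_map_of_mem R.subtype (x := (⟨b ^ p, h1⟩ : R))
          (Ideal.pow_mem_of_mem J hb p hp.pos)⟩) (IsNoetherian.noetherian J)
    refine ⟨N * k, fun b hb => exists_mem_eq_of_mem_map hmem hmul ?_⟩
    rw [Ideal.map_pow]
    rw [pow_mul] at hb
    exact Ideal.pow_right_mono hN k hb

/-- Induction on the set of directions in which `b` is not yet constant, and inside it on the order
`m` with `E_i ^ m b = 0`. Subtracting `x_i ^ m / m!` times the last nonzero iterate, which is
constant along `E_i`, lowers the order. -/
theorem surjective_eval₂Hom (h : IsDualFrame R E x) (hp : p.Prime) (hB : (p : B) = 0)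
    (hE : ∀ i b, (E i)^[p] b = 0) :
    Function.Surjective (MvPolynomial.eval₂Hom R.subtype x) := by
  have key : ∀ (l : List (Fin n)) (b : B), (∀ i ∉ l, E i b = 0) →
      b ∈ (MvPolynomial.eval₂Hom R.subtype x).range := by
    intro l
    induction l with
    | nil =>
      intro b hb
      exact ⟨MvPolynomial.C ⟨b, (h.mem_iff b).2 fun i => hb i (by simp)⟩, by simp⟩
    | cons i l ih =>
      have : ∀ m ≤ p, ∀ b, (∀ j ∉ i :: l, E j b = 0) → (E i)^[m] b = 0 →
          b ∈ (MvPolynomial.eval₂Hom R.subtype x).range := by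
        intro m
        induction m with
        | zero =>
          intro _ b _ hb
          rw [Function.iterate_zero, id_eq] at hb
          exact hb ▸ zero_mem _
        | succ m ihm =>
          intro hm b hb hb'
          set e := (E i)^[m] b with he
          have hei : E i e = 0 := by rwa [he, ← Function.iterate_succ_apply' (E i)]
          have hej : ∀ j ∉ i :: l, E j e = 0 := by
            intro j hj
            have : ∀ k, E j ((E i)^[k] b) = 0 := fun k => by
              induction k with
              | zero => exact hb j hj
              | succ k ihk => rw [Function.iterate_succ_apply', h.commute, ihk, map_zero]
            exact this m
          have he' : e ∈ (MvPolynomial.eval₂Hom R.subtype x).range := ih e fun j hj => by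
            rcases eq_or_ne j i with rfl | hji
            · exact hei
            · exact hej j (by simp [hji, hj])
          have hx : x i ∈ (MvPolynomial.eval₂Hom R.subtype x).range := ⟨MvPolynomial.X i, by simp⟩
          have h1 : b - invFactorial p m * (x i ^ m * e) ∈
              (MvPolynomial.eval₂Hom R.subtype x).range := by
            refine ihm (Nat.le_of_succ_le hm) _ (fun j hj => ?_) ?_
            · rw [map_sub, hb j hj, Derivation.leibniz, Derivation.map_natCast, Derivation.leibniz,
                hej j hj, Derivation.leibniz_pow, h.dual, if_neg (by rintro rfl; simp at hj)]
              simp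
            · rw [iterate_map_sub (E i), iterate_mul_of_eq_zero _ (Derivation.map_natCast _ _),
                iterate_pow_mul _ (by rw [h.dual, if_pos rfl]) _ hei, ← mul_assoc,
                invFactorial_mul hp hB (Nat.lt_of_succ_le hm), one_mul, sub_self]
          have h2 := add_mem h1 (mul_mem (natCast_mem _ (invFactorial p m))
            (mul_mem (pow_mem hx m) he'))
          rwa [sub_add_cancel] at h2
      exact fun b hb => this p le_rfl b hb (hE i b)
  exact fun b => key (List.finRange n) b fun i hi => absurd (List.mem_finRange i) hi

/-- Partial derivatives correspond to the `E_i` because polynomial coefficients are constants; so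
relations among the `x_i` can be differentiated. -/
theorem eval₂_pderiv (h : IsDualFrame R E x) (i : Fin n) (P : MvPolynomial (Fin n) R) :
    MvPolynomial.eval₂Hom R.subtype x (MvPolynomial.pderiv i P) =
      E i (MvPolynomial.eval₂Hom R.subtype x P) := by
  induction P using MvPolynomial.induction_on with
  | C a => simpa using ((h.mem_iff _).1 a.2 i).symm
  | add P Q hP hQ => simp only [map_add, hP, hQ]
  | mul_X P j hP =>
    rw [Derivation.leibniz, map_add, smul_eq_mul, smul_eq_mul, map_mul, map_mul, hP, map_mul,
      Derivation.leibniz, MvPolynomial.pderiv_X, MvPolynomial.coe_eval₂Hom, MvPolynomial.eval₂_X,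
      h.dual, smul_eq_mul, smul_eq_mul, Pi.single_apply]
    simp only [eq_comm (a := j)]
    split_ifs <;> simp

end IsDualFrame

end CharP

/-! ### Monomial basis and presentation over the constants in characteristic `p` -/

section Presentation

variable {B : Type u} [CommRing B] {p n : ℕ} {R : Subring B} {E : Fin n → Derivation ℤ B B}
  {x : Fin n → B}

namespace IsDualFrame

/-- Induction on the degree. The partial derivatives of a relation are relations of smaller degree,
hence zero. Exponents below `p` are invertible, so every nonconstant coefficient vanishes, and the
constant term is then the relation itself. -/
theorem eq_zero_of_mem_restrictDegree (h : IsDualFrame R E x) (hp : p.Prime) (hB : (p : B) = 0)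
    {P : MvPolynomial (Fin n) R} (hP : P ∈ MvPolynomial.restrictDegree (Fin n) R (p - 1))
    (h0 : MvPolynomial.eval₂Hom R.subtype x P = 0) : P = 0 := by
  have key : ∀ (d : ℕ) (P : MvPolynomial (Fin n) R),
      P ∈ MvPolynomial.restrictDegree (Fin n) R (p - 1) →
      MvPolynomial.eval₂Hom R.subtype x P = 0 → (∀ s : Fin n →₀ ℕ, d ≤ s.degree → MvPolynomial.coeff s P = 0) →
      P = 0 := by
    intro d
    induction d with
    | zero => exact fun P _ _ h => MvPolynomial.ext _ _ fun s => h s (Nat.zero_le _)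
    | succ d ih =>
      intro P hP h0 hd
      rw [MvPolynomial.mem_restrictDegree] at hP
      have h1 : ∀ i, MvPolynomial.pderiv i P = 0 := by
        intro i
        refine ih _ ?_ (by rw [h.eval₂_pderiv, h0, map_zero]) fun s hs => ?_
        · rw [MvPolynomial.mem_restrictDegree]
          intro s hs j
          rw [MvPolynomial.mem_support_iff, MvPolynomial.coeff_pderiv] at hs
          exact le_trans (by simp) (hP _ (MvPolynomial.mem_support_iff.2 (left_ne_zero_of_mul hs)) j)
        · rw [MvPolynomial.coeff_pderiv, hd, zero_mul]
          rw [map_add, Finsupp.degree_single]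
          exact Nat.add_le_add_right hs 1
      have h2 : ∀ s : Fin n →₀ ℕ, s ≠ 0 → MvPolynomial.coeff s P = 0 := by
        intro s hs
        by_contra hne
        obtain ⟨i, hi⟩ := Finsupp.ne_iff.1 hs
        have hsi := hP s (MvPolynomial.mem_support_iff.2 hne) i
        have h3 := MvPolynomial.coeff_pderiv (i := i) P (s - Finsupp.single i 1)
        have hi' : 1 ≤ s i := Nat.one_le_iff_ne_zero.2 hi
        have hle : Finsupp.single i 1 ≤ s := by simpa using hi'
        rw [h1, MvPolynomial.coeff_zero, tsub_add_cancel_of_le hle] at h3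
        obtain ⟨m, hm⟩ := Nat.exists_eq_add_of_le hi'
        have h4 : MvPolynomial.coeff s P * (m + 1 : ℕ) = 0 := by
          rw [h3]
          congr 1
          rw [Finsupp.tsub_apply, Finsupp.single_eq_same, hm]
          simp
        have hR : (p : R) = 0 := Subtype.ext (by simpa using hB)
        have hm' : m + 1 < p := by have := hp.pos; lia
        have h5 := invFactorial_mul hp hR hm'
        apply hne
        rw [← mul_one (MvPolynomial.coeff s P), ← h5, Nat.factorial_succ, Nat.cast_mul]
        linear_combination (invFactorial p (m + 1) * m.factorial : R) * h4
      have h6 : P = MvPolynomial.C (MvPolynomial.coeff 0 P) := MvPolynomial.ext _ _ fun s => by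
        rw [MvPolynomial.coeff_C]
        split_ifs with hs
        · rw [hs]
        · exact h2 s (Ne.symm hs)
      rw [h6] at h0 ⊢
      have : ((MvPolynomial.coeff 0 P : R) : B) = 0 := by simpa using h0
      rw [show MvPolynomial.coeff 0 P = 0 from Subtype.ext this, map_zero]
  refine key (P.totalDegree + 1) P hP h0 fun s hs => ?_
  refine MvPolynomial.coeff_eq_zero_of_totalDegree_lt ?_
  rw [Finsupp.degree_apply] at hs
  exact hs

/-- Divide every exponent by `p` with remainder and replace `X_k ^ (p a)` by `c_k ^ a`. -/
theorem exists_sub_mem_restrictDegree {A : Type u} [CommRing A] (hp : p.Prime) (c : Fin n → A)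
    (P : MvPolynomial (Fin n) A) : ∃ Q ∈ MvPolynomial.restrictDegree (Fin n) A (p - 1),
      P - Q ∈ Ideal.span (Set.range fun k => MvPolynomial.X k ^ p - MvPolynomial.C (c k)) := by
  set I := Ideal.span (Set.range fun k : Fin n => MvPolynomial.X k ^ p - MvPolynomial.C (c k))
  induction P using MvPolynomial.induction_on' with
  | monomial s a =>
    refine ⟨MvPolynomial.monomial (s.mapRange (· % p) (Nat.zero_mod p))
      (a * ∏ k, c k ^ (s k / p)), ?_, ?_⟩
    · rw [MvPolynomial.mem_restrictDegree]
      intro t ht k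
      rw [Finset.mem_singleton.1 (MvPolynomial.support_monomial_subset ht)]
      exact Nat.le_sub_one_of_lt (Nat.mod_lt _ hp.pos)
    · rw [← Ideal.Quotient.eq, MvPolynomial.monomial_eq, MvPolynomial.monomial_eq,
        Finsupp.prod_fintype _ _ (fun _ => pow_zero _), Finsupp.prod_fintype _ _ (fun _ => pow_zero _)]
      simp only [map_mul, map_prod, map_pow, Finsupp.mapRange_apply]
      rw [mul_assoc, ← Finset.prod_mul_distrib]
      congr 1
      refine Finset.prod_congr rfl fun k _ => ?_
      have : Ideal.Quotient.mk I (MvPolynomial.X k) ^ p = Ideal.Quotient.mk I (MvPolynomial.C (c k)) := by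
        rw [← map_pow, Ideal.Quotient.eq]
        exact Ideal.subset_span ⟨k, rfl⟩
      rw [← this, ← pow_mul, ← pow_add, Nat.div_add_mod]
  | add P P' hP hP' =>
    obtain ⟨Q, hQ, h⟩ := hP
    obtain ⟨Q', hQ', h'⟩ := hP'
    refine ⟨Q + Q', add_mem hQ hQ', ?_⟩
    rw [add_sub_add_comm]
    exact add_mem h h'

theorem ker_eval₂Hom (h : IsDualFrame R E x) (hp : p.Prime) (hB : (p : B) = 0) (c : Fin n → R)
    (hc : ∀ k, (c k : B) = x k ^ p) :
    RingHom.ker (MvPolynomial.eval₂Hom R.subtype x) =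
      Ideal.span (Set.range fun k => MvPolynomial.X k ^ p - MvPolynomial.C (c k)) := by
  have hle : Ideal.span (Set.range fun k => MvPolynomial.X k ^ p - MvPolynomial.C (c k)) ≤
      RingHom.ker (MvPolynomial.eval₂Hom R.subtype x) := by
    rw [Ideal.span_le]
    rintro _ ⟨k, rfl⟩
    simp [hc]
  refine le_antisymm (fun P hP => ?_) hle
  obtain ⟨Q, hQ, hPQ⟩ := exists_sub_mem_restrictDegree hp c P
  have h1 : MvPolynomial.eval₂Hom R.subtype x Q = 0 := by
    have := sub_mem hP (hle hPQ)
    rwa [sub_sub_cancel] at this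
  rwa [h.eq_zero_of_mem_restrictDegree hp hB hQ h1, sub_zero] at hPQ

/-- The monomials in `x` with exponents below `p` form a basis: they generate by reduction of
exponents, and there are no relations of restricted degree. -/
theorem free (h : IsDualFrame R E x) (hp : p.Prime) (hB : (p : B) = 0)
    (hE : ∀ i b, (E i)^[p] b = 0) : Module.Free R B := by
  have hR : ∀ i, x i ^ p ∈ R := fun i => (h.mem_iff _).2 fun j => by
    rw [Derivation.leibniz_pow, nsmul_eq_mul, hB, zero_mul]
  let e : MvPolynomial.restrictDegree (Fin n) R (p - 1) →ₗ[R] B :=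
    (MvPolynomial.aeval (R := R) x).toLinearMap.domRestrict _
  have he : ∀ P, e P = MvPolynomial.eval₂Hom R.subtype x P.1 := fun P => rfl
  have hbij : Function.Bijective e := by
    constructor
    · rw [injective_iff_map_eq_zero]
      exact fun P hP => Subtype.ext (h.eq_zero_of_mem_restrictDegree hp hB P.2 hP)
    · intro b
      obtain ⟨P, rfl⟩ := h.surjective_eval₂Hom hp hB hE b
      obtain ⟨Q, hQ, hPQ⟩ := exists_sub_mem_restrictDegree hp (fun k => (⟨_, hR k⟩ : R)) P
      refine ⟨⟨Q, hQ⟩, ?_⟩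
      rw [← h.ker_eval₂Hom hp hB (fun k => (⟨_, hR k⟩ : R)) fun k => rfl, RingHom.mem_ker, map_sub,
        sub_eq_zero] at hPQ
      exact hPQ.symm
  have := Module.Free.of_basis (MvPolynomial.basisRestrictSupport R
    {s : Fin n →₀ ℕ | ∀ i, s i ≤ p - 1})
  exact Module.Free.of_equiv' this (LinearEquiv.ofBijective e hbij)

end IsDualFrame

end Presentation

/-! ### Rings of constants in characteristic zero -/

section CharZero

variable {B : Type u} [CommRing B] {J : Ideal B}

/-- Here `b - x c` is the Taylor series `∑ (-x) ^ k E ^ k b / k!`, whose terms after the first are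
divisible by `x`. It converges because `x ∈ J`, and `E` of its partial sums tends to zero by
telescoping. -/
theorem exists_derivation_sub_mul_eq_zero (hB : ∀ n : ℕ, n ≠ 0 → IsUnit (n : B))
    [IsAdicComplete J B] (E : Derivation ℤ B B) {x : B} (hx : E x = 1) (hxJ : x ∈ J) (b : B) :
    ∃ c, E (b - x * c) = 0 := by
  have hu : ∀ k : ℕ, ∃ u : B, u * k.factorial = 1 := fun k =>
    (hB _ k.factorial_ne_zero).exists_left_inv
  choose u hu using hu
  have hu' : ∀ k, u (k + 1) * (k + 1 : ℕ) = u k := fun k => by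
    have h1 := hu (k + 1)
    rw [Nat.factorial_succ, Nat.cast_mul] at h1
    linear_combination (-u (k + 1) * (k + 1 : ℕ)) * hu k + u k * h1
  let s : ℕ → B := fun N => ∑ k ∈ Finset.range N, u (k + 1) * (-x) ^ k * E^[k + 1] b
  have hs : ∀ N, E (b - x * s N) = u N * (-x) ^ N * E^[N + 1] b := by
    intro N
    induction N with
    | zero => simpa [s] using (show E b = u 0 * E b by have := hu 0; simp at this; simp [this])
    | succ N ih =>
      have : b - x * s (N + 1) = (b - x * s N) + u (N + 1) * ((-x) ^ (N + 1) * E^[N + 1] b) := by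
        simp only [s, Finset.sum_range_succ]; ring
      -- The inverse of the factorial is merely some element of `B`; that it is a constant follows
      -- by differentiating its defining equation.
      have h0 : E (u (N + 1)) = 0 := by
        have h1 := congrArg E (hu (N + 1))
        rw [Derivation.leibniz, Derivation.map_natCast, smul_zero, zero_add, Derivation.map_one_eq_zero,
          smul_eq_mul] at h1
        exact (hB _ (Nat.factorial_ne_zero _)).mul_right_eq_zero.1 h1
      rw [this, map_add, ih, Derivation.leibniz, h0, Derivation.leibniz, Derivation.leibniz_pow,
        map_neg, hx, ← hu' N, Function.iterate_succ_apply' E (N + 1)]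
      simp only [nsmul_eq_mul, smul_eq_mul, Nat.add_sub_cancel]
      ring
  obtain ⟨c, hc⟩ := exists_limit J s fun N => by
    simp only [s, Finset.sum_range_succ, add_sub_cancel_left]
    exact Ideal.mul_mem_right _ _ (Ideal.mul_mem_left _ _ (Ideal.pow_mem_pow (neg_mem hxJ) N))
  refine ⟨c, eq_zero_of_forall_mem_pow J fun N => ?_⟩
  have h1 : E (x * (c - s (N + 1))) ∈ J ^ N := by
    have := derivation_mem_pow E J N (Ideal.mul_mem_left _ x (hc (N + 1)))
    exact this
  have h2 : E (b - x * s (N + 1)) ∈ J ^ N := by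
    rw [hs]
    exact Ideal.mul_mem_right _ _ (Ideal.mul_mem_left _ _
      (Ideal.pow_le_pow_right N.le_succ (Ideal.pow_mem_pow (neg_mem hxJ) _)))
  have := sub_mem h2 h1
  rw [← map_sub] at this
  convert this using 2
  ring

/-- Differentiating the constant `x c` repeatedly gives `k! x c = (-1) ^ k x ^ (k + 1) E ^ k c`, so
`x c` lies in every power of `J`. -/
theorem mul_eq_zero_of_derivation_eq_zero (hB : ∀ n : ℕ, n ≠ 0 → IsUnit (n : B))
    [IsHausdorff J B] (E : Derivation ℤ B B) {x : B} (hx : E x = 1) (hxJ : x ∈ J) {c : B}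
    (h : E (x * c) = 0) : x * c = 0 := by
  refine eq_zero_of_forall_mem_pow J fun N => ?_
  have h1 : ∀ k, x * c * (k.factorial : B) = (-1) ^ k * (x ^ (k + 1) * E^[k] c) := by
    intro k
    induction k with
    | zero => simp
    | succ k ih =>
      have := congrArg E ih
      rw [Derivation.leibniz, h, Derivation.map_natCast, Derivation.leibniz, Derivation.leibniz,
        Derivation.leibniz_pow, Derivation.leibniz_pow, map_neg, hx,
        ← Function.iterate_succ_apply' E] at this
      simp at this
      have h2 : ((-1 : B)) ^ k * (-1) ^ k = 1 := by rw [← mul_pow]; simp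
      have h3 : x ^ (k + 1) * E^[k] (E c) = -((k + 1) * x ^ k * E^[k] c) := by
        linear_combination -(-1 : B) ^ k * this - (x ^ (k + 1) * E^[k] (E c) + (k + 1) * x ^ k * E^[k] c) * h2
      rw [Function.iterate_succ_apply, Nat.factorial_succ, Nat.cast_mul, pow_succ x (k + 1), pow_succ (-1 : B) k]
      push_cast
      linear_combination (k + 1 : B) * ih + (-1 : B) ^ k * x * h3
  have h2 : x * c * (N.factorial : B) ∈ J ^ N := by
    rw [h1]
    exact Ideal.mul_mem_left _ _ (Ideal.mul_mem_right _ _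
      (Ideal.pow_le_pow_right N.le_succ (Ideal.pow_mem_pow hxJ _)))
  obtain ⟨v, hv⟩ := (hB _ N.factorial_ne_zero).exists_right_inv
  have := Ideal.mul_mem_right v _ h2
  rwa [mul_assoc, hv, mul_one] at this

end CharZero

/-! ### The ring retraction and formal smoothness in characteristic zero -/

section CharZero

variable {B : Type u} [CommRing B] {J : Ideal B} {n : ℕ} {R : Subring B}
  {E : Fin n → Derivation ℤ B B} {x : Fin n → B}

namespace IsDualFrame

/-- The directions are corrected one at a time. After a correction by `x_i c`, a derivation `E_j`
treated before maps the result to a multiple of `x_i` which, by commutation, is killed by `E_i`;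
such a multiple is zero. -/
theorem exists_sub_mem_span (h : IsDualFrame R E x) (hB : ∀ n : ℕ, n ≠ 0 → IsUnit (n : B))
    [IsAdicComplete J B] (hJ : ∀ i, x i ∈ J) (b : B) :
    ∃ r ∈ R, b - r ∈ Ideal.span (Set.range x) := by
  have key : ∀ (l : List (Fin n)), ∃ r, (∀ i ∈ l, E i r = 0) ∧ b - r ∈ Ideal.span (Set.range x) := by
    intro l
    induction l with
    | nil => exact ⟨b, by simp, by simp⟩
    | cons i l ih =>
      obtain ⟨r, hr, hr'⟩ := ih
      have hxi : E i (x i) = 1 := by rw [h.dual, if_pos rfl]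
      obtain ⟨c, hc⟩ := exists_derivation_sub_mul_eq_zero hB (E i) hxi (hJ i) r
      refine ⟨r - x i * c, fun j hj => ?_, ?_⟩
      · rcases eq_or_ne j i with rfl | hji
        · exact hc
        · have h1 : E j (r - x i * c) = x i * -E j c := by
            rw [map_sub, hr j (List.mem_of_ne_of_mem hji hj), Derivation.leibniz, h.dual, if_neg hji]
            simp
          have h2 := h.commute j i (r - x i * c)
          rw [hc, map_zero, h1] at h2
          rw [h1]
          exact mul_eq_zero_of_derivation_eq_zero hB (E i) hxi (hJ i) h2.symm
      · have := add_mem hr' (Ideal.mul_mem_right c _ (Ideal.subset_span (Set.mem_range_self i)))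
        convert this using 1
        ring
  obtain ⟨r, hr, hr'⟩ := key (List.finRange n)
  exact ⟨r, (h.mem_iff r).2 fun i => hr i (List.mem_finRange i), hr'⟩

/-- The generators are removed one at a time. If `r = a x_i + y` with `y` in the ideal of the
remaining ones, change `y` by a multiple of `x_i` into an element of that ideal that is constant
along `E_i`. The rest is a multiple of `x_i` that is killed by `E_i`, hence zero. -/
theorem eq_zero_of_mem_span (h : IsDualFrame R E x) (hB : ∀ n : ℕ, n ≠ 0 → IsUnit (n : B))
    [IsAdicComplete J B] (hJ : ∀ i, x i ∈ J) {r : B} (hr : r ∈ R)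
    (hr' : r ∈ Ideal.span (Set.range x)) : r = 0 := by
  have key : ∀ (l : List (Fin n)), r ∈ Ideal.span (x '' {i | i ∈ l}) → r = 0 := by
    intro l
    induction l with
    | nil => simp
    | cons i l ih =>
      intro hrl
      have hxi : E i (x i) = 1 := by rw [h.dual, if_pos rfl]
      have h1 : ∀ y ∈ Ideal.span (x '' {i | i ∈ l}), ∃ c, y - x i * c ∈ Ideal.span (x '' {i | i ∈ l}) ∧
          E i (y - x i * c) = 0 := by
        intro y hy
        refine Submodule.span_induction (p := fun y _ => ∀ a, ∃ c,
          a * y - x i * c ∈ Ideal.span (x '' {i | i ∈ l}) ∧ E i (a * y - x i * c) = 0)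
          ?_ ?_ ?_ ?_ hy 1 |>.imp fun c hc => by simpa using hc
        · rintro _ ⟨j, hj, rfl⟩ a
          rcases eq_or_ne i j with rfl | hij
          · exact ⟨a, by rw [mul_comm, sub_self]; exact ⟨zero_mem _, map_zero _⟩⟩
          · obtain ⟨c, hc⟩ := exists_derivation_sub_mul_eq_zero hB (E i) hxi (hJ i) a
            refine ⟨x j * c, ?_, ?_⟩
            · have := Ideal.mul_mem_left _ (a - x i * c) (Ideal.subset_span (Set.mem_image_of_mem x hj))
              convert this using 1
              ring
            · rw [show a * x j - x i * (x j * c) = (a - x i * c) * x j by ring, Derivation.leibniz, hc,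
                h.dual, if_neg hij]
              simp
        · exact fun a => ⟨0, by simp⟩
        · intro y z _ _ hy hz a
          obtain ⟨c, hc, hc'⟩ := hy a
          obtain ⟨d, hd, hd'⟩ := hz a
          refine ⟨c + d, ?_⟩
          rw [show a * (y + z) - x i * (c + d) = (a * y - x i * c) + (a * z - x i * d) by ring]
          exact ⟨add_mem hc hd, by rw [map_add, hc', hd', add_zero]⟩
        · intro b y _ hy a
          rw [smul_eq_mul, ← mul_assoc]
          exact hy _
      rw [show x '' {j | j ∈ i :: l} = insert (x i) (x '' {j | j ∈ l}) by
        rw [← Set.image_insert_eq]; congr 1; ext j; simp] at hrl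
      obtain ⟨a, y, hy, hay⟩ := Ideal.mem_span_insert.1 hrl
      obtain ⟨c, hc, hc'⟩ := h1 y hy
      have h2 : x i * (a + c) = 0 := mul_eq_zero_of_derivation_eq_zero hB (E i) hxi (hJ i) <| by
        rw [show x i * (a + c) = r - (y - x i * c) by rw [hay]; ring, map_sub, hc',
          (h.mem_iff r).1 hr, sub_zero]
      refine ih ?_
      convert hc using 1
      rw [hay]
      linear_combination h2
  refine key (List.finRange n) ?_
  simpa using hr'

/-- The two preceding results say that `B = R ⊕ (x)`. The projection with kernel the ideal `(x)` is
a ring homomorphism, so it can serve as both `π` and `θ` with exponent one; as `(x) ⊆ J`, it maps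
`J` into `J ∩ R`. -/
theorem exists_isRetraction (h : IsDualFrame R E x) (hB : ∀ n : ℕ, n ≠ 0 → IsUnit (n : B))
    [IsAdicComplete J B] (hJ : ∀ i, x i ∈ J) :
    ∃ π : B →+* B, IsRetraction R x J 1 π π := by
  choose π hπ hπ' using h.exists_sub_mem_span hB hJ
  have huniq : ∀ {b r : B}, r ∈ R → b - r ∈ Ideal.span (Set.range x) → π b = r := by
    intro b r hr hbr
    rw [← sub_eq_zero]
    refine h.eq_zero_of_mem_span hB hJ (sub_mem (hπ b) hr) ?_
    have := sub_mem hbr (hπ' b)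
    convert this using 1
    ring
  let π' : B →+* B :=
    { toFun := π
      map_one' := huniq R.one_mem (by simp)
      map_zero' := huniq R.zero_mem (by simp)
      map_mul' := fun a b => huniq (R.mul_mem (hπ a) (hπ b)) <| by
        have := add_mem (Ideal.mul_mem_right b _ (hπ' a)) (Ideal.mul_mem_left _ (π a) (hπ' b))
        convert this using 1
        ring
      map_add' := fun a b => huniq (R.add_mem (hπ a) (hπ b)) <| by
        have := add_mem (hπ' a) (hπ' b)
        convert this using 1
        ring }
  have hxJ : Ideal.span (Set.range x) ≤ J := by
    rw [Ideal.span_le]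
    rintro _ ⟨i, rfl⟩
    exact hJ i
  have hself : ∀ r ∈ R, π r = r := fun r hr => huniq hr (by simp)
  have hsub : ∀ b, π b - b ^ 1 ∈ Ideal.span (Set.range x) := fun b => by
    rw [← neg_mem_iff, pow_one, neg_sub]
    exact hπ' b
  refine ⟨π', one_ne_zero, hπ, hself, fun r hr b => ?_, hπ', hπ, fun r hr => ?_, hsub,
    fun b => hxJ (hsub b), fun k => ⟨k, fun b hb => ?_⟩⟩
  · change π' (r * b) = r * π' b
    rw [map_mul]
    congr 1
    exact hself r hr
  · rw [pow_one]
    exact hself r hr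
  · have := mem_pow_of_mem_pow (φ := π'.codRestrict R hπ) (J := J.comap R.subtype) (n := k) ?_ hb
    · exact ⟨_, this, rfl⟩
    · rw [Ideal.map_le_iff_le_comap]
      intro b hb
      change π b ∈ J
      have := add_mem (hxJ (hsub b)) (pow_one b ▸ hb)
      simpa using this

/-- Both sides are constants that differ by an element of `(x)`, and a constant in `(x)` is zero. -/
theorem retraction_natural (h : IsDualFrame R E x) (hB : ∀ n : ℕ, n ≠ 0 → IsUnit (n : B))
    [IsAdicComplete J B] (hJ : ∀ i, x i ∈ J) {A : Type v} [CommRing A] {R' : Subring A}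
    {x' : Fin n → A} {J' : Ideal A} {e e' : ℕ} {π' : A →+ A} {θ' : A →+* A} {π : B →+ B} {θ : B →+* B}
    (hπ' : IsRetraction R' x' J' e' π' θ') (hπ : IsRetraction R x J e π θ) (φ : A →+* B)
    (hφ : ∀ r ∈ R', φ r ∈ R) (hx : ∀ i, φ (x' i) = x i) (a : A) : π (φ a) = φ (π' a) := by
  rw [← sub_eq_zero]
  refine h.eq_zero_of_mem_span hB hJ (sub_mem (hπ.mem _) (hφ _ (hπ'.mem a))) ?_
  have h1 : φ (a - π' a) ∈ Ideal.span (Set.range x) := by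
    have : (Ideal.span (Set.range x')).map φ ≤ Ideal.span (Set.range x) := by
      rw [Ideal.map_span, Ideal.span_le]
      rintro _ ⟨_, ⟨i, rfl⟩, rfl⟩
      exact Ideal.subset_span ⟨i, (hx i).symm⟩
    exact this (Ideal.mem_map_of_mem φ (hπ'.sub_mem a))
  have := sub_mem h1 (hπ.sub_mem (φ a))
  rw [map_sub] at this
  convert this using 1
  ring

/-- No polynomial in the `x_i` over `R` has larger order than it visibly has. By induction,
differentiation lowers the order by one, and since integers are invertible the coefficients of the
partial derivatives determine all but the constant coefficient; that one is a constant in `(x)`. -/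
theorem mem_pow_idealOfVars (h : IsDualFrame R E x) (hB : ∀ n : ℕ, n ≠ 0 → IsUnit (n : B))
    [IsAdicComplete J B] (hJ : ∀ i, x i ∈ J) (m : ℕ) {P : MvPolynomial (Fin n) R}
    (hP : MvPolynomial.eval₂Hom R.subtype x P ∈ Ideal.span (Set.range x) ^ m) :
    P ∈ MvPolynomial.idealOfVars (Fin n) R ^ m := by
  induction m generalizing P with
  | zero => simp
  | succ m ih =>
    have h1 : ∀ i, MvPolynomial.pderiv i P ∈ MvPolynomial.idealOfVars (Fin n) R ^ m := fun i => by
      refine ih ?_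
      rw [h.eval₂_pderiv]
      exact derivation_mem_pow _ _ _ hP
    rw [MvPolynomial.mem_pow_idealOfVars_iff']
    intro s hs
    by_cases h0 : s = 0
    · subst h0
      have h2 : MvPolynomial.eval₂Hom R.subtype x (P - MvPolynomial.C (P.coeff 0)) ∈
          Ideal.span (Set.range x) := by
        have h4 : P - MvPolynomial.C (P.coeff 0) ∈ MvPolynomial.idealOfVars (Fin n) R ^ 1 := by
          rw [MvPolynomial.mem_pow_idealOfVars_iff']
          intro s hs
          have : s = 0 := by
            rw [← Finsupp.degree_eq_zero_iff]
            lia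
          rw [this]
          simp
        rw [pow_one] at h4
        have h5 : (MvPolynomial.idealOfVars (Fin n) R).map (MvPolynomial.eval₂Hom R.subtype x) ≤
            Ideal.span (Set.range x) := by
          rw [MvPolynomial.idealOfVars, Ideal.map_span, Ideal.span_le]
          rintro _ ⟨_, ⟨i, rfl⟩, rfl⟩
          exact Ideal.subset_span ⟨i, by simp⟩
        exact h5 (Ideal.mem_map_of_mem _ h4)
      have h3 := sub_mem (Ideal.pow_le_self m.succ_ne_zero hP) h2
      rw [map_sub, sub_sub_cancel, MvPolynomial.coe_eval₂Hom, MvPolynomial.eval₂_C] at h3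
      exact Subtype.ext (h.eq_zero_of_mem_span hB hJ (P.coeff 0).2 h3)
    · obtain ⟨i, hi⟩ := Finsupp.ne_iff.1 h0
      have hi' : 1 ≤ s i := Nat.one_le_iff_ne_zero.2 hi
      have hle : Finsupp.single i 1 ≤ s := by simpa using hi'
      have h3 := MvPolynomial.coeff_pderiv (i := i) P (s - Finsupp.single i 1)
      have hdeg := congrArg Finsupp.degree (tsub_add_cancel_of_le hle)
      rw [map_add, Finsupp.degree_single] at hdeg
      have h4 := (MvPolynomial.mem_pow_idealOfVars_iff' _ _).1 (h1 i) (s - Finsupp.single i 1) (by lia)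
      obtain ⟨k, hk⟩ := Nat.exists_eq_add_of_le hi'
      rw [h4, tsub_add_cancel_of_le hle, Finsupp.tsub_apply, Finsupp.single_eq_same, hk,
        Nat.add_sub_cancel_left] at h3
      have h5 := congrArg (Subtype.val) h3
      apply Subtype.ext
      refine (hB (k + 1) k.succ_ne_zero).mul_left_eq_zero.1 ?_
      push_cast at h5 ⊢
      exact h5.symm

/-- Iterate `b ≡ π b` modulo `(x)`: the coefficients of the remainder with respect to the `x_i` are
themselves approximated to order `m`. -/
theorem exists_eval_sub_mem (π : B →+ B) {e : ℕ} {θ : B →+* B}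
    (hπ : IsRetraction R x J e π θ) (m : ℕ) (b : B) : ∃ P : MvPolynomial (Fin n) R,
      b - MvPolynomial.eval₂Hom R.subtype x P ∈ Ideal.span (Set.range x) ^ m := by
  induction m generalizing b with
  | zero => exact ⟨0, by simp⟩
  | succ m ih =>
    have key : ∀ y ∈ Ideal.span (Set.range x), ∃ P : MvPolynomial (Fin n) R,
        y - MvPolynomial.eval₂Hom R.subtype x P ∈ Ideal.span (Set.range x) ^ (m + 1) := by
      intro y hy
      refine Submodule.span_induction (p := fun y _ => ∀ a, ∃ P : MvPolynomial (Fin n) R,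
        a * y - MvPolynomial.eval₂Hom R.subtype x P ∈ Ideal.span (Set.range x) ^ (m + 1))
        ?_ ?_ ?_ ?_ hy 1 |>.imp fun c hc => by simpa using hc
      · rintro _ ⟨i, rfl⟩ a
        obtain ⟨P, hP⟩ := ih a
        refine ⟨P * MvPolynomial.X i, ?_⟩
        rw [map_mul, MvPolynomial.coe_eval₂Hom, MvPolynomial.eval₂_X, ← sub_mul, pow_succ]
        exact Ideal.mul_mem_mul hP (Ideal.subset_span (Set.mem_range_self i))
      · exact fun a => ⟨0, by simp⟩
      · intro y z _ _ hy hz a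
        obtain ⟨P, hP⟩ := hy a
        obtain ⟨Q, hQ⟩ := hz a
        refine ⟨P + Q, ?_⟩
        rw [mul_add, map_add, add_sub_add_comm]
        exact add_mem hP hQ
      · intro c y _ hy a
        rw [smul_eq_mul, ← mul_assoc]
        exact hy _
    obtain ⟨P, hP⟩ := key _ (hπ.sub_mem b)
    refine ⟨MvPolynomial.C ⟨π b, hπ.mem b⟩ + P, ?_⟩
    rw [map_add, MvPolynomial.coe_eval₂Hom, MvPolynomial.eval₂_C, ← sub_sub]
    exact hP

/-- Modulo any power of `(x)` the ring `B` is a truncated polynomial ring over `R`. Lifting the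
images of the `x_i` defines a homomorphism on the polynomial ring; it kills a power of the variables
and therefore descends to `B`. -/
theorem isAdicallyFormallySmooth (h : IsDualFrame R E x) (hB : ∀ n : ℕ, n ≠ 0 → IsUnit (n : B))
    [IsAdicComplete J B] (hJ : ∀ i, x i ∈ J) : IsAdicallyFormallySmooth R.subtype J := by
  obtain ⟨π, hπ⟩ := h.exists_isRetraction hB hJ
  intro C _ N hN α β ⟨m, hm⟩ hαβ
  choose y hy using fun i => Ideal.Quotient.mk_surjective (β (x i))
  have hxJ : Ideal.span (Set.range x) ≤ J := by
    rw [Ideal.span_le]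
    rintro _ ⟨i, rfl⟩
    exact hJ i
  let ε := MvPolynomial.eval₂Hom R.subtype x
  let γ := MvPolynomial.eval₂Hom α y
  have hγ : (Ideal.Quotient.mk N).comp γ = β.comp ε := by
    refine MvPolynomial.ringHom_ext (fun r => ?_) fun i => ?_
    · simpa [γ, ε] using (RingHom.congr_fun hαβ r).symm
    · simp [γ, ε, hy]
  have hε : (MvPolynomial.idealOfVars (Fin n) R).map ε ≤ J := by
    rw [MvPolynomial.idealOfVars, Ideal.map_span, Ideal.span_le]
    rintro _ ⟨_, ⟨i, rfl⟩, rfl⟩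
    simpa [ε] using hJ i
  -- The exponent `m * 2`: the `m`-th power of the variables goes into `N`, and `N ^ 2 = 0`.
  have hker : MvPolynomial.idealOfVars (Fin n) R ^ (m * 2) ≤ RingHom.ker γ := by
    have h1 : (MvPolynomial.idealOfVars (Fin n) R ^ m).map γ ≤ N := by
      rw [Ideal.map_le_iff_le_comap]
      intro P hP
      rw [Ideal.mem_comap, ← Ideal.Quotient.eq_zero_iff_mem]
      have := RingHom.congr_fun hγ P
      rw [RingHom.comp_apply] at this
      rw [this]
      exact hm (mem_pow_of_mem_pow hε hP)
    rw [pow_mul]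
    intro P hP
    have := mem_pow_of_mem_pow h1 hP
    rwa [hN] at this
  let σ := (Ideal.Quotient.mk (Ideal.span (Set.range x) ^ (m * 2))).comp ε
  have hσ : Function.Surjective σ := by
    intro b
    obtain ⟨b, rfl⟩ := Ideal.Quotient.mk_surjective b
    obtain ⟨P, hP⟩ := exists_eval_sub_mem _ hπ (m * 2) b
    exact ⟨P, (Ideal.Quotient.eq.2 hP).symm⟩
  have hσγ : RingHom.ker σ ≤ RingHom.ker γ := fun P hP =>
    hker (h.mem_pow_idealOfVars hB hJ _ (Ideal.Quotient.eq_zero_iff_mem.1 hP))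
  let δ := RingHom.liftOfSurjective σ hσ ⟨γ, hσγ⟩
  have hδ : ∀ P, δ (Ideal.Quotient.mk _ (ε P)) = γ P := fun P =>
    RingHom.liftOfSurjective_comp_apply σ hσ ⟨γ, hσγ⟩ P
  refine ⟨δ.comp (Ideal.Quotient.mk _), ?_, ?_⟩
  · ext r
    have := hδ (MvPolynomial.C r)
    simpa [ε, γ] using this
  · ext b
    obtain ⟨P, hP⟩ := exists_eval_sub_mem _ hπ (m * 2) b
    rw [RingHom.comp_apply, RingHom.comp_apply, Ideal.Quotient.eq.2 hP, hδ]
    have h1 := RingHom.congr_fun hγ P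
    rw [RingHom.comp_apply, RingHom.comp_apply] at h1
    rw [h1, ← sub_eq_zero, ← map_sub, ← RingHom.mem_ker, ← neg_mem_iff, neg_sub]
    exact hm (Ideal.pow_right_mono hxJ m (Ideal.pow_le_pow_right (Nat.le_mul_of_pos_right m two_pos) hP))

end IsDualFrame

end CharZero

/-! ### Construction of morphisms -/

section Morphisms

variable {X Y : LocallyRingedSpace.{u}}

/-- A morphism of locally ringed spaces is given by a continuous map and compatible homomorphisms
of the rings of sections that preserve the sections not vanishing at a point. -/
def homMk (b : C(X, Y))
    (φ : ∀ V : Opens Y, Sec Y V →+* Sec X (Opens.comap b V))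
    (hφ : ∀ (V V' : Opens Y) (h : V' ≤ V) (s : Sec Y V),
      φ V' (res h s) = res (U := Opens.comap b V) (W := Opens.comap b V') (fun _ hx => h hx) (φ V s))
    (hloc : ∀ (V : Opens Y) (s : Sec Y V) (x : X) (hx : b x ∈ V), VanishesAt s (b x) hx →
      VanishesAt (φ V s) x hx) : X ⟶ Y where
  base := TopCat.ofHom b
  c := { app := fun V => CommRingCat.ofHom (φ V.unop)
         naturality := fun V V' i => by
          refine CommRingCat.hom_ext (RingHom.ext fun s => ?_)
          exact hφ V.unop V'.unop i.unop.le s }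
  prop x := by
    refine ⟨fun a ha => ?_⟩
    obtain ⟨V, hx, s, rfl⟩ := Y.presheaf.exists_germ_eq a
    by_contra h
    have h1 : VanishesAt s (b x) hx := (vanishesAt_iff_germ s (b x) hx).2 h
    have h2 := (vanishesAt_iff_germ _ x hx).1 (hloc V s x hx h1)
    refine h2 ?_
    have h3 := ConcreteCategory.congr_hom (PresheafedSpace.stalkMap_germ
      (X := X.toPresheafedSpace) (Y := Y.toPresheafedSpace)
      ⟨TopCat.ofHom b, { app := fun V => CommRingCat.ofHom (φ V.unop), naturality := fun V V' i =>
        CommRingCat.hom_ext (RingHom.ext fun s => hφ V.unop V'.unop i.unop.le s) }⟩ V x hx) s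
    rw [CommRingCat.comp_apply, CommRingCat.comp_apply] at h3
    erw [h3] at ha
    exact ha

theorem hom_ext {f g : X ⟶ Y} (hb : ∀ x, f.base x = g.base x)
    (h : ∀ (V : Opens Y) (W : Opens X) (hf : W ≤ preim f V) (hg : W ≤ preim g V) (s : Sec Y V),
      pull f hf s = pull g hg s) : f = g := by
  obtain ⟨⟨fb, fc⟩, hf⟩ := f
  obtain ⟨⟨gb, gc⟩, hg⟩ := g
  have hb' : fb = gb := TopCat.hom_ext (ContinuousMap.ext hb)
  subst hb'
  have hc : fc = gc := by
    refine NatTrans.ext (funext fun V' => CommRingCat.hom_ext (RingHom.ext fun s => ?_))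
    obtain ⟨V⟩ := V'
    have := h V ((Opens.map fb).obj V) le_rfl le_rfl s
    rw [pull, pull, RingHom.comp_apply, RingHom.comp_apply, res_self, res_self] at this
    exact this
  subst hc
  rfl

end Morphisms

/-! ### The quotient by a sheaf of subrings -/

section Quotient

variable {X S : LocallyRingedSpace.{u}}

/-- A subsheaf of rings of the structure sheaf that contains the inverses of its units. -/
structure IsSubringSheaf (R : ∀ U : Opens X, Subring (Sec X U)) : Prop where
  res_mem : ∀ (U W : Opens X) (h : W ≤ U), ∀ a ∈ R U, res h a ∈ R W
  mem_of_local : ∀ (U : Opens X) (a : Sec X U),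
    (∀ x ∈ U, ∃ (W : Opens X) (h : W ≤ U), x ∈ W ∧ res h a ∈ R W) → a ∈ R U
  inv_mem : ∀ (U : Opens X), ∀ a ∈ R U, ∀ b, a * b = 1 → b ∈ R U

namespace IsSubringSheaf

variable {R : ∀ U : Opens X, Subring (Sec X U)}

/-- The presheaf of rings given by a subsheaf of rings of the structure sheaf. -/
def presheaf (hR : IsSubringSheaf R) : TopCat.Presheaf CommRingCat.{u} X.toTopCat where
  obj U := CommRingCat.of (R U.unop)
  map i := CommRingCat.ofHom <| ((res i.unop.le).comp (R _).subtype).codRestrict (R _)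
    fun a => hR.res_mem _ _ i.unop.le a a.2
  map_id _ := CommRingCat.hom_ext <| RingHom.ext fun a => Subtype.ext (res_self _ a.1)
  map_comp i j := CommRingCat.hom_ext <| RingHom.ext fun a =>
    Subtype.ext (res_res i.unop.le j.unop.le a.1).symm

theorem isSheaf (hR : IsSubringSheaf R) : hR.presheaf.IsSheaf := by
  rw [TopCat.Presheaf.isSheaf_iff_isSheafUniqueGluing]
  intro ι U sf hsf
  obtain ⟨(a : Sec X (iSup U)), ha, huniq⟩ := X.sheaf.existsUnique_gluing U (fun i => (sf i).1)
    fun i j => congrArg Subtype.val (hsf i j)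
  have ha' : ∀ i, res (le_iSup U i) a = (sf i).1 := ha
  refine ⟨⟨a, hR.mem_of_local _ a fun x hx => ?_⟩, fun i => Subtype.ext (ha' i), fun b hb => ?_⟩
  · obtain ⟨i, hi⟩ := Opens.mem_iSup.1 hx
    exact ⟨U i, le_iSup U i, hi, (ha' i).symm ▸ (sf i).2⟩
  · exact Subtype.ext (huniq b.1 fun i => congrArg Subtype.val (hb i))

/-- The inverse on the open set where `a` does not vanish belongs to `R` by `inv_mem`. This makes
the stalks local and the projection a morphism of locally ringed spaces. -/
theorem isUnit_germ (hR : IsSubringSheaf R) {U : Opens X} (a : R U) (x : X) (hx : x ∈ U)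
    (h : ¬ VanishesAt a.1 x hx) :
    IsUnit (hR.presheaf.germ U x hx (a : R U)) := by
  have hxD : x ∈ X.toRingedSpace.basicOpen a.1 := (mem_basicOpen_iff a.1 x hx).2 h
  have hle := X.toRingedSpace.basicOpen_le a.1
  obtain ⟨v, hv⟩ := (isUnit_res_basicOpen a.1).exists_right_inv
  have hmem := hR.res_mem _ _ hle a.1 a.2
  let a' : R (X.toRingedSpace.basicOpen a.1) := ⟨_, hmem⟩
  let v' : R (X.toRingedSpace.basicOpen a.1) := ⟨v, hR.inv_mem _ _ hmem v hv⟩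
  have h1 : a' * v' = 1 := Subtype.ext hv
  have h2 : hR.presheaf.germ U x hx (a : R U) = hR.presheaf.germ _ x hxD (a' : R _) :=
    (hR.presheaf.germ_res_apply (homOfLE hle) x hxD a).symm
  rw [h2]
  exact (IsUnit.of_mul_eq_one v' h1).map (hR.presheaf.germ _ x hxD).hom

/-- The space `X` with a subsheaf of rings of its structure sheaf. -/
def space (hR : IsSubringSheaf R) : LocallyRingedSpace.{u} where
  carrier := X.toTopCat
  presheaf := hR.presheaf
  IsSheaf := hR.isSheaf
  isLocalRing x := by
    have : Nontrivial (hR.presheaf.stalk x) := by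
      refine ⟨⟨0, 1, fun h => ?_⟩⟩
      rw [← map_zero (hR.presheaf.germ ⊤ x trivial).hom,
        ← map_one (hR.presheaf.germ ⊤ x trivial).hom] at h
      obtain ⟨W, hxW, i, j, hij⟩ := hR.presheaf.germ_eq x _ _ _ _ h
      have h1 : (0 : Sec X W) = 1 := by
        have := congrArg Subtype.val hij
        rwa [map_zero, map_one] at this
      have h2 := congrArg (X.presheaf.germ W x hxW) h1
      rw [map_zero, map_one] at h2
      exact zero_ne_one h2
    refine IsLocalRing.of_isUnit_or_isUnit_one_sub_self fun t => ?_
    obtain ⟨U, hx, a, rfl⟩ := hR.presheaf.exists_germ_eq t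
    by_cases h : VanishesAt (a : R U).1 x hx
    · refine Or.inr ?_
      let b : R U := a
      have h1 : ¬ VanishesAt (1 - b).1 x hx := by
        intro h'
        have := h'.add h
        refine not_vanishesAt_of_isUnit isUnit_one x hx ?_
        convert this using 1
        exact (sub_add_cancel _ _).symm
      have h2 := hR.isUnit_germ (1 - b) x hx h1
      have h3 := map_sub (hR.presheaf.germ U x hx).hom (1 : hR.presheaf.obj (op U)) a
      rw [map_one] at h3
      exact h3 ▸ h2
    · exact Or.inl (hR.isUnit_germ a x hx h)

/-- The projection from `X` to the quotient space. -/
def proj (hR : IsSubringSheaf R) : X ⟶ hR.space :=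
  homMk (Y := hR.space) (ContinuousMap.id X) (fun U => (R U).subtype) (fun _ _ _ _ => rfl)
    fun U a x hx h => by
      by_contra h'
      exact (vanishesAt_iff_germ (X := hR.space) a x hx).1 h (hR.isUnit_germ a x hx h')

end IsSubringSheaf

/-- The morphism `q : X ⟶ Y` is a homeomorphism, and it identifies the structure sheaf of `Y` with
the sheaf `R` of subrings of the structure sheaf of `X`. -/
structure IsProjection (R : ∀ U : Opens X, Subring (Sec X U)) {Y : LocallyRingedSpace.{u}}
    (q : X ⟶ Y) : Prop where
  isHomeomorph : IsHomeomorph q.base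
  injective : ∀ V : Opens Y, Function.Injective (pull q (le_refl (preim q V)))
  range_eq : ∀ V : Opens Y, (pull q (le_refl (preim q V))).range = R (preim q V)

theorem IsSubringSheaf.exists_isProjection {R : ∀ U : Opens X, Subring (Sec X U)}
    (hR : IsSubringSheaf R) : ∃ (Y : LocallyRingedSpace.{u}) (q : X ⟶ Y), IsProjection R q := by
  refine ⟨hR.space, hR.proj, IsHomeomorph.id, fun V a b hab => ?_, fun V => ?_⟩
  · refine Subtype.ext ?_
    have h1 := (res_self (X := X) (U := V) le_rfl _).symm.trans (hab.trans (res_self (X := X) (U := V) le_rfl _))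
    exact h1
  · ext a
    constructor
    · rintro ⟨b, rfl⟩
      exact (res_self (X := X) (U := V) le_rfl (b : R V).1).symm ▸ (b : R V).2
    · intro ha
      exact ⟨(⟨a, ha⟩ : R V), res_self (X := X) (U := V) le_rfl a⟩

end Quotient

/-! ### Formal affine open sets of the quotient space -/

section Transfer

variable {A : Type u} {B : Type v} [CommRing A] [CommRing B]

theorem comap_pow_ringEquiv (e : A ≃+* B) (I : Ideal B) (n : ℕ) (a : A) :
    a ∈ (I.comap (e : A →+* B)) ^ n ↔ e a ∈ I ^ n := by
  constructor
  · exact fun h => mem_pow_of_mem_pow (φ := (e : A →+* B)) Ideal.map_comap_le h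
  · intro h
    have h1 : I.map (e.symm : B →+* A) ≤ I.comap (e : A →+* B) := by
      rw [Ideal.map_le_iff_le_comap]
      intro b hb
      change e (e.symm b) ∈ I
      rwa [e.apply_symm_apply]
    have := mem_pow_of_mem_pow h1 h
    simpa using this

theorem isAdicComplete_comap_ringEquiv (e : A ≃+* B) (I : Ideal B) [IsAdicComplete I B] :
    IsAdicComplete (I.comap (e : A →+* B)) A := by
  refine isAdicComplete_of _ (fun a ha => ?_) fun c hc => ?_
  · rw [← e.map_eq_zero_iff]
    exact eq_zero_of_forall_mem_pow I fun n => (comap_pow_ringEquiv e I n a).1 (ha n)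
  · obtain ⟨L, hL⟩ := exists_limit I (fun n => e (c n)) fun n => by
      rw [← map_sub]
      exact (comap_pow_ringEquiv e I n _).1 (hc n)
    refine ⟨e.symm L, fun n => ?_⟩
    rw [comap_pow_ringEquiv, map_sub, e.apply_symm_apply]
    exact hL n

theorem IsCompletedAway.congr_ringEquiv {A' : Type u} {B' : Type v} [CommRing A'] [CommRing B']
    {φ : A →+* A'} {ψ : B →+* B'} (e : A ≃+* B) (e' : A' ≃+* B') (h : ∀ a, e' (φ a) = ψ (e a))
    {I : Ideal B} {s : A} (hψ : IsCompletedAway ψ I (e s)) :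
    IsCompletedAway φ (I.comap (e : A →+* B)) s := by
  have hI : (I.comap (e : A →+* B)).map φ = (I.map ψ).comap (e' : A' →+* B') := by
    refine le_antisymm ?_ fun a ha => ?_
    · rw [Ideal.map_le_iff_le_comap]
      intro a ha
      rw [Ideal.mem_comap, Ideal.mem_comap, RingEquiv.coe_toRingHom, h]
      exact Ideal.mem_map_of_mem ψ ha
    · have h1 : (I.map ψ).map (e'.symm : B' →+* A') ≤ (I.comap (e : A →+* B)).map φ := by
        rw [Ideal.map_le_iff_le_comap, Ideal.map_le_iff_le_comap]
        intro b hb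
        obtain ⟨a, rfl⟩ := e.surjective b
        rw [Ideal.mem_comap, Ideal.mem_comap, ← h]
        simpa using Ideal.mem_map_of_mem φ (show a ∈ I.comap (e : A →+* B) from hb)
      have := h1 (Ideal.mem_map_of_mem _ ha)
      simpa using this
  refine ⟨?_, ?_, fun n b => ?_, fun n a ha => ?_⟩
  · have := hψ.complete
    rw [hI]
    exact isAdicComplete_comap_ringEquiv e' _
  · have := hψ.isUnit
    rw [← h] at this
    exact (isUnit_map_iff e' _).1 this
  · obtain ⟨k, a, hka⟩ := hψ.exists_mul_sub_mem n (e' b)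
    refine ⟨k, e.symm a, ?_⟩
    rw [hI, comap_pow_ringEquiv, map_sub, map_mul, map_pow, h, h, e.apply_symm_apply]
    exact hka
  · rw [hI, comap_pow_ringEquiv, h] at ha
    obtain ⟨k, hk⟩ := hψ.exists_pow_mul_mem n _ ha
    refine ⟨k, ?_⟩
    rw [comap_pow_ringEquiv, map_mul, map_pow]
    exact hk

end Transfer

section QuotientSpace

variable {X S Y : LocallyRingedSpace.{u}}

theorem preim_basicOpen_eq (f : X ⟶ Y) {V : Opens Y} (s : Sec Y V) :
    preim f (basicOpen s) = basicOpen (pull f (le_refl (preim f V)) s) :=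
  ((basicOpen_pull f (le_refl (preim f V)) s).trans
    (inf_eq_right.2 (preim_mono f (basicOpen_le s)))).symm

theorem vanishesAt_congr {U : Opens X} {s : Sec X U} {x y : X} (h : x = y) (hx : x ∈ U)
    (hy : y ∈ U) : VanishesAt s x hx ↔ VanishesAt s y hy := by
  subst h
  rfl

theorem IsFormalAffine.of_eq_basicOpen {U W : Opens X} (hU : IsFormalAffine X U) {s : Sec X U}
    (h : W = basicOpen s) : IsFormalAffine X W := by
  subst h
  exact hU.basicOpen s

theorem IsFormalAffine.definingIdeal_eq_map {U W : Opens X} (hU : IsFormalAffine X U) {s : Sec X U}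
    (hW : W ≤ U) (h : W = basicOpen s) : definingIdeal X W = (definingIdeal X U).map (res hW) := by
  subst h
  exact hU.definingIdeal_basicOpen s

/-- Compatible retractions onto the subrings `R W`, for the formal affine open subsets `W`
of `U`. -/
def HasRetractions (R : ∀ U : Opens X, Subring (Sec X U)) (U : Opens X) {n : ℕ}
    (x : Fin n → Sec X U) (e : ℕ) : Prop :=
  ∃ (π : ∀ W : Opens X, W ≤ U → Sec X W →+ Sec X W) (θ : ∀ W : Opens X, W ≤ U → Sec X W →+* Sec X W),
    (∀ (W : Opens X) (h : W ≤ U), IsFormalAffine X W →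
      IsRetraction (R W) (fun k => res h (x k)) (definingIdeal X W) e (π W h) (θ W h)) ∧
    ∀ (W : Opens X) (h : W ≤ U) (W' : Opens X) (h' : W' ≤ W), IsFormalAffine X W →
      IsFormalAffine X W' → ∀ b, π W' (h'.trans h) (res h' b) = res h' (π W h b)

namespace IsProjection

variable {R : ∀ U : Opens X, Subring (Sec X U)} {q : X ⟶ Y}

theorem exists_preim_eq (hq : IsProjection R q) (U : Opens X) : ∃ V : Opens Y, preim q V = U := by
  refine ⟨⟨q.base '' (U : Set X), hq.isHomeomorph.isOpenMap (U : Set X) U.isOpen⟩, ?_⟩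
  ext x
  exact Function.Injective.mem_set_image hq.isHomeomorph.injective

theorem pull_mem (hq : IsProjection R q) (hR : IsSubringSheaf R) {V : Opens Y} {W : Opens X}
    (h : W ≤ preim q V) (s : Sec Y V) : pull q h s ∈ R W := by
  rw [← res_pull q le_rfl h]
  refine hR.res_mem _ _ h _ ?_
  rw [← hq.range_eq]
  exact ⟨s, rfl⟩

theorem exists_pull_eq (hq : IsProjection R q) {V : Opens Y} {a : Sec X (preim q V)}
    (ha : a ∈ R (preim q V)) : ∃ s, pull q (le_refl (preim q V)) s = a := by
  rwa [← hq.range_eq] at ha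

theorem definingIdeal_eq (hq : IsProjection R q) (V : Opens Y) :
    definingIdeal Y V = (definingIdeal X (preim q V)).comap (pull q le_rfl) := by
  ext s
  rw [Ideal.mem_comap, mem_definingIdeal, mem_definingIdeal]
  constructor
  · exact fun h x hx => (vanishesAt_pull q le_rfl s x hx).2 (h _ hx)
  · intro h y hy
    obtain ⟨x, rfl⟩ := hq.isHomeomorph.surjective y
    exact (vanishesAt_pull q le_rfl s x hy).1 (h x hy)

/-- The sections of `Y` are the elements of `R`. -/
def secEquiv (hq : IsProjection R q) (V : Opens Y) : Sec Y V ≃+* R (preim q V) :=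
  RingEquiv.ofBijective ((pull q le_rfl).codRestrict (R (preim q V)) fun s => by
    rw [← hq.range_eq]; exact ⟨s, rfl⟩)
    ⟨fun a b h => hq.injective V (congrArg Subtype.val h), fun a => by
      obtain ⟨s, hs⟩ := hq.exists_pull_eq a.2
      exact ⟨s, Subtype.ext hs⟩⟩

@[simp]
theorem coe_secEquiv (hq : IsProjection R q) (V : Opens Y) (s : Sec Y V) :
    (hq.secEquiv V s : Sec X (preim q V)) = pull q le_rfl s :=
  rfl

theorem definingIdeal_eq_comap (hq : IsProjection R q) (V : Opens Y) :
    definingIdeal Y V = ((definingIdeal X (preim q V)).comap (R (preim q V)).subtype).comap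
      (hq.secEquiv V : Sec Y V →+* R (preim q V)) :=
  hq.definingIdeal_eq V

/-- The continuous map is forced, as `q` is a homeomorphism; on sections the factorization is `g`
followed by the identification of `R` with the sections of `Y`. All compatibilities can be checked
after pulling back along `q`. -/
theorem exists_hom (hq : IsProjection R q) (g : X ⟶ S)
    (hg : ∀ (V : Opens S) (W : Opens X) (h : W ≤ preim g V) (s : Sec S V), pull g h s ∈ R W) :
    ∃ g' : Y ⟶ S, q ≫ g' = g := by
  let e := hq.isHomeomorph.homeomorph
  let b : C(Y, S) := g.base.hom.comp ⟨e.symm, e.symm.continuous⟩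
  have he : ∀ x, e.symm (q.base x) = x := e.symm_apply_apply
  have hb : ∀ x, b (q.base x) = g.base x := fun x => congrArg g.base (he x)
  have hle : ∀ V : Opens S, preim q (Opens.comap b V) ≤ preim g V := fun V x hx => by
    have : b (q.base x) ∈ V := hx
    rwa [hb] at this
  let φ : ∀ V : Opens S, Sec S V →+* Sec Y (Opens.comap b V) := fun V =>
    ((hq.secEquiv (Opens.comap b V)).symm : _ →+* Sec Y (Opens.comap b V)).comp
      ((pull g (hle V)).codRestrict (R _) fun s => hg V _ (hle V) s)
  have hφ : ∀ (V : Opens S) (W : Opens X) (h : W ≤ preim q (Opens.comap b V)) (s : Sec S V),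
      pull q h (φ V s) = pull g (h.trans (hle V)) s := by
    intro V W h s
    have h1 : pull q le_rfl (φ V s) = pull g (hle V) s := by
      rw [← hq.coe_secEquiv]
      simp [φ]
    rw [← res_pull q le_rfl h, h1, res_pull]
  have hnat : ∀ (V V' : Opens S) (h : V' ≤ V) (s : Sec S V), φ V' (res h s) =
      res (U := Opens.comap b V) (W := Opens.comap b V') (fun _ hx => h hx) (φ V s) := by
    intro V V' h s
    apply hq.injective
    have h1 := pull_res q (V := Opens.comap b V) (V' := Opens.comap b V') (fun _ hx => h hx) le_rfl
      (φ V s)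
    rw [hφ, pull_res, h1, hφ]
  have hloc : ∀ (V : Opens S) (s : Sec S V) (y : Y) (hy : b y ∈ V), VanishesAt s (b y) hy →
      VanishesAt (φ V s) y hy := by
    intro V s y hy h
    obtain ⟨x, rfl⟩ := hq.isHomeomorph.surjective y
    have hx : x ∈ preim q (Opens.comap b V) := hy
    rw [← vanishesAt_pull q (V := Opens.comap b V) le_rfl _ x hx, hφ, vanishesAt_pull]
    exact (vanishesAt_congr (hb x) hy _).1 h
  refine ⟨homMk b φ hnat hloc, hom_ext hb fun V W h h' s => ?_⟩
  refine (pull_comp q (homMk b φ hnat hloc) (V' := Opens.comap b V) (W := W) le_rfl h s).trans ?_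
  have h2 : pull (homMk b φ hnat hloc) (le_refl (Opens.comap b V)) s = φ V s := res_self _ _
  exact (congrArg (pull q (V := Opens.comap b V) h) h2).trans (hφ V W h s)

/-- Noetherianity, completeness and primes come from the retraction. For the topology, `θ b ≡ b ^ e`
modulo the ideal of definition, so `D(b) = D(θ b)`: functions in `R` define a basis and separate
points. The completed localizations are those of `IsRetraction.isCompletedAway`, which needs the
retractions on `V` and on a basic open subset to be compatible. -/
theorem isFormalAffine (hq : IsProjection R q) (hR : IsSubringSheaf R) {V : Opens Y}
    (hU : IsFormalAffine X (preim q V)) {n : ℕ} {x : Fin n → Sec X (preim q V)} {e : ℕ}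
    (hx : HasRetractions R (preim q V) x e) : IsFormalAffine Y V := by
  obtain ⟨π, θ, hret, hnat⟩ := hx
  have hrU := hret _ le_rfl hU
  have := hU.noetherian
  have := hU.complete
  have hRc := hrU.isAdicComplete
  have hRn := hrU.isNoetherianRing
  have hpow : ∀ (b : Sec X (preim q V)), ∃ s : Sec Y V,
      basicOpen (pull q (le_refl (preim q V)) s) = basicOpen b := by
    intro b
    obtain ⟨s, hs⟩ := hq.exists_pull_eq (hrU.theta_mem b)
    refine ⟨s, ?_⟩
    rw [hs, basicOpen, basicOpen_eq_of_sub_mem (hrU.theta_sub_mem' b)]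
    exact X.toRingedSpace.basicOpen_pow b e (Nat.pos_of_ne_zero hrU.ne_zero)
  refine IsFormalAffine.of_isCompletedAway ?_ ?_ (isEmbedding_pointPrime ?_ ?_) ?_ ?_
  · exact isNoetherianRing_of_ringEquiv _ (hq.secEquiv V).symm
  · rw [hq.definingIdeal_eq_comap]
    exact isAdicComplete_comap_ringEquiv _ _
  · intro y hy W hyW
    obtain ⟨x, rfl⟩ := hq.isHomeomorph.surjective y
    obtain ⟨b, hxb, hb⟩ := hU.exists_basicOpen (x := x) hy (W := preim q W) hyW
    obtain ⟨s, hs⟩ := hpow b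
    rw [← preim_basicOpen_eq] at hs
    rw [← hs] at hxb hb
    refine ⟨s, hxb, fun y hy => ?_⟩
    obtain ⟨x, rfl⟩ := hq.isHomeomorph.surjective y
    exact hb hy
  · rintro ⟨y, hy⟩ ⟨y', hy'⟩ h
    obtain ⟨x, rfl⟩ := hq.isHomeomorph.surjective y
    obtain ⟨x', rfl⟩ := hq.isHomeomorph.surjective y'
    have h1 : (⟨x, hy⟩ : preim q V) = ⟨x', hy'⟩ := by
      refine hU.isEmbedding.injective (PrimeSpectrum.ext (Ideal.ext fun b => ?_))
      obtain ⟨s, hs⟩ := hpow b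
      have h2 := congrArg (fun P : PrimeSpectrum (Sec Y V) => s ∈ P.asIdeal) h
      simp only [mem_pointPrime] at h2
      rw [mem_pointPrime, mem_pointPrime, vanishesAt_iff_notMem_basicOpen b x hy,
        vanishesAt_iff_notMem_basicOpen b x' hy']
      change x ∉ basicOpen b ↔ x' ∉ basicOpen b
      rw [← hs, ← vanishesAt_iff_notMem_basicOpen _ x hy, ← vanishesAt_iff_notMem_basicOpen _ x' hy',
        vanishesAt_pull (V := V) q (le_refl (preim q V)) s x hy,
        vanishesAt_pull (V := V) q (le_refl (preim q V)) s x' hy']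
      exact iff_of_eq h2
    exact Subtype.ext (congrArg q.base (congrArg Subtype.val h1))
  · intro P hP
    have hPp := P.2
    have hle : (definingIdeal X (preim q V)).comap (R (preim q V)).subtype ≤
        P.asIdeal.comap ((hq.secEquiv V).symm : R (preim q V) →+* Sec Y V) := by
      intro r hr
      refine hP ?_
      rw [hq.definingIdeal_eq_comap, Ideal.mem_comap]
      simpa using hr
    obtain ⟨Q, hQ, hJQ, hQP⟩ := hrU.exists_prime _ hle
    obtain ⟨x, hx, hxQ⟩ := hU.exists_point Q hJQ
    refine ⟨⟨q.base x, hx⟩, PrimeSpectrum.ext (Ideal.ext fun s => ?_)⟩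
    rw [mem_pointPrime, ← vanishesAt_pull q le_rfl s x hx, hxQ]
    have := Ideal.ext_iff.1 hQP (hq.secEquiv V s)
    rw [Ideal.mem_comap, Ideal.mem_comap] at this
    simpa using this
  · intro s
    have hle : preim q (basicOpen s) ≤ preim q V := preim_mono q (basicOpen_le s)
    have hWeq := preim_basicOpen_eq q s
    have hW : IsFormalAffine X (preim q (basicOpen s)) := hU.of_eq_basicOpen hWeq
    have := hW.noetherian
    have hJ := hU.definingIdeal_eq_map hle hWeq
    have h1 := hU.isCompletedAway _ hle hWeq
    have hs : pull q (le_refl (preim q V)) s ∈ R (preim q V) := hq.pull_mem hR le_rfl s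
    have hrW := hret _ hle hW
    rw [hJ] at hrW
    have h2 := IsRetraction.isCompletedAway h1 hs hrU hrW (fun r hr => hR.res_mem _ _ hle r hr)
      (hR.inv_mem _) fun b => hnat _ le_rfl _ hle hU hW b
    rw [hq.definingIdeal_eq_comap]
    refine IsCompletedAway.congr_ringEquiv (hq.secEquiv V) (hq.secEquiv (basicOpen s)) (fun a => ?_) h2
    refine Subtype.ext ?_
    change pull q le_rfl (res _ a) = res hle (pull q le_rfl a)
    rw [pull_res, res_pull]

end IsProjection

end QuotientSpace

/-! ### The sheaf of constants of a family of vector fields -/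

section Constants

variable {X S Y : LocallyRingedSpace.{u}} {f : X ⟶ S} {F : ∀ U : Opens X, Set (VectorField f U)}

/-- The functions on `U` that are annihilated by all local vector fields in `F`. -/
def constants (F : ∀ U : Opens X, Set (VectorField f U)) (U : Opens X) : Subring (Sec X U) where
  carrier := {a | ∀ (W : Opens X) (h : W ≤ U), ∀ D ∈ F W, D.der W le_rfl (res h a) = 0}
  mul_mem' ha hb W h D hD := by simp [ha W h D hD, hb W h D hD]
  one_mem' W h D _ := by simp
  add_mem' ha hb W h D hD := by simp [ha W h D hD, hb W h D hD]
  zero_mem' W h D _ := by simp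
  neg_mem' ha W h D hD := by simp [ha W h D hD]

theorem mem_constants {U : Opens X} {a : Sec X U} : a ∈ constants F U ↔
    ∀ (W : Opens X) (h : W ≤ U), ∀ D ∈ F W, D.der W le_rfl (res h a) = 0 :=
  Iff.rfl

theorem isSubringSheaf_constants
    (hF : ∀ (U W : Opens X) (h : W ≤ U), ∀ D ∈ F U, D.restrict h ∈ F W) :
    IsSubringSheaf (constants F) where
  res_mem U W h a ha W' h' D hD := by
    rw [res_res]
    exact ha W' _ D hD
  mem_of_local U a ha W h D hD := by
    refine sec_ext fun x hx => ?_
    obtain ⟨W', h', hxW', ha'⟩ := ha x (h hx)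
    refine ⟨W ⊓ W', inf_le_left, ⟨hx, hxW'⟩, ?_⟩
    have := ha' (W ⊓ W') inf_le_right _ (hF W (W ⊓ W') inf_le_left D hD)
    rw [map_zero, ← D.der_res, res_res]
    rw [res_res] at this
    exact this
  inv_mem U a ha b hab W h D hD := by
    have h1 := congrArg (D.der W le_rfl) (congrArg (res h) hab)
    rw [map_mul, map_one, Derivation.leibniz, ha W h D hD, Derivation.map_one_eq_zero, smul_zero,
      add_zero, smul_eq_mul] at h1
    have h2 := congrArg (res h) hab
    rw [map_mul, map_one] at h2
    exact (IsUnit.of_mul_eq_one _ h2).mul_right_eq_zero.1 h1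

theorem IsFrame.mem_constants_iff {U : Opens X} {n : ℕ} {E : Fin n → VectorField f U}
    {x : Fin n → Sec X U} (hE : IsFrame F U E x) {W : Opens X} (h : W ≤ U) (a : Sec X W) :
    a ∈ constants F W ↔ ∀ k, (E k).der W h a = 0 := by
  constructor
  · intro ha k
    simpa using ha W le_rfl _ (hE.mem W h k)
  · intro ha W' h' D hD
    rw [(hE.mem_iff W' (h'.trans h) D).1 hD]
    simp [VectorField.sum_der, (E _).der_res W W' h h', ha]

theorem IsFrame.isDualFrame {U : Opens X} {n : ℕ} {E : Fin n → VectorField f U}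
    {x : Fin n → Sec X U} (hE : IsFrame F U E x)
    (hcomm : ∀ i j (W : Opens X) (h : W ≤ U) (a : Sec X W),
      (E i).der W h ((E j).der W h a) = (E j).der W h ((E i).der W h a))
    {W : Opens X} (h : W ≤ U) :
    IsDualFrame (constants F W) (fun k => (E k).der W h) (fun k => res h (x k)) where
  mem_iff := hE.mem_constants_iff h
  dual := hE.der_res W h
  commute i j b := hcomm i j W h b

theorem IsFrame.hasRetractions_of_prime {U : Opens X} {n : ℕ} {E : Fin n → VectorField f U}
    {x : Fin n → Sec X U} (hE : IsFrame F U E x)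
    (hcomm : ∀ i j (W : Opens X) (h : W ≤ U) (a : Sec X W),
      (E i).der W h ((E j).der W h a) = (E j).der W h ((E i).der W h a))
    {p : ℕ} (hp : p.Prime) (hpX : ∀ W : Opens X, (p : Sec X W) = 0)
    (hEp : ∀ i (W : Opens X) (h : W ≤ U) (a : Sec X W), ((E i).der W h)^[p] a = 0) :
    HasRetractions (constants F) U x p := by
  refine ⟨fun W h => taylorList p (fun k => (E k).der W h) (fun k => res h (x k)) (List.finRange n),
    fun W h => powHom hp (hpX W), fun W h hW => ?_, fun W h W' h' _ _ b => ?_⟩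
  · have := hW.noetherian
    exact (hE.isDualFrame hcomm h).isRetraction_taylorList hp (hpX W) (fun i => hEp i W h) _
  · rw [map_taylorList (res h') _ (fun k => (E k).der W' (h'.trans h)) fun i b =>
      ((E i).der_res W W' h h' b).symm]
    simp only [res_res]

theorem IsFrame.hasRetractions_of_isUnit {U : Opens X} {n : ℕ} {E : Fin n → VectorField f U}
    {x : Fin n → Sec X U} (hE : IsFrame F U E x)
    (hcomm : ∀ i j (W : Opens X) (h : W ≤ U) (a : Sec X W),
      (E i).der W h ((E j).der W h a) = (E j).der W h ((E i).der W h a))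
    (hF : IsSubringSheaf (constants F))
    (hX : ∀ (W : Opens X) (n : ℕ), n ≠ 0 → IsUnit (n : Sec X W))
    (hx : ∀ k, x k ∈ definingIdeal X U) : HasRetractions (constants F) U x 1 := by
  have hx' : ∀ (W : Opens X) (h : W ≤ U) (k : Fin n), res h (x k) ∈ definingIdeal X W :=
    fun W h k => map_res_definingIdeal_le h (Ideal.mem_map_of_mem _ (hx k))
  have key : ∀ (W : Opens X) (h : W ≤ U), ∃ π : Sec X W →+* Sec X W, IsFormalAffine X W →
      IsRetraction (constants F W) (fun k => res h (x k)) (definingIdeal X W) 1 π π := by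
    intro W h
    by_cases hW : IsFormalAffine X W
    · have := hW.complete
      obtain ⟨π, hπ⟩ := (hE.isDualFrame hcomm h).exists_isRetraction (hX W) (hx' W h)
      exact ⟨π, fun _ => hπ⟩
    · exact ⟨RingHom.id _, fun h => absurd h hW⟩
  choose π hπ using key
  refine ⟨fun W h => π W h, π, hπ, fun W h W' h' hW hW' b => ?_⟩
  have := hW'.complete
  exact (hE.isDualFrame hcomm (h'.trans h)).retraction_natural (hX W') (hx' W' _) (hπ W h hW)
    (hπ W' _ hW') (res h') (fun r hr => hF.res_mem _ _ h' r hr) (fun k => res_res _ _ _) b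

/-- The main point is that a field `D` which kills the functions on `Y` lies in `F`. The field `D -
∑ D(x_i) E_i` kills the constants and the coordinates, hence all polynomials in the coordinates over
the constants. These are dense, and derivations are continuous. -/
theorem IsProjection.isQuotient {q : X ⟶ Y} (hq : IsProjection (constants F) q)
    (hF : ∀ (U W : Opens X) (h : W ≤ U), ∀ D ∈ F U, D.restrict h ∈ F W)
    (hloc : ∀ (U : Opens X) (D : VectorField f U),
      (∀ x ∈ U, ∃ (W : Opens X) (h : W ≤ U), x ∈ W ∧ D.restrict h ∈ F W) → D ∈ F U)
    (hframe : ∀ y : X, ∃ (U : Opens X) (n : ℕ) (E : Fin n → VectorField f U) (x : Fin n → Sec X U),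
      y ∈ U ∧ IsFormalAffine X U ∧ IsFrame F U E x ∧
        ∀ (W : Opens X) (h : W ≤ U), IsFormalAffine X W → ∀ (b : Sec X W) (k : ℕ),
          ∃ P : MvPolynomial (Fin n) (constants F W), b - MvPolynomial.eval₂Hom
            (constants F W).subtype (fun k => res h (x k)) P ∈ definingIdeal X W ^ k) :
    IsQuotient f F q where
  overBase := by
    refine hq.exists_hom f fun V W h s W' h' D _ => ?_
    rw [res_pull]
    exact D.der_pull W' le_rfl V _ s
  tangent U D := by
    have hR := isSubringSheaf_constants hF
    constructor
    · intro hD W h V hV s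
      have := hq.pull_mem hR hV s W le_rfl _ (hF U W h D hD)
      rwa [res_self] at this
    · intro hD
      refine hloc U D fun y hy => ?_
      obtain ⟨U₀, n, E, x, hyU₀, hU₀, hE, hdense⟩ := hframe y
      obtain ⟨W, hyW, hWU, hWU₀, hW⟩ := hU₀.exists_le hyU₀ hy
      refine ⟨W, hWU, hyW, (hE.mem_iff W hWU₀ _).2 (VectorField.ext_of_isFormalAffine hW fun b => ?_)⟩
      set D' := D.restrict hWU -
        ∑ i, (D.restrict hWU).der W le_rfl (res hWU₀ (x i)) • (E i).restrict hWU₀ with hD'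
      have h0 : ∀ i, D'.der W le_rfl (res hWU₀ (x i)) = 0 := fun i => by
        rw [hD', VectorField.sub_der, hE.eq_of_sum, sub_self]
      have h1 : ∀ r ∈ constants F W, D'.der W le_rfl r = 0 := by
        intro r hr
        obtain ⟨V, rfl⟩ := hq.exists_preim_eq W
        obtain ⟨s, rfl⟩ := hq.exists_pull_eq hr
        have h2 : ∀ i, (E i).der (preim q V) hWU₀ (pull q le_rfl s) = 0 :=
          (hE.mem_constants_iff hWU₀ _).1 hr
        simp [hD', VectorField.sum_der, hD, h2]
      have h3 : ∀ P : MvPolynomial (Fin n) (constants F W), D'.der W le_rfl (MvPolynomial.eval₂Hom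
          (constants F W).subtype (fun k => res hWU₀ (x k)) P) = 0 := by
        intro P
        induction P using MvPolynomial.induction_on with
        | C a => simpa using h1 _ a.2
        | add P Q hP hQ => rw [map_add, map_add, hP, hQ, add_zero]
        | mul_X P k hP =>
          rw [map_mul, Derivation.leibniz, hP, MvPolynomial.coe_eval₂Hom, MvPolynomial.eval₂_X, h0]
          simp
      have := hW.complete
      rw [← sub_eq_zero, ← VectorField.sub_der]
      refine eq_zero_of_forall_mem_pow (definingIdeal X W) fun k => ?_
      obtain ⟨P, hP⟩ := hdense W hWU₀ hW b (k + 1)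
      have := derivation_mem_pow (D'.der W le_rfl) _ k hP
      rwa [map_sub, h3, sub_zero] at this
  injective := hq.injective
  constants V a := by
    change a ∈ (pull q (le_refl (preim q V))).range ↔ _
    rw [hq.range_eq]
    rfl

end Constants

/-! ### Closed immersions -/

section ClosedImmersions

variable {X Y Z : LocallyRingedSpace.{u}}

/-- After localization the map is surjective up to the `N`-th power of the ideal of definition of
`Z`. By the adic condition such a power lies in the ideal generated from `X`, so completeness gives
surjectivity. -/
theorem IsClosedImmersionOver.basicOpen {i : Z ⟶ X} {U : Opens X} (hi : IsClosedImmersionOver i U)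
    (s : Sec X U) : IsClosedImmersionOver i (basicOpen s) := by
  have hle : preim i (FormalGeometry.basicOpen s) ≤ preim i U := preim_mono i (basicOpen_le s)
  have heq := preim_basicOpen_eq i s
  have hA := hi.affine.basicOpen s
  have hZ := hi.affine_preim.of_eq_basicOpen heq
  have hJZ := hi.affine_preim.definingIdeal_eq_map hle heq
  have hcZ := hi.affine_preim.isCompletedAway _ hle heq
  have hJ := hi.affine.definingIdeal_basicOpen s
  have hsq : ∀ a, res hle (pull i (le_refl (preim i U)) a) =
      pull i (le_refl (preim i (FormalGeometry.basicOpen s))) (res (basicOpen_le s) a) := fun a => by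
    rw [res_pull, pull_res]
  have hadic : definingIdeal Z (preim i (FormalGeometry.basicOpen s)) ≤
      ((definingIdeal X (FormalGeometry.basicOpen s)).map
        (pull i (le_refl (preim i (FormalGeometry.basicOpen s))))).radical := by
    rw [hJZ, Ideal.map_le_iff_le_comap]
    intro b hb
    obtain ⟨n, hn⟩ := hi.adic hb
    refine ⟨n, ?_⟩
    rw [← map_pow]
    have h1 := Ideal.mem_map_of_mem (res hle) hn
    rw [Ideal.map_map] at h1
    rw [hJ, Ideal.map_map]
    convert h1 using 2
    exact RingHom.ext fun a => (hsq a).symm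
  refine ⟨hA, hZ, ?_, hadic⟩
  have := hA.complete
  have := hZ.complete
  obtain ⟨N, hN⟩ := Ideal.exists_pow_le_of_le_radical_of_fg hadic hZ.definingIdeal_fg
  have hc := isAdicComplete_of_pow_le N hN (map_pull_definingIdeal_le i _)
  refine surjective_of_mk_map_comp_surjective (I := definingIdeal X (FormalGeometry.basicOpen s)) _
    fun b => ?_
  obtain ⟨b, rfl⟩ := Ideal.Quotient.mk_surjective b
  obtain ⟨k, c, hc⟩ := hcZ.exists_mul_sub_mem N b
  obtain ⟨a, rfl⟩ := hi.surjective c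
  obtain ⟨v, hv⟩ := ((isUnit_res_basicOpen s).pow k).exists_right_inv
  refine ⟨v * res (basicOpen_le s) a, ?_⟩
  rw [RingHom.comp_apply, Ideal.Quotient.eq, ← neg_mem_iff, neg_sub]
  rw [← hJZ] at hc
  have h1 := Ideal.mul_mem_left _ (pull i (le_refl (preim i (FormalGeometry.basicOpen s))) v) (hN hc)
  have h2 := congrArg (pull i (le_refl (preim i (FormalGeometry.basicOpen s)))) hv
  rw [map_mul, map_pow, map_one] at h2
  convert h1 using 1
  rw [hsq, hsq, map_mul]
  linear_combination -b * h2

theorem IsClosedImmersionOver.exists_le {i : Z ⟶ X} {U W : Opens X}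
    (hi : IsClosedImmersionOver i U) {x : X} (hxU : x ∈ U) (hxW : x ∈ W) :
    ∃ U' : Opens X, x ∈ U' ∧ U' ≤ W ∧ U' ≤ U ∧ IsClosedImmersionOver i U' := by
  obtain ⟨s, hxs, hs⟩ := hi.affine.exists_basicOpen hxU hxW
  exact ⟨_, hxs, hs, basicOpen_le s, hi.basicOpen s⟩

/-- A function in the ideal of `Z` that does not vanish at `x` would define a neighbourhood of `x`
disjoint from the image. So the prime of `x` contains that ideal and gives a prime of the quotient
ring, which is a point of `Z` by the adic condition. -/
theorem IsClosedImmersionOver.mem_range_of_mem_closure {i : Z ⟶ X} {U : Opens X}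
    (hU : IsClosedImmersionOver i U) {x : X} (hxU : x ∈ U) (hx : x ∈ closure (Set.range i.base)) :
    x ∈ Set.range i.base := by
  rw [mem_closure_iff_nhds] at hx
  have hcon : ¬ (Set.range i.base)ᶜ ∈ nhds x := fun h => by
    obtain ⟨y, hy, hy'⟩ := hx _ h
    exact hy hy'
  have hker : RingHom.ker (pull i (le_refl (preim i U))) ≤ (pointPrime X U ⟨x, hxU⟩).asIdeal := by
    intro s hs
    rw [mem_pointPrime]
    by_contra h
    refine hcon (Filter.mem_of_superset ((FormalGeometry.basicOpen s).isOpen.mem_nhds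
      ((mem_basicOpen_iff s x hxU).2 h)) ?_)
    rintro _ hy ⟨z, rfl⟩
    have hzU := basicOpen_le s hy
    refine (mem_basicOpen_iff s _ hzU).1 hy ?_
    have h1 := (vanishesAt_pull i (le_refl (preim i U)) s z hzU).1
    refine h1 ?_
    rw [RingHom.mem_ker.1 hs]
    exact map_zero _
  have hsurj := hU.surjective
  let P : Ideal (Sec Z (preim i U)) := (pointPrime X U ⟨x, hxU⟩).asIdeal.map (pull i le_rfl)
  have hP : P.IsPrime := Ideal.map_isPrime_of_surjective hsurj hker
  have hcomap : ∀ s, pull i (le_refl (preim i U)) s ∈ P ↔ VanishesAt s x hxU := by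
    intro s
    rw [← mem_pointPrime ⟨x, hxU⟩, ← Ideal.mem_comap]
    rw [Ideal.comap_map_of_surjective _ hsurj, ← RingHom.ker_eq_comap_bot, sup_eq_left.2 hker]
  have hJ : definingIdeal Z (preim i U) ≤ P := by
    refine hU.adic.trans ((hP.radical_le_iff).2 ?_)
    rw [Ideal.map_le_iff_le_comap]
    intro s hs
    exact (hcomap s).2 (mem_definingIdeal.1 hs x hxU)
  obtain ⟨z, hz, hzP⟩ := hU.affine_preim.exists_point P hJ
  refine ⟨z, ?_⟩
  have : (⟨i.base z, hz⟩ : U) = ⟨x, hxU⟩ := by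
    refine hU.affine.isEmbedding.injective (PrimeSpectrum.ext (Ideal.ext fun s => ?_))
    rw [mem_pointPrime, mem_pointPrime, ← hcomap, ← hzP]
    exact (vanishesAt_pull i (le_refl (preim i U)) s z hz).symm
  exact congrArg Subtype.val this

theorem IsFormalClosedImmersion.isClosed_range {i : Z ⟶ X} (hi : IsFormalClosedImmersion i) :
    IsClosed (Set.range i.base) := by
  refine isClosed_of_closure_subset fun x hx => ?_
  obtain ⟨U, hxU, hU⟩ := hi x
  exact hU.mem_range_of_mem_closure hxU hx

/-- The composite of a closed immersion with the quotient by a sheaf of subrings, if the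
coordinates vanish on the closed subspace. -/
theorem IsProjection.isClosedImmersionOver {R : ∀ U : Opens X, Subring (Sec X U)} {q : X ⟶ Y}
    (hq : IsProjection R q) (hR : IsSubringSheaf R) {V : Opens Y} {i : Z ⟶ X}
    (hi : IsClosedImmersionOver i (preim q V)) {n : ℕ} {x : Fin n → Sec X (preim q V)}
    (hx : ∀ k, x k ∈ idealOf i (preim q V)) {e : ℕ} (hret : HasRetractions R (preim q V) x e) :
    IsClosedImmersionOver (i ≫ q) V := by
  have hV := hq.isFormalAffine hR hi.affine hret
  obtain ⟨π, θ, hret, -⟩ := hret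
  have hr := hret _ le_rfl hi.affine
  have hspan : Ideal.span (Set.range fun k => res (le_refl (preim q V)) (x k)) ≤
      RingHom.ker (pull i (le_refl (preim i (preim q V)))) := by
    rw [Ideal.span_le]
    rintro _ ⟨k, rfl⟩
    change res le_rfl (x k) ∈ _
    rw [res_self]
    exact hx k
  have hk : ∀ a b, a - b ∈ Ideal.span (Set.range fun k => res (le_refl (preim q V)) (x k)) →
      pull i (le_refl (preim i (preim q V))) a = pull i le_rfl b := fun a b h => by
    rw [← sub_eq_zero, ← map_sub]
    exact hspan h
  have hpull : ∀ s, pull (i ≫ q) (le_refl (preim (i ≫ q) V)) s =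
      pull i (le_refl (preim i (preim q V))) (pull q le_rfl s) := fun s =>
    pull_comp i q (V' := preim q V) (W := preim i (preim q V)) le_rfl le_rfl s
  refine ⟨hV, hi.affine_preim, fun c => ?_, ?_⟩
  · obtain ⟨b, rfl⟩ := hi.surjective c
    obtain ⟨s, hs⟩ := hq.exists_pull_eq (hr.mem b)
    exact ⟨s, (hpull s).trans ((congrArg _ hs).trans (hk _ _ (hr.sub_mem b)).symm)⟩
  · refine hi.adic.trans ?_
    refine (Ideal.radical_mono ?_).trans (Ideal.radical_idem _).le
    rw [Ideal.map_le_iff_le_comap]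
    intro b hb
    -- Modulo the coordinates, which vanish on `Z`, the power `b ^ e` equals `θ b`, a function that
    -- comes from `Y` and lies in its ideal of definition.
    refine ⟨e, ?_⟩
    obtain ⟨s, hs⟩ := hq.exists_pull_eq (hr.theta_mem b)
    have h1 : pull i (le_refl (preim i (preim q V))) b ^ e =
        pull (i ≫ q) (le_refl (preim (i ≫ q) V)) s := by
      refine Eq.trans ?_ ((congrArg _ hs.symm).trans (hpull s).symm)
      rw [← map_pow, hk _ _ (hr.theta_sub_mem b)]
    refine (congrArg (· ∈ _) h1).mpr ?_
    refine Ideal.mem_map_of_mem _ ?_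
    rw [hq.definingIdeal_eq, Ideal.mem_comap, hs]
    have h2 := add_mem (hr.theta_sub_mem' b)
      (Ideal.pow_le_self hr.ne_zero (Ideal.pow_mem_pow hb e))
    simpa using h2

end ClosedImmersions

/-! ### Flatness of homeomorphisms, tested on sections -/

section Flatness

/-- The equational criterion for flatness of a ring homomorphism. -/
theorem ringHom_flat_iff {A : Type u} {B : Type v} [CommRing A] [CommRing B] (φ : A →+* B) :
    φ.Flat ↔ ∀ {l : ℕ} (f : Fin l → A) (m : Fin l → B), ∑ i, φ (f i) * m i = 0 →
      ∃ (k : ℕ) (a : Fin l → Fin k → A) (y : Fin k → B),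
        (∀ i, m i = ∑ j, φ (a i j) * y j) ∧ ∀ j, ∑ i, f i * a i j = 0 := by
  let _ : Algebra A B := φ.toAlgebra
  have h := Module.Flat.iff_forall_isTrivialRelation (R := A) (M := B)
  simp only [Algebra.smul_def] at h
  exact ⟨fun h' _ _ _ => h.1 h', fun h' => h.2 (h' _ _)⟩

variable {X Y : LocallyRingedSpace.{u}}

theorem stalkMap_germ (q : X ⟶ Y) {V : Opens Y} {W : Opens X} (h : W ≤ preim q V) (x : X)
    (hx : x ∈ W) (s : Sec Y V) :
    (q.stalkMap x).hom (Y.presheaf.germ V (q.base x) (h hx) s) =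
      X.presheaf.germ W x hx (pull q h s) := by
  rw [pull, RingHom.comp_apply, germ_res]
  exact LocallyRingedSpace.stalkMap_germ_apply q V x (h hx) s

theorem exists_forall_germ_eq {m : ℕ} {x : X} {U : Opens X} (hx : x ∈ U)
    (c : Fin m → X.presheaf.stalk x) :
    ∃ (W : Opens X) (_ : W ≤ U) (hxW : x ∈ W) (a : Fin m → Sec X W),
      ∀ k, X.presheaf.germ W x hxW (a k) = c k := by
  obtain ⟨W, hW, hxW, h⟩ := exists_open_of_forall_fin (m := m) hx
    (P := fun k W => ∀ h : x ∈ W, ∃ a : Sec X W, X.presheaf.germ W x h a = c k)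
    (fun k W W' hW' h hx' => by
      obtain ⟨a, ha⟩ := h (hW' hx')
      exact ⟨res hW' a, by rw [germ_res, ha]⟩)
    (fun k => by
      obtain ⟨W, hxW, a, ha⟩ := X.presheaf.exists_germ_eq (c k)
      exact ⟨W, hxW, fun _ => ⟨a, ha⟩⟩)
  choose a ha using fun k => h k hxW
  exact ⟨W, hW, hxW, a, ha⟩

theorem exists_res_eq_of_germ_eq {x : X} {U : Opens X} (hx : x ∈ U) {a b : Sec X U}
    (h : X.presheaf.germ U x hx a = X.presheaf.germ U x hx b) :
    ∃ (W : Opens X) (hW : W ≤ U), x ∈ W ∧ res hW a = res hW b := by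
  obtain ⟨W, hxW, i, j, hij⟩ := X.presheaf.germ_eq x hx hx a b h
  exact ⟨W, i.le, hxW, hij⟩

/-- A homeomorphism is flat if it is flat on the sections over a basis of open sets. -/
theorem isFlat_of_basis {q : X ⟶ Y} (hq : IsHomeomorph q.base)
    (h : ∀ (x : X) (W : Opens X), x ∈ W → ∃ V : Opens Y, x ∈ preim q V ∧ preim q V ≤ W ∧
      (pull q (le_refl (preim q V))).Flat) : IsFlat q := by
  intro x
  rw [ringHom_flat_iff]
  intro l f m hfm
  obtain ⟨V₁, -, hx₁, s, hs⟩ := exists_forall_germ_eq (x := q.base x) (U := ⊤) trivial f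
  obtain ⟨W₁, hW₁, hxW₁, b, hb⟩ := exists_forall_germ_eq (x := x) (U := preim q V₁) hx₁ m
  have hsum : X.presheaf.germ W₁ x hxW₁ (∑ i, pull q hW₁ (s i) * b i) =
      X.presheaf.germ W₁ x hxW₁ 0 := by
    rw [map_sum, map_zero, ← hfm]
    refine Finset.sum_congr rfl fun i _ => ?_
    rw [map_mul, hb, ← stalkMap_germ q hW₁ x hxW₁, hs]
  obtain ⟨W₂, hW₂, hxW₂, h0⟩ := exists_res_eq_of_germ_eq hxW₁ hsum
  obtain ⟨V, hxV, hVW, hflat⟩ := h x W₂ hxW₂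
  have hVV : V ≤ V₁ := by
    intro y hy
    obtain ⟨x', rfl⟩ := hq.surjective y
    exact hW₁ (hW₂ (hVW hy))
  have hrel : ∑ i, pull q (le_refl (preim q V)) (res hVV (s i)) * res (hVW.trans hW₂) (b i) = 0 := by
    have := congrArg (res hVW) h0
    rw [res_res, res_res, map_sum, map_zero] at this
    rw [← this]
    refine Finset.sum_congr rfl fun i _ => ?_
    rw [map_mul, res_pull, pull_res]
  obtain ⟨k, a, y, h1, h2⟩ := (ringHom_flat_iff _).1 hflat _ _ hrel
  refine ⟨k, fun i j => Y.presheaf.germ V (q.base x) hxV (a i j),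
    fun j => X.presheaf.germ (preim q V) x hxV (y j), fun i => ?_, fun j => ?_⟩
  · rw [← hb, ← germ_res (hVW.trans hW₂) x hxV, h1, map_sum]
    refine Finset.sum_congr rfl fun j _ => ?_
    rw [map_mul, ← stalkMap_germ q le_rfl x hxV]
  · have h3 := congrArg (Y.presheaf.germ V (q.base x) hxV) (h2 j)
    rw [map_sum, map_zero] at h3
    rw [← h3]
    refine Finset.sum_congr rfl fun i _ => ?_
    rw [map_mul, germ_res hVV (q.base x) hxV, hs]

end Flatness

/-! ### Charts of the foliation and the quotient in characteristic `p` -/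

section PrimeCharacteristic

variable {X S Z : LocallyRingedSpace.{u}} {f : X ⟶ S}

/-- A smooth foliation has frames over small formal affine open sets, with coordinates in the ideal
of the closed subscheme. -/
theorem IsSmoothFoliation.exists_chart {F : SubTangent f} (hF : IsSmoothFoliation F)
    (hX : IsNoetherianFormalScheme X) {i : Z ⟶ X} (hi : IsFormalClosedImmersion i)
    (hT : IsTransverse F i) (y : X) (W : Opens X) (hy : y ∈ W) :
    ∃ (U : Opens X) (n : ℕ) (E : Fin n → VectorField f U) (t : Fin n → Sec X U),
      y ∈ U ∧ U ≤ W ∧ IsFrame (fun U => (F U : Set (VectorField f U))) U E t ∧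
        IsClosedImmersionOver i U ∧ ∀ k, t k ∈ idealOf i U := by
  have := hX.compact
  have hcl := hi.isClosed_range
  obtain ⟨U, n, E, t, hyU, hE, ht⟩ := hF.exists_isFrame hX.isLocallyFormalAffine i hcl hT y
  obtain ⟨U', hyU', hi'⟩ := hi y
  by_cases hyZ : y ∈ Set.range i.base
  · obtain ⟨U₁, hy₁, h₁, -, hi₁⟩ := hi'.exists_le hyU' (W := U ⊓ W) ⟨hyU, hy⟩
    refine ⟨U₁, n, _, _, hy₁, h₁.trans inf_le_right, hE.restrict (h₁.trans inf_le_left), hi₁,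
      fun k => ?_⟩
    have h2 : pull i (le_refl (preim i U)) (t k) = 0 := ht hyZ k
    rw [idealOf, RingHom.mem_ker, pull_res, ← res_pull i le_rfl
      (preim_mono i (h₁.trans inf_le_left)), h2, map_zero]
  -- Away from `Z` one shrinks to the complement of `Z`; there the ideal of `Z` is the whole ring,
  -- so the condition on the coordinates is empty.
  · obtain ⟨U₁, hy₁, h₁, -, hi₁⟩ := hi'.exists_le hyU' (W := U ⊓ W ⊓ ⟨(Set.range i.base)ᶜ,
      hcl.isOpen_compl⟩) ⟨⟨hyU, hy⟩, hyZ⟩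
    refine ⟨U₁, n, _, _, hy₁, h₁.trans (inf_le_left.trans inf_le_right),
      hE.restrict (h₁.trans (inf_le_left.trans inf_le_left)), hi₁, fun k => ?_⟩
    refine sec_ext fun z hz => ?_
    exact absurd ⟨z, rfl⟩ (h₁ hz).2

theorem IsProjection.compactSpace {Y : LocallyRingedSpace.{u}} {R : ∀ U : Opens X, Subring (Sec X U)}
    {q : X ⟶ Y} (hq : IsProjection R q) (hX : CompactSpace X) : CompactSpace Y :=
  have : CompactSpace X.toPresheafedSpace := hX
  hq.isHomeomorph.surjective.compactSpace hq.isHomeomorph.continuous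

/-- In characteristic `p`, a smooth foliation has a flat quotient. -/
theorem IsSmoothFoliation.exists_quotient_of_prime {F : SubTangent f} (hF : IsSmoothFoliation F)
    (hX : IsNoetherianFormalScheme X) {i : Z ⟶ X} (hi : IsFormalClosedImmersion i)
    (hT : IsTransverse F i) {p : ℕ} (hp : p.Prime) (hpS : (p : Sec S ⊤) = 0) :
    ∃ (Y : LocallyRingedSpace.{u}) (q : X ⟶ Y),
        IsNoetherianFormalScheme Y ∧
        IsQuotient f (fun U => (F U : Set (VectorField f U))) q ∧
        IsFlat q ∧
        IsFormalClosedImmersion (i ≫ q) ∧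
        ∀ y : X, ∃ (V : Opens Y) (n : ℕ) (t : Fin n → Sec X (preim q V)) (c : Fin n → Sec Y V),
          y ∈ preim q V ∧ IsFormalAffine Y V ∧ IsFormalAffine X (preim q V) ∧
          (∀ k, t k ∈ idealOf i (preim q V)) ∧
          Function.Surjective (MvPolynomial.eval₂Hom (pull q (le_refl (preim q V))) t) ∧
          RingHom.ker (MvPolynomial.eval₂Hom (pull q (le_refl (preim q V))) t) =
            Ideal.span (Set.range fun k => MvPolynomial.X k ^ p - MvPolynomial.C (c k)) := by
  have hR := isSubringSheaf_constants (F := fun U => (F U : Set (VectorField f U)))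
    hF.isSubsheaf.restrict_mem
  have hpX : ∀ W : Opens X, (p : Sec X W) = 0 := fun W => by
    have := congrArg (pull f (W := W) (V := ⊤) fun _ _ => trivial) hpS
    rwa [map_natCast, map_zero] at this
  obtain ⟨Y, q, hq⟩ := hR.exists_isProjection
  have hdual : ∀ {U : Opens X} {n : ℕ} {E : Fin n → VectorField f U} {t : Fin n → Sec X U}
      (_ : IsFrame (fun U => (F U : Set (VectorField f U))) U E t) (W : Opens X) (h : W ≤ U),
      IsDualFrame (constants (fun U => (F U : Set (VectorField f U))) W) (fun k => (E k).der W h)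
        (fun k => res h (t k)) := fun hE W h => hE.isDualFrame (hE.commute hF) h
  have hEp : ∀ {U : Opens X} {n : ℕ} {E : Fin n → VectorField f U} {t : Fin n → Sec X U}
      (_ : IsFrame (fun U => (F U : Set (VectorField f U))) U E t) (i : Fin n) (W : Opens X)
      (h : W ≤ U) (a : Sec X W), ((E i).der W h)^[p] a = 0 := fun hE => hE.iterate_eq_zero hF hp hpS
  have hchart : ∀ (y : X) (W : Opens X), y ∈ W → ∃ (V : Opens Y) (n : ℕ)
      (E : Fin n → VectorField f (preim q V)) (t : Fin n → Sec X (preim q V)),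
      y ∈ preim q V ∧ preim q V ≤ W ∧
        IsFrame (fun U => (F U : Set (VectorField f U))) (preim q V) E t ∧
        IsClosedImmersionOver i (preim q V) ∧ ∀ k, t k ∈ idealOf i (preim q V) := by
    intro y W hy
    obtain ⟨U, n, E, t, h⟩ := hF.exists_chart hX hi hT y W hy
    obtain ⟨V, rfl⟩ := hq.exists_preim_eq U
    exact ⟨V, n, E, t, h⟩
  have hret : ∀ {U : Opens X} {n : ℕ} {E : Fin n → VectorField f U} {t : Fin n → Sec X U}
      (_ : IsFrame (fun U => (F U : Set (VectorField f U))) U E t), HasRetractions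
        (constants (fun U => (F U : Set (VectorField f U)))) U t p := fun hE =>
    hE.hasRetractions_of_prime (hE.commute hF) hp hpX (hEp hE)
  refine ⟨Y, q, ⟨hq.compactSpace hX.compact, fun y => ?_⟩, hq.isQuotient hF.isSubsheaf.restrict_mem
    hF.isSubsheaf.mem_of_local fun y => ?_, isFlat_of_basis hq.isHomeomorph fun x W hx => ?_,
    fun y => ?_, fun y => ?_⟩
  · obtain ⟨x, rfl⟩ := hq.isHomeomorph.surjective y
    obtain ⟨V, n, E, t, hxV, -, hE, hiV, -⟩ := hchart x ⊤ trivial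
    exact ⟨V, hxV, hq.isFormalAffine hR hiV.affine (hret hE)⟩
  · obtain ⟨V, n, E, t, hyV, -, hE, hiV, -⟩ := hchart y ⊤ trivial
    refine ⟨_, n, E, t, hyV, hiV.affine, hE, fun W h _ b k => ?_⟩
    obtain ⟨P, rfl⟩ := (hdual hE W h).surjective_eval₂Hom hp (hpX W) (fun i => hEp hE i W h) b
    exact ⟨P, by rw [sub_self]; exact zero_mem _⟩
  · obtain ⟨V, n, E, t, hxV, hVW, hE, -⟩ := hchart x W hx
    refine ⟨V, hxV, hVW, ?_⟩
    have h1 := (hdual hE _ le_rfl).free hp (hpX _) fun i => hEp hE i _ le_rfl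
    have h2 : (constants (fun U => (F U : Set (VectorField f U))) (preim q V)).subtype.Flat :=
      (inferInstance : Module.Flat (constants (fun U => (F U : Set (VectorField f U))) (preim q V))
        (Sec X (preim q V)))
    exact (RingHom.Flat.of_bijective (f := (hq.secEquiv V : Sec Y V →+* _))
      (hq.secEquiv V).bijective).comp h2
  · obtain ⟨x, rfl⟩ := hq.isHomeomorph.surjective y
    obtain ⟨V, n, E, t, hxV, -, hE, hiV, ht⟩ := hchart x ⊤ trivial
    exact ⟨V, hxV, hq.isClosedImmersionOver hR hiV ht (hret hE)⟩
  · obtain ⟨V, n, E, t, hyV, -, hE, hiV, ht⟩ := hchart y ⊤ trivial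
    have hd := hdual hE _ (le_refl (preim q V))
    simp only [res_self] at hd
    have hpow : ∀ k, t k ^ p ∈ constants (fun U => (F U : Set (VectorField f U))) (preim q V) :=
      fun k => (hd.mem_iff _).2 fun j => by
        rw [Derivation.leibniz_pow, nsmul_eq_mul, hpX, zero_mul]
    let e := hq.secEquiv V
    -- The presentation is known over the ring of constants; `e'` transports it to the functions on
    -- `Y`.
    let e' := MvPolynomial.mapEquiv (Fin n) e
    have he : MvPolynomial.eval₂Hom (pull q (le_refl (preim q V))) t =
        (MvPolynomial.eval₂Hom (constants (fun U => (F U : Set (VectorField f U)))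
          (preim q V)).subtype t).comp (e' : _ →+* _) := by
      refine MvPolynomial.ringHom_ext (fun r => ?_) fun k => ?_
      · simp [e', e]
      · simp [e']
    refine ⟨V, n, t, fun k => e.symm ⟨_, hpow k⟩, hyV, hq.isFormalAffine hR hiV.affine (hret hE),
      hiV.affine, ht, ?_, ?_⟩
    · rw [he, RingHom.coe_comp]
      exact (hd.surjective_eval₂Hom hp (hpX _) fun i => hEp hE i _ le_rfl).comp e'.surjective
    · rw [he, ← RingHom.comap_ker, hd.ker_eval₂Hom hp (hpX _) (fun k => ⟨_, hpow k⟩) fun k => rfl]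
      have h1 : Ideal.span (Set.range fun k => MvPolynomial.X k ^ p - MvPolynomial.C
          (⟨_, hpow k⟩ : constants (fun U => (F U : Set (VectorField f U))) (preim q V))) =
          (Ideal.span (Set.range fun k => MvPolynomial.X k ^ p -
            MvPolynomial.C (e.symm ⟨_, hpow k⟩))).map (e' : _ →+* _) := by
        rw [Ideal.map_span, ← Set.range_comp]
        congr 2
        ext1 k
        simp [e']
      rw [h1]
      exact Ideal.comap_map_of_bijective _ e'.bijective

end PrimeCharacteristic

/-! ### Local splitting and local freeness -/

section Splitting

variable {X S Z : LocallyRingedSpace.{u}} {f : X ⟶ S}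

/-- Locally, a smooth foliation splits off from the tangent sheaf. -/
theorem IsSmoothFoliation.exists_splitting {F : SubTangent f} (hF : IsSmoothFoliation F)
    (hS : IsNoetherianFormalScheme S) (hX : IsNoetherianFormalScheme X) {i : Z ⟶ X}
    (hi : IsFormalClosedImmersion i) (hT : IsTransverse F i) (y : X) :
    ∃ (U : Opens X) (n : ℕ) (x : Fin n → Sec X U),
      y ∈ U ∧ IsFormalAffine X U ∧ (∃ V : Opens S, IsFormalAffine S V ∧ U ≤ preim f V) ∧
      (y ∈ Set.range i.base → ∀ k, x k ∈ idealOf i U) ∧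
      ∀ (U' : Opens X) (h : U' ≤ U) (hU' : IsFormalAffine X U') (V : Opens S)
        (hV : U' ≤ preim f V), IsFormalAffine S V →
          SplitsOver F hU' V hV (fun k => res h (x k)) := by
  obtain ⟨V, hyV, hV⟩ := hS.exists_affine (f.base y)
  obtain ⟨U, n, E, x, hyU, hUV, hE, hiU, hx⟩ := hF.exists_chart hX hi hT y (preim f V) hyV
  exact ⟨U, n, x, hyU, hiU.affine, ⟨V, hV, hUV⟩, fun _ => hx, fun U' h hU' V' hV' hV'a =>
    splitsOver_of_isFrame hU' hV'a hV' (hE.restrict h)⟩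

theorem IsSmoothFoliation.isLocallyFree {F : SubTangent f} (hF : IsSmoothFoliation F)
    (hX : IsNoetherianFormalScheme X) {i : Z ⟶ X} (hi : IsFormalClosedImmersion i)
    (hT : IsTransverse F i) : IsLocallyFree F :=
  isLocallyFree_of_isFrame fun y => by
    obtain ⟨U, n, E, x, hyU, -, hE, -⟩ := hF.exists_chart hX hi hT y ⊤ trivial
    exact ⟨U, n, E, x, hyU, hE⟩

end Splitting

/-! ### The universal property of formal completions -/

section Completion

variable {X Z Xhat : LocallyRingedSpace.{u}}

/-- Membership in a power of the largest ideal of definition is a local property. -/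
theorem IsFormalAffine.mem_definingIdeal_pow_of_local {U : Opens X} (hU : IsFormalAffine X U)
    {n : ℕ} {a : Sec X U}
    (h : ∀ x ∈ U, ∃ (W : Opens X) (hW : W ≤ U), x ∈ W ∧ res hW a ∈ definingIdeal X W ^ n) :
    a ∈ definingIdeal X U ^ n := by
  -- The ideal of all multipliers that bring `a` into `J ^ n`. If it were proper, a maximal ideal
  -- above it would contain `J`, hence be a point; near that point `a` lies in `J ^ n`, so a power
  -- of some `s` not vanishing there is a multiplier.
  let Q : Ideal (Sec X U) := (definingIdeal X U ^ n).colon {a}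
  suffices hQ : Q = ⊤ by
    have h1 : (1 : Sec X U) ∈ Q := hQ ▸ Submodule.mem_top
    rw [Submodule.mem_colon_singleton] at h1
    simpa using h1
  by_contra hQ
  obtain ⟨P, hP, hQP⟩ := Ideal.exists_le_maximal Q hQ
  have hle : definingIdeal X U ^ n ≤ Q := fun b hb => by
    rw [Submodule.mem_colon_singleton]
    exact Ideal.mul_mem_right _ _ hb
  obtain ⟨x, hx, hPx⟩ := hU.exists_point P (hP.isPrime.le_of_pow_le (hle.trans hQP))
  obtain ⟨W, hW, hxW, haW⟩ := h x hx
  obtain ⟨s, hxs, hs⟩ := hU.exists_basicOpen hx hxW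
  have h1 : res (basicOpen_le s) a ∈ (definingIdeal X U).map (res (basicOpen_le s)) ^ n := by
    rw [← hU.definingIdeal_basicOpen, ← res_res hW hs]
    exact mem_pow_of_mem_pow (map_res_definingIdeal_le hs) haW
  obtain ⟨k, hk⟩ := (hU.isCompletedAway_basicOpen s).exists_pow_mul_mem n a h1
  have h2 : s ^ k ∈ Q := by rwa [Submodule.mem_colon_singleton, smul_eq_mul]
  have h3 : s ∈ P := hP.isPrime.mem_of_pow_mem k (hQP h2)
  exact (mem_basicOpen_iff s x hx).1 hxs ((hPx s).2 h3)

theorem IsFormalAffine.eq_of_local {U : Opens X} (hU : IsFormalAffine X U) {a b : Sec X U}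
    (h : ∀ x ∈ U, ∀ n, ∃ (W : Opens X) (hW : W ≤ U), x ∈ W ∧
      res hW a - res hW b ∈ definingIdeal X W ^ n) : a = b := by
  have := hU.complete
  rw [← sub_eq_zero]
  refine eq_zero_of_forall_mem_pow (definingIdeal X U) fun n =>
    hU.mem_definingIdeal_pow_of_local fun x hx => ?_
  obtain ⟨W, hW, hxW, h'⟩ := h x hx n
  exact ⟨W, hW, hxW, by rwa [map_sub]⟩

theorem map_pull_vanishingIdeal_le (g : Z ⟶ X) {T : Set X} (hg : Set.range g.base ⊆ T)
    {U : Opens X} {W : Opens Z} (h : W ≤ preim g U) :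
    (vanishingIdeal X T U).map (pull g h) ≤ definingIdeal Z W := by
  rw [Ideal.map_le_iff_le_comap]
  intro s hs
  rw [Ideal.mem_comap, mem_definingIdeal]
  intro x hx
  rw [vanishesAt_pull]
  exact mem_vanishingIdeal.1 hs _ _ (hg ⟨x, rfl⟩)

theorem map_res_vanishingIdeal_le (T : Set X) {U W : Opens X} (h : W ≤ U) :
    (vanishingIdeal X T U).map (res h) ≤ vanishingIdeal X T W := by
  rw [Ideal.map_le_iff_le_comap]
  intro s hs
  rw [Ideal.mem_comap, mem_vanishingIdeal]
  intro x hx hxT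
  rw [vanishesAt_res]
  exact mem_vanishingIdeal.1 hs _ _ hxT

namespace IsFormalCompletion

variable {T : Set X} {j : Xhat ⟶ X}

/-- A completion is a completed localization at `1`, so the results on derivations and
approximations apply to it. -/
theorem isCompletedAway (hj : IsFormalCompletion T j) {U : Opens X} (hU : IsFormalAffine X U) :
    IsCompletedAway (pull j (le_refl (preim j U))) (vanishingIdeal X T U) 1 where
  complete := hj.complete U hU
  isUnit := by simp
  exists_mul_sub_mem n b := by
    obtain ⟨c, hc⟩ := (hj.bijective U hU n).2 (Ideal.Quotient.mk _ b)
    obtain ⟨a, rfl⟩ := Ideal.Quotient.mk_surjective c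
    rw [Ideal.quotientMap_mk, Ideal.Quotient.eq, Ideal.map_pow] at hc
    refine ⟨0, a, ?_⟩
    rw [pow_zero, one_mul, ← neg_sub]
    exact neg_mem hc
  exists_pow_mul_mem n a ha := by
    refine ⟨0, ?_⟩
    rw [pow_zero, one_mul, ← Ideal.Quotient.eq_zero_iff_mem]
    apply (hj.bijective U hU n).1
    rw [map_zero, Ideal.quotientMap_mk, Ideal.Quotient.eq_zero_iff_mem, Ideal.map_pow]
    exact ha

theorem exists_sub_mem (hj : IsFormalCompletion T j) {U : Opens X} (hU : IsFormalAffine X U)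
    (n : ℕ) (b : Sec Xhat (preim j U)) :
    ∃ a, b - pull j (le_refl (preim j U)) a ∈
      (vanishingIdeal X T U).map (pull j (le_refl (preim j U))) ^ n := by
  obtain ⟨k, a, h⟩ := (hj.isCompletedAway hU).exists_mul_sub_mem n b
  exact ⟨a, by simpa using h⟩

theorem mem_pow (hj : IsFormalCompletion T j) {U : Opens X} (hU : IsFormalAffine X U)
    {n : ℕ} {a : Sec X U} (h : pull j (le_refl (preim j U)) a ∈
      (vanishingIdeal X T U).map (pull j (le_refl (preim j U))) ^ n) :
    a ∈ vanishingIdeal X T U ^ n := by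
  obtain ⟨k, h⟩ := (hj.isCompletedAway hU).exists_pow_mul_mem n a h
  simpa using h

/-- Every neighbourhood of a point of the completion contains the trace of a formal affine open
set of `X`. -/
theorem exists_preim_le (hj : IsFormalCompletion T j) (hX : IsLocallyFormalAffine X) {x : Xhat}
    {V : Opens Xhat} (hx : x ∈ V) {O : Opens X} (hO : j.base x ∈ O) :
    ∃ U : Opens X, j.base x ∈ U ∧ U ≤ O ∧ IsFormalAffine X U ∧ preim j U ≤ V := by
  obtain ⟨O', hO', hV⟩ := hj.isClosedEmbedding.isInducing.isOpen_iff.1 V.isOpen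
  have hxO : j.base x ∈ (⟨O', hO'⟩ : Opens X) := by
    have : x ∈ j.base ⁻¹' O' := by rw [hV]; exact hx
    exact this
  obtain ⟨U, hxU, hUO, hU⟩ := hX.exists_le (W := O ⊓ ⟨O', hO'⟩) ⟨hO, hxO⟩
  refine ⟨U, hxU, hUO.trans inf_le_left, hU, fun y hy => ?_⟩
  have h1 : y ∈ j.base ⁻¹' O' := (hUO hy).2
  rw [hV] at h1
  exact h1

theorem isLocallyFormalAffine (hj : IsFormalCompletion T j) (hX : IsLocallyFormalAffine X) :
    IsLocallyFormalAffine Xhat := fun x => by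
  obtain ⟨U, hxU, hU⟩ := hX (j.base x)
  exact ⟨preim j U, hxU, hj.affine U hU⟩

theorem isNoetherianFormalScheme (hj : IsFormalCompletion T j) (hX : IsNoetherianFormalScheme X) :
    IsNoetherianFormalScheme Xhat where
  compact := by
    have : CompactSpace X.toPresheafedSpace := hX.compact
    exact hj.isClosedEmbedding.compactSpace
  exists_affine := hj.isLocallyFormalAffine hX.isLocallyFormalAffine

end IsFormalCompletion

/-- For a morphism `g : Z ⟶ X` with image in `T`, the section `c` of `Z` is the pull-back of the
section `s` of the completion of `X` along `T`: it has the same approximations by sections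
of `X`. -/
def IsPullAlong (T : Set X) (j : Xhat ⟶ X) (g : Z ⟶ X) {V : Opens Xhat} (s : Sec Xhat V)
    {W : Opens Z} (c : Sec Z W) : Prop :=
  ∀ x ∈ W, ∀ n : ℕ, ∃ (U : Opens X) (hUV : preim j U ≤ V) (W' : Opens Z) (h : W' ≤ W)
    (hg : W' ≤ preim g U) (a : Sec X U), x ∈ W' ∧ IsFormalAffine X U ∧
      res hUV s - pull j (le_refl (preim j U)) a ∈
        (vanishingIdeal X T U).map (pull j (le_refl (preim j U))) ^ n ∧
      res h c - pull g hg a ∈ definingIdeal Z W' ^ n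

namespace IsPullAlong

variable {T : Set X} {j : Xhat ⟶ X} {g : Z ⟶ X}

theorem res_right {V : Opens Xhat} {s : Sec Xhat V} {W W₁ : Opens Z} {c : Sec Z W}
    (hc : IsPullAlong T j g s c) (h₁ : W₁ ≤ W) : IsPullAlong T j g s (res h₁ c) := by
  intro x hx n
  obtain ⟨U, hUV, W', h, hg, a, hxW, hU, h2, h3⟩ := hc x (h₁ hx) n
  refine ⟨U, hUV, W' ⊓ W₁, inf_le_right, inf_le_left.trans hg, a, ⟨hxW, hx⟩, hU, h2, ?_⟩
  have := mem_pow_of_mem_pow (map_res_definingIdeal_le (inf_le_left : W' ⊓ W₁ ≤ W')) h3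
  rw [res_res]
  rwa [map_sub, res_res, res_pull] at this

theorem of_local {V : Opens Xhat} {s : Sec Xhat V} {W : Opens Z} {c : Sec Z W}
    (hc : ∀ x ∈ W, ∃ (W' : Opens Z) (h : W' ≤ W), x ∈ W' ∧ IsPullAlong T j g s (res h c)) :
    IsPullAlong T j g s c := by
  intro x hx n
  obtain ⟨W₁, h₁, hx₁, hc₁⟩ := hc x hx
  obtain ⟨U, hUV, W', h, hg, a, hxW, hU, h2, h3⟩ := hc₁ x hx₁ n
  rw [res_res] at h3
  exact ⟨U, hUV, W', h.trans h₁, hg, a, hxW, hU, h2, h3⟩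

/-- The approximations of sections of the completion can be restricted to a smaller formal affine
open set. -/
theorem restrict_mem (T : Set X) (j : Xhat ⟶ X) {V : Opens Xhat} {s : Sec Xhat V} {U U' : Opens X}
    (hUV : preim j U ≤ V)
    (h : U' ≤ U) {a : Sec X U} {n : ℕ}
    (ha : res hUV s - pull j (le_refl (preim j U)) a ∈
        (vanishingIdeal X T U).map (pull j (le_refl (preim j U))) ^ n) :
    res ((preim_mono j h).trans hUV) s - pull j (le_refl (preim j U')) (res h a) ∈
        (vanishingIdeal X T U').map (pull j (le_refl (preim j U'))) ^ n := by
  have h1 : ((vanishingIdeal X T U).map (pull j (le_refl (preim j U)))).map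
      (res (preim_mono j h)) ≤ (vanishingIdeal X T U').map (pull j (le_refl (preim j U'))) := by
    rw [Ideal.map_map, Ideal.map_le_iff_le_comap]
    intro b hb
    rw [Ideal.mem_comap, RingHom.comp_apply, res_pull, ← pull_res j h le_rfl]
    exact Ideal.mem_map_of_mem _ (map_res_vanishingIdeal_le T h (Ideal.mem_map_of_mem _ hb))
  have h2 := mem_pow_of_mem_pow h1 ha
  rw [map_sub, res_res, res_pull] at h2
  rwa [pull_res]

/-- Common approximations of two pairs of sections. -/
theorem exists_common (hX : IsLocallyFormalAffine X) {V V' : Opens Xhat} {s : Sec Xhat V}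
    {s' : Sec Xhat V'} {W : Opens Z}
    {c c' : Sec Z W} (hc : IsPullAlong T j g s c) (hc' : IsPullAlong T j g s' c') {x : Z} (hx : x ∈ W)
    (n : ℕ) : ∃ (U : Opens X) (hUV : preim j U ≤ V) (hUV' : preim j U ≤ V') (W' : Opens Z)
      (h : W' ≤ W) (hg : W' ≤ preim g U) (a a' : Sec X U), x ∈ W' ∧ IsFormalAffine X U ∧
      res hUV s - pull j (le_refl (preim j U)) a ∈
        (vanishingIdeal X T U).map (pull j (le_refl (preim j U))) ^ n ∧
      res hUV' s' - pull j (le_refl (preim j U)) a' ∈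
        (vanishingIdeal X T U).map (pull j (le_refl (preim j U))) ^ n ∧
      res h c - pull g hg a ∈ definingIdeal Z W' ^ n ∧
      res h c' - pull g hg a' ∈ definingIdeal Z W' ^ n := by
  obtain ⟨U₁, hU₁, W₁, h₁, hg₁, a₁, hx₁, -, hs₁, hc₁⟩ := hc x hx n
  obtain ⟨U₂, hU₂, W₂, h₂, hg₂, a₂, hx₂, -, hs₂, hc₂⟩ := hc' x hx n
  obtain ⟨U, hxU, hUle, hU⟩ := hX.exists_le (x := g.base x) (W := U₁ ⊓ U₂) ⟨hg₁ hx₁, hg₂ hx₂⟩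
  have hl : U ≤ U₁ := hUle.trans inf_le_left
  have hr : U ≤ U₂ := hUle.trans inf_le_right
  have hW₁ : (W₁ ⊓ W₂) ⊓ preim g U ≤ W₁ := inf_le_left.trans inf_le_left
  have hW₂ : (W₁ ⊓ W₂) ⊓ preim g U ≤ W₂ := inf_le_left.trans inf_le_right
  refine ⟨U, (preim_mono j hl).trans hU₁, (preim_mono j hr).trans hU₂, (W₁ ⊓ W₂) ⊓ preim g U,
    hW₁.trans h₁, inf_le_right, res hl a₁, res hr a₂, ⟨⟨hx₁, hx₂⟩, hxU⟩, hU,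
    restrict_mem T j hU₁ hl hs₁, restrict_mem T j hU₂ hr hs₂, ?_, ?_⟩
  · have := mem_pow_of_mem_pow (map_res_definingIdeal_le hW₁) hc₁
    rwa [map_sub, res_res, res_pull, ← pull_res g hl inf_le_right] at this
  · have := mem_pow_of_mem_pow (map_res_definingIdeal_le hW₂) hc₂
    rwa [map_sub, res_res, res_pull, ← pull_res g hr inf_le_right] at this

/-- Two values have approximations `a`, `a'` by functions on `X` to the same section of the
completion. Then `a - a'` lies in the `n`-th power of the ideal of `T`, whose pull-back to `Z` lies
in the `n`-th power of the ideal of definition, and `Z` is separated. -/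
theorem unique (hX : IsLocallyFormalAffine X) (hZ : IsLocallyFormalAffine Z)
    (hj : IsFormalCompletion T j) (hg : Set.range g.base ⊆ T) {V : Opens Xhat} {s : Sec Xhat V}
    {W : Opens Z} {c c' : Sec Z W} (hc : IsPullAlong T j g s c) (hc' : IsPullAlong T j g s c') :
    c = c' := by
  refine sec_ext fun x hx => ?_
  obtain ⟨W₀, hx₀, hle, hW₀⟩ := hZ.exists_le hx
  refine ⟨W₀, hle, hx₀, hW₀.eq_of_local fun y hy n => ?_⟩
  obtain ⟨U, hUV, _, W', h, hgU, a, a', hy', hU, h1, h2, h3, h4⟩ :=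
    (hc.res_right hle).exists_common hX (hc'.res_right hle) hy n
  refine ⟨W', h, hy', ?_⟩
  have h5 : a - a' ∈ vanishingIdeal X T U ^ n := hj.mem_pow hU (by
    have := sub_mem h2 h1
    rw [map_sub]
    convert this using 1
    ring)
  have h6 := mem_pow_of_mem_pow (map_pull_vanishingIdeal_le g hg hgU) h5
  rw [map_sub] at h6
  have := sub_mem (add_mem h3 h6) h4
  convert this using 1
  ring

theorem add (hX : IsLocallyFormalAffine X) {V : Opens Xhat} {s s' : Sec Xhat V} {W : Opens Z}
    {c c' : Sec Z W} (hc : IsPullAlong T j g s c) (hc' : IsPullAlong T j g s' c') :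
    IsPullAlong T j g (s + s') (c + c') := by
  intro x hx n
  obtain ⟨U, hUV, _, W', h, hgU, a, a', hy', hU, h1, h2, h3, h4⟩ := hc.exists_common hX hc' hx n
  refine ⟨U, hUV, W', h, hgU, a + a', hy', hU, ?_, ?_⟩
  · have := add_mem h1 h2
    convert this using 1
    simp only [map_add]; ring
  · have := add_mem h3 h4
    convert this using 1
    simp only [map_add]; ring

theorem mul (hX : IsLocallyFormalAffine X) {V : Opens Xhat} {s s' : Sec Xhat V} {W : Opens Z}
    {c c' : Sec Z W} (hc : IsPullAlong T j g s c) (hc' : IsPullAlong T j g s' c') :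
    IsPullAlong T j g (s * s') (c * c') := by
  intro x hx n
  obtain ⟨U, hUV, _, W', h, hgU, a, a', hy', hU, h1, h2, h3, h4⟩ := hc.exists_common hX hc' hx n
  refine ⟨U, hUV, W', h, hgU, a * a', hy', hU, ?_, ?_⟩
  · have := add_mem (Ideal.mul_mem_right (res hUV s') _ h1)
      (Ideal.mul_mem_left _ (pull j (le_refl (preim j U)) a) h2)
    convert this using 1
    simp only [map_mul]; ring
  · have := add_mem (Ideal.mul_mem_right (res h c') _ h3)
      (Ideal.mul_mem_left _ (pull g hgU a) h4)
    convert this using 1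
    simp only [map_mul]; ring

theorem res_left (hX : IsLocallyFormalAffine X) {V V' : Opens Xhat} {s : Sec Xhat V} {W : Opens Z}
    {c : Sec Z W} (hc : IsPullAlong T j g s c) (hV : V' ≤ V)
    (hW : ∀ x ∈ W, ∃ y ∈ V', j.base y = g.base x) (hj : IsFormalCompletion T j) :
    IsPullAlong T j g (res hV s) c := by
  intro x hx n
  obtain ⟨U, hUV, W', h, hgU, a, hxW, hU, h2, h3⟩ := hc x hx n
  obtain ⟨y, hy, hyx⟩ := hW x hx
  obtain ⟨U', hyU, hle, hU', hUV'⟩ := hj.exists_preim_le hX hy (O := U) (by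
    rw [hyx]; exact hgU hxW)
  rw [hyx] at hyU
  refine ⟨U', hUV', W' ⊓ preim g U', inf_le_left.trans h, inf_le_right, res hle a, ⟨hxW, hyU⟩,
    hU', ?_, ?_⟩
  · rw [res_res]
    exact restrict_mem T j hUV hle h2
  · have := mem_pow_of_mem_pow
      (map_res_definingIdeal_le (inf_le_left : W' ⊓ preim g U' ≤ W')) h3
    rwa [map_sub, res_res, res_pull, ← pull_res g hle inf_le_right] at this

theorem pull_right (hX : IsLocallyFormalAffine X) {V : Opens X} {W : Opens Z} (h : W ≤ preim g V)
    (a : Sec X V) {V' : Opens Xhat} (hV : V' ≤ preim j V)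
    (hW : ∀ x ∈ W, ∃ y ∈ V', j.base y = g.base x) (hj : IsFormalCompletion T j) :
    IsPullAlong T j g (pull j hV a) (pull g h a) := by
  intro x hx n
  obtain ⟨y, hy, hyx⟩ := hW x hx
  obtain ⟨U, hyU, hle, hU, hUV⟩ := hj.exists_preim_le hX hy (O := V) (hV hy)
  rw [hyx] at hyU
  refine ⟨U, hUV, W ⊓ preim g U, inf_le_left, inf_le_right, res hle a, ⟨hx, hyU⟩, hU, ?_, ?_⟩
  · rw [res_pull, pull_res, sub_self]
    exact zero_mem _
  · rw [res_pull, pull_res, sub_self]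
    exact zero_mem _

/-- The approximations of `s` by functions on `X` form a Cauchy sequence for the ideal of `T`; its
pull-back converges on `W` because the image of `g` lies in `T`. -/
theorem exists_of_affine (hj : IsFormalCompletion T j) (hg : Set.range g.base ⊆ T)
    {U : Opens X} (hU : IsFormalAffine X U) {W : Opens Z} (hW : IsFormalAffine Z W)
    (h : W ≤ preim g U) {V : Opens Xhat} (hUV : preim j U ≤ V) (s : Sec Xhat V) :
    ∃ c : Sec Z W, IsPullAlong T j g s c := by
  have := hW.complete
  choose a ha using fun n => hj.exists_sub_mem hU n (res hUV s)
  obtain ⟨c, hc⟩ := exists_limit (definingIdeal Z W) (fun n => pull g h (a n)) fun n => by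
    rw [← map_sub]
    refine mem_pow_of_mem_pow (map_pull_vanishingIdeal_le g hg h) (hj.mem_pow hU ?_)
    have := sub_mem (ha n) (Ideal.pow_le_pow_right (Nat.le_succ n) (ha (n + 1)))
    rw [map_sub]
    convert this using 1
    ring
  refine ⟨c, fun x hx n => ⟨U, hUV, W, le_rfl, h, a n, hx, hU, ha n, ?_⟩⟩
  rw [res_self]
  exact hc n

/-- Vanishing at a point is decided by the first-order approximation, a function on `X`. This makes
the lifted morphism local. -/
theorem vanishesAt_iff (hj : IsFormalCompletion T j) {V : Opens Xhat} {s : Sec Xhat V}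
    {W : Opens Z} {c : Sec Z W} (hc : IsPullAlong T j g s c) {x : Z} (hx : x ∈ W) {y : Xhat}
    (hyx : j.base y = g.base x) (hy : y ∈ V) : VanishesAt s y hy ↔ VanishesAt c x hx := by
  obtain ⟨U, hUV, W', h, hgU, a, hxW, hU, h2, h3⟩ := hc x hx 1
  have hyU : y ∈ preim j U := by
    have : g.base x ∈ U := hgU hxW
    rw [← hyx] at this
    exact this
  rw [pow_one] at h2 h3
  have h4 := mem_definingIdeal.1 h3 x hxW
  have h5 := mem_definingIdeal.1 (map_pull_vanishingIdeal_le j hj.range_eq.le le_rfl h2) y hyU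
  rw [← vanishesAt_res h c x hxW, vanishesAt_of_sub h4, ← vanishesAt_res hUV s y hyU,
    vanishesAt_of_sub h5, vanishesAt_pull, vanishesAt_pull]
  exact vanishesAt_congr hyx _ _

end IsPullAlong

/-- A morphism whose image is contained in `T` factors through the formal completion
along `T`. -/
theorem IsFormalCompletion.exists_lift {T : Set X} {j : Xhat ⟶ X} (hj : IsFormalCompletion T j)
    (hX : IsLocallyFormalAffine X) (hZ : IsLocallyFormalAffine Z) (g : Z ⟶ X)
    (hg : Set.range g.base ⊆ T) : ∃ g' : Z ⟶ Xhat, g' ≫ j = g := by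
  have hex : ∀ z : Z, ∃ y : Xhat, j.base y = g.base z := fun z => by
    have : g.base z ∈ Set.range j.base := by rw [hj.range_eq]; exact hg ⟨z, rfl⟩
    exact this
  choose b₀ hb₀ using hex
  let b : C(Z, Xhat) := ⟨b₀, by
    rw [hj.isClosedEmbedding.isInducing.continuous_iff]
    have : j.base ∘ b₀ = g.base := funext hb₀
    rw [this]
    exact g.base.hom.continuous⟩
  have hb : ∀ z, j.base (b z) = g.base z := hb₀
  have hex : ∀ (V : Opens Xhat) (s : Sec Xhat V),
      ∃ c : Sec Z (Opens.comap b V), IsPullAlong T j g s c := by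
    intro V s
    have hloc : ∀ x ∈ Opens.comap b V, ∃ (W : Opens Z) (_ : W ≤ Opens.comap b V), x ∈ W ∧
        ∃ c : Sec Z W, IsPullAlong T j g s c := by
      intro x hx
      obtain ⟨U, hxU, -, hU, hUV⟩ := hj.exists_preim_le hX (x := b x) (V := V) hx (O := ⊤) trivial
      rw [hb] at hxU
      obtain ⟨W, hxW, hle, hW⟩ := hZ.exists_le (x := x) (W := Opens.comap b V ⊓ preim g U)
        ⟨hx, hxU⟩
      exact ⟨W, hle.trans inf_le_left, hxW,
        IsPullAlong.exists_of_affine hj hg hU hW (hle.trans inf_le_right) hUV s⟩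
    obtain ⟨c, hc⟩ := exists_glue (U := Opens.comap b V)
      (fun W _ (c : Sec Z W) => IsPullAlong T j g s c)
      (fun W _ W' h' c hc => hc.res_right h') (fun W _ c c' hc hc' => hc.unique hX hZ hj hg hc') hloc
    refine ⟨c, IsPullAlong.of_local fun x hx => ?_⟩
    obtain ⟨W, hW, hxW, c', hc'⟩ := hloc x hx
    refine ⟨W, hW, hxW, ?_⟩
    rw [hc W hW c' hc']
    exact hc'
  have hpt : ∀ V : Opens Xhat, ∀ x ∈ Opens.comap b V, ∃ y ∈ V, j.base y = g.base x :=
    fun V x hx => ⟨b x, hx, hb x⟩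
  have htop : ∀ V : Opens Xhat, V ≤ preim j ⊤ := fun V x _ => trivial
  have htop' : ∀ W : Opens Z, W ≤ preim g ⊤ := fun W x _ => trivial
  choose φ₀ hφ₀ using hex
  -- Uniqueness turns the chosen values into ring homomorphisms compatible with restriction: each
  -- law only requires that both sides have the same approximations.
  have hu : ∀ (V : Opens Xhat) (s : Sec Xhat V) (c : Sec Z (Opens.comap b V)),
      IsPullAlong T j g s c → φ₀ V s = c := fun V s c hc => (hφ₀ V s).unique hX hZ hj hg hc
  let φ : ∀ V : Opens Xhat, Sec Xhat V →+* Sec Z (Opens.comap b V) := fun V =>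
    { toFun := φ₀ V
      map_one' := hu V 1 1 (by
        simpa using IsPullAlong.pull_right hX (htop' _) 1 (htop V) (hpt V) hj)
      map_zero' := hu V 0 0 (by
        simpa using IsPullAlong.pull_right hX (htop' _) 0 (htop V) (hpt V) hj)
      map_add' := fun s s' => hu V _ _ ((hφ₀ V s).add hX (hφ₀ V s'))
      map_mul' := fun s s' => hu V _ _ ((hφ₀ V s).mul hX (hφ₀ V s')) }
  have hnat : ∀ (V V' : Opens Xhat) (h : V' ≤ V) (s : Sec Xhat V), φ V' (res h s) =
      res (U := Opens.comap b V) (W := Opens.comap b V') (fun _ hx => h hx) (φ V s) :=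
    fun V V' h s => hu V' _ _ (((hφ₀ V s).res_right _).res_left hX h (hpt V') hj)
  have hloc : ∀ (V : Opens Xhat) (s : Sec Xhat V) (x : Z) (hx : b x ∈ V), VanishesAt s (b x) hx →
      VanishesAt (φ V s) x hx := fun V s x hx h =>
    ((hφ₀ V s).vanishesAt_iff hj (x := x) hx (hb x) hx).1 h
  refine ⟨homMk b φ hnat hloc, hom_ext hb fun V W h h' s => ?_⟩
  have hle : W ≤ preim (homMk b φ hnat hloc) (preim j V) := h
  refine (pull_comp (homMk b φ hnat hloc) j (V' := preim j V) (W := W) le_rfl hle s).trans ?_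
  have h1 : pull (homMk b φ hnat hloc) (le_refl (Opens.comap b (preim j V)))
      (pull j (le_refl (preim j V)) s) = φ (preim j V) (pull j (le_refl (preim j V)) s) :=
    res_self _ _
  have h2 : pull (homMk b φ hnat hloc) hle (pull j (le_refl (preim j V)) s) =
      res (U := Opens.comap b (preim j V)) hle
        (φ (preim j V) (pull j (le_refl (preim j V)) s)) := by
    rw [← h1]
    exact (res_pull (homMk b φ hnat hloc) le_rfl hle _).symm
  rw [h2]
  refine ((hφ₀ _ _).res_right hle).unique hX hZ hj hg ?_
  exact IsPullAlong.pull_right hX h' s le_rfl (fun x hx => ⟨b x, hle hx, hb x⟩) hj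

end Completion

/-! ### Vector fields on formal completions -/

section CompletionVectorFields

variable {X S Xhat : LocallyRingedSpace.{u}} {f : X ⟶ S} {j : Xhat ⟶ X} {T : Set X}

/-- The commutator of two vector fields. -/
def VectorField.bracket {U : Opens X} (D E : VectorField f U) : VectorField f U where
  der W h := ⁅D.der W h, E.der W h⁆
  der_res W W' h h' a := by
    simp only [Derivation.commutator_apply, map_sub, D.der_res W W' h h', E.der_res W W' h h']
  der_pull W h V hV s := by
    simp only [Derivation.commutator_apply, D.der_pull W h, E.der_pull W h, map_zero, sub_self]

theorem VectorField.bracket_der {U : Opens X} (D E : VectorField f U) (W : Opens X) (h : W ≤ U)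
    (a : Sec X W) : (D.bracket E).der W h a =
      D.der W h (E.der W h a) - E.der W h (D.der W h a) :=
  Derivation.commutator_apply (D1 := D.der W h) (D2 := E.der W h) a

theorem Extends.restrict {U : Opens X} {W : Opens Xhat} {D : VectorField f U}
    {E : VectorField (j ≫ f) W} (h : Extends j D E) {U' : Opens X} (hU : U' ≤ U) {W' : Opens Xhat}
    (hW : W' ≤ W) : Extends j (D.restrict hU) (E.restrict hW) :=
  fun U₁ h₁ W₁ h₂ hj a => h U₁ (h₁.trans hU) W₁ (h₂.trans hW) hj a

namespace IsFormalCompletion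

/-- A derivation that kills the functions on `X` kills the functions on the completion. -/
theorem derivation_res_eq_zero (hj : IsFormalCompletion T j) {U : Opens X}
    (hU : IsFormalAffine X U) {W : Opens Xhat} (hW : W ≤ preim j U)
    [IsHausdorff (definingIdeal Xhat W) (Sec Xhat W)] (δ : Derivation ℤ (Sec Xhat W) (Sec Xhat W))
    (h : ∀ a, δ (pull j hW a) = 0) (b : Sec Xhat (preim j U)) : δ (res hW b) = 0 := by
  refine (hj.isCompletedAway hU).eq_zero_of_leibniz (res hW) (definingIdeal Xhat W) ?_
    (δ.toLinearMap.toAddMonoidHom.comp (res hW).toAddMonoidHom) (fun b b' => ?_) (fun a => ?_) b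
  · exact (Ideal.map_mono (map_pull_vanishingIdeal_le j hj.range_eq.le le_rfl)).trans
      (map_res_definingIdeal_le hW)
  · change δ (res hW (b * b')) = res hW b * δ (res hW b') + res hW b' * δ (res hW b)
    rw [map_mul, Derivation.leibniz]
    rfl
  · change δ (res hW (pull j le_rfl a)) = 0
    rw [res_pull, h]

/-- A vector field on the completion is determined by its action on functions on `X`. -/
theorem vectorField_eq_zero (hj : IsFormalCompletion T j) {g : Xhat ⟶ S} {W : Opens Xhat}
    {D : VectorField g W}
    (h : ∀ w ∈ W, ∃ U : Opens X, IsFormalAffine X U ∧ w ∈ preim j U ∧ ∀ (W' : Opens Xhat)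
      (hW : W' ≤ W) (hU : W' ≤ preim j U) (a : Sec X U), D.der W' hW (pull j hU a) = 0) :
    D = 0 := by
  refine VectorField.ext_of_local fun w hw => ?_
  obtain ⟨U, hU, hwU, hD⟩ := h w hw
  obtain ⟨s, hws, hs⟩ := (hj.affine U hU).exists_basicOpen hwU hw
  have hA := (hj.affine U hU).basicOpen s
  have := hA.complete
  refine ⟨basicOpen s, hs, hws, VectorField.ext_of_isFormalAffine hA fun b => ?_⟩
  have h1 : (D.der (basicOpen s) hs) = 0 :=
    ((hj.affine U hU).isCompletedAway_basicOpen s).derivation_ext fun b =>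
      hj.derivation_res_eq_zero hU (basicOpen_le s) _ (fun a => hD _ hs (basicOpen_le s) a) b
  change D.der (basicOpen s) hs b = 0
  rw [h1]
  rfl

/-- Vector fields on formal affine open sets of `X` extend to the completion. -/
theorem exists_extends (hj : IsFormalCompletion T j) (hX : IsLocallyFormalAffine X) {U : Opens X}
    (hU : IsFormalAffine X U) {V : Opens S} (hV : IsFormalAffine S V) (h : U ≤ preim f V)
    (D : VectorField f U) : ∃ E : VectorField (j ≫ f) (preim j U), Extends j D E := by
  obtain ⟨d, hd⟩ := (hj.isCompletedAway hU).exists_derivation (D.der U le_rfl)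
  have hle : preim j U ≤ preim (j ≫ f) V := preim_mono j h
  obtain ⟨E, hE⟩ := exists_vectorField (f := j ≫ f) (hj.affine U hU) hV hle d fun s => by
    have h1 : pull (j ≫ f) hle s = pull j le_rfl (pull f h s) := pull_comp j f h le_rfl s
    rw [h1, hd, D.der_pull, map_zero]
  refine ⟨E, fun U' hU' W' hW' hjW a => sec_ext fun w hw => ?_⟩
  obtain ⟨s, hws, hs⟩ := hU.exists_basicOpen (x := j.base w) (hW' hw) (W := U') (hjW hw)
  obtain ⟨W, hwW, hWle, hW⟩ := hj.isLocallyFormalAffine hX |>.exists_le (x := w)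
    (W := W' ⊓ preim j (basicOpen s)) ⟨hw, hws⟩
  have hWW' : W ≤ W' := hWle.trans inf_le_left
  have hWs : W ≤ preim j (basicOpen s) := hWle.trans inf_le_right
  have := hW.complete
  refine ⟨W, hWW', hwW, ?_⟩
  rw [← E.der_res, res_pull, res_pull, ← pull_res j hs hWs, ← pull_res j hs hWs, ← D.der_res,
    ← sub_eq_zero]
  -- The defect of compatibility with `D`. It satisfies the Leibniz rule along the pull-back and
  -- vanishes on `Γ(U)`, so it vanishes.
  let δ : Sec X (basicOpen s) →+ Sec Xhat W :=
    ((E.der W (hWW'.trans hW')).toLinearMap.toAddMonoidHom.comp (pull j hWs).toAddMonoidHom) -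
      ((pull j hWs).toAddMonoidHom.comp
        (D.der (basicOpen s) (basicOpen_le s)).toLinearMap.toAddMonoidHom)
  have hδ : ∀ c, δ c = E.der W (hWW'.trans hW') (pull j hWs c) -
    pull j hWs (D.der (basicOpen s) (basicOpen_le s) c) := fun c => rfl
  refine Eq.trans (hδ _).symm ((hU.isCompletedAway_basicOpen s).eq_zero_of_leibniz (pull j hWs)
    (definingIdeal Xhat W) ?_ δ (fun b b' => ?_) (fun b => ?_) _)
  · exact (Ideal.map_mono (map_res_definingIdeal_le _)).trans (map_pull_definingIdeal_le j hWs)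
  · simp only [hδ, map_mul, Derivation.leibniz, smul_eq_mul, map_add]
    ring
  · rw [hδ, pull_res, D.der_res U (basicOpen s) le_rfl, pull_res,
      ← res_pull j (le_refl (preim j U)) (hWW'.trans hW'),
      ← res_pull j (le_refl (preim j U)) (hWW'.trans hW'), E.der_res _ W le_rfl, hE, hd, sub_self]

end IsFormalCompletion

section RestrictToCompletion

variable {F : SubTangent f}

theorem restrictToCompletion_restrict (F : SubTangent f) (j : Xhat ⟶ X) (W W₁ : Opens Xhat)
    (h : W₁ ≤ W) (D : VectorField (j ≫ f) W) (hD : D ∈ restrictToCompletion F j W) :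
    D.restrict h ∈ restrictToCompletion F j W₁ := by
  intro w hw
  obtain ⟨W', hW', hwW', hspan⟩ := hD w (h hw)
  refine ⟨W₁ ⊓ W', inf_le_left, ⟨hw, hwW'⟩, ?_⟩
  rw [VectorField.restrict_restrict, ← VectorField.restrict_restrict hW' inf_le_right]
  generalize D.restrict hW' = D' at hspan
  induction hspan using Submodule.span_induction with
  | mem E hE =>
    obtain ⟨U, hU, D', hD', hE⟩ := hE
    exact Submodule.subset_span ⟨U, inf_le_right.trans hU, D', hD', hE.restrict le_rfl inf_le_right⟩
  | zero => exact zero_mem _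
  | add E E' _ _ h h' => exact add_mem h h'
  | smul a E _ h =>
    rw [VectorField.restrict_smul]
    exact Submodule.smul_mem _ _ h

theorem restrictToCompletion_mem_of_local (F : SubTangent f) (j : Xhat ⟶ X) (W : Opens Xhat)
    (D : VectorField (j ≫ f) W) (h : ∀ x ∈ W, ∃ (W' : Opens Xhat) (h : W' ≤ W), x ∈ W' ∧
      D.restrict h ∈ restrictToCompletion F j W') : D ∈ restrictToCompletion F j W := by
  intro w hw
  obtain ⟨W', hW', hwW', hD⟩ := h w hw
  obtain ⟨W₁, hW₁, hwW₁, hD₁⟩ := hD w hwW'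
  exact ⟨W₁, hW₁.trans hW', hwW₁, hD₁⟩

/-- The extensions of a frame are a frame of the restriction to the completion. -/
theorem IsFormalCompletion.isFrame (hj : IsFormalCompletion T j) (hX : IsLocallyFormalAffine X)
    (hF : IsSubsheaf F)
    {U : Opens X} {n : ℕ} {E : Fin n → VectorField f U} {x : Fin n → Sec X U}
    (hE : IsFrame (fun U => (F U : Set (VectorField f U))) U E x)
    {E' : Fin n → VectorField (j ≫ f) (preim j U)} (hE' : ∀ k, Extends j (E k) (E' k)) :
    IsFrame (restrictToCompletion F j) (preim j U) E' (fun k => pull j le_rfl (x k)) where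
  dual k l := by
    rw [hE' k U le_rfl _ le_rfl le_rfl, hE.dual]
    split_ifs <;> simp
  mem_iff W h D := by
    constructor
    · intro hD
      refine VectorField.ext_of_local fun w hw => ?_
      obtain ⟨W', hW', hwW', hspan⟩ := hD w hw
      refine ⟨W', hW', hwW', ?_⟩
      -- The expansion in the frame is linear in the field, so it suffices to check it for the
      -- extension of a section of `F`, and there on functions on `X`, where it is the expansion of
      -- that section.
      have key : ∀ D' ∈ Submodule.span (Sec Xhat W') {E : VectorField (j ≫ f) W' |
          ∃ (U : Opens X), W' ≤ preim j U ∧ ∃ D' ∈ F U, Extends j D' E},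
          D' = ∑ i, D'.der W' le_rfl (pull j (hW'.trans h) (x i)) •
            (E' i).restrict (hW'.trans h) := by
        intro D' hD'
        induction hD' using Submodule.span_induction with
        | mem D' hD' =>
          obtain ⟨U₁, hU₁, D₁, hD₁, hDE⟩ := hD'
          rw [← sub_eq_zero]
          refine hj.vectorField_eq_zero fun y hy => ?_
          obtain ⟨U₂, hyU₂, hle, hU₂⟩ := hX.exists_le (x := j.base y) (W := U ⊓ U₁)
            ⟨h (hW' hy), hU₁ hy⟩
          have hUU : U₂ ≤ U := hle.trans inf_le_left
          have hUU₁ : U₂ ≤ U₁ := hle.trans inf_le_right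
          refine ⟨U₂, hU₂, hyU₂, fun W₂ hW₂ hWU a => ?_⟩
          have h1 := (hE.mem_iff U₂ hUU _).1 (hF.restrict_mem _ _ hUU₁ D₁ hD₁)
          have h2 := congrArg (fun D => pull j hWU (VectorField.der D U₂ le_rfl a)) h1
          simp only [VectorField.sum_der, VectorField.smul_der, VectorField.restrict_der, res_self,
            map_sum, map_mul] at h2
          rw [← hDE U₂ hUU₁ W₂ hW₂ hWU a] at h2
          rw [VectorField.sub_der, h2, VectorField.sum_der, sub_eq_zero]
          refine Finset.sum_congr rfl fun i _ => ?_
          rw [VectorField.smul_der, VectorField.restrict_der, hE' i U₂ hUU W₂ _ hWU a,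
            ← D'.der_res _ _ le_rfl, res_pull, ← hDE U₂ hUU₁ W₂ hW₂ hWU, pull_res]
        | zero =>
          simp
        | add D₁ D₂ _ _ h₁ h₂ =>
          simp only [VectorField.add_der, add_smul, Finset.sum_add_distrib]
          rw [← h₁, ← h₂]
        | smul a D₁ _ h₁ =>
          simp only [VectorField.smul_der, res_self, mul_smul, ← Finset.smul_sum]
          rw [← h₁]
      have h1 := key _ hspan
      rw [VectorField.restrict_sum, h1]
      refine Finset.sum_congr rfl fun i _ => ?_
      rw [VectorField.restrict_smul, ← D.der_res _ _ le_rfl, res_pull, res_pull]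
      rfl
    · intro hD w hw
      refine ⟨W, le_rfl, hw, ?_⟩
      rw [VectorField.restrict_self, hD]
      refine sum_mem fun i _ => Submodule.smul_mem _ _ (Submodule.subset_span ?_)
      exact ⟨U, h, E i, by simpa using hE.mem U le_rfl i, (hE' i).restrict le_rfl h⟩

/-- The bracket of the extensions vanishes on functions on `X`, and a field on the completion is
determined by its action on these. -/
theorem IsFormalCompletion.commute (hj : IsFormalCompletion T j) {U : Opens X}
    (hU : IsFormalAffine X U) {D₁ D₂ : VectorField f U}
    (h : ∀ (W : Opens X) (h : W ≤ U) (a : Sec X W),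
      D₁.der W h (D₂.der W h a) = D₂.der W h (D₁.der W h a))
    {E₁ E₂ : VectorField (j ≫ f) (preim j U)} (h₁ : Extends j D₁ E₁) (h₂ : Extends j D₂ E₂)
    (W : Opens Xhat) (hW : W ≤ preim j U) (a : Sec Xhat W) :
    E₁.der W hW (E₂.der W hW a) = E₂.der W hW (E₁.der W hW a) := by
  have h0 : E₁.bracket E₂ = 0 := hj.vectorField_eq_zero fun w hw =>
    ⟨U, hU, hw, fun W' hW' hUW' a => by
      rw [VectorField.bracket_der, h₂ U le_rfl W' hW' hUW', h₁ U le_rfl W' hW' hUW',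
        h₁ U le_rfl W' hW' hUW', h₂ U le_rfl W' hW' hUW', h, sub_self]⟩
  have := E₁.bracket_der E₂ W hW a
  rw [h0] at this
  exact (sub_eq_zero.1 this.symm)

end RestrictToCompletion

end CompletionVectorFields

/-! ### The quotient of the formal completion -/

section CompletionQuotient

variable {X S Z Xhat Y : LocallyRingedSpace.{u}} {f : X ⟶ S} {F : SubTangent f}

theorem vanishesAt_of_mem_idealOf {i : Z ⟶ X} {U : Opens X} {s : Sec X U} (hs : s ∈ idealOf i U)
    {x : X} (hx : x ∈ U) (hxi : x ∈ Set.range i.base) : VanishesAt s x hx := by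
  obtain ⟨z, rfl⟩ := hxi
  have h1 := (vanishesAt_pull i (le_refl (preim i U)) s z hx).1
  refine h1 ?_
  rw [RingHom.mem_ker.1 hs]
  exact map_zero _

theorem IsClosedImmersionOver.of_comp {i' : Z ⟶ Xhat} {j : Xhat ⟶ X} {U : Opens X}
    (h : IsClosedImmersionOver (i' ≫ j) U) (hU : IsFormalAffine Xhat (preim j U)) :
    IsClosedImmersionOver i' (preim j U) := by
  have hpull : ∀ a, pull (i' ≫ j) (le_refl (preim (i' ≫ j) U)) a =
      pull i' (le_refl (preim i' (preim j U))) (pull j le_rfl a) := fun a =>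
    pull_comp i' j (V' := preim j U) (W := preim i' (preim j U)) le_rfl le_rfl a
  refine ⟨hU, h.affine_preim, fun c => ?_, ?_⟩
  · obtain ⟨a, ha⟩ := h.surjective c
    exact ⟨pull j le_rfl a, (hpull a).symm.trans ha⟩
  · refine h.adic.trans (Ideal.radical_mono
      (Ideal.map_le_iff_le_comap.2 fun (a : Sec X U) ha => ?_))
    refine Ideal.mem_comap.2 ((congrArg (· ∈ _) (hpull a)).mpr ?_)
    exact Ideal.mem_map_of_mem _ (map_pull_definingIdeal_le j le_rfl (Ideal.mem_map_of_mem _ ha))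

/-- A frame of `F` over a formal affine open set `U` and its extension to the completion along the
image of `i`, where the coordinates vanish on the closed subscheme. -/
structure IsCompletedChart (F : SubTangent f) (i : Z ⟶ X) (j : Xhat ⟶ X) (U : Opens X)
    (V : Opens S) {n : ℕ} (E : Fin n → VectorField f U) (x : Fin n → Sec X U)
    (E' : Fin n → VectorField (j ≫ f) (preim j U)) (x' : Fin n → Sec Xhat (preim j U)) : Prop where
  affine_base : IsFormalAffine S V
  le_base : U ≤ preim f V
  affine_source : IsFormalAffine X U
  isFrame : IsFrame (fun U => (F U : Set (VectorField f U))) U E x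
  mem_idealOf : ∀ k, x k ∈ idealOf i U
  affine : IsFormalAffine Xhat (preim j U)
  extends_frame : ∀ k, Extends j (E k) (E' k)
  pull_eq : ∀ k, pull j le_rfl (x k) = x' k
  isFrame' : IsFrame (restrictToCompletion F j) (preim j U) E' x'
  commute : ∀ k l (W : Opens Xhat) (h : W ≤ preim j U) (a : Sec Xhat W),
      (E' k).der W h ((E' l).der W h a) = (E' l).der W h ((E' k).der W h a)

variable {i : Z ⟶ X} {j : Xhat ⟶ X}

theorem IsFormalCompletion.exists_chart (hF : IsSmoothFoliation F)
    (hS : IsNoetherianFormalScheme S) (hX : IsNoetherianFormalScheme X)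
    (hi : IsFormalClosedImmersion i) (hT : IsTransverse F i)
    (hj : IsFormalCompletion (Set.range i.base) j) (y : Xhat) (W : Opens Xhat) (hy : y ∈ W)
    (V₀ : Opens S) (hV₀ : (j ≫ f).base y ∈ V₀) :
    ∃ (U : Opens X) (V : Opens S) (n : ℕ) (E : Fin n → VectorField f U) (x : Fin n → Sec X U)
      (E' : Fin n → VectorField (j ≫ f) (preim j U)) (x' : Fin n → Sec Xhat (preim j U)),
      y ∈ preim j U ∧ preim j U ≤ W ∧ V ≤ V₀ ∧ IsClosedImmersionOver i U ∧
        IsCompletedChart F i j U V E x E' x' := by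
  obtain ⟨V, hyV, hVV₀, hV⟩ := hS.isLocallyFormalAffine.exists_le hV₀
  obtain ⟨O, hyO, hOV, -, hOW⟩ := hj.exists_preim_le hX.isLocallyFormalAffine hy
    (O := preim f V) hyV
  obtain ⟨U, n, E, x, hyU, hUO, hE, hiU, hx⟩ := hF.exists_chart hX hi hT _ O hyO
  have hUV : U ≤ preim f V := hUO.trans hOV
  choose E' hE' using fun k =>
    hj.exists_extends hX.isLocallyFormalAffine hiU.affine hV hUV (E k)
  exact ⟨U, V, n, E, x, E', _, hyU, (preim_mono j hUO).trans hOW, hVV₀, hiU, hV, hUV, hiU.affine,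
    hE, hx, hj.affine U hiU.affine, hE', fun _ => rfl,
    hj.isFrame hX.isLocallyFormalAffine hF.isSubsheaf hE hE', fun k l =>
      hj.commute hiU.affine (fun W h a => hE.commute hF k l W h a) (hE' k) (hE' l)⟩

namespace IsCompletedChart

variable {U : Opens X} {V : Opens S} {n : ℕ} {E : Fin n → VectorField f U} {x : Fin n → Sec X U}
  {E' : Fin n → VectorField (j ≫ f) (preim j U)} {x' : Fin n → Sec Xhat (preim j U)}

/-- The points of the completion are the points of `Z`, where the coordinates vanish. This is what
makes the Taylor series in characteristic zero converge. -/
theorem mem_definingIdeal (h : IsCompletedChart F i j U V E x E' x')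
    (hj : IsFormalCompletion (Set.range i.base) j) (k : Fin n) :
    x' k ∈ definingIdeal Xhat (preim j U) := by
  rw [FormalGeometry.mem_definingIdeal, ← h.pull_eq]
  intro y hy
  rw [vanishesAt_pull]
  refine vanishesAt_of_mem_idealOf (h.mem_idealOf k) hy ?_
  rw [← hj.range_eq]
  exact ⟨y, rfl⟩

theorem res_mem_definingIdeal (h : IsCompletedChart F i j U V E x E' x')
    (hj : IsFormalCompletion (Set.range i.base) j) {W : Opens Xhat} (hW : W ≤ preim j U)
    (k : Fin n) : res hW (x' k) ∈ definingIdeal Xhat W :=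
  map_res_definingIdeal_le hW (Ideal.mem_map_of_mem _ (h.mem_definingIdeal hj k))

theorem restrict (h : IsCompletedChart F i j U V E x E' x')
    (hj : IsFormalCompletion (Set.range i.base) j) {U' : Opens X} (hU : U' ≤ U)
    (hU' : IsFormalAffine X U') {V' : Opens S} (hV' : IsFormalAffine S V') (hUV : U' ≤ preim f V') :
    IsCompletedChart F i j U' V' (fun k => (E k).restrict hU) (fun k => res hU (x k))
      (fun k => (E' k).restrict (preim_mono j hU)) (fun k => res (preim_mono j hU) (x' k)) where
  affine_base := hV'
  le_base := hUV
  affine_source := hU'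
  isFrame := h.isFrame.restrict hU
  mem_idealOf k := by
    have h2 : pull i (le_refl (preim i U)) (x k) = 0 := h.mem_idealOf k
    rw [idealOf, RingHom.mem_ker, pull_res, ← res_pull i le_rfl (preim_mono i hU), h2, map_zero]
  affine := hj.affine U' hU'
  extends_frame k := (h.extends_frame k).restrict hU (preim_mono j hU)
  pull_eq k := by rw [pull_res, ← h.pull_eq, res_pull]
  isFrame' := h.isFrame'.restrict (preim_mono j hU)
  commute k l W hW a := h.commute k l W (hW.trans (preim_mono j hU)) a

theorem isDualFrame (h : IsCompletedChart F i j U V E x E' x') {W : Opens Xhat}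
    (hW : W ≤ preim j U) :
    IsDualFrame (constants (restrictToCompletion F j) W) (fun k => (E' k).der W hW)
      (fun k => res hW (x' k)) :=
  h.isFrame'.isDualFrame h.commute hW

theorem hasRetractions (h : IsCompletedChart F i j U V E x E' x')
    (hj : IsFormalCompletion (Set.range i.base) j)
    (hu : ∀ (W : Opens Xhat) (n : ℕ), n ≠ 0 → IsUnit (n : Sec Xhat W)) :
    HasRetractions (constants (restrictToCompletion F j)) (preim j U) x' 1 :=
  h.isFrame'.hasRetractions_of_isUnit h.commute
    (isSubringSheaf_constants (restrictToCompletion_restrict F j)) hu (h.mem_definingIdeal hj)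

end IsCompletedChart

theorem isUnit_natCast_of_pull {g : X ⟶ S} (h : ∀ n : ℕ, n ≠ 0 → IsUnit (n : Sec S ⊤))
    (W : Opens X) (n : ℕ) (hn : n ≠ 0) : IsUnit (n : Sec X W) := by
  have := (h n hn).map (pull g (V := ⊤) (W := W) fun _ _ => trivial)
  rwa [map_natCast] at this

variable {q : Xhat ⟶ Y}

theorem IsFormalCompletion.isNoetherianFormalScheme_quotient (hF : IsSmoothFoliation F)
    (hS : IsNoetherianFormalScheme S) (hX : IsNoetherianFormalScheme X)
    (hi : IsFormalClosedImmersion i) (hT : IsTransverse F i)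
    (hj : IsFormalCompletion (Set.range i.base) j)
    (hu : ∀ (W : Opens Xhat) (n : ℕ), n ≠ 0 → IsUnit (n : Sec Xhat W))
    (hq : IsProjection (constants (restrictToCompletion F j)) q) : IsNoetherianFormalScheme Y where
  compact := hq.compactSpace (hj.isNoetherianFormalScheme hX).compact
  exists_affine y := by
    obtain ⟨x, rfl⟩ := hq.isHomeomorph.surjective y
    obtain ⟨U, V, n, E, x, E', x', hyU, -, -, hiU, h⟩ := hj.exists_chart hF hS hX hi hT x ⊤ trivial ⊤
      trivial
    obtain ⟨V', hV'⟩ := hq.exists_preim_eq (preim j U)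
    have h1 := h.hasRetractions hj hu
    have h2 := h.affine
    clear h
    generalize preim j U = U' at *
    subst hV'
    exact ⟨V', hyU, hq.isFormalAffine
      (isSubringSheaf_constants (restrictToCompletion_restrict F j)) h2 h1⟩

theorem IsFormalCompletion.isQuotient (hF : IsSmoothFoliation F)
    (hS : IsNoetherianFormalScheme S) (hX : IsNoetherianFormalScheme X)
    (hi : IsFormalClosedImmersion i) (hT : IsTransverse F i)
    (hj : IsFormalCompletion (Set.range i.base) j)
    (hu : ∀ (W : Opens Xhat) (n : ℕ), n ≠ 0 → IsUnit (n : Sec Xhat W))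
    (hq : IsProjection (constants (restrictToCompletion F j)) q) :
    IsQuotient (j ≫ f) (restrictToCompletion F j) q := by
  refine hq.isQuotient (restrictToCompletion_restrict F j) (restrictToCompletion_mem_of_local F j)
    fun y => ?_
  obtain ⟨U, V, n, E, x, E', x', hyU, -, -, hiU, h⟩ := hj.exists_chart hF hS hX hi hT y ⊤ trivial ⊤
    trivial
  refine ⟨preim j U, n, E', x', hyU, h.affine, h.isFrame', fun W hW hWa b k => ?_⟩
  have := hWa.complete
  -- Polynomials in the coordinates over the constants are dense for the powers of the ideal of the
  -- coordinates, hence for the powers of the larger ideal of definition.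
  obtain ⟨π, hπ⟩ := (h.isDualFrame hW).exists_isRetraction (hu W) (h.res_mem_definingIdeal hj hW)
  obtain ⟨P, hP⟩ := IsDualFrame.exists_eval_sub_mem (π : Sec Xhat W →+ Sec Xhat W) hπ k b
  refine ⟨P, Ideal.pow_right_mono (Ideal.span_le.2 ?_) k hP⟩
  rintro _ ⟨l, rfl⟩
  exact h.res_mem_definingIdeal hj hW l

theorem IsFormalCompletion.isFormallySmooth (hF : IsSmoothFoliation F)
    (hS : IsNoetherianFormalScheme S) (hX : IsNoetherianFormalScheme X)
    (hi : IsFormalClosedImmersion i) (hT : IsTransverse F i)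
    (hj : IsFormalCompletion (Set.range i.base) j)
    (hu : ∀ (W : Opens Xhat) (n : ℕ), n ≠ 0 → IsUnit (n : Sec Xhat W))
    (hq : IsProjection (constants (restrictToCompletion F j)) q) : IsFormallySmooth q := by
  intro y
  obtain ⟨U, V, n, E, x, E', x', hyU, -, -, hiU, h⟩ := hj.exists_chart hF hS hX hi hT y ⊤ trivial ⊤
    trivial
  obtain ⟨V', hV'⟩ := hq.exists_preim_eq (preim j U)
  have h1 := h.hasRetractions hj hu
  have h2 := h.affine
  have h3 := h.isDualFrame le_rfl
  have h4 := h.res_mem_definingIdeal hj le_rfl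
  clear h
  generalize preim j U = U' at *
  subst hV'
  refine ⟨V', preim q V', le_rfl, hyU, hq.isFormalAffine
      (isSubringSheaf_constants (restrictToCompletion_restrict F j)) h2 h1, h2, ?_⟩
  have := h2.complete
  intro C _ N hN α β hβ hαβ
  let e := hq.secEquiv V'
  obtain ⟨γ, hγ, hγ'⟩ := h3.isAdicallyFormallySmooth (hu _) h4 C N hN
    (α.comp (e.symm : _ →+* Sec Y V')) β hβ (by
      rw [← RingHom.comp_assoc, ← hαβ]
      refine RingHom.ext fun r => congrArg β ?_
      obtain ⟨s, rfl⟩ := e.surjective r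
      simp [e])
  refine ⟨γ, RingHom.ext fun s => ?_, hγ'⟩
  have := congrArg (fun φ : _ →+* C => φ (e s)) hγ
  simpa [e] using this

theorem IsFormalCompletion.isFormalClosedImmersion {i' : Z ⟶ Xhat} {F : SubTangent f}
    (hF : IsSmoothFoliation F)
    (hS : IsNoetherianFormalScheme S) (hX : IsNoetherianFormalScheme X)
    (hi : IsFormalClosedImmersion (i' ≫ j)) (hT : IsTransverse F (i' ≫ j))
    (hj : IsFormalCompletion (Set.range (i' ≫ j).base) j)
    (hu : ∀ (W : Opens Xhat) (n : ℕ), n ≠ 0 → IsUnit (n : Sec Xhat W))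
    (hq : IsProjection (constants (restrictToCompletion F j)) q) :
    IsFormalClosedImmersion (i' ≫ q) := by
  intro y
  obtain ⟨x, rfl⟩ := hq.isHomeomorph.surjective y
  obtain ⟨U, V, n, E, x, E', x', hyU, -, -, hiU, h⟩ := hj.exists_chart hF hS hX hi hT x ⊤ trivial ⊤
    trivial
  obtain ⟨V', hV'⟩ := hq.exists_preim_eq (preim j U)
  have h1 := h.hasRetractions hj hu
  have h2 := hiU.of_comp h.affine
  have h3 : ∀ k, x' k ∈ idealOf i' (preim j U) := fun k => by
    have : pull i' (le_refl (preim i' (preim j U))) (pull j le_rfl (x k)) = 0 :=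
      (pull_comp i' j (V' := preim j U) (W := preim i' (preim j U)) le_rfl le_rfl (x k)).symm.trans
        (h.mem_idealOf k)
    rw [h.pull_eq] at this
    exact this
  clear h
  generalize preim j U = U' at *
  subst hV'
  exact ⟨V', hyU, hq.isClosedImmersionOver
    (isSubringSheaf_constants (restrictToCompletion_restrict F j)) h2 h3 h1⟩

end CompletionQuotient

/-! ### Vanishing of continuous differentials -/

section Unramified

variable {A R : Type u} [CommRing A] [CommRing R]

/-- All derivations of `R` over `A` into `J`-adically separated modules vanish. -/
def DerivationsVanish (φ : A →+* R) (J : Ideal R) : Prop :=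
  ∀ (M : Type u) [AddCommGroup M] [Module R M] [IsHausdorff J M] (D : Derivation ℤ R M),
    (∀ a, D (φ a) = 0) → D = 0

/-- The hypothesis applies to the universal derivation into the completed differentials, which are
separated. So all exact differentials die in the completion, and with them each of its levels. -/
theorem DerivationsVanish.subsingleton_omega [Algebra A R] {J : Ideal R}
    (h : DerivationsVanish (algebraMap A R) J) :
    Subsingleton (Omega A R J) := by
  let D : Derivation ℤ R (Omega A R J) := Derivation.mk'
    ((AdicCompletion.of J (Ω[R⁄A])).toAddMonoidHom.comp
      (KaehlerDifferential.D A R).toLinearMap.toAddMonoidHom).toIntLinearMap fun a b => by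
        change AdicCompletion.of J _ (KaehlerDifferential.D A R (a * b)) =
          a • AdicCompletion.of J _ (KaehlerDifferential.D A R b) +
            b • AdicCompletion.of J _ (KaehlerDifferential.D A R a)
        rw [Derivation.leibniz, map_add, map_smul, map_smul]
  have hD : ∀ b, AdicCompletion.of J _ (KaehlerDifferential.D A R b) = 0 := fun b => by
    have := h (Omega A R J) D fun a => by
      change AdicCompletion.of J _ (KaehlerDifferential.D A R (algebraMap A R a)) = 0
      rw [Derivation.map_algebraMap, map_zero]
    exact congrArg (fun D : Derivation ℤ R (Omega A R J) => D b) this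
  have hof : AdicCompletion.of J (Ω[R⁄A]) = 0 := by
    refine LinearMap.ext_on (KaehlerDifferential.span_range_derivation A R) ?_
    rintro _ ⟨b, rfl⟩
    exact hD b
  refine subsingleton_of_forall_eq 0 fun x => AdicCompletion.ext fun n => ?_
  obtain ⟨ω, hω⟩ := Submodule.mkQ_surjective _ (x.val n)
  have h1 := congrArg (fun y : Omega A R J => y.val n) (LinearMap.congr_fun hof ω)
  rw [← hω]
  exact h1

theorem DerivationsVanish.of_comp {A' : Type u} [CommRing A'] {φ : A →+* R} {J : Ideal R}
    (ψ : A' →+* A) (h : DerivationsVanish (φ.comp ψ) J) : DerivationsVanish φ J :=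
  fun M _ _ _ D hD => h M D fun _ => hD _

/-- Derivations vanish after a completed localization, if multiplication with the inverted element
maps the differentials to `J` times the differentials. -/
theorem derivationsVanish_of_isCompletedAway [Algebra A R] {J : Ideal R} {s : R}
    (hs : ∀ ω : Ω[R⁄A], s • ω ∈ (J • ⊤ : Submodule R (Ω[R⁄A]))) {R' : Type u} [CommRing R']
    {ψ : R →+* R'} (hψ : IsCompletedAway ψ J s) :
    DerivationsVanish (ψ.comp (algebraMap A R)) (J.map ψ) := by
  intro M _ _ _ D hD
  refine hψ.derivation_eq_zero D fun b => ?_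
  let _ : Module R M := Module.compHom M ψ
  have hsmul : ∀ (r : R) (m : M), r • m = ψ r • m := fun _ _ => rfl
  let _ : Module A M := Module.compHom M (ψ.comp (algebraMap A R))
  have : IsScalarTower A R M := ⟨fun a r m => by
    rw [Algebra.smul_def, mul_smul]
    rfl⟩
  let d : Derivation A R M := Derivation.mk'
    { toFun := fun b => D (ψ b)
      map_add' := fun a b => by rw [map_add, map_add]
      map_smul' := fun a b => by
        rw [Algebra.smul_def, map_mul, Derivation.leibniz, ← RingHom.comp_apply, hD, smul_zero,
          add_zero]
        rfl } fun a b => by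
        change D (ψ (a * b)) = ψ a • D (ψ b) + ψ b • D (ψ a)
        rw [map_mul, Derivation.leibniz]
  -- The hypothesis on `s` gives `s ^ k N ⊆ J ^ k N` for the image `N` of the differentials. As `s`
  -- acts invertibly on `M`, the values of `D` lie in all `J ^ k M`.
  let N : Submodule R M := LinearMap.range d.liftKaehlerDifferential
  have hN : ∀ n ∈ N, s • n ∈ J • N := by
    rintro _ ⟨ω, rfl⟩
    rw [← map_smul]
    have := Submodule.mem_map_of_mem (f := d.liftKaehlerDifferential) (hs ω)
    rwa [Submodule.map_smul'', Submodule.map_top] at this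
  have hN' : ∀ k : ℕ, ∀ n ∈ N, s ^ k • n ∈ J ^ k • N := by
    intro k
    induction k with
    | zero => intro n hn; simpa using hn
    | succ k ih =>
      intro n hn
      rw [pow_succ s, mul_smul]
      refine Submodule.smul_induction_on (p := fun y => s ^ k • y ∈ J ^ (k + 1) • N) (hN n hn)
        (fun r hr m hm => ?_) fun x y hx hy => ?_
      · rw [smul_comm, pow_succ', mul_smul]
        exact Submodule.smul_mem_smul hr (ih m hm)
      · rw [smul_add]; exact add_mem hx hy
  have hJ : ∀ k : ℕ, ∀ m ∈ J ^ k • N, m ∈ (J.map ψ ^ k • ⊤ : Submodule R' M) := by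
    intro k m hm
    refine Submodule.smul_induction_on hm (fun r hr m _ => ?_) fun x y hx hy => add_mem hx hy
    rw [hsmul]
    refine Submodule.smul_mem_smul ?_ Submodule.mem_top
    rw [← Ideal.map_pow]
    exact Ideal.mem_map_of_mem _ hr
  have hb : D (ψ b) ∈ N := ⟨KaehlerDifferential.D A R b, d.liftKaehlerDifferential_comp_D b⟩
  refine IsHausdorff.haus (I := J.map ψ) inferInstance _ fun k => ?_
  rw [SModEq.zero]
  have h1 := hJ k _ (hN' k _ hb)
  obtain ⟨c, hc⟩ := (hψ.isUnit.pow k).exists_left_inv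
  have h2 := Submodule.smul_mem _ c h1
  rwa [hsmul, map_pow, ← mul_smul, hc, one_smul] at h2

/-- Applied to the differentials modulo `J`, a module that is separated because `J` kills it, the
hypothesis shows that the differentials equal `J` times themselves; then every `s` satisfies the
assumption of the preceding result. -/
theorem DerivationsVanish.isCompletedAway {φ : A →+* R} {J : Ideal R} (h : DerivationsVanish φ J)
    {R' : Type u} [CommRing R'] {ψ : R →+* R'} {s : R} (hψ : IsCompletedAway ψ J s) :
    DerivationsVanish (ψ.comp φ) (J.map ψ) := by
  let _ : Algebra A R := φ.toAlgebra
  refine derivationsVanish_of_isCompletedAway (A := A) (fun ω => ?_) hψ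
  have hd : ∀ b, KaehlerDifferential.D A R b ∈ (J • ⊤ : Submodule R (Ω[R⁄A])) := fun b => by
    let M := Ω[R⁄A] ⧸ (J • ⊤ : Submodule R (Ω[R⁄A]))
    have : IsHausdorff J M := ⟨fun m hm => by
      obtain ⟨ω, rfl⟩ := Submodule.mkQ_surjective _ m
      have h1 := hm 1
      rw [SModEq.zero, pow_one] at h1
      refine Submodule.smul_induction_on (p := fun m => m = 0) h1 (fun r hr m _ => ?_)
        fun x y hx hy => by rw [hx, hy, add_zero]
      obtain ⟨ω, rfl⟩ := Submodule.mkQ_surjective _ m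
      rw [← map_smul, Submodule.mkQ_apply, Submodule.Quotient.mk_eq_zero]
      exact Submodule.smul_mem_smul hr Submodule.mem_top⟩
    let D : Derivation ℤ R M := Derivation.mk'
      ((Submodule.mkQ (J • ⊤ : Submodule R (Ω[R⁄A]))).toAddMonoidHom.comp
        (KaehlerDifferential.D A R).toLinearMap.toAddMonoidHom).toIntLinearMap fun a b => by
          change Submodule.mkQ _ (KaehlerDifferential.D A R (a * b)) =
            a • Submodule.mkQ _ (KaehlerDifferential.D A R b) +
              b • Submodule.mkQ _ (KaehlerDifferential.D A R a)
          rw [Derivation.leibniz, map_add, map_smul, map_smul]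
    have h1 := h M D fun a => by
      change Submodule.mkQ _ (KaehlerDifferential.D A R (algebraMap A R a)) = 0
      rw [Derivation.map_algebraMap, map_zero]
    have h2 : D b = 0 := by rw [h1]; rfl
    exact (Submodule.Quotient.mk_eq_zero _).1 h2
  refine Submodule.smul_mem _ s ?_
  have : ω ∈ (⊤ : Submodule R (Ω[R⁄A])) := trivial
  rw [← KaehlerDifferential.span_range_derivation] at this
  refine Submodule.span_le.2 ?_ this
  rintro _ ⟨b, rfl⟩
  exact hd b

/-- The differentials are finitely generated modulo `J` if `R / J` is of finite type. -/
theorem exists_fg_sup_kaehlerDifferential [Algebra A R] {J : Ideal R} (hJ : J.FG)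
    (hft : ((Ideal.Quotient.mk J).comp (algebraMap A R)).FiniteType) :
    ∃ G : Submodule R (Ω[R⁄A]), G.FG ∧ ⊤ ≤ (J • ⊤ : Submodule R (Ω[R⁄A])) ⊔ G := by
  obtain ⟨t, ht⟩ := hJ
  have hft' : Algebra.FiniteType A (R ⧸ J) := RingHom.finiteType_algebraMap.1 hft
  obtain ⟨m, g, hg⟩ := Algebra.FiniteType.iff_quotient_mvPolynomial''.1 hft'
  choose b hb using fun k => Ideal.Quotient.mk_surjective (g (MvPolynomial.X k))
  let D := KaehlerDifferential.D A R
  let G := Submodule.span R (D '' t) ⊔ Submodule.span R (Set.range fun k => D (b k))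
  refine ⟨G, (Submodule.fg_span (t.finite_toSet.image _)).sup
    (Submodule.fg_span (Set.finite_range _)), ?_⟩
  have hDJ : ∀ c ∈ J, D c ∈ (J • ⊤ : Submodule R (Ω[R⁄A])) ⊔ G := by
    intro c hc
    rw [← ht] at hc
    induction hc using Submodule.span_induction with
    | mem c hc => exact Submodule.mem_sup_right (Submodule.mem_sup_left
        (Submodule.subset_span ⟨c, hc, rfl⟩))
    | zero => rw [map_zero]; exact zero_mem _
    | add x y _ _ hx hy => rw [map_add]; exact add_mem hx hy
    | smul r x hx h =>
      rw [smul_eq_mul, Derivation.leibniz]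
      refine add_mem (Submodule.smul_mem _ _ h) (Submodule.mem_sup_left ?_)
      exact Submodule.smul_mem_smul (ht ▸ hx) Submodule.mem_top
  have hDP : ∀ P : MvPolynomial (Fin m) A, D (MvPolynomial.aeval b P) ∈
      (J • ⊤ : Submodule R (Ω[R⁄A])) ⊔ G := by
    intro P
    induction P using MvPolynomial.induction_on with
    | C a =>
      rw [MvPolynomial.algHom_C, Derivation.map_algebraMap]
      exact zero_mem _
    | add P Q hP hQ => rw [map_add, map_add]; exact add_mem hP hQ
    | mul_X P k hP =>
      rw [map_mul, Derivation.leibniz, MvPolynomial.aeval_X]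
      refine add_mem (Submodule.smul_mem _ _ ?_) (Submodule.smul_mem _ _ hP)
      exact Submodule.mem_sup_right (Submodule.mem_sup_right (Submodule.subset_span ⟨k, rfl⟩))
  refine (KaehlerDifferential.span_range_derivation A R).ge.trans (Submodule.span_le.2 ?_)
  rintro _ ⟨c, rfl⟩
  obtain ⟨P, hP⟩ := hg (Ideal.Quotient.mk J c)
  have h1 : (Ideal.Quotient.mkₐ A J).comp (MvPolynomial.aeval b) = g :=
    MvPolynomial.algHom_ext fun k => by simp [hb]
  have h2 : c - MvPolynomial.aeval b P ∈ J := by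
    rw [← Ideal.Quotient.eq, ← hP, ← h1]
    rfl
  have := add_mem (hDJ _ h2) (hDP P)
  rwa [← map_add, sub_add_cancel] at this

/-- If there are no derivations over `A` into the residue field at `m`, then the differentials
vanish modulo `J` in a neighbourhood of `m`. -/
theorem exists_smul_mem_of_derivation [Algebra A R] {J m : Ideal R} (hJ : J.FG)
    (hft : ((Ideal.Quotient.mk J).comp (algebraMap A R)).FiniteType) [hm : m.IsMaximal]
    {K : Type u} [Field K] {θ : R →+* K} (hθ : RingHom.ker θ = m)
    (h : ∀ δ : R →+ K, (∀ a b, δ (a * b) = θ a * δ b + θ b * δ a) →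
      (∀ a, δ (algebraMap A R a) = 0) → ∀ b, δ b = 0) :
    ∃ s : R, s ∉ m ∧ ∀ ω : Ω[R⁄A], s • ω ∈ (J • ⊤ : Submodule R (Ω[R⁄A])) := by
  obtain ⟨G, hG, hGJ⟩ := exists_fg_sup_kaehlerDifferential hJ hft
  -- A linear form on the differentials modulo `m`, followed by the embedding of `R / m` into `K`,
  -- is a derivation into `K`, hence zero.
  have htop : (⊤ : Submodule R (Ω[R⁄A])) ≤ m • ⊤ := by
    let _ : Field (R ⧸ m) := Ideal.Quotient.field m
    let W := Ω[R⁄A] ⧸ (m • ⊤ : Submodule R (Ω[R⁄A]))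
    let θ' : R ⧸ m →+* K := Ideal.Quotient.lift m θ fun a ha => by rwa [← hθ] at ha
    have key : ∀ (l : Module.Dual (R ⧸ m) W) (b : R),
        l (Submodule.mkQ _ (KaehlerDifferential.D A R b)) = 0 := by
      intro l b
      let δ : R →+ K := θ'.toAddMonoidHom.comp (l.toAddMonoidHom.comp
        ((Submodule.mkQ (m • ⊤ : Submodule R (Ω[R⁄A]))).toAddMonoidHom.comp
          (KaehlerDifferential.D A R).toLinearMap.toAddMonoidHom))
      have hδ : ∀ b, δ b = θ' (l (Submodule.mkQ _ (KaehlerDifferential.D A R b))) := fun _ => rfl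
      have hl : ∀ (r : R) (w : W), l (r • w) = Ideal.Quotient.mk m r * l w := fun r w =>
        l.map_smul (Ideal.Quotient.mk m r) w
      have h1 := h δ (fun a b => by
        rw [hδ, Derivation.leibniz, map_add, map_smul, map_smul, map_add, hl, hl, map_add, map_mul,
          map_mul]
        rfl) (fun a => by
        rw [hδ, Derivation.map_algebraMap, map_zero, map_zero, map_zero]) b
      rw [hδ] at h1
      exact (map_eq_zero θ').1 h1
    refine (KaehlerDifferential.span_range_derivation A R).ge.trans (Submodule.span_le.2 ?_)
    rintro _ ⟨b, rfl⟩
    have h1 := (Module.forall_dual_apply_eq_zero_iff (R ⧸ m) _).1 fun l => key l b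
    exact (Submodule.Quotient.mk_eq_zero _).1 h1
  -- Nakayama's lemma for the differentials modulo `J`, which are finitely generated; it provides `s
  -- ≡ 1` modulo `m`.
  obtain ⟨s, hs, hs'⟩ := Submodule.exists_sub_one_mem_and_smul_le_of_fg_of_le_sup (I := m)
    (N := J • ⊤) (P := ⊤) hG le_top (by
      refine htop.trans ((Submodule.smul_mono (le_refl m) hGJ).trans ?_)
      rw [Submodule.smul_sup]
      exact sup_le_sup_right Submodule.smul_le_right _)
  refine ⟨s, fun h' => hm.ne_top ?_, fun ω => hs' (Submodule.smul_mem_pointwise_smul _ _ _ trivial)⟩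
  rw [Ideal.eq_top_iff_one]
  have := sub_mem h' hs
  rwa [sub_sub_cancel] at this

/-- Derivations of a separable algebraic field extension vanish. -/
theorem derivation_eq_zero_of_isSeparable {k K : Type u} [Field k] [Field K] (g : k →+* K)
    (hg : letI : Algebra k K := g.toAlgebra; Algebra.IsSeparable k K) (d : K →+ K)
    (hd : ∀ a b, d (a * b) = a * d b + b * d a) (h0 : ∀ a, d (g a) = 0) (b : K) : d b = 0 := by
  let _ : Algebra k K := g.toAlgebra
  have : Algebra.IsSeparable k K := hg
  have : Algebra.FormallyUnramified k K := .of_isSeparable _ _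
  let D : Derivation k K K := Derivation.mk'
    { toFun := d
      map_add' := map_add d
      map_smul' := fun a b => by
        change d (g a * b) = g a * d b
        rw [hd, h0, mul_zero, add_zero] } hd
  have h1 : D = 0 := by
    rw [← D.liftKaehlerDifferential_comp, Subsingleton.elim D.liftKaehlerDifferential 0]
    ext b
    simp
  exact congrArg (fun D : Derivation k K K => D b) h1

end Unramified

/-! ### Derivations into residue fields and tangent vectors -/

section StalkRing

variable {B O : Type u} [CommRing B] [CommRing O] [IsLocalRing O]

theorem leibniz_eq_zero_of_mem_sq {K : Type u} [CommRing K] {θ : B →+* K} {p : Ideal B}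
    (hp : ∀ b ∈ p, θ b = 0) {δ : B →+ K} (hδ : ∀ a b, δ (a * b) = θ a * δ b + θ b * δ a) {b : B}
    (hb : b ∈ p ^ 2) : δ b = 0 := by
  rw [sq] at hb
  refine Submodule.mul_induction_on hb (fun x hx y hy => ?_) fun x y hx hy => ?_
  · rw [hδ, hp x hx, hp y hy, zero_mul, zero_mul, add_zero]
  · rw [map_add, hx, hy, add_zero]

/-- A derivation of `B` into the residue field of a local ring `O` that is close to the
localization of `B` induces a linear form on the maximal ideal. -/
theorem exists_linearMap_of_derivation (φ : B →+* O) {p : Ideal B}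
    (hp : ∀ b, b ∈ p ↔ φ b ∈ IsLocalRing.maximalIdeal O)
    (h₁ : IsLocalRing.maximalIdeal O ≤ p.map φ) (h₂ : ∀ b, φ b ∈ (p ^ 2).map φ → b ∈ p ^ 2)
    (h₃ : ∀ c : O, ∃ b, c - φ b ∈ IsLocalRing.maximalIdeal O)
    (δ : B →+ IsLocalRing.ResidueField O)
    (hδ : ∀ a b, δ (a * b) =
      IsLocalRing.residue O (φ a) * δ b + IsLocalRing.residue O (φ b) * δ a) :
    ∃ v : IsLocalRing.maximalIdeal O →ₗ[O] IsLocalRing.ResidueField O,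
      ∀ b (hb : φ b ∈ IsLocalRing.maximalIdeal O), v ⟨φ b, hb⟩ = δ b := by
  set m := IsLocalRing.maximalIdeal O with hm
  have hres : ∀ c, c ∈ m ↔ IsLocalRing.residue O c = 0 := fun c =>
    (IsLocalRing.residue_eq_zero_iff c).symm
  have hpm : p.map φ = m := le_antisymm (Ideal.map_le_iff_le_comap.2 fun b hb => (hp b).1 hb) h₁
  have hex : ∀ t ∈ m, ∃ b ∈ p, t - φ b ∈ m ^ 2 := by
    intro t ht
    rw [← hpm] at ht
    induction ht using Submodule.span_induction with
    | mem t ht =>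
      obtain ⟨b, hb, rfl⟩ := ht
      exact ⟨b, hb, by rw [sub_self]; exact zero_mem _⟩
    | zero => exact ⟨0, zero_mem _, by rw [map_zero, sub_self]; exact zero_mem _⟩
    | add t t' _ _ h h' =>
      obtain ⟨b, hb, hbt⟩ := h
      obtain ⟨b', hb', hbt'⟩ := h'
      refine ⟨b + b', add_mem hb hb', ?_⟩
      have := add_mem hbt hbt'
      convert this using 1
      rw [map_add]; ring
    | smul c t ht h =>
      obtain ⟨b, hb, hbt⟩ := h
      obtain ⟨d, hd⟩ := h₃ c
      refine ⟨d * b, Ideal.mul_mem_left _ _ hb, ?_⟩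
      have htm : t ∈ m := by
        rw [← hpm]
        exact ht
      have h1 : (c - φ d) * t ∈ m ^ 2 := by
        rw [sq]
        exact Ideal.mul_mem_mul hd htm
      have := add_mem h1 (Ideal.mul_mem_left _ (φ d) hbt)
      convert this using 1
      rw [smul_eq_mul, map_mul]; ring
  have hwd : ∀ b, φ b ∈ m ^ 2 → δ b = 0 := fun b hb =>
    leibniz_eq_zero_of_mem_sq (θ := (IsLocalRing.residue O).comp φ)
      (fun b hb => (hres _).1 ((hp b).1 hb)) hδ (h₂ b (by rwa [Ideal.map_pow, hpm]))
  -- The linear form is `t ↦ δ (β t)`, where `β t` represents `t` modulo `m ^ 2`. The choice does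
  -- not matter because `δ` kills `p ^ 2`, which by `h₂` is the preimage of `m ^ 2`.
  choose β hβ hβ' using fun t : m => hex t.1 t.2
  have huniq : ∀ (t : m) (b : B), t.1 - φ b ∈ m ^ 2 → δ (β t) = δ b := fun t b hb => by
    rw [← sub_eq_zero, ← map_sub]
    refine hwd _ ?_
    have := sub_mem hb (hβ' t)
    convert this using 1
    rw [map_sub]; ring
  refine ⟨{ toFun := fun t => δ (β t), map_add' := fun t t' => ?_, map_smul' := fun c t => ?_ },
    fun b hb => huniq _ b (by rw [sub_self]; exact zero_mem _)⟩
  · rw [← map_add]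
    refine huniq _ _ ?_
    have := add_mem (hβ' t) (hβ' t')
    convert this using 1
    rw [map_add, Submodule.coe_add]; ring
  · obtain ⟨d, hd⟩ := h₃ c
    have h1 : δ (β (c • t)) = δ (d * β t) := by
      refine huniq _ _ ?_
      have h1 : (c - φ d) * t.1 ∈ m ^ 2 := by
        rw [sq]
        exact Ideal.mul_mem_mul hd t.2
      have := add_mem h1 (Ideal.mul_mem_left _ (φ d) (hβ' t))
      convert this using 1
      rw [map_mul, Submodule.coe_smul, smul_eq_mul]; ring
    rw [h1, hδ, (hres _).1 ((hp _).1 (hβ t)), zero_mul, add_zero, RingHom.id_apply,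
      Algebra.smul_def]
    rw [hres, map_sub, sub_eq_zero] at hd
    rw [← hd]
    rfl

end StalkRing

/-- For an ideal containing a power of `J`, the completion introduces no new elements: approximate
to order `n` and absorb the error into `q`. It is needed for the square of the ideal of a point. -/
theorem IsCompletedAway.exists_pow_mul_mem_of_le {A : Type u} {B : Type v} [CommRing A]
    [CommRing B] {φ : A →+* B} {J : Ideal A} {s : A} (h : IsCompletedAway φ J s) {q : Ideal A}
    {n : ℕ} (hq : J ^ n ≤ q) {a : A} (ha : φ a ∈ q.map φ) : ∃ k : ℕ, s ^ k * a ∈ q := by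
  have key : ∀ c ∈ q.map φ, ∃ (k : ℕ), ∃ b ∈ q, φ s ^ k * c - φ b ∈ J.map φ ^ n := by
    intro c hc
    induction hc using Submodule.span_induction with
    | mem c hc =>
      obtain ⟨b, hb, rfl⟩ := hc
      exact ⟨0, b, hb, by simp⟩
    | zero => exact ⟨0, 0, zero_mem _, by simp⟩
    | add c c' _ _ hc hc' =>
      obtain ⟨k, b, hb, h1⟩ := hc
      obtain ⟨k', b', hb', h2⟩ := hc'
      refine ⟨k + k', s ^ k' * b + s ^ k * b', add_mem (Ideal.mul_mem_left _ _ hb)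
        (Ideal.mul_mem_left _ _ hb'), ?_⟩
      have := add_mem (Ideal.mul_mem_left _ (φ s ^ k') h1) (Ideal.mul_mem_left _ (φ s ^ k) h2)
      convert this using 1
      simp only [map_add, map_mul, map_pow]; ring
    | smul d c _ hc =>
      obtain ⟨k, b, hb, h1⟩ := hc
      obtain ⟨k', d', h2⟩ := h.exists_mul_sub_mem n d
      refine ⟨k' + k, d' * b, Ideal.mul_mem_left _ _ hb, ?_⟩
      have := add_mem (Ideal.mul_mem_left _ (φ s ^ k * c) h2) (Ideal.mul_mem_left _ (φ d') h1)
      convert this using 1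
      simp only [smul_eq_mul, map_mul]; ring
  obtain ⟨k, b, hb, h1⟩ := key _ ha
  rw [← map_pow, ← map_mul, ← map_sub] at h1
  obtain ⟨l, hl⟩ := h.exists_pow_mul_mem n _ h1
  refine ⟨l + k, ?_⟩
  have := add_mem (hq hl) (Ideal.mul_mem_left _ (s ^ l) hb)
  convert this using 1
  ring

/-! ### Germs at closed points and lifted tangent vectors -/

section Tangent

variable {X S : LocallyRingedSpace.{u}} {f : X ⟶ S}

/-- The homomorphism from the sections to the germs. -/
def germHom {U : Opens X} (x : X) (hx : x ∈ U) : Sec X U →+* X.presheaf.stalk x :=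
  (X.presheaf.germ U x hx).hom

theorem germHom_res {U W : Opens X} (h : W ≤ U) (x : X) (hx : x ∈ W) (s : Sec X U) :
    germHom x hx (res h s) = germHom x (h hx) s :=
  germ_res h x hx s

theorem vanishesAt_iff_germHom {U : Opens X} (s : Sec X U) (x : X) (hx : x ∈ U) :
    VanishesAt s x hx ↔ germHom x hx s ∈ IsLocalRing.maximalIdeal (X.presheaf.stalk x) :=
  vanishesAt_iff_germ s x hx

theorem exists_mem_map_res_of_mem_map_germHom {U : Opens X} {x : X} (hx : x ∈ U)
    (q : Ideal (Sec X U)) {t : X.presheaf.stalk x} (ht : t ∈ q.map (germHom x hx)) :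
    ∃ (W : Opens X) (hW : W ≤ U) (hxW : x ∈ W), ∃ τ ∈ q.map (res hW), germHom x hxW τ = t := by
  have hres : ∀ {W W' : Opens X} (hW : W ≤ U) (h : W' ≤ W), ∀ τ ∈ q.map (res hW),
      res h τ ∈ q.map (res (h.trans hW)) := by
    intro W W' hW h τ hτ
    have := Ideal.mem_map_of_mem (res h) hτ
    rwa [Ideal.map_map, res_comp] at this
  induction ht using Submodule.span_induction with
  | mem t ht =>
    obtain ⟨b, hb, rfl⟩ := ht
    exact ⟨U, le_rfl, hx, _, Ideal.mem_map_of_mem _ hb, by rw [res_self]⟩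
  | zero => exact ⟨U, le_rfl, hx, 0, zero_mem _, map_zero _⟩
  | add t t' _ _ h h' =>
    obtain ⟨W, hW, hxW, τ, hτ, rfl⟩ := h
    obtain ⟨W', hW', hxW', τ', hτ', rfl⟩ := h'
    have hx' : x ∈ W ⊓ W' := ⟨hxW, hxW'⟩
    refine ⟨W ⊓ W', inf_le_left.trans hW, hx', res inf_le_left τ + res inf_le_right τ',
      add_mem (hres hW _ τ hτ) (hres hW' _ τ' hτ'), ?_⟩
    rw [map_add, germHom_res, germHom_res]
  | smul c t _ h =>
    obtain ⟨W, hW, hxW, τ, hτ, rfl⟩ := h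
    obtain ⟨W', hxW', σ, rfl⟩ := X.presheaf.exists_germ_eq c
    have hx' : x ∈ W ⊓ W' := ⟨hxW, hxW'⟩
    refine ⟨W ⊓ W', inf_le_left.trans hW, hx', res inf_le_right σ * res inf_le_left τ,
      Ideal.mul_mem_left _ _ (hres hW _ τ hτ), ?_⟩
    rw [map_mul, germHom_res, germHom_res]
    rfl

/-- The prime ideal of the functions that vanish at a point. -/
def vanishingPrime {U : Opens X} (x : X) (hx : x ∈ U) : Ideal (Sec X U) :=
  (pointPrime X U ⟨x, hx⟩).asIdeal

theorem mem_vanishingPrime {U : Opens X} {x : X} {hx : x ∈ U} {s : Sec X U} :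
    s ∈ vanishingPrime x hx ↔ VanishesAt s x hx :=
  Iff.rfl

/-- A maximal ideal above the prime of `x` contains the ideal of definition, so it is the prime of a
point `y`. If `y ≠ x`, a basic neighbourhood of `y` that avoids the closed point `x` is given by a
function vanishing at `x` but not at `y`, a contradiction. -/
theorem vanishingPrime_isMaximal {U : Opens X} (hU : IsFormalAffine X U) {x : X} (hx : x ∈ U)
    (hcl : IsClosed ({x} : Set X)) : (vanishingPrime x hx).IsMaximal := by
  have hprime : (vanishingPrime x hx).IsPrime := (pointPrime X U ⟨x, hx⟩).isPrime
  obtain ⟨q, hq, hpq⟩ := Ideal.exists_le_maximal _ hprime.ne_top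
  have hJ : definingIdeal X U ≤ vanishingPrime x hx := fun s hs => mem_definingIdeal.1 hs x hx
  obtain ⟨y, hy, hyq⟩ := hU.exists_point q (hJ.trans hpq)
  have hyx : y = x := by
    by_contra hne
    obtain ⟨s, hys, hs⟩ := hU.exists_basicOpen hy (W := ⟨{x}ᶜ, hcl.isOpen_compl⟩) hne
    have h1 : VanishesAt s x hx := by
      by_contra h
      exact hs ((mem_basicOpen_iff s x hx).2 h) rfl
    exact (mem_basicOpen_iff s y hy).1 hys ((hyq s).2 (hpq h1))
  subst hyx
  have : vanishingPrime y hx = q := Ideal.ext fun s => hyq s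
  rwa [this]

theorem isUnit_germHom {U : Opens X} {x : X} (hx : x ∈ U) {s : Sec X U} (h : ¬ VanishesAt s x hx) :
    IsUnit (germHom x hx s) := by
  rw [vanishesAt_iff_germHom] at h
  simpa using h

/-- A germ is a quotient of germs of functions on `U`, up to the `n`-th power of the functions
in `J`. -/
theorem IsFormalAffine.exists_germHom_sub_mem {U : Opens X} (hU : IsFormalAffine X U) {x : X}
    (hx : x ∈ U) (n : ℕ) (c : X.presheaf.stalk x) : ∃ s a : Sec X U, ¬ VanishesAt s x hx ∧
      germHom x hx s * c - germHom x hx a ∈ (definingIdeal X U ^ n).map (germHom x hx) := by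
  obtain ⟨W, hxW, τ, rfl⟩ := X.presheaf.exists_germ_eq c
  obtain ⟨s, hxs, hs⟩ := hU.exists_basicOpen hx hxW
  obtain ⟨k, a, hka⟩ := (hU.isCompletedAway_basicOpen s).exists_mul_sub_mem n (res hs τ)
  refine ⟨s ^ k, a, fun h => ?_, ?_⟩
  · rw [VanishesAt, map_pow] at h
    exact (mem_basicOpen_iff s x hx).1 hxs (eq_zero_of_pow_eq_zero h)
  · have h1 := Ideal.mem_map_of_mem (germHom x hxs) hka
    rw [← Ideal.map_pow, Ideal.map_map, map_sub, map_mul, map_pow, germHom_res, germHom_res,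
      germHom_res] at h1
    have h2 : (germHom x hxs).comp (res (basicOpen_le s)) = germHom x hx :=
      RingHom.ext fun b => germHom_res _ _ _ _
    rw [h2] at h1
    rw [map_pow]
    exact h1

theorem map_germHom_le {U : Opens X} {x : X} (hx : x ∈ U) :
    (vanishingPrime x hx).map (germHom x hx) ≤
      IsLocalRing.maximalIdeal (X.presheaf.stalk x) :=
  Ideal.map_le_iff_le_comap.2 fun b hb => (vanishesAt_iff_germHom b x hx).1 hb

theorem definingIdeal_le_vanishingPrime {U : Opens X} {x : X} (hx : x ∈ U) :
    definingIdeal X U ≤ vanishingPrime x hx := fun _ hs => mem_definingIdeal.1 hs x hx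

theorem exists_mul_sub_one_mem_vanishingPrime {U : Opens X} (hU : IsFormalAffine X U)
    {x : X} (hx : x ∈ U) (hcl : IsClosed ({x} : Set X)) {s : Sec X U} (hs : ¬ VanishesAt s x hx) :
    ∃ c, s * c - 1 ∈ vanishingPrime x hx := by
  obtain ⟨c, i, hi, h⟩ := (vanishingPrime_isMaximal hU hx hcl).exists_inv (x := s) hs
  exact ⟨c, by rw [← h, mul_comm, sub_add_cancel_left]; exact neg_mem hi⟩

/-- The residue field at a closed point is a quotient of the ring of sections. -/
theorem IsFormalAffine.exists_sub_germHom_mem {U : Opens X} (hU : IsFormalAffine X U)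
    {x : X} (hx : x ∈ U) (hcl : IsClosed ({x} : Set X)) (c : X.presheaf.stalk x) :
    ∃ b, c - germHom x hx b ∈ IsLocalRing.maximalIdeal (X.presheaf.stalk x) := by
  obtain ⟨s, a, hs, hsa⟩ := hU.exists_germHom_sub_mem hx 1 c
  rw [pow_one] at hsa
  have h1 := map_germHom_le hx (Ideal.map_mono (definingIdeal_le_vanishingPrime hx) hsa)
  obtain ⟨d, hd⟩ := exists_mul_sub_one_mem_vanishingPrime hU hx hcl hs
  have h2 := (vanishesAt_iff_germHom _ x hx).1 hd
  refine ⟨d * a, ?_⟩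
  have := sub_mem (Ideal.mul_mem_left _ (germHom x hx d) h1) (Ideal.mul_mem_left _ c h2)
  convert this using 1
  simp only [map_sub, map_mul, map_one]
  ring

/-- Although the stalk is not literally the localization of `Γ(U)`, it has the same residue field at
a closed point, its maximal ideal is generated by functions on `U`, and functions whose germs lie in
the extension of `p ^ 2` already lie in `p ^ 2`. -/
theorem IsFormalAffine.exists_linearMap_of_derivation {U : Opens X} (hU : IsFormalAffine X U)
    {x : X} (hx : x ∈ U) (hcl : IsClosed ({x} : Set X))
    (δ : Sec X U →+ IsLocalRing.ResidueField (X.presheaf.stalk x))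
    (hδ : ∀ a b, δ (a * b) = IsLocalRing.residue _ (germHom x hx a) * δ b +
      IsLocalRing.residue _ (germHom x hx b) * δ a) :
    ∃ v : IsLocalRing.maximalIdeal (X.presheaf.stalk x) →ₗ[X.presheaf.stalk x]
        IsLocalRing.ResidueField (X.presheaf.stalk x),
      ∀ b (hb : germHom x hx b ∈ IsLocalRing.maximalIdeal (X.presheaf.stalk x)),
        v ⟨germHom x hx b, hb⟩ = δ b := by
  have hmax := vanishingPrime_isMaximal hU hx hcl
  have hJ := definingIdeal_le_vanishingPrime hx
  refine FormalGeometry.exists_linearMap_of_derivation (germHom x hx) (p := vanishingPrime x hx)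
    (fun b => vanishesAt_iff_germHom b x hx) (fun t ht => ?_) (fun b hb => ?_)
    (hU.exists_sub_germHom_mem hx hcl) δ hδ
  · obtain ⟨s, a, hs, hsa⟩ := hU.exists_germHom_sub_mem hx 1 t
    rw [pow_one] at hsa
    have h1 := Ideal.map_mono hJ hsa
    have ha : a ∈ vanishingPrime x hx := by
      rw [mem_vanishingPrime, vanishesAt_iff_germHom]
      have := sub_mem (Ideal.mul_mem_left _ (germHom x hx s) ht) (map_germHom_le hx h1)
      rwa [sub_sub_cancel] at this
    have h2 := add_mem h1 (Ideal.mem_map_of_mem (germHom x hx) ha)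
    rw [sub_add_cancel] at h2
    exact (Ideal.unit_mul_mem_iff_mem _ (isUnit_germHom hx hs)).1 h2
  · obtain ⟨W, hW, hxW, τ, hτ, hτb⟩ := exists_mem_map_res_of_mem_map_germHom hx _ hb
    obtain ⟨W', hW', hxW', hres⟩ := exists_res_eq_of_germ_eq (a := τ) (b := res hW b) hxW
      (hτb.trans (germHom_res hW x hxW b).symm)
    obtain ⟨s, hxs, hs⟩ := hU.exists_basicOpen hx hxW'
    have h1 : res (basicOpen_le s) b ∈ (vanishingPrime x hx ^ 2).map (res (basicOpen_le s)) := by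
      have h2 := Ideal.mem_map_of_mem (res (hs.trans hW')) hτ
      rw [Ideal.map_map, res_comp, ← res_res hW' hs, hres, res_res, res_res] at h2
      exact h2
    obtain ⟨k, hk⟩ := (hU.isCompletedAway_basicOpen s).exists_pow_mul_mem_of_le
      (Ideal.pow_right_mono hJ 2) h1
    obtain ⟨c, hc⟩ := exists_mul_sub_one_mem_vanishingPrime hU hx hcl (s := s ^ k) fun h => by
      rw [VanishesAt, map_pow] at h
      exact (mem_basicOpen_iff s x hx).1 hxs (eq_zero_of_pow_eq_zero h)
    -- With `ε = s ^ k c - 1` in the maximal ideal, the identity `(1 - ε)(1 + ε) + ε ^ 2 = 1` writes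
    -- `b` as a sum of two elements of its square.
    have h3 := sub_mem (Ideal.mul_mem_left _ ((1 - (s ^ k * c - 1)) * c) hk)
      (Ideal.mul_mem_left _ (-b) (Ideal.pow_mem_pow hc 2))
    convert h3 using 1
    ring

theorem stalkMap_germHom (f : X ⟶ S) {V : Opens S} {U : Opens X} (h : U ≤ preim f V) (x : X)
    (hx : x ∈ U) (s : Sec S V) :
    (f.stalkMap x).hom (germHom (f.base x) (h hx) s) = germHom x hx (pull f h s) :=
  stalkMap_germ f h x hx s

theorem stalkMap_mem_maximalIdeal (f : X ⟶ S) (x : X) {t : S.presheaf.stalk (f.base x)}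
    (ht : t ∈ IsLocalRing.maximalIdeal (S.presheaf.stalk (f.base x))) :
    (f.stalkMap x).hom t ∈ IsLocalRing.maximalIdeal (X.presheaf.stalk x) := by
  have := f.prop x
  rw [IsLocalRing.mem_maximalIdeal, mem_nonunits_iff] at *
  exact fun h => ht (isUnit_of_map_unit (f.stalkMap x).hom _ h)

theorem linearMap_eq_zero_of_mem_sq {O : Type u} [CommRing O] [IsLocalRing O]
    (v : IsLocalRing.maximalIdeal O →ₗ[O] IsLocalRing.ResidueField O) {t : O}
    (ht : t ∈ IsLocalRing.maximalIdeal O ^ 2) (ht' : t ∈ IsLocalRing.maximalIdeal O) :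
    v ⟨t, ht'⟩ = 0 := by
  have : ∃ h : t ∈ IsLocalRing.maximalIdeal O, v ⟨t, h⟩ = 0 := by
    rw [sq] at ht
    refine Submodule.mul_induction_on ht (fun a ha b hb => ?_) fun a b ha hb => ?_
    · refine ⟨Ideal.mul_mem_left _ _ hb, ?_⟩
      have h1 := v.map_smul a ⟨b, hb⟩
      rw [Algebra.smul_def] at h1
      have h2 : algebraMap O (IsLocalRing.ResidueField O) a = 0 :=
        (IsLocalRing.residue_eq_zero_iff a).2 ha
      rw [h2, zero_mul] at h1
      exact h1
    · obtain ⟨ha, ha'⟩ := ha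
      obtain ⟨hb, hb'⟩ := hb
      refine ⟨add_mem ha hb, ?_⟩
      have h1 := v.map_add ⟨a, ha⟩ ⟨b, hb⟩
      rw [ha', hb', add_zero] at h1
      exact h1
  exact this.2

/-- If the vector fields are free on `E_1, …, E_n` with dual functions `t_1, …, t_n` and tangent
vectors lift, then a derivation over `S` into the residue field at a closed point vanishes if it
kills the `t_i`. -/
theorem derivation_eq_zero_of_tangentVectorsLift (hlift : TangentVectorsLift f)
    (hsep : HasSeparableResidueFields f) {F : SubTangent f} (hF : ∀ U : Opens X, F U = ⊤)
    {U : Opens X} (hU : IsFormalAffine X U) {V : Opens S} (hV : IsFormalAffine S V)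
    (h : U ≤ preim f V) {n : ℕ} {E : Fin n → VectorField f U} {t : Fin n → Sec X U}
    (hE : IsFrame (fun U => (F U : Set (VectorField f U))) U E t)
    {x : X} (hx : x ∈ U) (hcl : IsClosed ({x} : Set X)) (ht : ∀ k, VanishesAt (t k) x hx)
    (δ : Sec X U →+ IsLocalRing.ResidueField (X.presheaf.stalk x))
    (hδ : ∀ a b, δ (a * b) = IsLocalRing.residue _ (germHom x hx a) * δ b +
      IsLocalRing.residue _ (germHom x hx b) * δ a)
    (hδf : ∀ a, δ (pull f h a) = 0) (hδt : ∀ k, δ (t k) = 0) (b : Sec X U) : δ b = 0 := by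
  have hfx : f.base x ∈ V := h hx
  have hJ := definingIdeal_le_vanishingPrime hfx
  have hres : ∀ c : X.presheaf.stalk x, c ∈ IsLocalRing.maximalIdeal (X.presheaf.stalk x) ↔
      IsLocalRing.residue _ c = 0 := fun c => (IsLocalRing.residue_eq_zero_iff c).symm
  have hpull : ∀ a : Sec S V, ¬ VanishesAt a (f.base x) hfx →
      IsLocalRing.residue _ (germHom x hx (pull f h a)) ≠ 0 := fun a ha => by
    rw [Ne, ← hres, ← vanishesAt_iff_germHom, vanishesAt_pull]
    exact ha
  -- the functions that vanish at `x`
  have hδp : ∀ b, VanishesAt b x hx → δ b = 0 := by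
    obtain ⟨v, hv⟩ := hU.exists_linearMap_of_derivation hx hcl δ hδ
    obtain ⟨U₀, hx₀, D, hD⟩ := hlift x hcl v fun c ⟨s, hs, hsc⟩ => by
      -- The linear form must kill the image of the maximal ideal of the base. Modulo its square a
      -- germ there is a fraction `e / a` of functions on `V`, and `δ` kills the pull-backs of
      -- these.
      obtain ⟨a, e, ha, hae⟩ := hV.exists_germHom_sub_mem hfx 2 s
      have h1 : germHom (f.base x) hfx a * s - germHom (f.base x) hfx e ∈
          IsLocalRing.maximalIdeal (S.presheaf.stalk (f.base x)) ^ 2 := by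
        rw [Ideal.map_pow] at hae
        exact Ideal.pow_right_mono ((Ideal.map_mono hJ).trans (map_germHom_le hfx)) 2 hae
      have hloc : (IsLocalRing.maximalIdeal (S.presheaf.stalk (f.base x))).map (f.stalkMap x).hom ≤
          IsLocalRing.maximalIdeal (X.presheaf.stalk x) :=
        Ideal.map_le_iff_le_comap.2 fun _ h => stalkMap_mem_maximalIdeal f x h
      have h2 := mem_pow_of_mem_pow hloc h1
      rw [map_sub, map_mul, stalkMap_germHom f h x hx, stalkMap_germHom f h x hx, hsc] at h2
      have h3 := Ideal.mul_mem_left _ (germHom x hx (pull f h a)) c.2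
      have h4 : germHom x hx (pull f h e) ∈ IsLocalRing.maximalIdeal (X.presheaf.stalk x) := by
        have := sub_mem h3 (Ideal.pow_le_self two_ne_zero h2)
        rwa [sub_sub_cancel] at this
      have h5 := linearMap_eq_zero_of_mem_sq v h2 (Ideal.pow_le_self two_ne_zero h2)
      have h6 := v.map_sub (germHom x hx (pull f h a) • c) ⟨_, h4⟩
      rw [hv, hδf, sub_zero, map_smul, Algebra.smul_def] at h6
      exact (mul_eq_zero.1 (h6.symm.trans h5)).resolve_left (hpull a ha)
    have hxW : x ∈ U ⊓ U₀ := ⟨hx, hx₀⟩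
    have key : ∀ b, VanishesAt b x hx → δ b = IsLocalRing.residue (X.presheaf.stalk x)
        (germHom x hxW (D.der (U ⊓ U₀) inf_le_right (res inf_le_left b))) := by
      intro b hb
      have hb' := (vanishesAt_iff_germHom _ x hxW).1 ((vanishesAt_res inf_le_left b x hxW).2 hb)
      have h1 : v ⟨_, (vanishesAt_iff_germHom b x hx).1 hb⟩ = v ⟨_, hb'⟩ :=
        congrArg v (Subtype.ext (germHom_res (inf_le_left : U ⊓ U₀ ≤ U) x hxW b).symm)
      rw [← hv b ((vanishesAt_iff_germHom b x hx).1 hb), h1]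
      exact hD (U ⊓ U₀) inf_le_right hxW _ hb'
    -- Since `F` is the whole tangent sheaf, the lifted field is `∑ D(t_k) E_k`, and the value of
    -- `D(t_k)` at `x` is `δ (t_k) = 0`.
    have hsum := (hE.mem_iff (U ⊓ U₀) inf_le_left (D.restrict inf_le_right)).1 (by
      rw [hF]
      trivial)
    intro b hb
    rw [key b hb]
    have h1 := congrArg (fun D => VectorField.der D (U ⊓ U₀) le_rfl (res inf_le_left b)) hsum
    simp only [VectorField.restrict_der, VectorField.sum_der, VectorField.smul_der, res_self] at h1
    rw [h1, map_sum, map_sum]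
    refine Finset.sum_eq_zero fun k _ => ?_
    rw [map_mul, map_mul, ← key _ (ht k), hδt, zero_mul]
  -- the induced derivation of the residue field
  have hsurj : ∀ c : IsLocalRing.ResidueField (X.presheaf.stalk x),
      ∃ b : Sec X U, IsLocalRing.residue _ (germHom x hx b) = c := fun c => by
    obtain ⟨c, rfl⟩ := IsLocalRing.residue_surjective c
    obtain ⟨b, hb⟩ := hU.exists_sub_germHom_mem hx hcl c
    rw [hres, map_sub, sub_eq_zero] at hb
    exact ⟨b, hb.symm⟩
  choose σ hσ using hsurj
  have hd : ∀ b, δ (σ (IsLocalRing.residue _ (germHom x hx b))) = δ b := fun b => by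
    rw [← sub_eq_zero, ← map_sub]
    refine hδp _ ?_
    rw [vanishesAt_iff_germHom, hres, map_sub, map_sub, hσ, sub_self]
  let d : IsLocalRing.ResidueField (X.presheaf.stalk x) →+
      IsLocalRing.ResidueField (X.presheaf.stalk x) := AddMonoidHom.mk' (fun c => δ (σ c))
    fun c c' => by
      rw [← map_add, ← hd (σ c + σ c'), map_add, map_add, hσ, hσ]
  have hdδ : ∀ b, d (IsLocalRing.residue _ (germHom x hx b)) = δ b := hd
  have hleib : ∀ c c', d (c * c') = c * d c' + c' * d c := fun c c' => by
    have h1 := hδ (σ c) (σ c')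
    rw [← hdδ, map_mul, map_mul, hσ, hσ] at h1
    exact h1
  have hzero := derivation_eq_zero_of_isSeparable
    (IsLocalRing.ResidueField.map (f.stalkMap x).hom) (hsep x hcl) d hleib fun e => by
      obtain ⟨s, rfl⟩ := IsLocalRing.residue_surjective e
      obtain ⟨a, c, ha, hac⟩ := hV.exists_germHom_sub_mem hfx 1 s
      rw [pow_one] at hac
      have h1 := stalkMap_mem_maximalIdeal f x (map_germHom_le hfx (Ideal.map_mono hJ hac))
      rw [hres, map_sub, map_sub, map_mul, map_mul, stalkMap_germHom f h x hx,
        stalkMap_germHom f h x hx, sub_eq_zero] at h1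
      have h2 := congrArg d h1
      rw [hleib, hdδ, hdδ, hδf, hδf, mul_zero, add_zero] at h2
      rw [IsLocalRing.ResidueField.map_residue]
      exact (mul_eq_zero.1 h2).resolve_left (hpull a ha)
  rw [← hdδ, hzero]

end Tangent

/-! ### Morphisms of finite type and the quotient over the completed base -/

theorem IsCompletedAway.finiteType {A : Type u} {B : Type v} {C : Type w} [CommRing A] [CommRing B]
    [CommRing C] {ψ : B →+* C} {J : Ideal B} {s : B} (h : IsCompletedAway ψ J s) {φ : A →+* B}
    (hφ : ((Ideal.Quotient.mk J).comp φ).FiniteType) :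
    ((Ideal.Quotient.mk (J.map ψ)).comp (ψ.comp φ)).FiniteType := by
  obtain ⟨c, hc⟩ := h.isUnit.exists_right_inv
  let ψ' : B ⧸ J →+* C ⧸ J.map ψ := Ideal.quotientMap _ ψ Ideal.le_comap_map
  have h1 : Function.Surjective
      (Polynomial.eval₂RingHom ψ' (Ideal.Quotient.mk (J.map ψ) c)) := by
    intro b
    obtain ⟨b, rfl⟩ := Ideal.Quotient.mk_surjective b
    obtain ⟨k, a, hka⟩ := h.exists_mul_sub_mem 1 b
    refine ⟨Polynomial.C (Ideal.Quotient.mk J a) * Polynomial.X ^ k, ?_⟩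
    rw [pow_one] at hka
    have h2 := Ideal.mul_mem_left _ (c ^ k) hka
    rw [mul_sub, ← mul_assoc, ← mul_pow, mul_comm c, hc, one_pow, one_mul,
      ← Ideal.Quotient.mk_eq_mk_iff_sub_mem] at h2
    rw [h2, Polynomial.coe_eval₂RingHom, Polynomial.eval₂_mul, Polynomial.eval₂_C,
      Polynomial.eval₂_X_pow, map_mul, map_pow, mul_comm]
    rfl
  have h3 : (Polynomial.C : B ⧸ J →+* Polynomial (B ⧸ J)).FiniteType :=
    RingHom.finiteType_algebraMap.2 inferInstance
  have h4 := (h3.comp_surjective h1).comp hφ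
  convert h4 using 1
  ext a
  simp [ψ']

theorem IsFormalAffine.finiteType_basicOpen {X : LocallyRingedSpace.{u}} {U : Opens X}
    (hU : IsFormalAffine X U) (s : Sec X U) {A : Type u} [CommRing A] {φ : A →+* Sec X U}
    (hφ : ((Ideal.Quotient.mk (definingIdeal X U)).comp φ).FiniteType) :
    ((Ideal.Quotient.mk (definingIdeal X (basicOpen s))).comp
      ((res (basicOpen_le s)).comp φ)).FiniteType := by
  rw [hU.definingIdeal_basicOpen s]
  exact (hU.isCompletedAway_basicOpen s).finiteType hφ

theorem IsOfFiniteType.exists_le {X S : LocallyRingedSpace.{u}} {f : X ⟶ S}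
    (hf : IsOfFiniteType f) {x : X} {W : Opens X} (hx : x ∈ W) {V₀ : Opens S}
    (hV₀ : f.base x ∈ V₀) :
    ∃ (V : Opens S) (U : Opens X) (h : U ≤ preim f V), x ∈ U ∧ U ≤ W ∧ V ≤ V₀ ∧
      IsFormalAffine S V ∧ IsFormalAffine X U ∧
        ((Ideal.Quotient.mk (definingIdeal X U)).comp (pull f h)).FiniteType := by
  obtain ⟨V, U, h, hxU, hV, hU, hft⟩ := hf x
  obtain ⟨a, hxa, ha⟩ := hV.exists_basicOpen (h hxU) hV₀
  have hx' : x ∈ W ⊓ preim f (basicOpen a) := ⟨hx, hxa⟩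
  obtain ⟨s, hxs, hs⟩ := hU.exists_basicOpen hxU hx'
  refine ⟨basicOpen a, basicOpen s, hs.trans inf_le_right, hxs, hs.trans inf_le_left, ha,
    hV.basicOpen a, hU.basicOpen s, ?_⟩
  have h1 := hU.finiteType_basicOpen s hft
  have h2 : (res (basicOpen_le s)).comp (pull f h) =
      (pull f (hs.trans inf_le_right)).comp (res (basicOpen_le a)) := by
    ext c
    exact (res_pull f h (basicOpen_le s) c).trans
      (pull_res f (basicOpen_le a) (hs.trans inf_le_right) c).symm
  rw [h2, ← RingHom.comp_assoc] at h1
  exact h1.of_comp_finiteType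

section Base

variable {X S Z Xhat Shat Y : LocallyRingedSpace.{u}} {f : X ⟶ S} {F : SubTangent f}
  {j : Xhat ⟶ X} {k : Shat ⟶ S} {q : Xhat ⟶ Y}

/-- Functions on the completed base are limits of functions on `S`, which `D` kills; continuity does
the rest. -/
theorem VectorField.der_pull_completion {g : Xhat ⟶ S} {T : Set S} (hk : IsFormalCompletion T k)
    (hS : IsLocallyFormalAffine S) (hX : IsLocallyFormalAffine Xhat) (g' : Xhat ⟶ Shat)
    (hg : g' ≫ k = g) {W : Opens Xhat} (D : VectorField g W) {V : Opens Shat}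
    (hV : W ≤ preim g' V) (s : Sec Shat V) : D.der W le_rfl (pull g' hV s) = 0 := by
  subst hg
  refine sec_ext fun x hx => ?_
  obtain ⟨O, hxO, -, hO, hOV⟩ := hk.exists_preim_le hS (x := g'.base x) (hV hx) (O := ⊤) trivial
  have hx' : x ∈ W ⊓ preim g' (preim k O) := ⟨hx, hxO⟩
  obtain ⟨U, hxU, hUW, hU⟩ := hX.exists_le hx'
  have hUO : U ≤ preim g' (preim k O) := hUW.trans inf_le_right
  have := hU.complete
  refine ⟨U, hUW.trans inf_le_left, hxU, ?_⟩
  rw [map_zero, ← D.der_res W U le_rfl (hUW.trans inf_le_left), res_pull,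
    ← pull_res g' hOV hUO]
  refine (hk.isCompletedAway hO).eq_zero_of_leibniz (pull g' hUO) (definingIdeal Xhat U) ?_
    ((D.der U (hUW.trans inf_le_left)).toLinearMap.toAddMonoidHom.comp
      (pull g' hUO).toAddMonoidHom) (fun b b' => ?_) (fun a => ?_) _
  · refine (Ideal.map_mono (map_pull_vanishingIdeal_le k ?_ le_rfl)).trans
      (map_pull_definingIdeal_le g' hUO)
    exact hk.range_eq.le
  · have := (D.der U (hUW.trans inf_le_left)).leibniz (pull g' hUO b) (pull g' hUO b')
    rw [← map_mul] at this
    exact this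
  · have := D.der_pull U (hUW.trans inf_le_left) O hUO a
    rwa [pull_comp g' k le_rfl hUO] at this

theorem IsProjection.exists_hom_completion
    (hq : IsProjection (constants (restrictToCompletion F j)) q) {T : Set S}
    (hk : IsFormalCompletion T k) (hT : Set.range (j ≫ f).base ⊆ T) (hS : IsLocallyFormalAffine S)
    (hX : IsLocallyFormalAffine Xhat) : ∃ r : Y ⟶ Shat, q ≫ r ≫ k = j ≫ f := by
  obtain ⟨g, hg⟩ := hk.exists_lift hS hX (j ≫ f) hT
  obtain ⟨r, hr⟩ := hq.exists_hom g fun V W h s => mem_constants.2 fun W' h' D hD => by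
    rw [res_pull]
    exact D.der_pull_completion hk hS hX g hg _ s
  exact ⟨r, by rw [← hg, ← hr, Category.assoc]⟩

theorem IsProjection.exists_ringHom {R : ∀ U : Opens Xhat, Subring (Sec Xhat U)}
    (hq : IsProjection R q) {V : Opens Y} {U : Opens Xhat} (hV : preim q V = U)
    (π : Sec Xhat U →+* Sec Xhat U) (hπ : ∀ a, π a ∈ R U) :
    ∃ ρ : Sec Xhat U →+* Sec Y V, ∀ a, pull q hV.ge (ρ a) = π a := by
  subst hV
  refine ⟨(hq.secEquiv V).symm.toRingHom.comp (π.codRestrict _ hπ), fun a => ?_⟩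
  have := hq.coe_secEquiv V ((hq.secEquiv V).symm ⟨π a, hπ a⟩)
  rw [RingEquiv.apply_symm_apply] at this
  exact this.symm

theorem IsProjection.injective_of_preim_eq {R : ∀ U : Opens Xhat, Subring (Sec Xhat U)}
    (hq : IsProjection R q) {V : Opens Y} {U : Opens Xhat} (hV : preim q V = U) :
    Function.Injective (pull q hV.ge) := by
  subst hV
  exact hq.injective V

theorem IsProjection.pull_mem_of_preim_eq {R : ∀ U : Opens Xhat, Subring (Sec Xhat U)}
    (hq : IsProjection R q) {V : Opens Y} {U : Opens Xhat} (hV : preim q V = U) (s : Sec Y V) :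
    pull q hV.ge s ∈ R U := by
  subst hV
  rw [← hq.range_eq]
  exact ⟨s, rfl⟩

theorem IsProjection.isFormalAffine_of_preim_eq {R : ∀ U : Opens Xhat, Subring (Sec Xhat U)}
    (hq : IsProjection R q) (hR : IsSubringSheaf R) {V : Opens Y} {U : Opens Xhat}
    (hV : preim q V = U) (hU : IsFormalAffine Xhat U) {n : ℕ} {x : Fin n → Sec Xhat U} {e : ℕ}
    (hx : HasRetractions R U x e) : IsFormalAffine Y V := by
  subst hV
  exact hq.isFormalAffine hR hU hx

end Base

/-! ### Functions on the quotient over a chart -/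

section Chart

variable {X S Z Xhat Y : LocallyRingedSpace.{u}} {f : X ⟶ S} {F : SubTangent f} {i : Z ⟶ X}
  {j : Xhat ⟶ X} {q : Xhat ⟶ Y} {U : Opens X} {V : Opens S} {n : ℕ} {E : Fin n → VectorField f U}
  {x : Fin n → Sec X U} {E' : Fin n → VectorField (j ≫ f) (preim j U)}
  {x' : Fin n → Sec Xhat (preim j U)}

theorem IsCompletedChart.isFormalAffine_quotient (h : IsCompletedChart F i j U V E x E' x')
    (hj : IsFormalCompletion (Set.range i.base) j)
    (hu : ∀ (W : Opens Xhat) (n : ℕ), n ≠ 0 → IsUnit (n : Sec Xhat W))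
    (hq : IsProjection (constants (restrictToCompletion F j)) q) {VY : Opens Y}
    (hVY : preim q VY = preim j U) : IsFormalAffine Y VY :=
  hq.isFormalAffine_of_preim_eq (isSubringSheaf_constants (restrictToCompletion_restrict F j))
    hVY h.affine (h.hasRetractions hj hu)

/-- Over a chart, the functions on the quotient are approximated by the functions on `X`: setting
the coordinates equal to zero defines a ring homomorphism to the functions on the quotient. -/
theorem IsCompletedChart.exists_ringHom (h : IsCompletedChart F i j U V E x E' x')
    (hj : IsFormalCompletion (Set.range i.base) j)
    (hu : ∀ (W : Opens Xhat) (n : ℕ), n ≠ 0 → IsUnit (n : Sec Xhat W))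
    (hq : IsProjection (constants (restrictToCompletion F j)) q) {VY : Opens Y}
    (hVY : preim q VY = preim j U) :
    ∃ γ : Sec X U →+* Sec Y VY,
      (∀ (a : Sec X U) (s : Sec Y VY), pull q hVY.ge s = pull j le_rfl a → γ a = s) ∧
      (∀ k, γ (x k) = 0) ∧ (∀ (m : ℕ) (s : Sec Y VY), ∃ b, s - γ b ∈ definingIdeal Y VY ^ m) ∧
      ∀ (b : Sec X U) (w : Xhat) (hw : w ∈ preim j U),
        VanishesAt (γ b) (q.base w) (hVY.ge hw) ↔ VanishesAt b (j.base w) hw := by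
  have hcomplete := h.affine.complete
  have hdual := h.isDualFrame le_rfl
  have hx' := h.res_mem_definingIdeal hj le_rfl
  obtain ⟨π, hπ⟩ := hdual.exists_isRetraction (hu _) hx'
  have hzero := fun r => hdual.eq_zero_of_mem_span (hu _) hx' (r := r)
  simp only [res_self] at hπ hx' hzero
  obtain ⟨ρ, hρ⟩ := hq.exists_ringHom hVY π fun a => hπ.mem a
  have hinj := hq.injective_of_preim_eq hVY
  have hρq : ∀ s, ρ (pull q hVY.ge s) = s := fun s => hinj (by
    rw [hρ]
    exact hπ.eq_self _ (hq.pull_mem_of_preim_eq hVY s))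
  have hspan : ∀ b ∈ Ideal.span (Set.range x'), b ∈ definingIdeal Xhat (preim j U) :=
    fun b hb => Ideal.span_le.2 (by rintro _ ⟨l, rfl⟩; exact hx' l) hb
  have hsub : ∀ b, b - pull q hVY.ge (ρ b) ∈ definingIdeal Xhat (preim j U) := fun b => by
    rw [hρ]
    exact hspan _ (hπ.sub_mem b)
  have hvan : ∀ (b : Sec Xhat (preim j U)) (w : Xhat) (hw : w ∈ preim j U),
      VanishesAt (ρ b) (q.base w) (hVY.ge hw) ↔ VanishesAt b w hw := fun b w hw => by
    rw [← vanishesAt_pull q hVY.ge (ρ b) w hw]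
    exact (vanishesAt_of_sub (FormalGeometry.mem_definingIdeal.1 (hsub b) w hw)).symm
  have hmap : (definingIdeal Xhat (preim j U)).map ρ ≤ definingIdeal Y VY :=
    Ideal.map_le_iff_le_comap.2 fun b hb => by
      rw [Ideal.mem_comap, FormalGeometry.mem_definingIdeal]
      intro y hy
      obtain ⟨w, rfl⟩ := hq.isHomeomorph.surjective y
      have hw : w ∈ preim j U := hVY.le hy
      exact (hvan b w hw).2 (FormalGeometry.mem_definingIdeal.1 hb w hw)
  refine ⟨ρ.comp (pull j le_rfl), fun a s hs => ?_, fun l => ?_, fun m s => ?_, fun b w hw => ?_⟩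
  · rw [RingHom.comp_apply, ← hs, hρq]
  · rw [RingHom.comp_apply, h.pull_eq]
    refine hinj ?_
    rw [map_zero, hρ]
    refine hzero _ (hπ.mem _) ?_
    have h1 := Submodule.sub_mem _ (Ideal.subset_span (Set.mem_range_self l)) (hπ.sub_mem (x' l))
    rwa [sub_sub_cancel] at h1
  · obtain ⟨b, hb⟩ := hj.exists_sub_mem h.affine_source m (pull q hVY.ge s)
    refine ⟨b, ?_⟩
    have h1 := Ideal.pow_right_mono (map_pull_vanishingIdeal_le j hj.range_eq.le le_rfl) m hb
    have h2 := mem_pow_of_mem_pow hmap h1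
    rwa [map_sub, hρq] at h2
  · rw [RingHom.comp_apply, hvan _ w hw, vanishesAt_pull]

end Chart

/-! ### The quotient by the whole tangent sheaf is unramified over the base -/

/-- The homomorphism `B → R / m` is surjective with kernel that of `θ`. This transports the map to a
residue field of `X` to the functions on the quotient. -/
theorem exists_ringHom_of_approximation {B : Type u} {R : Type v} {K : Type w} [CommRing B]
    [CommRing R] [CommRing K] (γ : B →+* R) (m : Ideal R) (θ : B →+* K)
    (h₁ : ∀ r, ∃ b, r - γ b ∈ m) (h₂ : ∀ b, γ b ∈ m ↔ θ b = 0) :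
    ∃ θ' : R →+* K, (∀ b, θ' (γ b) = θ b) ∧ RingHom.ker θ' = m := by
  have hmk : ∀ r b, r - γ b ∈ m ↔ Ideal.Quotient.mk m r = Ideal.Quotient.mk m (γ b) :=
    fun r b => (Ideal.Quotient.mk_eq_mk_iff_sub_mem _ _).symm
  have hsurj : Function.Surjective ((Ideal.Quotient.mk m).comp γ) := fun r => by
    obtain ⟨r, rfl⟩ := Ideal.Quotient.mk_surjective r
    obtain ⟨b, hb⟩ := h₁ r
    exact ⟨b, ((hmk r b).1 hb).symm⟩
  let θ₀ : R ⧸ m →+* K := RingHom.liftOfSurjective _ hsurj ⟨θ, fun b hb =>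
    (h₂ b).1 (Ideal.Quotient.eq_zero_iff_mem.1 hb)⟩
  have hθ : ∀ b, θ₀ (Ideal.Quotient.mk m (γ b)) = θ b := fun b =>
    RingHom.liftOfRightInverse_comp_apply ((Ideal.Quotient.mk m).comp γ) _
      (Function.rightInverse_surjInv hsurj) _ b
  refine ⟨θ₀.comp (Ideal.Quotient.mk m), hθ, Ideal.ext fun r => ?_⟩
  obtain ⟨b, hb⟩ := h₁ r
  have h3 : r ∈ m ↔ γ b ∈ m := ⟨fun h => by simpa using sub_mem h hb, fun h => by
    simpa using add_mem hb h⟩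
  rw [h3, h₂, RingHom.mem_ker, RingHom.comp_apply, (hmk r b).1 hb, hθ]

theorem pull_congr {X S : LocallyRingedSpace.{u}} {f g : X ⟶ S} (hfg : f = g) {V : Opens S}
    {W : Opens X} (h : W ≤ preim f V) (h' : W ≤ preim g V) (a : Sec S V) :
    pull f h a = pull g h' a := by
  subst hfg
  rfl

section Unramified

variable {X S Z Xhat Shat Y : LocallyRingedSpace.{u}} {f : X ⟶ S} {F : SubTangent f} {i : Z ⟶ X}
  {j : Xhat ⟶ X} {k : Shat ⟶ S} {q : Xhat ⟶ Y} {r : Y ⟶ Shat}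

/-- Let `γ` be the map that sets the coordinates equal to zero. A derivation of the functions on `Y`
into the residue field at `w`, composed with `γ`, is a derivation on `X` over `S` that kills the
coordinates, hence is zero. As the image of `γ` is dense, the given derivation vanishes too, and
Nakayama's lemma spreads this to a basic neighbourhood of the point. -/
theorem IsCompletedChart.exists_derivationsVanish {U : Opens X} {V : Opens S} {n : ℕ}
    {E : Fin n → VectorField f U} {x : Fin n → Sec X U}
    {E' : Fin n → VectorField (j ≫ f) (preim j U)} {x' : Fin n → Sec Xhat (preim j U)}
    (h : IsCompletedChart F i j U V E x E' x')
    (hft : ((Ideal.Quotient.mk (definingIdeal X U)).comp (pull f h.le_base)).FiniteType)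
    (hsep : HasSeparableResidueFields f) (hlift : TangentVectorsLift f)
    (hF : ∀ U : Opens X, F U = ⊤) (hj : IsFormalCompletion (Set.range i.base) j)
    (hu : ∀ (W : Opens Xhat) (n : ℕ), n ≠ 0 → IsUnit (n : Sec Xhat W))
    (hq : IsProjection (constants (restrictToCompletion F j)) q) (hr : q ≫ r ≫ k = j ≫ f)
    {w : Xhat} (hw : w ∈ preim j U) (hcl : IsClosed ({j.base w} : Set X)) :
    ∃ (VY : Opens Y) (hVY : VY ≤ preim r (preim k V)), q.base w ∈ VY ∧
      preim q VY ≤ preim j U ∧ IsFormalAffine Y VY ∧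
        ((Ideal.Quotient.mk (definingIdeal Y VY)).comp (pull r hVY)).FiniteType ∧
        DerivationsVanish (pull r hVY) (definingIdeal Y VY) := by
  obtain ⟨VY, hVY⟩ := hq.exists_preim_eq (preim j U)
  have hY := h.isFormalAffine_quotient hj hu hq hVY
  obtain ⟨γ, hγ, hγx, hγs, hγv⟩ := h.exists_ringHom hj hu hq hVY
  have hwY : q.base w ∈ VY := hVY.ge hw
  have hle : VY ≤ preim r (preim k V) := fun y hy => by
    obtain ⟨w', rfl⟩ := hq.isHomeomorph.surjective y
    have h1 : preim j U ≤ preim (q ≫ r ≫ k) V := hr ▸ preim_mono j h.le_base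
    exact h1 (hVY.le hy)
  have hbase : ∀ a, γ (pull f h.le_base a) = pull r hle (pull k le_rfl a) := fun a => by
    refine hγ _ _ ?_
    refine (pull_comp q r hle hVY.ge _).symm.trans ((pull_comp (q ≫ r) k (V' := preim k V) le_rfl
      (hVY.ge.trans (preim_mono q hle)) a).symm.trans ((pull_congr ?_ _ _ a).trans
        (pull_comp j f h.le_base le_rfl a)))
    rw [Category.assoc, hr]
  have hγJ : (definingIdeal X U).map γ ≤ definingIdeal Y VY :=
    Ideal.map_le_iff_le_comap.2 fun b hb => by
      rw [Ideal.mem_comap, FormalGeometry.mem_definingIdeal]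
      intro y hy
      obtain ⟨w', rfl⟩ := hq.isHomeomorph.surjective y
      have hw' : w' ∈ preim j U := hVY.le hy
      exact (hγv b w' hw').2 (FormalGeometry.mem_definingIdeal.1 hb _ hw')
  have hftY : ((Ideal.Quotient.mk (definingIdeal Y VY)).comp (pull r hle)).FiniteType := by
    have h1 : Function.Surjective
        (Ideal.quotientMap (definingIdeal Y VY) γ (Ideal.map_le_iff_le_comap.1 hγJ)) := fun s => by
      obtain ⟨s, rfl⟩ := Ideal.Quotient.mk_surjective s
      obtain ⟨b, hb⟩ := hγs 1 s
      rw [pow_one, ← Ideal.Quotient.mk_eq_mk_iff_sub_mem] at hb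
      exact ⟨Ideal.Quotient.mk _ b, hb.symm⟩
    have h2 := hft.comp_surjective h1
    have h3 : (Ideal.quotientMap (definingIdeal Y VY) γ (Ideal.map_le_iff_le_comap.1 hγJ)).comp
        ((Ideal.Quotient.mk (definingIdeal X U)).comp (pull f h.le_base)) =
        ((Ideal.Quotient.mk (definingIdeal Y VY)).comp (pull r hle)).comp
          (pull k (le_refl (preim k V))) :=
      RingHom.ext fun a => congrArg (Ideal.Quotient.mk _) (hbase a)
    rw [h3] at h2
    exact h2.of_comp_finiteType
  have hmax : (vanishingPrime (j.base w) hw).IsMaximal :=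
    vanishingPrime_isMaximal h.affine_source hw hcl
  have hJm : definingIdeal Y VY ≤ vanishingPrime (q.base w) hwY := definingIdeal_le_vanishingPrime hwY
  obtain ⟨θ, hθ, hker⟩ := exists_ringHom_of_approximation γ (vanishingPrime (q.base w) hwY)
    ((IsLocalRing.residue (X.presheaf.stalk (j.base w))).comp (germHom (j.base w) hw))
    (fun s => by
      obtain ⟨b, hb⟩ := hγs 1 s
      exact ⟨b, hJm (by rwa [pow_one] at hb)⟩)
    (fun b => (hγv b w hw).trans ((vanishesAt_iff_germHom b _ hw).trans
      (IsLocalRing.residue_eq_zero_iff _).symm))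
  have hsurj : Function.Surjective θ := fun c => by
    obtain ⟨c, rfl⟩ := IsLocalRing.residue_surjective c
    obtain ⟨b, hb⟩ := h.affine_source.exists_sub_germHom_mem hw hcl c
    rw [← IsLocalRing.residue_eq_zero_iff, map_sub, sub_eq_zero] at hb
    exact ⟨γ b, (hθ b).trans hb.symm⟩
  have hmaxY : (vanishingPrime (q.base w) hwY).IsMaximal := by
    rw [← hker]
    exact RingHom.ker_isMaximal_of_surjective θ hsurj
  let : Algebra (Sec Shat (preim k V)) (Sec Y VY) := (pull r hle).toAlgebra
  obtain ⟨s, hs, hω⟩ := exists_smul_mem_of_derivation (A := Sec Shat (preim k V))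
    hY.definingIdeal_fg hftY hker fun δ hδ hδA => by
      have h1 := derivation_eq_zero_of_tangentVectorsLift hlift hsep hF h.affine_source
        h.affine_base h.le_base h.isFrame hw hcl
        (fun l => vanishesAt_of_mem_idealOf (h.mem_idealOf l) hw (hj.range_eq.le ⟨w, rfl⟩))
        (δ.comp γ.toAddMonoidHom) (fun a b => by
          have := hδ (γ a) (γ b)
          rw [hθ, hθ, ← map_mul] at this
          exact this)
        (fun a => (congrArg δ (hbase a)).trans (hδA _))
        (fun l => (congrArg δ (hγx l)).trans (map_zero δ))
      intro s
      -- Order two, because a derivation into the residue field kills the square of the maximal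
      -- ideal but not the ideal itself.
      obtain ⟨b, hb⟩ := hγs 2 s
      have h2 := leibniz_eq_zero_of_mem_sq (θ := θ) (fun b hb => by
        rw [← RingHom.mem_ker, hker]
        exact hJm hb) hδ hb
      rw [map_sub, sub_eq_zero] at h2
      exact h2.trans (h1 b)
  have hle' : basicOpen s ≤ preim r (preim k V) := (basicOpen_le s).trans hle
  have hcomp : (res (basicOpen_le s)).comp (pull r hle) = pull r hle' :=
    RingHom.ext fun a => res_pull r hle _ a
  refine ⟨basicOpen s, hle', (mem_basicOpen_iff s _ hwY).2 hs,
    (preim_mono q (basicOpen_le s)).trans hVY.le, hY.basicOpen s, ?_, ?_⟩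
  · rw [← hcomp]
    exact hY.finiteType_basicOpen s hftY
  · rw [← hcomp, hY.definingIdeal_basicOpen s]
    exact derivationsVanish_of_isCompletedAway hω (hY.isCompletedAway_basicOpen s)

theorem IsFormalCompletion.exists_derivationsVanish (hF : IsSmoothFoliation F)
    (hS : IsNoetherianFormalScheme S) (hX : IsNoetherianFormalScheme X) (hf : IsOfFiniteType f)
    (hsep : HasSeparableResidueFields f)
    (hi : IsFormalClosedImmersion i) (hT : IsTransverse F i)
    (hj : IsFormalCompletion (Set.range i.base) j)
    (hu : ∀ (W : Opens Xhat) (n : ℕ), n ≠ 0 → IsUnit (n : Sec Xhat W))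
    (hq : IsProjection (constants (restrictToCompletion F j)) q)
    (htop : ∀ U : Opens X, F U = ⊤) (hlift : TangentVectorsLift f)
    (hr : q ≫ r ≫ k = j ≫ f) {w : Xhat} (hcl : IsClosed ({j.base w} : Set X))
    {V₀ : Opens S} (hV₀ : (j ≫ f).base w ∈ V₀) {W : Opens Y} (hW : q.base w ∈ W) :
    ∃ (V : Opens S) (VY : Opens Y) (h : VY ≤ preim r (preim k V)), q.base w ∈ VY ∧ VY ≤ W ∧
      V ≤ V₀ ∧ IsFormalAffine S V ∧ IsFormalAffine Y VY ∧
        ((Ideal.Quotient.mk (definingIdeal Y VY)).comp (pull r h)).FiniteType ∧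
        DerivationsVanish (pull r h) (definingIdeal Y VY) := by
  obtain ⟨U, V, n, E, x, E', x', hwU, hUW, hVV₀, -, h⟩ := hj.exists_chart hF hS hX hi hT w
    (preim q W) hW V₀ hV₀
  obtain ⟨V', U', hUV', hwU', hU'U, hV'V, hV', hU', hft⟩ := hf.exists_le (x := j.base w) hwU
    (h.le_base hwU)
  obtain ⟨VY, hVY, hwVY, hVYU, hY, hftY, hD⟩ := (h.restrict hj hU'U hU' hV'
    hUV').exists_derivationsVanish hft hsep hlift htop hj hu hq hr hwU' hcl
  refine ⟨V', VY, hVY, hwVY, fun y hy => ?_, hV'V.trans hVV₀, hV', hY, hftY, hD⟩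
  obtain ⟨w', rfl⟩ := hq.isHomeomorph.surjective y
  exact hUW (preim_mono j hU'U (hVYU hy))

/-- The image of `j` is closed, so it contains a closed point of `X` in the closure of `j w`. The
point has to be closed in `X`, where the hypotheses on residue fields and tangent vectors are made.
-/
theorem IsFormalCompletion.exists_isClosed_singleton {T : Set X} (hj : IsFormalCompletion T j)
    (hX : IsNoetherianFormalScheme X) (w : Xhat) :
    ∃ w' ∈ closure {w}, IsClosed ({j.base w'} : Set X) := by
  have := hX.compact
  obtain ⟨x, hx, hcl⟩ := hX.isLocallyFormalAffine.exists_isClosed_singleton (j.base w)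
  have h1 : x ∈ j.base '' closure {w} := by
    rw [← hj.isClosedEmbedding.closure_image_eq, Set.image_singleton]
    exact hx
  obtain ⟨w', hw', rfl⟩ := h1
  exact ⟨w', hw', hcl⟩

/-- Vanishing of the differentials is obtained on open neighbourhoods of the points over closed
points of `X`, and these neighbourhoods contain all points. -/
theorem IsFormalCompletion.isUnramified (hF : IsSmoothFoliation F)
    (hS : IsNoetherianFormalScheme S) (hX : IsNoetherianFormalScheme X) (hf : IsOfFiniteType f)
    (hsep : HasSeparableResidueFields f)
    (hi : IsFormalClosedImmersion i) (hT : IsTransverse F i)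
    (hj : IsFormalCompletion (Set.range i.base) j)
    (hu : ∀ (W : Opens Xhat) (n : ℕ), n ≠ 0 → IsUnit (n : Sec Xhat W))
    (hq : IsProjection (constants (restrictToCompletion F j)) q)
    (htop : ∀ U : Opens X, F U = ⊤) (hlift : TangentVectorsLift f)
    {T : Set S} (hk : IsFormalCompletion T k) (hr : q ≫ r ≫ k = j ≫ f) : IsUnramified r := by
  have key : ∀ y : Y, ∃ (V : Opens Shat) (VY : Opens Y) (h : VY ≤ preim r V), y ∈ VY ∧
      IsFormalAffine Shat V ∧ IsFormalAffine Y VY ∧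
        ((Ideal.Quotient.mk (definingIdeal Y VY)).comp (pull r h)).FiniteType ∧
        DerivationsVanish (pull r h) (definingIdeal Y VY) := by
    intro y
    obtain ⟨w, rfl⟩ := hq.isHomeomorph.surjective y
    obtain ⟨w', hw', hcl⟩ := hj.exists_isClosed_singleton hX w
    obtain ⟨V, VY, h, hy, -, -, hV, hVY, hft, hD⟩ := hj.exists_derivationsVanish hF hS hX hf hsep hi
      hT hu hq htop hlift hr hcl (V₀ := ⊤) trivial (W := ⊤) trivial
    exact ⟨preim k V, VY, h, mem_of_mem_closure_singleton (U := preim q VY) hw' hy, hk.affine V hV,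
      hVY, hft, hD⟩
  refine ⟨fun y => ?_, fun y => ?_⟩
  · obtain ⟨V, VY, h, hy, hV, hVY, hft, -⟩ := key y
    exact ⟨V, VY, h, hy, hV, hVY, hft⟩
  · obtain ⟨V, VY, h, hy, hV, hVY, -, hD⟩ := key y
    refine ⟨V, VY, h, hy, hV, hVY, ?_⟩
    let : Algebra (Sec Shat V) (Sec Y VY) := (pull r h).toAlgebra
    exact DerivationsVanish.subsingleton_omega (A := Sec Shat V) hD

end Unramified

/-! ### Unramified morphisms that restrict to an immersion -/

/-- If `φ : A → R` becomes surjective modulo a topologically nilpotent ideal `N` and `R` has no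
continuous derivations over `A`, then `N ≤ φ(L) R` for every ideal `L` that contains the kernel of
`A → R / N`. -/
theorem DerivationsVanish.le_map {A R : Type u} [CommRing A] [CommRing R] [IsNoetherianRing R]
    {φ : A →+* R} {J : Ideal R} [IsAdicComplete J R] (h : DerivationsVanish φ J) {N : Ideal R}
    (hN : N ≤ J) (hsurj : ∀ r, ∃ a, r - φ a ∈ N) {L : Ideal A}
    (hL : ∀ a, φ a ∈ N → a ∈ L) : N ≤ L.map φ := by
  have hjac := IsAdicComplete.le_jacobson_bot J
  suffices hNQ : N ≤ L.map φ ⊔ N * N from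
    Submodule.le_of_le_smul_of_le_jacobson_bot (I := N) (IsNoetherian.noetherian N)
      (hN.trans hjac) hNQ
  set Q := L.map φ ⊔ N * N with hQ
  have := IsHausdorff.of_le_jacobson (M := R ⧸ Q) J hjac
  choose a ha using hsurj
  have hmk : ∀ (r : R) (b : A), r - φ b ∈ N →
      Submodule.Quotient.mk (p := Q) (r - φ (a r)) = Submodule.Quotient.mk (r - φ b) := by
    intro r b hb
    rw [Submodule.Quotient.eq]
    have h1 : φ (b - a r) ∈ N := by
      have := Ideal.sub_mem N (ha r) hb
      rw [map_sub]
      convert this using 1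
      ring
    have h2 : φ (b - a r) ∈ Q := Submodule.mem_sup_left (Ideal.mem_map_of_mem φ (hL _ h1))
    convert h2 using 1
    rw [map_sub]
    ring
  -- The class of `r - φ (a r)` modulo `Q = L R + N ^ 2` does not depend on the choice of `a r`, and
  -- it is a derivation over `A` in `r`. On `N` it is the quotient map, so its vanishing gives `N ≤
  -- Q`.
  let δ : R →+ R ⧸ Q := AddMonoidHom.mk' (fun r => Submodule.Quotient.mk (r - φ (a r)))
    fun r r' => by
      have h1 : r + r' - φ (a r + a r') = r - φ (a r) + (r' - φ (a r')) := by
        rw [map_add]; ring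
      rw [hmk (r + r') (a r + a r') (by rw [h1]; exact add_mem (ha r) (ha r')), h1,
        Submodule.Quotient.mk_add]
  have hδ : ∀ r r', δ (r * r') = r • δ r' + r' • δ r := fun r r' => by
    have h1 : r * r' - φ (a r * a r') =
        r * (r' - φ (a r')) + r' * (r - φ (a r)) - (r - φ (a r)) * (r' - φ (a r')) := by
      rw [map_mul]; ring
    have h2 := hmk (r * r') (a r * a r') (by
      rw [h1]
      exact sub_mem (add_mem (Ideal.mul_mem_left _ _ (ha r')) (Ideal.mul_mem_left _ _ (ha r)))
        (Ideal.mul_mem_left _ _ (ha r')))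
    refine h2.trans ?_
    rw [h1]
    refine ((Submodule.Quotient.eq Q).2 (?_ : _ - (r * (r' - φ (a r')) + r' * (r - φ (a r))) ∈ Q))
    rw [sub_sub_cancel_left]
    exact neg_mem (Submodule.mem_sup_right (Ideal.mul_mem_mul (ha r) (ha r')))
  have hzero := h (R ⧸ Q) (Derivation.mk' δ.toIntLinearMap hδ) fun b => by
    refine (hmk (φ b) b (by rw [sub_self]; exact zero_mem _)).trans ?_
    rw [sub_self, Submodule.Quotient.mk_zero]
  intro r hr
  have h1 : δ r = 0 := congrArg (fun D : Derivation ℤ R (R ⧸ Q) => D r) hzero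
  have h2 := (hmk r 0 (by rwa [map_zero, sub_zero])).symm.trans h1
  rwa [map_zero, sub_zero, Submodule.Quotient.mk_eq_zero] at h2

section Immersion

variable {S Z Shat Y : LocallyRingedSpace.{u}} {c : Z ⟶ Y} {r : Y ⟶ Shat} {k : Shat ⟶ S}

/-- If `r` becomes a closed immersion over an affine open set after restriction to a closed formal
subscheme with the same points, and `r` has no continuous differentials there, then `r` is a closed
immersion there. -/
theorem IsClosedImmersionOver.of_derivationsVanish {T : Set S} (hk : IsFormalCompletion T k)
    (hT : T ⊆ closure (Set.range (c ≫ r ≫ k).base)) (hcs : Function.Surjective c.base)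
    {V : Opens S} (hV : IsClosedImmersionOver (c ≫ r ≫ k) V)
    (hW : IsFormalAffine Y (preim r (preim k V)))
    (hD : DerivationsVanish (pull r (le_refl (preim r (preim k V))))
      (definingIdeal Y (preim r (preim k V)))) : IsClosedImmersionOver r (preim k V) := by
  have hA := hk.affine V hV.affine
  have hnoeth := hW.noetherian
  have hcomplete := hW.complete
  have hcompleteA := hA.complete
  -- Over `V` the image of `Z` is closed, and the points of the completed base lie in its closure,
  -- so they all come from `Z`.
  have hpoint : ∀ t ∈ preim k V, ∃ z, r.base (c.base z) = t := fun t ht => by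
    obtain ⟨z, hz⟩ := hV.mem_range_of_mem_closure ht (hT (hk.range_eq.le ⟨t, rfl⟩))
    exact ⟨z, hk.isClosedEmbedding.injective hz⟩
  set φ := pull r (le_refl (preim r (preim k V))) with hφ
  have hφv : ∀ a, (∀ z (hz : c.base z ∈ preim r (preim k V)), VanishesAt (φ a) (c.base z) hz) →
      a ∈ definingIdeal Shat (preim k V) := fun a ha => by
    rw [mem_definingIdeal]
    intro t ht
    obtain ⟨z, rfl⟩ := hpoint t ht
    exact (vanishesAt_pull r (le_refl (preim r (preim k V))) a (c.base z) ht).1 (ha z ht)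
  have hle : (definingIdeal Shat (preim k V)).map φ ≤ definingIdeal Y (preim r (preim k V)) :=
    map_pull_definingIdeal_le r le_rfl
  set N := RingHom.ker (pull c (le_refl (preim c (preim r (preim k V))))) with hN
  have hNv : ∀ s ∈ N, ∀ z (hz : c.base z ∈ preim r (preim k V)), VanishesAt s (c.base z) hz :=
    fun s hs z hz => by
      have h1 := (vanishesAt_pull c (le_refl (preim c (preim r (preim k V)))) s z hz).1
      refine h1 ?_
      rw [RingHom.mem_ker.1 hs]
      exact map_zero _
  have hNJ : N ≤ definingIdeal Y (preim r (preim k V)) := fun s hs => mem_definingIdeal.2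
    fun y hy => by
      obtain ⟨z, rfl⟩ := hcs y
      exact hNv s hs z hy
  have hsub : ∀ s, ∃ a, s - φ a ∈ N := fun s => by
    obtain ⟨a, ha⟩ := hV.surjective (pull c (le_refl (preim c (preim r (preim k V)))) s)
    refine ⟨pull k le_rfl a, ?_⟩
    rw [hN, RingHom.mem_ker, map_sub, sub_eq_zero]
    refine ha.symm.trans ?_
    refine (pull_comp c (r ≫ k) (V' := preim r (preim k V)) le_rfl le_rfl a).trans ?_
    exact congrArg _ (pull_comp r k (V' := preim k V) le_rfl le_rfl a)
  -- The kernel of the map to the functions on `Z` lies in the ideal generated by the ideal of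
  -- definition of the base. So `φ` is surjective modulo that ideal, and hence surjective.
  have hNle := hD.le_map hNJ hsub (L := definingIdeal Shat (preim k V)) fun a ha =>
    hφv a (hNv _ ha)
  have := IsHausdorff.of_le_jacobson (M := Sec Y (preim r (preim k V)))
    ((definingIdeal Shat (preim k V)).map φ) (hle.trans (IsAdicComplete.le_jacobson_bot _))
  have hsurj : Function.Surjective φ :=
    surjective_of_mk_map_comp_surjective (I := definingIdeal Shat (preim k V)) φ fun s => by
      obtain ⟨s, rfl⟩ := Ideal.Quotient.mk_surjective s
      obtain ⟨a, ha⟩ := hsub s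
      exact ⟨a, ((Ideal.Quotient.mk_eq_mk_iff_sub_mem _ _).2 (hNle ha)).symm⟩
  refine ⟨hA, hW, hsurj, fun s hs => Ideal.le_radical ?_⟩
  obtain ⟨a, rfl⟩ := hsurj s
  exact Ideal.mem_map_of_mem φ (hφv a fun z hz => mem_definingIdeal.1 hs _ hz)

/-- It remains to make the neighbourhood in `Y` a full preimage of an open set of the base.
Functions on `Z` lift to the base, so a small basic open set of `Z` is cut out by a function there;
as `Z → Y` is surjective on points, the preimage in `Y` of the corresponding open set lies in `W`
and is basic in `W`. -/
theorem IsClosedImmersionOver.exists_of_derivationsVanish {T : Set S}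
    (hk : IsFormalCompletion T k) (hT : T ⊆ closure (Set.range (c ≫ r ≫ k).base))
    (hcs : Function.Surjective c.base) {V₀ V : Opens S}
    (hV₀ : IsClosedImmersionOver (c ≫ r ≫ k) V₀) (hVV₀ : V ≤ V₀) {W : Opens Y}
    (hW : IsFormalAffine Y W) (hWV : W ≤ preim r (preim k V))
    (hD : DerivationsVanish (pull r hWV) (definingIdeal Y W)) {z : Z} (hz : c.base z ∈ W) :
    ∃ U : Opens Shat, r.base (c.base z) ∈ U ∧ IsClosedImmersionOver r U := by
  have hzV : (c ≫ r ≫ k).base z ∈ V := hWV hz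
  obtain ⟨a', hza', ha'⟩ := hV₀.affine.exists_basicOpen (hVV₀ hzV) hzV
  obtain ⟨e, hze, he⟩ := hV₀.affine_preim.exists_basicOpen (x := z) (hVV₀ hzV) (W := preim c W) hz
  obtain ⟨a, rfl⟩ := hV₀.surjective e
  rw [← preim_basicOpen_eq] at hze he
  have hmul : FormalGeometry.basicOpen (a * a') =
      FormalGeometry.basicOpen a ⊓ FormalGeometry.basicOpen a' := S.toRingedSpace.basicOpen_mul a a'
  have hzV₃ : (c ≫ r ≫ k).base z ∈ FormalGeometry.basicOpen (a * a') := by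
    rw [hmul]
    exact ⟨hze, hza'⟩
  have hV₃ := hV₀.basicOpen (a * a')
  have hV₃V : FormalGeometry.basicOpen (a * a') ≤ V := hmul.le.trans (inf_le_right.trans ha')
  have hV₃eq : FormalGeometry.basicOpen (res hVV₀ (a * a')) = FormalGeometry.basicOpen (a * a') :=
    (basicOpen_res hVV₀ (a * a')).trans (inf_eq_right.2 hV₃V)
  have hle : preim r (preim k (FormalGeometry.basicOpen (a * a'))) ≤ W := fun y hy => by
    obtain ⟨z', rfl⟩ := hcs y
    exact he ((hmul.le.trans inf_le_left) hy)
  have heq : preim r (preim k (FormalGeometry.basicOpen (a * a'))) =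
      FormalGeometry.basicOpen (pull r hWV (pull k le_rfl (res hVV₀ (a * a')))) := by
    refine Eq.trans ?_ (basicOpen_pull r hWV _).symm
    have h1 := (preim_basicOpen_eq k (res hVV₀ (a * a'))).symm
    rw [hV₃eq] at h1
    refine Eq.trans (inf_eq_right.2 hle).symm ?_
    exact congrArg (fun O => W ⊓ preim r O) h1.symm
  refine ⟨_, hzV₃, IsClosedImmersionOver.of_derivationsVanish hk hT hcs hV₃
    (hW.of_eq_basicOpen heq) ?_⟩
  have h2 := hD.isCompletedAway (hW.isCompletedAway _ hle heq)
  rw [← hW.definingIdeal_eq_map hle heq] at h2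
  refine DerivationsVanish.of_comp (res (preim_mono k hV₃V)) ?_
  have h3 : (res hle).comp (pull r hWV) =
      (pull r (le_refl (preim r (preim k (FormalGeometry.basicOpen (a * a')))))).comp
        (res (preim_mono k hV₃V)) :=
    RingHom.ext fun s => (res_pull r hWV hle s).trans
      (pull_res r (preim_mono k hV₃V) le_rfl s).symm
  rwa [h3] at h2

end Immersion

/-! ### The immersion into the base and the theorem in characteristic zero -/

section Completion

variable {X S Z Xhat Shat Y : LocallyRingedSpace.{u}} {f : X ⟶ S} {F : SubTangent f}
  {i' : Z ⟶ Xhat} {j : Xhat ⟶ X} {k : Shat ⟶ S} {q : Xhat ⟶ Y} {r : Y ⟶ Shat}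

/-- The map `Z → Y` is surjective on points, and the composite of `Z → Y` with `r` and `k` is the
given immersion. The preceding result provides neighbourhoods at the points over closed points of
`X`, and every point of `Y` has such a point in its closure. -/
theorem IsFormalCompletion.isFormalImmersion (hF : IsSmoothFoliation F)
    (hS : IsNoetherianFormalScheme S) (hX : IsNoetherianFormalScheme X) (hf : IsOfFiniteType f)
    (hsep : HasSeparableResidueFields f)
    (hi : IsFormalClosedImmersion (i' ≫ j)) (hT : IsTransverse F (i' ≫ j))
    (hj : IsFormalCompletion (Set.range (i' ≫ j).base) j)
    (hu : ∀ (W : Opens Xhat) (n : ℕ), n ≠ 0 → IsUnit (n : Sec Xhat W))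
    (hq : IsProjection (constants (restrictToCompletion F j)) q)
    (htop : ∀ U : Opens X, F U = ⊤) (hlift : TangentVectorsLift f)
    (hk : IsFormalCompletion (closure (Set.range ((i' ≫ j) ≫ f).base)) k)
    (hr : q ≫ r ≫ k = j ≫ f) (him : IsFormalImmersion ((i' ≫ j) ≫ f)) : IsFormalImmersion r := by
  have hcomp : (i' ≫ j) ≫ f = (i' ≫ q) ≫ r ≫ k := by simp only [Category.assoc, hr]
  rw [hcomp] at hk him
  have hi's : Function.Surjective i'.base := fun w => by
    obtain ⟨z, hz⟩ := hj.range_eq.le ⟨w, rfl⟩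
    exact ⟨z, hj.isClosedEmbedding.injective hz⟩
  have hcs : Function.Surjective (i' ≫ q).base := fun y => by
    obtain ⟨w, rfl⟩ := hq.isHomeomorph.surjective y
    obtain ⟨z, rfl⟩ := hi's w
    exact ⟨z, rfl⟩
  intro y
  obtain ⟨w, rfl⟩ := hq.isHomeomorph.surjective y
  obtain ⟨w', hw', hcl⟩ := hj.exists_isClosed_singleton hX w
  obtain ⟨z, rfl⟩ := hi's w'
  obtain ⟨V₀, hzV₀, hV₀⟩ := him z
  rw [← hcomp] at hzV₀
  obtain ⟨V, W, hWV, hzW, -, hVV₀, -, hW, -, hD⟩ := hj.exists_derivationsVanish hF hS hX hf hsep hi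
    hT hu hq htop hlift hr hcl (V₀ := V₀) hzV₀ (W := ⊤) trivial
  obtain ⟨U, hzU, hU⟩ := IsClosedImmersionOver.exists_of_derivationsVanish (z := z) hk subset_rfl
    hcs hV₀ hVV₀ hW hWV hD hzW
  exact ⟨U, mem_of_mem_closure_singleton (U := preim q (preim r U)) hw' hzU, hU⟩

/-- In characteristic zero, the restriction of a smooth foliation to the completion along a
transverse closed subscheme has a formally smooth quotient. -/
theorem IsSmoothFoliation.exists_quotient_completion (hF : IsSmoothFoliation F)
    (hS : IsNoetherianFormalScheme S) (hX : IsNoetherianFormalScheme X) (hf : IsOfFiniteType f)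
    (hsep : HasSeparableResidueFields f) {i : Z ⟶ X} (hi : IsFormalClosedImmersion i)
    (hT : IsTransverse F i) (h0 : ∀ n : ℕ, n ≠ 0 → IsUnit (n : Sec S ⊤))
    (hj : IsFormalCompletion (Set.range i.base) j) :
    ∃ (Y : LocallyRingedSpace.{u}) (q : Xhat ⟶ Y),
      IsNoetherianFormalScheme Y ∧ IsQuotient (j ≫ f) (restrictToCompletion F j) q ∧
      IsFormallySmooth q ∧ (∃ i' : Z ⟶ Xhat, i' ≫ j = i ∧ IsFormalClosedImmersion (i' ≫ q)) ∧
      ((∀ U : Opens X, F U = ⊤) → TangentVectorsLift f →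
        ∀ (Shat : LocallyRingedSpace.{u}) (k : Shat ⟶ S),
          IsFormalCompletion (closure (Set.range (i ≫ f).base)) k →
          ∃ r : Y ⟶ Shat, q ≫ r ≫ k = j ≫ f ∧ IsUnramified r ∧
            (IsFormalImmersion (i ≫ f) → IsFormalImmersion r)) := by
  have hu : ∀ (W : Opens Xhat) (n : ℕ), n ≠ 0 → IsUnit (n : Sec Xhat W) :=
    isUnit_natCast_of_pull (g := j ≫ f) h0
  obtain ⟨i', rfl⟩ := hj.exists_lift hX.isLocallyFormalAffine (fun z => by
    obtain ⟨U, hzU, hU⟩ := hi (i.base z)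
    exact ⟨preim i U, hzU, hU.affine_preim⟩) i subset_rfl
  obtain ⟨Y, q, hq⟩ :=
    (isSubringSheaf_constants (restrictToCompletion_restrict F j)).exists_isProjection
  refine ⟨Y, q, hj.isNoetherianFormalScheme_quotient hF hS hX hi hT hu hq,
    hj.isQuotient hF hS hX hi hT hu hq, hj.isFormallySmooth hF hS hX hi hT hu hq,
    ⟨i', rfl, hj.isFormalClosedImmersion hF hS hX hi hT hu hq⟩, fun htop hlift Shat k hk => ?_⟩
  obtain ⟨r, hr⟩ := hq.exists_hom_completion hk (by
    rintro _ ⟨w, rfl⟩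
    obtain ⟨z, hz⟩ := hj.range_eq.le ⟨w, rfl⟩
    exact subset_closure ⟨z, congrArg f.base hz⟩) hS.isLocallyFormalAffine
    (hj.isLocallyFormalAffine hX.isLocallyFormalAffine)
  exact ⟨r, hr, hj.isUnramified hF hS hX hf hsep hi hT hu hq htop hlift hk hr,
    hj.isFormalImmersion hF hS hX hf hsep hi hT hu hq htop hlift hk hr⟩

end Completion

end FormalGeometry

end

theorem mainTheorem8 {X S Z : LocallyRingedSpace.{u}} (f : X ⟶ S)
    (hS : IsNoetherianFormalScheme S) (hX : IsNoetherianFormalScheme X) (hf : IsOfFiniteType f)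
    (hsep : HasSeparableResidueFields f)
    (F : SubTangent f) (hF : IsSmoothFoliation F)
    (i : Z ⟶ X) (hi : IsFormalClosedImmersion i) (hT : IsTransverse F i) :
    -- the local splitting of the differentials
    (∀ y : X, ∃ (U : Opens X) (n : ℕ) (x : Fin n → Sec X U),
      y ∈ U ∧ IsFormalAffine X U ∧ (∃ V : Opens S, IsFormalAffine S V ∧ U ≤ preim f V) ∧
      (y ∈ Set.range i.base → ∀ k, x k ∈ idealOf i U) ∧
      ∀ (U' : Opens X) (h : U' ≤ U) (hU' : IsFormalAffine X U') (V : Opens S)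
        (hV : U' ≤ preim f V), IsFormalAffine S V →
          SplitsOver F hU' V hV (fun k => res h (x k))) ∧
    IsLocallyFree F ∧
    -- characteristic zero
    ((∀ n : ℕ, n ≠ 0 → IsUnit (n : Sec S ⊤)) →
      ∀ (Xhat : LocallyRingedSpace.{u}) (j : Xhat ⟶ X),
        IsFormalCompletion (Set.range i.base) j →
        ∃ (Y : LocallyRingedSpace.{u}) (q : Xhat ⟶ Y),
          IsNoetherianFormalScheme Y ∧
          IsQuotient (j ≫ f) (restrictToCompletion F j) q ∧
          IsFormallySmooth q ∧
          (∃ i' : Z ⟶ Xhat, i' ≫ j = i ∧ IsFormalClosedImmersion (i' ≫ q)) ∧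
          ((∀ U : Opens X, F U = ⊤) → TangentVectorsLift f →
            ∀ (Shat : LocallyRingedSpace.{u}) (k : Shat ⟶ S),
              IsFormalCompletion (closure (Set.range (i ≫ f).base)) k →
              ∃ r : Y ⟶ Shat, q ≫ r ≫ k = j ≫ f ∧ IsUnramified r ∧
                (IsFormalImmersion (i ≫ f) → IsFormalImmersion r))) ∧
    -- characteristic p
    (∀ p : ℕ, p.Prime → (p : Sec S ⊤) = 0 →
      ∃ (Y : LocallyRingedSpace.{u}) (q : X ⟶ Y),
        IsNoetherianFormalScheme Y ∧
        IsQuotient f (fun U => (F U : Set (VectorField f U))) q ∧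
        IsFlat q ∧
        IsFormalClosedImmersion (i ≫ q) ∧
        ∀ y : X, ∃ (V : Opens Y) (n : ℕ) (t : Fin n → Sec X (preim q V)) (c : Fin n → Sec Y V),
          y ∈ preim q V ∧ IsFormalAffine Y V ∧ IsFormalAffine X (preim q V) ∧
          (∀ k, t k ∈ idealOf i (preim q V)) ∧
          Function.Surjective (MvPolynomial.eval₂Hom (pull q (le_refl (preim q V))) t) ∧
          RingHom.ker (MvPolynomial.eval₂Hom (pull q (le_refl (preim q V))) t) =
            Ideal.span (Set.range fun k => MvPolynomial.X k ^ p - MvPolynomial.C (c k))) := by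
  exact ⟨fun y => hF.exists_splitting hS hX hi hT y, hF.isLocallyFree hX hi hT,
    fun h0 Xhat j hj => hF.exists_quotient_completion hS hX hf hsep hi hT h0 hj,
    fun p hp hpS => hF.exists_quotient_of_prime hX hi hT hp hpS⟩
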